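/- **Setting.** Write $z^*$ for complex conjugation and $\langle x\rangle=(1+x^2)^{1/2}$. Let $u:\mathbb R\to\mathbb C$ be of class $C^4$ with $$\sup_{x\ge 0}\langle x\rangle^4\Bigl|\frac{d^k}{dx^k}(u(x)-1)\Bigr|+\sup_{x\le 0}\langle x\rangle^4\Bigl|\frac{d^k}{dx^k}(u(x)+1)\Bigr|<\infty,\qquad 0\le k\le 3,$$ and put $q=\frac{\sqrt2}{2}u$. Consider the system $$i\,\partial_xv_1+q^*v_2=\lambda v_1,\qquad -i\,\partial_xv_2+q\,v_1=\lambda v_2, \tag{S}$$ for $(\lambda,\zeta)\in\mathbb C^2$ with $\lambda^2-\zeta^2=\frac12$. The Jost solutions are the solutions of (S) with $$\psi_1\sim e^{-i\zeta x}\binom{1}{\sqrt2(\lambda-\zeta)}\ (x\to+\infty,\ \mathrm{Im}\,\zeta\le0),\qquad \psi_2\sim e^{i\zeta x}\binom{\sqrt2(\lambda-\zeta)}{1}\ (x\to+\infty,\ \mathrm{Im}\,\zeta\ge0),$$ $$\varphi_1\sim e^{-i\zeta x}\binom{1}{-\sqrt2(\lambda-\zeta)}\ (x\to-\infty,\ \mathrm{Im}\,\zeta\ge0),$$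 where $v\sim e^{\kappa x}w$ means $e^{-\kappa x}v(x)\to w$. With $\{v,w\}=v_1w_2-v_2w_1$ (independent of $x$) set $$a=\frac{\{\varphi_1,\psi_2\}}{4\zeta(\lambda-\zeta)}\ \ (\mathrm{Im}\,\zeta\ge 0,\ \zeta\ne0),\qquad b=-\frac{\{\varphi_1,\psi_1\}}{4\zeta(\lambda-\zeta)}\ \ (\zeta\in\mathbb R\setminus\{0\}).$$ Assume that $a$ has exactly one zero on the upper sheet $\Gamma^+=\{(\lambda,\zeta):\lambda^2-\zeta^2=\frac12,\ \mathrm{Im}\,\zeta>0\}$, at $\lambda=\lambda_0$. Let $\nu_0=(\frac12-\lambda_0^2)^{1/2}$ (principal root; $\zeta=i\nu_0$ at this zero), let $b_0$ be the constant with $\varphi_1(x,\lambda_0)=b_0\psi_2(x,\lambda_0)$ for all $x$, let $a'(\lambda_0)$ be the derivative with respect to $\lambda$ on $\Gamma^+$, and put $$\mu_0=\frac{b_0}{\nu_0a'(\lambda_0)},\qquad \widetilde\mu_0=\frac{1}{b_0\nu_0a'(\lambda_0)} .$$ For $\zeta\in\mathbb R$ let $\lambda=\lambda(\zeta)=\sqrt{\zeta^2+\frac12}$,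 $c=\frac ba$, $\widetilde c=-\frac{b^*}{a}$, where $c(\pm\lambda)$ is the value at the point $(\pm\lambda(\zeta),\zeta)$ and similarly for $\widetilde c$; put $$c_1=c(\lambda)+c(-\lambda),\quad c_2=\frac{c(\lambda)-c(-\lambda)}{\lambda},\qquad \widetilde c_1=\widetilde c(\lambda)+\widetilde c(-\lambda),\quad \widetilde c_2=\frac{\widetilde c(\lambda)-\widetilde c(-\lambda)}{\lambda},$$ and, for $z\in\mathbb R$, $$F_1(z)=\frac1{2\pi}\int_{\mathbb R} c_1(\zeta)e^{i\zeta z}d\zeta-\mu_0\lambda_0e^{-\nu_0z},\qquad F_2(z)=\frac1{2\pi}\int_{\mathbb R} c_2(\zeta)e^{i\zeta z}d\zeta-\mu_0e^{-\nu_0z},$$ $$\widetilde F_1(z)=\frac1{2\pi}\int_{\mathbb R}\widetilde c_1(\zeta)e^{-i\zeta z}d\zeta-\widetilde\mu_0\lambda_0e^{\nu_0z},\qquad \widetilde F_2(z)=\frac1{2\pi}\int_{\mathbb R}\widetilde c_2(\zeta)e^{-i\zeta z}d\zeta-\widetilde\mu_0e^{\nu_0z}.$$ **Kernels.** $\Psi=(\Psi_{ij})$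 is the $2\times2$ matrix kernel, $C^1$ on $\{y\ge x\}$, with $\Psi(x,\cdot)\in L^1(x,\infty)$ for every $x$, satisfying for $y>x$ $$(\partial_x+\partial_y)\binom{\Psi_{11}}{\Psi_{22}}=i\begin{pmatrix}-\frac{\sqrt2}2&q^*(x)\\-q(x)&\frac{\sqrt2}2\end{pmatrix}\binom{\Psi_{12}}{\Psi_{21}},\qquad(\partial_x-\partial_y)\binom{\Psi_{12}}{\Psi_{21}}=i\begin{pmatrix}-\frac{\sqrt2}2&q^*(x)\\-q(x)&\frac{\sqrt2}2\end{pmatrix}\binom{\Psi_{11}}{\Psi_{22}},$$ with $\Psi_{12}^*(x,x)=\Psi_{21}(x,x)=-\frac i2\bigl(q(x)-\frac{\sqrt2}2\bigr)$ and $\int_x^{+\infty}|\Psi(x,y)|\,dy\to0$ as $x\to+\infty$. $\Phi$ is the kernel, $C^1$ on $\{y\le x\}$, with $\Phi(x,\cdot)\in L^1(-\infty,x)$ for every $x$, satisfying for $y<x$ the same two equations with $\mp\frac{\sqrt2}2$ on the diagonals of the matrices replaced by $\pm\frac{\sqrt2}2$, with $\Phi_{12}^*(x,x)=\Phi_{21}(x,x)=\frac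 i2\bigl(q(x)+\frac{\sqrt2}2\bigr)$ and $\int_{-\infty}^x|\Phi(x,y)|\,dy\to0$ as $x\to-\infty$. **Proposition.** The functions $c_1,c_2,\widetilde c_1,\widetilde c_2$ are integrable on $\mathbb R$; the functions $F_1,F_2,\widetilde F_1,\widetilde F_2$ are real valued; $F_2$ and $\widetilde F_2$ are differentiable; and the following hold, all integrals being absolutely convergent. (Right system) For all $y\ge x$, $$2\sqrt2\,\Psi_{11}(x,y)=F_2(x+y)-\int_x^{+\infty}\Bigl[\Psi_{12}(x,s)\sqrt2\bigl(F_1(s+y)-iF_2'(s+y)\bigr)+\Psi_{11}(x,s)F_2(s+y)\Bigr]ds,$$ $$2\sqrt2\,\Psi_{12}(x,y)=\sqrt2\bigl(F_1(x+y)+iF_2'(x+y)\bigr)-\int_x^{+\infty}\Bigl[\Psi_{11}(x,s)\sqrt2\bigl(F_1(s+y)+iF_2'(s+y)\bigr)+\Psi_{12}(x,s)F_2(s+y)\Bigr]ds.$$ (Left system) For all $y\le x$, $$2\sqrt2\,\Phi_{11}(x,y)=-\widetilde F_2(x+y)-\int_{-\infty}^x\Bigl[\Phi_{12}(x,s)\sqrt2\bigl(\widetilde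 F_1(s+y)-i\widetilde F_2'(s+y)\bigr)-\Phi_{11}(x,s)\widetilde F_2(s+y)\Bigr]ds,$$ $$2\sqrt2\,\Phi_{12}(x,y)=\sqrt2\bigl(\widetilde F_1(x+y)+i\widetilde F_2'(x+y)\bigr)-\int_{-\infty}^x\Bigl[\Phi_{11}(x,s)\sqrt2\bigl(\widetilde F_1(s+y)+i\widetilde F_2'(s+y)\bigr)-\Phi_{12}(x,s)\widetilde F_2(s+y)\Bigr]ds.$$ -/

import Mathlib

open MeasureTheory Filter Topology

noncomputable section

namespace GPMarchenko

/-- The standing assumption on `u : ℝ → ℂ`: it is of class `C⁴` and, for `0 ≤ k ≤ 3`,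
`⟨x⟩⁴ |∂ᵏ(u - 1)|` is bounded on `x ≥ 0` and `⟨x⟩⁴ |∂ᵏ(u + 1)|` is bounded on `x ≤ 0`,
where `⟨x⟩⁴ = (1 + x²)²`. -/
structure KinkLike (u : ℝ → ℂ) : Prop where
  contDiff : ContDiff ℝ 4 u
  bound_right : ∀ k : ℕ, k ≤ 3 → ∃ C : ℝ, ∀ x : ℝ, 0 ≤ x →
    ‖iteratedDeriv k (fun t => u t - 1) x‖ * (1 + x ^ 2) ^ 2 ≤ C
  bound_left : ∀ k : ℕ, k ≤ 3 → ∃ C : ℝ, ∀ x : ℝ, x ≤ 0 →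
    ‖iteratedDeriv k (fun t => u t + 1) x‖ * (1 + x ^ 2) ^ 2 ≤ C

/-- The complex number `√2`. -/
def rt2 : ℂ := ((Real.sqrt 2 : ℝ) : ℂ)

/-- The potential `q = (√2 / 2) u`. -/
def pot (u : ℝ → ℂ) (x : ℝ) : ℂ := rt2 / 2 * u x

/-! ### Jost solutions -/

/-- `v = (v₁, v₂)` (indexed by `0, 1`) solves on `ℝ` the system
`i v₁' + q* v₂ = l v₁`, `- i v₂' + q v₁ = l v₂`, with spectral parameter `l`. -/
structure IsSolution (q : ℝ → ℂ) (l : ℂ) (v : ℝ → Fin 2 → ℂ) : Prop where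
  diff : ∀ k : Fin 2, Differentiable ℝ (fun x => v x k)
  eq_one : ∀ x : ℝ, Complex.I * deriv (fun t => v t 0) x + star (q x) * v x 1 = l * v x 0
  eq_two : ∀ x : ℝ, -Complex.I * deriv (fun t => v t 1) x + q x * v x 0 = l * v x 1

/-- `v` is the solution with `v(x) ∼ e^{κ x} w` as `x` tends to infinity along `F`
(`F` is `atTop` or `atBot`), that is `e^{-κ x} v(x) → w`. -/
def IsJost (q : ℝ → ℂ) (l : ℂ) (F : Filter ℝ) (κ : ℂ) (w : Fin 2 → ℂ)
    (v : ℝ → Fin 2 → ℂ) : Prop :=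
  IsSolution q l v ∧ Tendsto (fun x : ℝ => Complex.exp (-(κ * (x : ℂ))) • v x) F (𝓝 w)

/-- `ψ₁(x, l) ∼ e^{-iζx} (1, √2 (l - ζ))` as `x → +∞`, for `l² - ζ² = 1/2`, `Im ζ ≤ 0`. On this
range the asymptotic condition determines the solution. -/
def psi1 (q : ℝ → ℂ) (l ζ : ℂ) : ℝ → Fin 2 → ℂ :=
  Classical.epsilon fun v => IsJost q l atTop (-(Complex.I * ζ)) ![1, rt2 * (l - ζ)] v

/-- `ψ₂(x, l) ∼ e^{iζx} (√2 (l - ζ), 1)` as `x → +∞`, for `l² - ζ² = 1/2`, `Im ζ ≥ 0`. -/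
def psi2 (q : ℝ → ℂ) (l ζ : ℂ) : ℝ → Fin 2 → ℂ :=
  Classical.epsilon fun v => IsJost q l atTop (Complex.I * ζ) ![rt2 * (l - ζ), 1] v

/-- `φ₁(x, l) ∼ e^{-iζx} (1, -√2 (l - ζ))` as `x → -∞`, for `l² - ζ² = 1/2`, `Im ζ ≥ 0`. -/
def phi1 (q : ℝ → ℂ) (l ζ : ℂ) : ℝ → Fin 2 → ℂ :=
  Classical.epsilon fun v => IsJost q l atBot (-(Complex.I * ζ)) ![1, -(rt2 * (l - ζ))] v

/-! ### Transition coefficients -/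

/-- The Wronskian `{v, w} = v₁ w₂ - v₂ w₁`, which for two solutions with the same spectral
parameter does not depend on `x`; it is evaluated at `x = 0`. -/
def wronskian (v w : ℝ → Fin 2 → ℂ) : ℂ := v 0 0 * w 0 1 - v 0 1 * w 0 0

/-- `a = {φ₁, ψ₂} / (4ζ(l - ζ))`, for `l² - ζ² = 1/2`, `Im ζ ≥ 0`, `ζ ≠ 0`. -/
def coeffA (q : ℝ → ℂ) (l ζ : ℂ) : ℂ :=
  wronskian (phi1 q l ζ) (psi2 q l ζ) / (4 * ζ * (l - ζ))

/-- `b = -{φ₁, ψ₁} / (4ζ(l - ζ))`, for `l² - ζ² = 1/2`, `ζ` real and nonzero. -/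
def coeffB (q : ℝ → ℂ) (l ζ : ℂ) : ℂ :=
  -(wronskian (phi1 q l ζ) (psi1 q l ζ)) / (4 * ζ * (l - ζ))

/-- The upper sheet `Γ⁺` of the Riemann surface `l² - ζ² = 1/2`; points are pairs `(l, ζ)`. -/
def upperSheet : Set (ℂ × ℂ) := {P | P.1 ^ 2 - P.2 ^ 2 = 1 / 2 ∧ 0 < P.2.im}

/-- `ν = (1/2 - l²)^{1/2}` (principal square root; the usual root for `l ∈ (-√2/2, √2/2)`). -/
def nu (l : ℂ) : ℂ := (1 / 2 - l ^ 2) ^ (1 / 2 : ℂ)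

/-- The holomorphic function `ζ = iν` of `l` on the upper sheet. -/
def zetaUp (l : ℂ) : ℂ := Complex.I * nu l

/-- The derivative `a'(l)` of `a` with respect to `l` on the upper sheet. -/
def derivA (q : ℝ → ℂ) (l : ℂ) : ℂ := deriv (fun l' : ℂ => coeffA q l' (zetaUp l')) l

/-- The constant `b₀` with `φ₁(x, l₀) = b₀ ψ₂(x, l₀)` for all `x`, at a zero `l₀` of `a`. -/
def bZero (q : ℝ → ℂ) (l₀ : ℂ) : ℂ :=
  Classical.epsilon fun c : ℂ => ∀ x : ℝ, phi1 q l₀ (zetaUp l₀) x = c • psi2 q l₀ (zetaUp l₀) x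

/-- `μ₀ = b₀ / (ν₀ a'(l₀))`. -/
def muRight (q : ℝ → ℂ) (l₀ : ℂ) : ℂ := bZero q l₀ / (nu l₀ * derivA q l₀)

/-- `μ̃₀ = 1 / (b₀ ν₀ a'(l₀))`. -/
def muLeft (q : ℝ → ℂ) (l₀ : ℂ) : ℂ := 1 / (bZero q l₀ * nu l₀ * derivA q l₀)

/-- `λ(ζ) = √(ζ² + 1/2)` for real `ζ`. -/
def lamOf (ζ : ℝ) : ℂ := ((Real.sqrt (ζ ^ 2 + 1 / 2) : ℝ) : ℂ)

/-- `c = b / a`. -/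
def cRight (q : ℝ → ℂ) (l ζ : ℂ) : ℂ := coeffB q l ζ / coeffA q l ζ

/-- `c̃ = -b* / a`. -/
def cLeft (q : ℝ → ℂ) (l ζ : ℂ) : ℂ := -(star (coeffB q l ζ)) / coeffA q l ζ

/-- `c₁(ζ) = c(λ(ζ)) + c(-λ(ζ))`, the two points `(±λ(ζ), ζ)` lying on the two branches of the
hyperbola. -/
def cRight1 (q : ℝ → ℂ) (ζ : ℝ) : ℂ := cRight q (lamOf ζ) (ζ : ℂ) + cRight q (-lamOf ζ) (ζ : ℂ)

/-- `c₂(ζ) = (c(λ(ζ)) - c(-λ(ζ))) / λ(ζ)`. -/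
def cRight2 (q : ℝ → ℂ) (ζ : ℝ) : ℂ :=
  (cRight q (lamOf ζ) (ζ : ℂ) - cRight q (-lamOf ζ) (ζ : ℂ)) / lamOf ζ

/-- `c̃₁(ζ) = c̃(λ(ζ)) + c̃(-λ(ζ))`. -/
def cLeft1 (q : ℝ → ℂ) (ζ : ℝ) : ℂ := cLeft q (lamOf ζ) (ζ : ℂ) + cLeft q (-lamOf ζ) (ζ : ℂ)

/-- `c̃₂(ζ) = (c̃(λ(ζ)) - c̃(-λ(ζ))) / λ(ζ)`. -/
def cLeft2 (q : ℝ → ℂ) (ζ : ℝ) : ℂ :=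
  (cLeft q (lamOf ζ) (ζ : ℂ) - cLeft q (-lamOf ζ) (ζ : ℂ)) / lamOf ζ

/-- `F₁(z) = (1/2π) ∫ c₁(ζ) e^{iζz} dζ - μ₀ l₀ e^{-ν₀ z}`. -/
def FRight1 (q : ℝ → ℂ) (l₀ : ℂ) (z : ℝ) : ℂ :=
  1 / (2 * (Real.pi : ℂ)) * (∫ ζ : ℝ, cRight1 q ζ * Complex.exp (Complex.I * (ζ : ℂ) * (z : ℂ)))
    - muRight q l₀ * l₀ * Complex.exp (-(nu l₀ * (z : ℂ)))

/-- `F₂(z) = (1/2π) ∫ c₂(ζ) e^{iζz} dζ - μ₀ e^{-ν₀ z}`. -/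
def FRight2 (q : ℝ → ℂ) (l₀ : ℂ) (z : ℝ) : ℂ :=
  1 / (2 * (Real.pi : ℂ)) * (∫ ζ : ℝ, cRight2 q ζ * Complex.exp (Complex.I * (ζ : ℂ) * (z : ℂ)))
    - muRight q l₀ * Complex.exp (-(nu l₀ * (z : ℂ)))

/-- `F̃₁(z) = (1/2π) ∫ c̃₁(ζ) e^{-iζz} dζ - μ̃₀ l₀ e^{ν₀ z}`. -/
def FLeft1 (q : ℝ → ℂ) (l₀ : ℂ) (z : ℝ) : ℂ :=
  1 / (2 * (Real.pi : ℂ)) * (∫ ζ : ℝ, cLeft1 q ζ * Complex.exp (-(Complex.I * (ζ : ℂ) * (z : ℂ))))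
    - muLeft q l₀ * l₀ * Complex.exp (nu l₀ * (z : ℂ))

/-- `F̃₂(z) = (1/2π) ∫ c̃₂(ζ) e^{-iζz} dζ - μ̃₀ e^{ν₀ z}`. -/
def FLeft2 (q : ℝ → ℂ) (l₀ : ℂ) (z : ℝ) : ℂ :=
  1 / (2 * (Real.pi : ℂ)) * (∫ ζ : ℝ, cLeft2 q ζ * Complex.exp (-(Complex.I * (ζ : ℂ) * (z : ℂ))))
    - muLeft q l₀ * Complex.exp (nu l₀ * (z : ℂ))

/-! ### The kernels -/

/-- The partial derivative `∂ₓ K_{ij}(x, y)`. -/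
def dX (K : ℝ → ℝ → Matrix (Fin 2) (Fin 2) ℂ) (i j : Fin 2) (x y : ℝ) : ℂ :=
  deriv (fun t => K t y i j) x

/-- The partial derivative `∂_y K_{ij}(x, y)`. -/
def dY (K : ℝ → ℝ → Matrix (Fin 2) (Fin 2) ℂ) (i j : Fin 2) (x y : ℝ) : ℂ :=
  deriv (fun t => K x t i j) y

/-- `K = Ψ` is the kernel defined on `y ≥ x` by the linear hyperbolic system together with its
conditions on the diagonal and at `x → +∞`. -/
structure IsRightKernel (q : ℝ → ℂ) (K : ℝ → ℝ → Matrix (Fin 2) (Fin 2) ℂ) : Prop where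
  smooth : ∀ i j : Fin 2, ContDiffOn ℝ 1 (fun P : ℝ × ℝ => K P.1 P.2 i j) {P | P.1 ≤ P.2}
  eq_11 : ∀ x y : ℝ, x < y → dX K 0 0 x y + dY K 0 0 x y
    = Complex.I * (-(rt2 / 2) * K x y 0 1 + star (q x) * K x y 1 0)
  eq_22 : ∀ x y : ℝ, x < y → dX K 1 1 x y + dY K 1 1 x y
    = Complex.I * (-(q x) * K x y 0 1 + rt2 / 2 * K x y 1 0)
  eq_12 : ∀ x y : ℝ, x < y → dX K 0 1 x y - dY K 0 1 x y
    = Complex.I * (-(rt2 / 2) * K x y 0 0 + star (q x) * K x y 1 1)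
  eq_21 : ∀ x y : ℝ, x < y → dX K 1 0 x y - dY K 1 0 x y
    = Complex.I * (-(q x) * K x y 0 0 + rt2 / 2 * K x y 1 1)
  diag_12 : ∀ x : ℝ, star (K x x 0 1) = -(Complex.I / 2) * (q x - rt2 / 2)
  diag_21 : ∀ x : ℝ, K x x 1 0 = -(Complex.I / 2) * (q x - rt2 / 2)
  integrable : ∀ (i j : Fin 2) (x : ℝ), IntegrableOn (fun y => K x y i j) (Set.Ioi x)
  decay : ∀ i j : Fin 2, Tendsto (fun x : ℝ => ∫ y in Set.Ioi x, ‖K x y i j‖) atTop (𝓝 0)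

/-- `K = Φ` is the kernel defined on `y ≤ x` by the linear hyperbolic system together with its
conditions on the diagonal and at `x → -∞`. -/
structure IsLeftKernel (q : ℝ → ℂ) (K : ℝ → ℝ → Matrix (Fin 2) (Fin 2) ℂ) : Prop where
  smooth : ∀ i j : Fin 2, ContDiffOn ℝ 1 (fun P : ℝ × ℝ => K P.1 P.2 i j) {P | P.2 ≤ P.1}
  eq_11 : ∀ x y : ℝ, y < x → dX K 0 0 x y + dY K 0 0 x y
    = Complex.I * (rt2 / 2 * K x y 0 1 + star (q x) * K x y 1 0)
  eq_22 : ∀ x y : ℝ, y < x → dX K 1 1 x y + dY K 1 1 x y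
    = Complex.I * (-(q x) * K x y 0 1 - rt2 / 2 * K x y 1 0)
  eq_12 : ∀ x y : ℝ, y < x → dX K 0 1 x y - dY K 0 1 x y
    = Complex.I * (rt2 / 2 * K x y 0 0 + star (q x) * K x y 1 1)
  eq_21 : ∀ x y : ℝ, y < x → dX K 1 0 x y - dY K 1 0 x y
    = Complex.I * (-(q x) * K x y 0 0 - rt2 / 2 * K x y 1 1)
  diag_12 : ∀ x : ℝ, star (K x x 0 1) = Complex.I / 2 * (q x + rt2 / 2)
  diag_21 : ∀ x : ℝ, K x x 1 0 = Complex.I / 2 * (q x + rt2 / 2)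
  integrable : ∀ (i j : Fin 2) (x : ℝ), IntegrableOn (fun y => K x y i j) (Set.Iio x)
  decay : ∀ i j : Fin 2, Tendsto (fun x : ℝ => ∫ y in Set.Iio x, ‖K x y i j‖) atBot (𝓝 0)

/-! ### The Marchenko equations -/

/-- The integrand `K_{12} √2 (F₁ - i F₂') + K_{11} F₂`, with first factors at `(x, s)` and second
factors at `s + y`. -/
def integrand11 (K : ℝ → ℝ → Matrix (Fin 2) (Fin 2) ℂ) (F₁ F₂ : ℝ → ℂ) (x y s : ℝ) : ℂ :=
  K x s 0 1 * (rt2 * (F₁ (s + y) - Complex.I * deriv F₂ (s + y))) + K x s 0 0 * F₂ (s + y)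

/-- The integrand `K_{11} √2 (F₁ + i F₂') + K_{12} F₂`. -/
def integrand12 (K : ℝ → ℝ → Matrix (Fin 2) (Fin 2) ℂ) (F₁ F₂ : ℝ → ℂ) (x y s : ℝ) : ℂ :=
  K x s 0 0 * (rt2 * (F₁ (s + y) + Complex.I * deriv F₂ (s + y))) + K x s 0 1 * F₂ (s + y)

/-- The integrand `K_{12} √2 (F₁ - i F₂') - K_{11} F₂`. -/
def integrandLeft11 (K : ℝ → ℝ → Matrix (Fin 2) (Fin 2) ℂ) (F₁ F₂ : ℝ → ℂ) (x y s : ℝ) : ℂ :=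
  K x s 0 1 * (rt2 * (F₁ (s + y) - Complex.I * deriv F₂ (s + y))) - K x s 0 0 * F₂ (s + y)

/-- The integrand `K_{11} √2 (F₁ + i F₂') - K_{12} F₂`. -/
def integrandLeft12 (K : ℝ → ℝ → Matrix (Fin 2) (Fin 2) ℂ) (F₁ F₂ : ℝ → ℂ) (x y s : ℝ) : ℂ :=
  K x s 0 0 * (rt2 * (F₁ (s + y) + Complex.I * deriv F₂ (s + y))) - K x s 0 1 * F₂ (s + y)

/-- The right Marchenko system for `K = Ψ`, on `y ≥ x`, all integrals being convergent. -/
def RightMarchenko (K : ℝ → ℝ → Matrix (Fin 2) (Fin 2) ℂ) (F₁ F₂ : ℝ → ℂ) : Prop :=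
  ∀ x y : ℝ, x ≤ y →
    IntegrableOn (integrand11 K F₁ F₂ x y) (Set.Ioi x) ∧
    IntegrableOn (integrand12 K F₁ F₂ x y) (Set.Ioi x) ∧
    2 * rt2 * K x y 0 0
      = F₂ (x + y) - ∫ s in Set.Ioi x, integrand11 K F₁ F₂ x y s ∧
    2 * rt2 * K x y 0 1
      = rt2 * (F₁ (x + y) + Complex.I * deriv F₂ (x + y))
        - ∫ s in Set.Ioi x, integrand12 K F₁ F₂ x y s

/-- The left Marchenko system for `K = Φ`, on `y ≤ x`, all integrals being convergent. -/
def LeftMarchenko (K : ℝ → ℝ → Matrix (Fin 2) (Fin 2) ℂ) (F₁ F₂ : ℝ → ℂ) : Prop :=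
  ∀ x y : ℝ, y ≤ x →
    IntegrableOn (integrandLeft11 K F₁ F₂ x y) (Set.Iio x) ∧
    IntegrableOn (integrandLeft12 K F₁ F₂ x y) (Set.Iio x) ∧
    2 * rt2 * K x y 0 0
      = -F₂ (x + y) - ∫ s in Set.Iio x, integrandLeft11 K F₁ F₂ x y s ∧
    2 * rt2 * K x y 0 1
      = rt2 * (F₁ (x + y) + Complex.I * deriv F₂ (x + y))
        - ∫ s in Set.Iio x, integrandLeft12 K F₁ F₂ x y s

end GPMarchenko

end

open MeasureTheory Filter Topology

noncomputable section

namespace GPMarchenko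

/-! The curve λ² − ζ² = 1/2 is rational: z = λ + ζ is a global coordinate, with λ − ζ = 1/(2z). The
upper sheet becomes the upper half-plane, the two branches of the real hyperbola become the positive
and the negative half-line, and the points over ζ = 0 and ζ = ∞ sit at z = ±√2/2 and z = 0, ∞. In
this coordinate ψ₂ is `jost q z`, φ₁ is a reflected Jost solution of `refl q`, that is of −q*(−x),
and a = `wr q z` / (1 − 1/(2z²)), where the Wronskian `wr q` of φ₁ and ψ₂ is holomorphic in the
upper half-plane.

On the real z-line φ₁/a = ψ₁ + cψ₂ (`Tame.scattering`). The first component of this identity is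
multiplied by p(z)/z and by the transform ∫ χ(y) e^{iζy} dy of a test function χ supported in (x,
∞), and integrated over z. On the left, the transform of χ compensates the exponential growth of φ₁,
so the contour can be pushed into the upper half-plane. The only singularity met is the simple zero
z₀ of `wr q`, where φ₁ = b₀ψ₂; its residue gives the terms with μ₀ (`Tame.integral_contourFun`,
`IsBoundState.muRight_eq`). On the right, ψ₁ and ψ₂ are expressed through the kernel Ψ
(`IsRightKernel.jost_eq`), the two half-lines are folded onto the ζ-axis by dz/z = ±dζ/λ, and
Fourier inversion turns everything into integrals against χ. The weight p = √2 z isolates Ψ₁₁ and p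
= 1 isolates Ψ₁₂. As χ is arbitrary and all terms are continuous, the equations hold for every y ≥ x
(`integral_equation_of_spectral`).

Four facts support the argument. First, 1/a is controlled up to the real line. The energy |v₂|² −
|v₁|² of a solution has derivative −2 Im λ |v|², which yields |`wr q z`| ≥ c |2|z|² − 1| on compact
parts of the half-plane punctured at 0 (`Tame.wr_lower_bound`). Zeros therefore lie on |z|² = 1/2
and are simple, and a maximum principle carries the bound to the thresholds z = ±√2/2
(`Tame.bound_near_threshold`, `Tame.transmission_bound`).

Second, c = O(ζ⁻²). A cancellation between the expansions of the two Jost solutions at z = ∞ gives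
this at one end, and the symmetry z ↦ −1/(2z) transfers it to z = 0 (`Tame.reflection_bound`). Hence
c₁, c₂ and ζc₂ are integrable and F₂ is differentiable.

Third, Ψ represents the Jost solution although it is only C¹ and integrable in y. In the variables
(x, y − x) its entries solve transport equations; a Gronwall argument gives local uniform L¹ bounds,
boundary terms at y = ∞ vanish along a sequence, and the Laplace transform then satisfies the
differential system of the normalized Jost solution.

Fourth, symmetries. The involution z ↦ 1/(2z*) fixes z₀ and makes all functions F real, and the
reflection q ↦ −q*(−x) deduces the left system from the right one. -/

theorem differentiableOn_integral_of_dominated {α : Type*} [MeasurableSpace α] {μ : Measure α}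
    {F : ℂ → α → ℂ} {U : Set ℂ} (hU : IsOpen U) {b : α → ℝ} (hb : Integrable b μ)
    (hmeas : ∀ z ∈ U, AEStronglyMeasurable (F z) μ)
    (hbound : ∀ z ∈ U, ∀ᵐ a ∂μ, ‖F z a‖ ≤ b a)
    (hbound' : ∀ᵐ a ∂μ, ∀ z ∈ U, ‖F z a‖ ≤ b a)
    (hdiff : ∀ᵐ a ∂μ, DifferentiableOn ℂ (fun z => F z a) U) :
    DifferentiableOn ℂ (fun z => ∫ a, F z a ∂μ) U := by
  intro z₀ hz₀
  obtain ⟨ε, hε, hball⟩ := Metric.isOpen_iff.1 hU z₀ hz₀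
  have hsub : ∀ z ∈ Metric.ball z₀ (ε / 2), Metric.closedBall z (ε / 4) ⊆ U := by
    intro z hz w hw
    apply hball
    rw [Metric.mem_ball] at *
    rw [Metric.mem_closedBall] at hw
    have := dist_triangle w z z₀
    linarith
  have hin : ∀ z ∈ Metric.ball z₀ (ε / 2), z ∈ U := fun z hz =>
    hsub z hz (Metric.mem_closedBall_self (by positivity))
  have hd : ∀ᵐ a ∂μ, ∀ z ∈ Metric.ball z₀ (ε / 2),
      HasDerivAt (fun z => F z a) (deriv (fun z => F z a) z) z := by
    filter_upwards [hdiff] with a ha z hz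
    exact (ha.differentiableAt (hU.mem_nhds (hin z hz))).hasDerivAt
  have hz₀' : z₀ ∈ Metric.ball z₀ (ε / 2) := Metric.mem_ball_self (by positivity)
  -- The derivative in the parameter needs no separate bound: Cauchy's estimate on circles of radius
  -- ε/4 dominates it by b/(ε/4).
  refine ((hasDerivAt_integral_of_dominated_loc_of_deriv_le
    (F' := fun z a => deriv (fun z => F z a) z) (bound := fun a => b a / (ε / 4))
    (Metric.ball_mem_nhds z₀ (half_pos hε)) ?_ ?_ ?_ ?_ ?_ hd).2).differentiableAt.differentiableWithinAt
  · filter_upwards [hU.mem_nhds hz₀] with z hz using hmeas z hz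
  · exact hb.mono' (hmeas z₀ hz₀) (hbound z₀ hz₀)
  -- The derivative at z₀ is the limit of difference quotients along the sequence t n → 0, hence
  -- measurable.
  · let t : ℕ → ℂ := fun n => ((ε / 4 : ℝ) : ℂ) * ((1 / ((n : ℝ) + 1) : ℝ) : ℂ)
    have ht0 : Tendsto t atTop (𝓝[≠] 0) := by
      rw [tendsto_nhdsWithin_iff]
      constructor
      · have : Tendsto (fun n : ℕ => ((1 / ((n : ℝ) + 1) : ℝ) : ℂ)) atTop (𝓝 ((0 : ℝ) : ℂ)) :=
          (Complex.continuous_ofReal.tendsto 0).comp tendsto_one_div_add_atTop_nhds_zero_nat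
        simpa [t] using this.const_mul ((ε / 4 : ℝ) : ℂ)
      · refine Eventually.of_forall fun n => ?_
        have h1 : ((n : ℝ) + 1) ≠ 0 := by positivity
        have h2 : (ε / 4 : ℝ) ≠ 0 := by positivity
        simp only [t, Set.mem_compl_iff, Set.mem_singleton_iff, mul_eq_zero, Complex.ofReal_eq_zero]
        push Not
        exact ⟨h2, by positivity⟩
    have htU : ∀ n, z₀ + t n ∈ U := by
      intro n
      apply hsub z₀ hz₀'
      simp only [Metric.mem_closedBall, dist_eq_norm, add_sub_cancel_left, t, norm_mul,
        Complex.norm_real, Real.norm_eq_abs]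
      rw [abs_of_pos (by positivity), abs_of_pos (by positivity)]
      have : 1 / ((n : ℝ) + 1) ≤ 1 := by
        rw [div_le_one (by positivity)]; linarith [Nat.cast_nonneg (α := ℝ) n]
      nlinarith
    refine aestronglyMeasurable_of_tendsto_ae (u := atTop)
      (f := fun n a => (t n)⁻¹ * (F (z₀ + t n) a - F z₀ a)) (fun n => ?_) ?_
    · exact ((hmeas _ (htU n)).sub (hmeas _ hz₀)).const_mul _
    · filter_upwards [hd] with a ha
      exact (ha z₀ hz₀').tendsto_slope_zero.comp ht0
  · filter_upwards [hbound', hdiff] with a ha ha' z hz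
    refine Complex.norm_deriv_le_of_forall_mem_sphere_norm_le (by positivity) ?_ ?_
    · refine DifferentiableOn.diffContOnCl ?_
      rw [closure_ball _ (by positivity)]
      exact ha'.mono (hsub z hz)
    · intro w hw
      exact ha w (hsub z hz (Metric.sphere_subset_closedBall hw))
  · exact hb.div_const _

/-! ### Volterra equations on half-lines with a holomorphic parameter -/

section Volterra

variable {ι : Type*} [Fintype ι]

/-- The Volterra operator with kernel `g`. -/
def volterraOp (g : ι → ι → ℝ → ℝ → ℂ → ℂ) (f : ι → ℝ → ℂ → ℂ) : ι → ℝ → ℂ → ℂ :=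
  fun i x z => ∫ s in Set.Ioi x, ∑ j, g i j x s z * f j s z

/-- Standing assumptions on a Volterra kernel, dominated by `k x * h s`. -/
structure VolterraKernel (g : ι → ι → ℝ → ℝ → ℂ → ℂ) (S U : Set ℂ) (k h H : ℝ → ℝ) : Prop where
  sub : U ⊆ S
  isOpen : IsOpen U
  cont_k : Continuous k
  one_le_k : ∀ x, 1 ≤ k x
  h_nonneg : ∀ x, 0 ≤ h x
  hasDerivAt : ∀ x, HasDerivAt H (-(k x * h x)) x
  tendsto : Tendsto H atTop (𝓝 0)
  cont : ∀ z ∈ S, ∀ i j, Continuous fun p : ℝ × ℝ => g i j p.1 p.2 z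
  contOn : ∀ i j x s, ContinuousOn (g i j x s) S
  diffOn : ∀ i j x s, DifferentiableOn ℂ (g i j x s) U
  bound : ∀ z ∈ S, ∀ i x s, x ≤ s → ∑ j, ‖g i j x s z‖ ≤ k x * h s

/-- The regularity propagated by the Volterra operator. -/
structure VolterraReg (S U : Set ℂ) (k H : ℝ → ℝ) (C : ℝ) (f : ι → ℝ → ℂ → ℂ) : Prop where
  bound : ∀ i x, ∀ z ∈ S, ‖f i x z‖ ≤ C * (k x * Real.exp (2 * H x))
  cont : ∀ z ∈ S, ∀ i, Continuous fun x => f i x z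
  contOn : ∀ i x, ContinuousOn (f i x) S
  diffOn : ∀ i x, DifferentiableOn ℂ (f i x) U

variable {g : ι → ι → ℝ → ℝ → ℂ → ℂ} {S U : Set ℂ} {k h H : ℝ → ℝ}

/-- As H' = −k h, the weight k exp(2H) makes the dominating integrand an exact derivative. This is
how the Volterra operator contracts by a factor 1/2 without any smallness of the kernel. -/
theorem VolterraKernel.integral_weight (hg : VolterraKernel g S U k h H) (x : ℝ) :
    IntegrableOn (fun s => h s * (k s * Real.exp (2 * H s))) (Set.Ioi x) ∧
    ∫ s in Set.Ioi x, h s * (k s * Real.exp (2 * H s)) = (Real.exp (2 * H x) - 1) / 2 := by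
  have hd : ∀ s ∈ Set.Ici x, HasDerivAt (fun s => -(Real.exp (2 * H s) / 2))
      (h s * (k s * Real.exp (2 * H s))) s := by
    intro s _
    have := (((hg.hasDerivAt s).const_mul 2).exp.div_const 2).neg
    refine this.congr_deriv ?_
    ring
  have hpos : ∀ s ∈ Set.Ioi x, 0 ≤ h s * (k s * Real.exp (2 * H s)) := fun s _ =>
    mul_nonneg (hg.h_nonneg s) (mul_nonneg (zero_le_one.trans (hg.one_le_k s)) (Real.exp_pos _).le)
  have hlim : Tendsto (fun s => -(Real.exp (2 * H s) / 2)) atTop (𝓝 (-(Real.exp (2 * 0) / 2))) :=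
    (((Real.continuous_exp.tendsto _).comp (hg.tendsto.const_mul 2)).div_const 2).neg
  refine ⟨integrableOn_Ioi_deriv_of_nonneg' hd hpos hlim, ?_⟩
  rw [integral_Ioi_of_hasDerivAt_of_nonneg' hd hpos hlim]
  simp only [mul_zero, Real.exp_zero]
  ring

theorem VolterraKernel.sum_bound (hg : VolterraKernel g S U k h H) {C : ℝ} {f : ι → ℝ → ℂ → ℂ}
    (hf : VolterraReg S U k H C f) {z : ℂ} (hz : z ∈ S) (i : ι) {x s : ℝ} (hxs : x ≤ s) :
    ‖∑ j, g i j x s z * f j s z‖ ≤ k x * (C * (h s * (k s * Real.exp (2 * H s)))) := by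
  calc ‖∑ j, g i j x s z * f j s z‖ ≤ ∑ j, ‖g i j x s z‖ * (C * (k s * Real.exp (2 * H s))) := by
        refine (norm_sum_le _ _).trans (Finset.sum_le_sum fun j _ => ?_)
        rw [norm_mul]
        exact mul_le_mul_of_nonneg_left (hf.bound j s z hz) (norm_nonneg _)
    _ = (∑ j, ‖g i j x s z‖) * (C * (k s * Real.exp (2 * H s))) := by rw [Finset.sum_mul]
    _ ≤ (k x * h s) * (C * (k s * Real.exp (2 * H s))) := by
        refine mul_le_mul_of_nonneg_right (hg.bound z hz i x s hxs) ?_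
        exact (norm_nonneg _).trans (hf.bound i s z hz)
    _ = _ := by ring

theorem VolterraKernel.continuous_integrand (hg : VolterraKernel g S U k h H) {C : ℝ}
    {f : ι → ℝ → ℂ → ℂ} (hf : VolterraReg S U k H C f) {z : ℂ} (hz : z ∈ S) (i : ι) :
    Continuous fun p : ℝ × ℝ => ∑ j, g i j p.1 p.2 z * f j p.2 z :=
  continuous_finsetSum _ fun j _ => (hg.cont z hz i j).mul ((hf.cont z hz j).comp continuous_snd)

theorem VolterraKernel.integrableOn (hg : VolterraKernel g S U k h H) {C : ℝ}
    {f : ι → ℝ → ℂ → ℂ} (hf : VolterraReg S U k H C f) {z : ℂ} (hz : z ∈ S) (i : ι) (x : ℝ) :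
    IntegrableOn (fun s => ∑ j, g i j x s z * f j s z) (Set.Ioi x) := by
  refine Integrable.mono' (((hg.integral_weight x).1.const_mul C).const_mul (k x)) ?_ ?_
  · exact ((hg.continuous_integrand hf hz i).comp (by fun_prop :
      Continuous fun s : ℝ => (x, s))).aestronglyMeasurable
  · filter_upwards [ae_restrict_mem measurableSet_Ioi] with s hs
    exact hg.sum_bound hf hz i (le_of_lt hs)

theorem VolterraKernel.H_nonneg (hg : VolterraKernel g S U k h H) (x : ℝ) : 0 ≤ H x := by
  have hanti : Antitone H := antitone_of_hasDerivAt_nonpos hg.hasDerivAt fun s => by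
    have := mul_nonneg (zero_le_one.trans (hg.one_le_k s)) (hg.h_nonneg s)
    simpa using this
  exact hanti.le_of_tendsto hg.tendsto x

/-- The weighted bound is halved by `integral_weight`, and the same dominating function, integrable
and independent of the parameter, transmits continuity in x and continuity and holomorphy in z. -/
theorem VolterraKernel.reg_volterraOp (hg : VolterraKernel g S U k h H) {C : ℝ} (hC : 0 ≤ C)
    {f : ι → ℝ → ℂ → ℂ} (hf : VolterraReg S U k H C f) :
    VolterraReg S U k H (C / 2) (volterraOp g f) := by
  have hk0 : ∀ x, 0 ≤ k x := fun x => zero_le_one.trans (hg.one_le_k x)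
  refine ⟨?_, ?_, ?_, ?_⟩
  · intro i x z hz
    have h1 : ‖volterraOp g f i x z‖ ≤
        ∫ s in Set.Ioi x, k x * (C * (h s * (k s * Real.exp (2 * H s)))) := by
      refine norm_integral_le_of_norm_le (((hg.integral_weight x).1.const_mul C).const_mul (k x)) ?_
      filter_upwards [ae_restrict_mem measurableSet_Ioi] with s hs
      exact hg.sum_bound hf hz i (le_of_lt hs)
    rw [integral_const_mul, integral_const_mul, (hg.integral_weight x).2] at h1
    refine h1.trans ?_
    have := mul_nonneg (hk0 x) hC
    nlinarith [hk0 x]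
  · intro z hz i
    rw [continuous_iff_continuousAt]
    intro x₀
    obtain ⟨M, hM⟩ := (isCompact_Icc (a := x₀ - 1) (b := x₀ + 1)).bddAbove_image
      hg.cont_k.continuousOn
    have hM' : ∀ x ∈ Set.Ioo (x₀ - 1) (x₀ + 1), k x ≤ M := fun x hx =>
      hM ⟨x, ⟨hx.1.le, hx.2.le⟩, rfl⟩
    have hnhds : Set.Ioo (x₀ - 1) (x₀ + 1) ∈ 𝓝 x₀ := Ioo_mem_nhds (by linarith) (by linarith)
    -- The moving half-line is replaced by an indicator on a fixed one, so that dominated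
    -- convergence applies; the integrand is continuous at x₀ except for the null value s = x₀.
    have heq : (fun x => volterraOp g f i x z) =ᶠ[𝓝 x₀] fun x => ∫ s in Set.Ioi (x₀ - 1),
        (Set.Ioi x).indicator (fun s => ∑ j, g i j x s z * f j s z) s := by
      filter_upwards [hnhds] with x hx
      rw [setIntegral_indicator measurableSet_Ioi, Set.inter_eq_right.2]
      · rfl
      · exact Set.Ioi_subset_Ioi hx.1.le
    refine ContinuousAt.congr ?_ heq.symm
    refine continuousAt_of_dominated (bound := fun s => M * (C * (h s * (k s * Real.exp (2 * H s)))))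
      ?_ ?_ (((hg.integral_weight (x₀ - 1)).1.const_mul C).const_mul M) ?_
    · refine Eventually.of_forall fun x => ?_
      refine (Continuous.aestronglyMeasurable ?_).indicator measurableSet_Ioi
      exact (hg.continuous_integrand hf hz i).comp (by fun_prop : Continuous fun s : ℝ => (x, s))
    · filter_upwards [hnhds] with x hx
      refine Eventually.of_forall fun s => ?_
      have hn : 0 ≤ C * (h s * (k s * Real.exp (2 * H s))) := by
        have := hk0 s; have := hg.h_nonneg s; positivity
      by_cases hs : s ∈ Set.Ioi x
      · rw [Set.indicator_of_mem hs]
        exact (hg.sum_bound hf hz i (le_of_lt hs)).trans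
          (mul_le_mul_of_nonneg_right (hM' x hx) hn)
      · rw [Set.indicator_of_notMem hs, norm_zero]
        exact mul_nonneg ((hk0 x).trans (hM' x hx)) hn
    · have hne : ∀ᵐ s ∂(volume.restrict (Set.Ioi (x₀ - 1))), s ≠ x₀ :=
        ae_restrict_of_ae (by simp [ae_iff, measure_singleton])
      filter_upwards [hne] with s hs
      have hc : Continuous fun x => ∑ j, g i j x s z * f j s z :=
        (hg.continuous_integrand hf hz i).comp (by fun_prop : Continuous fun x : ℝ => (x, s))
      rcases lt_or_gt_of_ne hs with hlt | hgt
      · refine (continuousAt_const (y := (0 : ℂ))).congr ?_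
        filter_upwards [lt_mem_nhds hlt] with x hx
        rw [Set.indicator_of_notMem]
        simpa using hx.le
      · refine hc.continuousAt.congr ?_
        filter_upwards [gt_mem_nhds hgt] with x hx
        rw [Set.indicator_of_mem]
        simpa using hx
  · intro i x
    refine continuousOn_of_dominated
      (bound := fun s => k x * (C * (h s * (k s * Real.exp (2 * H s))))) ?_ ?_
      (((hg.integral_weight x).1.const_mul C).const_mul (k x)) ?_
    · intro z hz
      exact (hg.integrableOn hf hz i x).aestronglyMeasurable
    · intro z hz
      filter_upwards [ae_restrict_mem measurableSet_Ioi] with s hs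
      exact hg.sum_bound hf hz i (le_of_lt hs)
    · refine Eventually.of_forall fun s => ?_
      exact continuousOn_finsetSum _ fun j _ => (hg.contOn i j x s).mul (hf.contOn j s)
  · intro i x
    refine differentiableOn_integral_of_dominated hg.isOpen
      (b := fun s => k x * (C * (h s * (k s * Real.exp (2 * H s)))))
      (((hg.integral_weight x).1.const_mul C).const_mul (k x)) ?_ ?_ ?_ ?_
    · intro z hz
      exact (hg.integrableOn hf (hg.sub hz) i x).aestronglyMeasurable
    · intro z hz
      filter_upwards [ae_restrict_mem measurableSet_Ioi] with s hs
      exact hg.sum_bound hf (hg.sub hz) i (le_of_lt hs)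
    · filter_upwards [ae_restrict_mem measurableSet_Ioi] with s hs z hz
      exact hg.sum_bound hf (hg.sub hz) i (le_of_lt hs)
    · refine Eventually.of_forall fun s => ?_
      exact DifferentiableOn.fun_sum fun j _ => (hg.diffOn i j x s).mul (hf.diffOn j s)

/-- Existence, boundedness and regularity in the parameter of the solution of a Volterra
equation on half-lines `(x, ∞)`. -/
theorem VolterraKernel.exists_solution (hg : VolterraKernel g S U k h H) (w : ι → ℂ)
    (hw : ∀ i, ‖w i‖ ≤ 1) :
    ∃ m : ι → ℝ → ℂ → ℂ, VolterraReg S U k H 2 m ∧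
      ∀ z ∈ S, ∀ i x, m i x z = w i + ∫ s in Set.Ioi x, ∑ j, g i j x s z * m j s z := by
  have hk0 : ∀ x, 0 ≤ k x := fun x => zero_le_one.trans (hg.one_le_k x)
  -- Neumann series: the n-th iterate is bounded by 2⁻ⁿ times the weight, so the sum is bounded by
  -- twice the weight.
  let f : ℕ → ι → ℝ → ℂ → ℂ := fun n => (volterraOp g)^[n] fun i _ _ => w i
  have hsucc : ∀ n, f (n + 1) = volterraOp g (f n) := fun n =>
    Function.iterate_succ_apply' _ _ _
  have hreg : ∀ n, VolterraReg S U k H ((1 / 2) ^ n) (f n) := by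
    intro n
    induction n with
    | zero =>
      refine ⟨fun i x z _ => ?_, fun _ _ _ => continuous_const, fun _ _ => continuousOn_const,
        fun _ _ => differentiableOn_const _⟩
      have h1 : 1 ≤ Real.exp (2 * H x) := Real.one_le_exp (by linarith [hg.H_nonneg x])
      calc ‖w i‖ ≤ 1 := hw i
        _ ≤ (1 / 2) ^ 0 * (k x * Real.exp (2 * H x)) := by
          rw [pow_zero, one_mul]
          exact one_le_mul_of_one_le_of_one_le (hg.one_le_k x) h1
    | succ n ih =>
      rw [hsucc]
      have := hg.reg_volterraOp (by positivity) ih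
      rwa [show ((1 : ℝ) / 2) ^ (n + 1) = (1 / 2) ^ n / 2 by ring]
  have hΦcont : Continuous fun x => k x * Real.exp (2 * H x) := by
    have hHc : Continuous H := continuous_iff_continuousAt.2 fun x => (hg.hasDerivAt x).continuousAt
    exact hg.cont_k.mul (Real.continuous_exp.comp (hHc.const_mul 2))
  have hgeo : Summable fun n : ℕ => ((1 : ℝ) / 2) ^ n := summable_geometric_two
  have hsum : ∀ i x, ∀ z ∈ S, Summable fun n => f n i x z := fun i x z hz =>
    Summable.of_norm_bounded (hgeo.mul_right _) fun n => (hreg n).bound i x z hz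
  let m : ι → ℝ → ℂ → ℂ := fun i x z => ∑' n, f n i x z
  have hmb : ∀ i x, ∀ z ∈ S, ‖m i x z‖ ≤ 2 * (k x * Real.exp (2 * H x)) := by
    intro i x z hz
    refine tsum_of_norm_bounded (?_ : HasSum _ _) fun n => (hreg n).bound i x z hz
    exact hasSum_geometric_two.mul_right _
  refine ⟨m, ⟨hmb, ?_, ?_, ?_⟩, ?_⟩
  · intro z hz i
    rw [continuous_iff_continuousAt]
    intro x₀
    obtain ⟨M, hM⟩ := (isCompact_Icc (a := x₀ - 1) (b := x₀ + 1)).bddAbove_image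
      hΦcont.continuousOn
    have hnhds : Set.Icc (x₀ - 1) (x₀ + 1) ∈ 𝓝 x₀ := Icc_mem_nhds (by linarith) (by linarith)
    refine ContinuousOn.continuousAt ?_ hnhds
    refine continuousOn_tsum (fun n => ((hreg n).cont z hz i).continuousOn) (hgeo.mul_right M) ?_
    intro n x hx
    exact ((hreg n).bound i x z hz).trans
      (mul_le_mul_of_nonneg_left (hM ⟨x, hx, rfl⟩) (by positivity))
  · intro i x
    exact continuousOn_tsum (fun n => (hreg n).contOn i x) (hgeo.mul_right _)
      fun n z hz => (hreg n).bound i x z hz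
  · intro i x
    exact Complex.differentiableOn_tsum_of_summable_norm (hgeo.mul_right _) (fun n => (hreg n).diffOn i x)
      hg.isOpen fun n z hz => (hreg n).bound i x z (hg.sub hz)
  · intro z hz i x
    have h1 : HasSum (fun n => ∫ s in Set.Ioi x, ∑ j, g i j x s z * f n j s z)
        (∫ s in Set.Ioi x, ∑' n, ∑ j, g i j x s z * f n j s z) := by
      refine hasSum_integral_of_summable_integral_norm
        (fun n => hg.integrableOn (hreg n) hz i x) ?_
      refine Summable.of_nonneg_of_le (fun n => integral_nonneg fun s => norm_nonneg _)
        (fun n => ?_) (hgeo.mul_right (k x * ((Real.exp (2 * H x) - 1) / 2)))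
      calc ∫ s in Set.Ioi x, ‖∑ j, g i j x s z * f n j s z‖
          ≤ ∫ s in Set.Ioi x, k x * ((1 / 2) ^ n * (h s * (k s * Real.exp (2 * H s)))) := by
            refine setIntegral_mono_on (hg.integrableOn (hreg n) hz i x).norm
              (((hg.integral_weight x).1.const_mul _).const_mul _) measurableSet_Ioi ?_
            exact fun s hs => hg.sum_bound (hreg n) hz i (le_of_lt hs)
        _ = _ := by
            rw [integral_const_mul, integral_const_mul, (hg.integral_weight x).2]; ring
    have h2 : ∀ s, ∑' n, ∑ j, g i j x s z * f n j s z = ∑ j, g i j x s z * m j s z := by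
      intro s
      rw [Summable.tsum_finsetSum fun j _ => (hsum j s z hz).mul_left _]
      exact Finset.sum_congr rfl fun j _ => tsum_mul_left
    simp only [h2] at h1
    rw [← h1.tsum_eq]
    change ∑' n, f n i x z = _
    rw [(hsum i x z hz).tsum_eq_zero_add]
    congr 1
    refine tsum_congr fun n => ?_
    rw [hsucc]
    rfl

end Volterra

/-! ### Uniformization of the spectral curve -/

/-- The spectral parameter `l` as a function of the uniformizer `z = l + ζ`. -/
def lam (z : ℂ) : ℂ := z / 2 + 1 / (4 * z)

/-- The quasi-momentum `ζ` as a function of the uniformizer `z = l + ζ`. -/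
def zet (z : ℂ) : ℂ := z / 2 - 1 / (4 * z)

/-- The closed upper half-plane without the points over `ζ = 0` and `ζ = ∞`. -/
def sheet : Set ℂ := {z | 0 ≤ z.im ∧ z ≠ 0 ∧ zet z ≠ 0}

/-- The open upper half-plane. -/
def upper : Set ℂ := {z | 0 < z.im}

theorem rt2_sq : rt2 ^ 2 = 2 := by
  rw [rt2, ← Complex.ofReal_pow, Real.sq_sqrt (by norm_num)]; norm_num

theorem rt2_ne_zero : rt2 ≠ 0 := fun h => by
  have := rt2_sq
  rw [h] at this
  norm_num at this

theorem norm_rt2 : ‖rt2‖ = Real.sqrt 2 := by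
  rw [rt2, Complex.norm_real, Real.norm_of_nonneg (Real.sqrt_nonneg 2)]

theorem norm_rt2_half_le : ‖rt2 / 2‖ ≤ 1 := by
  rw [norm_div, norm_rt2, Complex.norm_ofNat, div_le_one (by norm_num)]
  exact Real.sqrt_le_iff.2 ⟨by norm_num, by norm_num⟩

theorem star_rt2 : star rt2 = rt2 := Complex.conj_ofReal _

theorem lam_add_zet (z : ℂ) : lam z + zet z = z := by unfold lam zet; ring

theorem lam_sub_zet (z : ℂ) : lam z - zet z = 1 / (2 * z) := by
  unfold lam zet
  by_cases hz : z = 0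
  · simp [hz]
  · field_simp; norm_num

theorem lam_sq_sub (z : ℂ) (hz : z ≠ 0) : lam z ^ 2 - zet z ^ 2 = 1 / 2 := by
  rw [sq_sub_sq, lam_add_zet, lam_sub_zet]; field_simp

/-- The factor is positive, so Im ζ and Im z have the same sign; this is what identifies the upper
sheet with the upper half-plane. -/
theorem zet_im (z : ℂ) : (zet z).im = z.im * (1 / 2 + 1 / (4 * Complex.normSq z)) := by
  have : zet z = z / 2 - z⁻¹ / 4 := by unfold zet; ring
  rw [this]
  simp only [Complex.sub_im, Complex.div_ofNat_im, Complex.inv_im]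
  ring

/-- Here the factor changes sign across the circle |z|² = 1/2, which lies over the spectral gap. The
energy estimates are driven by this sign. -/
theorem lam_im (z : ℂ) : (lam z).im = z.im * (1 / 2 - 1 / (4 * Complex.normSq z)) := by
  have : lam z = z / 2 + z⁻¹ / 4 := by unfold lam; ring
  rw [this]
  simp only [Complex.add_im, Complex.div_ofNat_im, Complex.inv_im]
  ring

theorem zet_im_nonneg {z : ℂ} (hz : 0 ≤ z.im) : 0 ≤ (zet z).im := by
  rw [zet_im]
  have := Complex.normSq_nonneg z
  positivity

theorem zet_im_pos {z : ℂ} (hz : 0 < z.im) : 0 < (zet z).im := by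
  rw [zet_im]
  have := Complex.normSq_nonneg z
  positivity

theorem upper_subset_sheet : upper ⊆ sheet := fun z hz => by
  refine ⟨le_of_lt hz, ?_, ?_⟩
  · rintro rfl; simp [upper] at hz
  · intro h
    have := zet_im_pos hz
    rw [h] at this
    simp at this

theorem isOpen_upper : IsOpen upper := isOpen_lt continuous_const Complex.continuous_im

theorem norm_lam_le {z : ℂ} (hz : z ≠ 0) : ‖lam z‖ ≤ ‖zet z‖ + 1 := by
  have h1 : lam z ^ 2 = zet z ^ 2 + 1 / 2 := by linear_combination lam_sq_sub z hz
  have h2 : ‖lam z‖ ^ 2 ≤ ‖zet z‖ ^ 2 + 1 / 2 := by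
    rw [← norm_pow, h1]
    refine (norm_add_le _ _).trans ?_
    rw [norm_pow]; norm_num
  nlinarith [norm_nonneg (lam z), norm_nonneg (zet z)]

theorem norm_le_zet {z : ℂ} (hz : z ≠ 0) : ‖z‖ ≤ 2 * ‖zet z‖ + 1 := by
  have := norm_add_le (lam z) (zet z)
  rw [lam_add_zet] at this
  linarith [norm_lam_le hz]

/-- Together with `norm_le_zet` this controls z and 1/z, which are λ + ζ and 2(λ − ζ), by one power
of ζ, hence treats the ends z = ∞ and z = 0 at once. -/
theorem norm_inv_le_zet {z : ℂ} (hz : z ≠ 0) : ‖1 / (2 * z)‖ ≤ 2 * ‖zet z‖ + 1 := by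
  have := norm_sub_le (lam z) (zet z)
  rw [lam_sub_zet] at this
  linarith [norm_lam_le hz]

theorem continuousOn_zet : ContinuousOn zet {z | z ≠ 0} := by
  unfold zet
  intro z hz
  have : (4 : ℂ) * z ≠ 0 := mul_ne_zero (by norm_num) hz
  exact ContinuousAt.continuousWithinAt (by fun_prop (disch := assumption))

theorem differentiableAt_zet {z : ℂ} (hz : z ≠ 0) : DifferentiableAt ℂ zet z := by
  unfold zet
  have : (4 : ℂ) * z ≠ 0 := mul_ne_zero (by norm_num) hz
  fun_prop (disch := assumption)

/-! ### Potentials -/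

/-- Decay of a potential to `√2/2` at `+∞`. -/
structure RightTame (q : ℝ → ℂ) : Prop where
  contDiff : ContDiff ℝ 2 q
  bound : ∃ C : ℝ, 0 ≤ C ∧ ∀ s : ℝ, 0 ≤ s → ‖q s - rt2 / 2‖ ≤ C / (1 + s) ^ 4 ∧
    ‖deriv q s‖ ≤ C / (1 + s) ^ 4 ∧ ‖deriv (deriv q) s‖ ≤ C / (1 + s) ^ 4

theorem hasDerivAt_neg_one_div (s : ℝ) (hs : 0 ≤ s) :
    HasDerivAt (fun s : ℝ => -(1 / (1 + s))) (1 / (1 + s) ^ 2) s := by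
  have h : HasDerivAt (fun s : ℝ => 1 + s) 1 s := (hasDerivAt_id s).const_add 1
  have h0 : 1 + s ≠ 0 := by positivity
  have := (h.inv h0).neg
  simp only [one_div]
  refine this.congr_deriv ?_
  field_simp

theorem tendsto_neg_one_div : Tendsto (fun s : ℝ => -(1 / (1 + s))) atTop (𝓝 0) := by
  have : Tendsto (fun s : ℝ => 1 / (1 + s)) atTop (𝓝 0) :=
    tendsto_const_nhds.div_atTop (tendsto_atTop_add_const_left _ _ tendsto_id)
  simpa using this.neg

theorem integrableOn_one_div_sq {x : ℝ} (hx : 0 ≤ x) :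
    IntegrableOn (fun s : ℝ => 1 / (1 + s) ^ 2) (Set.Ioi x) ∧
      ∫ s in Set.Ioi x, 1 / (1 + s) ^ 2 = 1 / (1 + x) := by
  have hd : ∀ s ∈ Set.Ici x, HasDerivAt (fun s : ℝ => -(1 / (1 + s))) (1 / (1 + s) ^ 2) s :=
    fun s hs => hasDerivAt_neg_one_div s (hx.trans hs)
  have hp : ∀ s ∈ Set.Ioi x, 0 ≤ 1 / (1 + s) ^ 2 := fun s _ => by positivity
  refine ⟨integrableOn_Ioi_deriv_of_nonneg' hd hp tendsto_neg_one_div, ?_⟩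
  rw [integral_Ioi_of_hasDerivAt_of_nonneg' hd hp tendsto_neg_one_div]
  ring

theorem hasDerivAt_integral_Ioi {F : ℝ → ℂ} (hF : Continuous F)
    (hint : ∀ x, IntegrableOn F (Set.Ioi x)) (x : ℝ) :
    HasDerivAt (fun x => ∫ s in Set.Ioi x, F s) (-F x) x := by
  have h : (fun x => ∫ s in Set.Ioi x, F s) =
      fun x => (∫ s in Set.Ioi 0, F s) - ∫ s in (0 : ℝ)..x, F s := by
    funext y
    rw [← intervalIntegral.integral_Ioi_sub_Ioi' (hint 0) (hint y)]
    ring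
  rw [h]
  have := (hF.integral_hasStrictDerivAt 0 x).hasDerivAt.const_sub (∫ s in Set.Ioi 0, F s)
  exact this

/-! ### The Volterra kernel of the Jost solution -/

/-- `(1 - e^{-2iζt}) / (2iζ)`. -/
def theta (t : ℝ) (z : ℂ) : ℂ :=
  (1 - Complex.exp (-(2 * Complex.I * zet z) * t)) / (2 * Complex.I * zet z)

/-- Mean value inequality on the left half-plane, which is convex and on which the exponential has
modulus at most one. -/
theorem norm_one_sub_exp_le {w : ℂ} (hw : w.re ≤ 0) : ‖1 - Complex.exp w‖ ≤ ‖w‖ := by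
  have hconv : Convex ℝ {w : ℂ | w.re ≤ 0} := convex_halfSpace_re_le 0
  have := hconv.norm_image_sub_le_of_norm_hasDerivWithin_le (𝕜 := ℂ) (f := Complex.exp) (C := 1)
    (f' := Complex.exp) (x := w) (y := 0)
    (fun x _ => (Complex.hasDerivAt_exp x).hasDerivWithinAt)
    (fun x hx => by rw [Complex.norm_exp]; exact Real.exp_le_one_iff.2 hx) hw (by simp)
  simpa using this

theorem exponent_re (z : ℂ) (t : ℝ) :
    (-(2 * Complex.I * zet z) * t).re = 2 * (zet z).im * t := by
  simp [Complex.mul_re, Complex.mul_im]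

theorem norm_theta_le {z : ℂ} (hz : z ∈ sheet) {t : ℝ} (ht : t ≤ 0) : ‖theta t z‖ ≤ |t| := by
  have h0 : 0 < ‖2 * Complex.I * zet z‖ :=
    norm_pos_iff.2 (mul_ne_zero (by simp) hz.2.2)
  rw [theta, norm_div, div_le_iff₀ h0]
  refine (norm_one_sub_exp_le ?_).trans ?_
  · rw [exponent_re]
    have := zet_im_nonneg hz.1
    nlinarith
  · rw [norm_mul, norm_neg, Complex.norm_real, Real.norm_eq_abs, mul_comm]

theorem norm_zet_mul_theta_le {z : ℂ} (hz : z ∈ sheet) {t : ℝ} (ht : t ≤ 0) :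
    ‖zet z‖ * ‖theta t z‖ ≤ 1 := by
  have h0 : 0 < ‖zet z‖ := norm_pos_iff.2 hz.2.2
  have h2 : ‖2 * Complex.I * zet z‖ = 2 * ‖zet z‖ := by simp
  rw [theta, norm_div, h2]
  have : ‖1 - Complex.exp (-(2 * Complex.I * zet z) * t)‖ ≤ 2 := by
    refine (norm_sub_le _ _).trans ?_
    rw [norm_one, Complex.norm_exp, exponent_re]
    have : Real.exp (2 * (zet z).im * t) ≤ 1 := by
      rw [Real.exp_le_one_iff]
      have := zet_im_nonneg hz.1
      nlinarith
    linarith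
  rw [mul_div_assoc', div_le_one (by positivity)]
  nlinarith

/-- A factor of size |ζ| is absorbed by the denominator 2iζ of `theta`, the rest costs |t|. The
bound is thus uniform up to ζ = 0 and ζ = ∞, at the price of linear growth in t. -/
theorem norm_mul_theta_le {z w : ℂ} (hz : z ∈ sheet) (hw : ‖w‖ ≤ 2 * ‖zet z‖ + 1) {t : ℝ}
    (ht : t ≤ 0) : ‖w * theta t z‖ ≤ 2 + |t| := by
  rw [norm_mul]
  have h1 := norm_zet_mul_theta_le hz ht
  have h2 := norm_theta_le hz ht
  nlinarith [norm_nonneg (theta t z)]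

/-- The entries of the perturbation: `(N m)₀ = potA m₁`. -/
def potA (q : ℝ → ℂ) (s : ℝ) : ℂ := Complex.I * (star (q s) - rt2 / 2)

/-- The entries of the perturbation: `(N m)₁ = potB m₀`. -/
def potB (q : ℝ → ℂ) (s : ℝ) : ℂ := -Complex.I * (q s - rt2 / 2)

theorem norm_potA (q : ℝ → ℂ) (s : ℝ) : ‖potA q s‖ = ‖q s - rt2 / 2‖ := by
  have : star (q s) - rt2 / 2 = star (q s - rt2 / 2) := by
    rw [star_sub, star_div₀, star_rt2]; simp
  rw [potA, this, norm_mul, Complex.norm_I, one_mul, norm_star]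

theorem norm_potB (q : ℝ → ℂ) (s : ℝ) : ‖potB q s‖ = ‖q s - rt2 / 2‖ := by
  rw [potB]; simp

/-- The Volterra kernel of the normalized Jost solution. -/
def jostKernel (q : ℝ → ℂ) (i j : Fin 2) (x s : ℝ) (z : ℂ) : ℂ :=
  ![![-(Complex.I * (rt2 / 2) * theta (x - s) z * potB q s),
      -((1 - Complex.I * z * theta (x - s) z) * potA q s)],
    ![-((1 + Complex.I * (1 / (2 * z)) * theta (x - s) z) * potB q s),
      Complex.I * (rt2 / 2) * theta (x - s) z * potA q s]] i j

/-- The entries come from −exp((x − s)M) N(s), where M is the matrix at q = √2/2 of the system for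
e^{−iζx}ψ₂ and N the perturbation. M has eigenvalues 0 and −2iζ, so exp(tM) = 1 + `theta` t · M. -/
theorem jostKernel_zero_zero (q : ℝ → ℂ) : jostKernel q 0 0 = fun x s z =>
    -(Complex.I * (rt2 / 2) * theta (x - s) z * potB q s) := rfl

theorem jostKernel_zero_one (q : ℝ → ℂ) : jostKernel q 0 1 = fun x s z =>
    -((1 - Complex.I * z * theta (x - s) z) * potA q s) := rfl

theorem jostKernel_one_zero (q : ℝ → ℂ) : jostKernel q 1 0 = fun x s z =>
    -((1 + Complex.I * (1 / (2 * z)) * theta (x - s) z) * potB q s) := rfl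

theorem jostKernel_one_one (q : ℝ → ℂ) : jostKernel q 1 1 = fun x s z =>
    Complex.I * (rt2 / 2) * theta (x - s) z * potA q s := rfl

theorem jostKernel_bound {q : ℝ → ℂ} {z : ℂ} (hz : z ∈ sheet) (i : Fin 2) {x s : ℝ} (hxs : x ≤ s) :
    ∑ j, ‖jostKernel q i j x s z‖ ≤
      (1 + max (-x) 0) * (3 * (1 + |s|) * ‖q s - rt2 / 2‖) := by
  have ht : x - s ≤ 0 := by linarith
  have habs : |x - s| = s - x := by rw [abs_of_nonpos ht]; ring
  have h1 := norm_mul_theta_le hz (norm_le_zet hz.2.1) ht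
  have h2 := norm_mul_theta_le hz (norm_inv_le_zet hz.2.1) ht
  have h3 : ‖rt2 / 2 * theta (x - s) z‖ ≤ |x - s| := by
    rw [norm_mul]
    have := norm_theta_le hz ht
    nlinarith [norm_rt2_half_le, norm_nonneg (theta (x - s) z)]
  rw [habs] at h1 h2 h3
  have hD := norm_nonneg (q s - rt2 / 2)
  -- The linear growth in s − x is split into a factor depending on x and one depending on s, the
  -- product form required of a Volterra kernel.
  have hk : 1 + (s - x) ≤ (1 + max (-x) 0) * (1 + |s|) := by
    have := le_abs_self s
    have := abs_nonneg s
    rcases le_total x 0 with hx | hx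
    · rw [max_eq_left (by linarith)]; nlinarith
    · rw [max_eq_right (by linarith)]; nlinarith
  have hrow : ∀ A B : ℂ, ‖A‖ ≤ 2 + (s - x) → ‖B‖ ≤ s - x →
      ‖B‖ * ‖q s - rt2 / 2‖ + (1 + ‖A‖) * ‖q s - rt2 / 2‖ ≤
        (1 + max (-x) 0) * (3 * (1 + |s|) * ‖q s - rt2 / 2‖) := by
    intro A B hA hB
    have : ‖B‖ + (1 + ‖A‖) ≤ 3 * ((1 + max (-x) 0) * (1 + |s|)) := by linarith
    nlinarith
  fin_cases i
  · simp only [Fin.zero_eta, Fin.sum_univ_two, jostKernel_zero_zero, jostKernel_zero_one]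
    refine le_trans (add_le_add (le_of_eq ?_) ?_) (hrow _ _ h1 h3)
    · simp only [norm_neg, norm_mul, Complex.norm_I, one_mul, norm_potB]
    · rw [norm_neg, norm_mul, norm_potA]
      refine mul_le_mul_of_nonneg_right ((norm_sub_le _ _).trans (le_of_eq ?_)) hD
      simp
  · simp only [Fin.mk_one, Fin.sum_univ_two, jostKernel_one_zero, jostKernel_one_one]
    rw [add_comm]
    refine le_trans (add_le_add (le_of_eq ?_) ?_) (hrow _ _ h2 h3)
    · simp only [norm_mul, Complex.norm_I, one_mul, norm_potA]
    · rw [norm_neg, norm_mul, norm_potB]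
      refine mul_le_mul_of_nonneg_right ((norm_add_le _ _).trans (le_of_eq ?_)) hD
      simp

theorem RightTame.exists_volterraKernel {q : ℝ → ℂ} (hq : RightTame q) :
    ∃ H : ℝ → ℝ, VolterraKernel (jostKernel q) sheet upper (fun x => 1 + max (-x) 0)
      (fun s => 3 * (1 + |s|) * ‖q s - rt2 / 2‖) H := by
  have hqc : Continuous q := hq.contDiff.continuous
  set ρ : ℝ → ℝ := fun s => (1 + max (-s) 0) * (3 * (1 + |s|) * ‖q s - rt2 / 2‖) with hρ
  have hρc : Continuous ρ := by
    simp only [hρ]; fun_prop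
  have hρi : IntegrableOn ρ (Set.Ioi 0) := by
    obtain ⟨C, hC0, hC⟩ := hq.bound
    refine Integrable.mono' ((integrableOn_one_div_sq le_rfl).1.const_mul (3 * C))
      hρc.aestronglyMeasurable ?_
    filter_upwards [ae_restrict_mem measurableSet_Ioi] with s hs
    have hs : 0 < s := hs
    have h1 := (hC s hs.le).1
    rw [Real.norm_of_nonneg (by simp only [hρ]; positivity)]
    simp only [hρ]
    rw [max_eq_right (by linarith), abs_of_pos hs]
    have h3 : C / (1 + s) ^ 4 ≤ C / (1 + s) ^ 3 :=
      div_le_div_of_nonneg_left hC0 (by positivity)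
        (pow_le_pow_right₀ (by linarith) (by norm_num))
    calc (1 + 0) * (3 * (1 + s) * ‖q s - rt2 / 2‖) ≤ 3 * (1 + s) * (C / (1 + s) ^ 3) := by
          rw [add_zero, one_mul]
          exact mul_le_mul_of_nonneg_left (h1.trans h3) (by positivity)
      _ = 3 * C * (1 / (1 + s) ^ 2) := by field_simp
  -- H is the tail of the integral of ρ beyond x, written as a difference so that it can be
  -- differentiated as a primitive.
  refine ⟨fun x => (∫ s in Set.Ioi 0, ρ s) - ∫ s in (0 : ℝ)..x, ρ s, upper_subset_sheet,
    isOpen_upper, by fun_prop, fun x => by simp, fun s => by positivity, fun x => ?_, ?_, ?_, ?_,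
    ?_, fun z hz i x s hxs => jostKernel_bound hz i hxs⟩
  · exact (hρc.integral_hasStrictDerivAt 0 x).hasDerivAt.const_sub (∫ s in Set.Ioi 0, ρ s)
  · have := (intervalIntegral_tendsto_integral_Ioi 0 hρi tendsto_id).const_sub
      (∫ s in Set.Ioi 0, ρ s)
    simpa using this
  · intro z hz i j
    have hA : Continuous (potA q) := by unfold potA; fun_prop
    have hB : Continuous (potB q) := by unfold potB; fun_prop
    have hT : Continuous fun p : ℝ × ℝ => theta (p.1 - p.2) z := by unfold theta; fun_prop
    fin_cases i <;> fin_cases j <;>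
      simp [jostKernel_zero_zero, jostKernel_zero_one, jostKernel_one_zero, jostKernel_one_one,
        div_eq_mul_inv] <;> fun_prop
  · intro i j x s
    have hz : ContinuousOn zet sheet := continuousOn_zet.mono fun z hz => hz.2.1
    have hT : ContinuousOn (theta (x - s)) sheet := by
      unfold theta
      refine ContinuousOn.div (by fun_prop) (by fun_prop) fun z hz => ?_
      exact mul_ne_zero (by simp) hz.2.2
    have hinv : ContinuousOn (fun z : ℂ => z⁻¹) sheet :=
      continuousOn_inv₀.mono fun z hz => hz.2.1
    fin_cases i <;> fin_cases j <;>
      simp [jostKernel_zero_zero, jostKernel_zero_one, jostKernel_one_zero, jostKernel_one_one,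
        div_eq_mul_inv] <;> fun_prop
  · intro i j x s
    have hz : DifferentiableOn ℂ zet upper := fun z hz =>
      (differentiableAt_zet (upper_subset_sheet hz).2.1).differentiableWithinAt
    have hT : DifferentiableOn ℂ (theta (x - s)) upper := by
      unfold theta
      refine DifferentiableOn.div (by fun_prop) (by fun_prop) fun z hz => ?_
      exact mul_ne_zero (by simp) (upper_subset_sheet hz).2.2
    have hinv : DifferentiableOn ℂ (fun z : ℂ => z⁻¹) upper :=
      differentiableOn_inv.mono fun z hz => (upper_subset_sheet hz).2.1
    fin_cases i <;> fin_cases j <;>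
      simp [jostKernel_zero_zero, jostKernel_zero_one, jostKernel_one_zero, jostKernel_one_one,
        div_eq_mul_inv] <;> fun_prop

theorem integrableOn_exp_mul {ζ : ℂ} (hζ : 0 ≤ ζ.im) {F : ℝ → ℂ} {x : ℝ}
    (hF : IntegrableOn F (Set.Ioi x)) :
    IntegrableOn (fun s : ℝ => Complex.exp (Complex.I * ζ * s) * F s) (Set.Ioi x) := by
  refine Integrable.bdd_mul (c := Real.exp (-(ζ.im * x))) hF
    (Continuous.aestronglyMeasurable (by fun_prop)) ?_
  filter_upwards [ae_restrict_mem measurableSet_Ioi] with s hs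
  have hs : x < s := hs
  rw [Complex.norm_exp]
  refine Real.exp_le_exp.2 ?_
  simp only [Complex.mul_re, Complex.mul_im, Complex.I_re, Complex.I_im, Complex.ofReal_re,
    Complex.ofReal_im]
  nlinarith

/-- Variation of constants in reverse. Expanding `theta` turns the Volterra equation into a
combination of four tail integrals `A`, `B`, `GA`, `GB` and the exponential `e'`, each
differentiable in x. -/
theorem jost_ode {q : ℝ → ℂ} (hqc : Continuous q) {z : ℂ} (hz : z ∈ sheet) {M₀ M₁ : ℝ → ℂ}
    (hM₀ : Continuous M₀) (hM₁ : Continuous M₁)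
    (hA : ∀ x, IntegrableOn (fun s => potA q s * M₁ s) (Set.Ioi x))
    (hB : ∀ x, IntegrableOn (fun s => potB q s * M₀ s) (Set.Ioi x))
    (h₀ : ∀ x, M₀ x = rt2 / 2 / z + ∫ s in Set.Ioi x,
      (jostKernel q 0 0 x s z * M₀ s + jostKernel q 0 1 x s z * M₁ s))
    (h₁ : ∀ x, M₁ x = 1 + ∫ s in Set.Ioi x,
      (jostKernel q 1 0 x s z * M₀ s + jostKernel q 1 1 x s z * M₁ s)) (x : ℝ) :
    HasDerivAt M₀ (-(Complex.I * z) * M₀ x + Complex.I * star (q x) * M₁ x) x ∧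
      HasDerivAt M₁ (Complex.I / (2 * z) * M₁ x - Complex.I * q x * M₀ x) x := by
  have hz0 : z ≠ 0 := hz.2.1
  have hζ0 : zet z ≠ 0 := hz.2.2
  have hα : Continuous (fun s => potA q s * M₁ s) := by unfold potA; fun_prop
  have hβ : Continuous (fun s => potB q s * M₀ s) := by unfold potB; fun_prop
  set e : ℝ → ℂ := fun s => Complex.exp (Complex.I * (2 * zet z) * s) with he
  set e' : ℝ → ℂ := fun s => Complex.exp (-(2 * Complex.I * zet z) * s) with he'
  have hee : ∀ s, e' s * e s = 1 := fun s => by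
    simp only [he, he', ← Complex.exp_add]
    rw [show -(2 * Complex.I * zet z) * (s : ℂ) + Complex.I * (2 * zet z) * s = 0 by ring,
      Complex.exp_zero]
  have hec : Continuous e := by simp only [he]; fun_prop
  have him : 0 ≤ (2 * zet z).im := by
    have := zet_im_nonneg hz.1
    simpa [Complex.mul_im] using this
  have hθ : ∀ x s : ℝ, theta (x - s) z = (1 - e' x * e s) / (2 * Complex.I * zet z) := by
    intro x s
    simp only [theta, he, he', ← Complex.exp_add]
    congr 3
    push_cast; ring
  have heA : ∀ x, IntegrableOn (fun s => e s * (potA q s * M₁ s)) (Set.Ioi x) := fun x =>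
    integrableOn_exp_mul him (hA x)
  have heB : ∀ x, IntegrableOn (fun s => e s * (potB q s * M₀ s)) (Set.Ioi x) := fun x =>
    integrableOn_exp_mul him (hB x)
  set A : ℝ → ℂ := fun x => ∫ s in Set.Ioi x, potA q s * M₁ s with hAd
  set B : ℝ → ℂ := fun x => ∫ s in Set.Ioi x, potB q s * M₀ s with hBd
  set GA : ℝ → ℂ := fun x => ∫ s in Set.Ioi x, e s * (potA q s * M₁ s) with hGAd
  set GB : ℝ → ℂ := fun x => ∫ s in Set.Ioi x, e s * (potB q s * M₀ s) with hGBd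
  have dA : HasDerivAt A (-(potA q x * M₁ x)) x := hasDerivAt_integral_Ioi hα hA x
  have dB : HasDerivAt B (-(potB q x * M₀ x)) x := hasDerivAt_integral_Ioi hβ hB x
  have dGA : HasDerivAt GA (-(e x * (potA q x * M₁ x))) x :=
    hasDerivAt_integral_Ioi (hec.mul hα) heA x
  have dGB : HasDerivAt GB (-(e x * (potB q x * M₀ x))) x :=
    hasDerivAt_integral_Ioi (hec.mul hβ) heB x
  have de' : HasDerivAt e' (-(2 * Complex.I * zet z) * e' x) x := by
    have h1 : HasDerivAt (fun s : ℝ => -(2 * Complex.I * zet z) * (s : ℂ))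
        (-(2 * Complex.I * zet z) * 1) x := (Complex.ofRealCLM.hasDerivAt).const_mul _
    refine h1.cexp.congr_deriv ?_
    simp only [he']; ring
  have hcomb : ∀ (c₁ c₂ c₃ c₄ : ℂ) (x : ℝ),
      ∫ s in Set.Ioi x, (c₁ * (potA q s * M₁ s) + c₂ * (potB q s * M₀ s)
        + (c₃ * (e s * (potA q s * M₁ s)) + c₄ * (e s * (potB q s * M₀ s)))) =
      c₁ * A x + c₂ * B x + (c₃ * GA x + c₄ * GB x) := by
    intro c₁ c₂ c₃ c₄ x
    have i1 := (hA x).const_mul c₁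
    have i2 := (hB x).const_mul c₂
    have i3 := (heA x).const_mul c₃
    have i4 := (heB x).const_mul c₄
    refine (integral_add (i1.add i2) (i3.add i4)).trans ?_
    congr 1
    · refine (integral_add i1 i2).trans ?_
      simp only [integral_const_mul, hAd, hBd]
    · refine (integral_add i3 i4).trans ?_
      simp only [integral_const_mul, hGAd, hGBd]
  set κ : ℂ := 1 / (2 * Complex.I * zet z) with hκ
  have hκ1 : 2 * Complex.I * zet z * κ = 1 := by
    rw [hκ, mul_one_div_cancel]; exact mul_ne_zero (by simp) hζ0
  have k₀ : ∀ x, M₀ x = rt2 / 2 / z - A x - κ * (-(Complex.I * z) * (A x - e' x * GA x)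
      + Complex.I * (rt2 / 2) * (B x - e' x * GB x)) := by
    intro x
    rw [h₀ x]
    have := hcomb (-1 + κ * (Complex.I * z)) (-(κ * (Complex.I * (rt2 / 2))))
      (-(κ * (Complex.I * z) * e' x)) (κ * (Complex.I * (rt2 / 2)) * e' x) x
    rw [sub_sub, sub_eq_add_neg]
    congr 1
    refine (integral_congr_ae (Eventually.of_forall fun s => ?_)).trans (this.trans ?_)
    · simp only [jostKernel_zero_zero, jostKernel_zero_one, hθ, hκ]
      ring
    · ring
  have k₁ : ∀ x, M₁ x = 1 - B x - κ * (-(Complex.I * (rt2 / 2)) * (A x - e' x * GA x)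
      + Complex.I * (1 / (2 * z)) * (B x - e' x * GB x)) := by
    intro x
    rw [h₁ x]
    have := hcomb (κ * (Complex.I * (rt2 / 2))) (-1 - (κ * (Complex.I * (1 / (2 * z)))))
      (-(κ * (Complex.I * (rt2 / 2)) * e' x)) (κ * (Complex.I * (1 / (2 * z))) * e' x) x
    rw [sub_sub, sub_eq_add_neg]
    congr 1
    refine (integral_congr_ae (Eventually.of_forall fun s => ?_)).trans (this.trans ?_)
    · simp only [jostKernel_one_zero, jostKernel_one_one, hθ, hκ]
      ring
    · ring
  have dA' := dA.sub (de'.mul dGA)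
  have dB' := dB.sub (de'.mul dGB)
  have D₀ := (dA.const_sub (rt2 / 2 / z)).sub
    (((dA'.const_mul (-(Complex.I * z))).add (dB'.const_mul (Complex.I * (rt2 / 2)))).const_mul κ)
  have D₁ := (dB.const_sub 1).sub
    (((dA'.const_mul (-(Complex.I * (rt2 / 2)))).add
      (dB'.const_mul (Complex.I * (1 / (2 * z))))).const_mul κ)
  have hr := rt2_sq
  have hzi : z * (1 / (2 * z)) = 1 / 2 := by field_simp
  have hζe : zet z = z / 2 - (1 / (2 * z)) / 2 := by unfold zet; field_simp; ring
  have hA0 : potA q x = Complex.I * (star (q x) - rt2 / 2) := rfl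
  have hB0 : potB q x = -Complex.I * (q x - rt2 / 2) := rfl
  have hdiv : rt2 / 2 / z = rt2 * (1 / (2 * z)) := by field_simp
  have hdiv' : Complex.I / (2 * z) = Complex.I * (1 / (2 * z)) := by ring
  have hexp := hee x
  have k0x := k₀ x
  have k1x := k₁ x
  rw [hdiv] at k0x
  rw [hdiv']
  have D₀' := D₀.congr_of_eventuallyEq (Eventually.of_forall k₀)
  have D₁' := D₁.congr_of_eventuallyEq (Eventually.of_forall k₁)
  set y := 1 / (2 * z) with hy
  have hk : Complex.I * κ * (z - y) = 1 := by
    rw [← hκ1, hζe]; ring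
  -- M annihilates the limiting vector and M² = −2iζM, so M applied to the solution retains only the
  -- exponential mode `e'`. This line and `e₁` are the two rows of that statement.
  have e₀ : -(Complex.I * z) * M₀ x + Complex.I * (rt2 / 2) * M₁ x =
      Complex.I * z * (e' x * GA x) - Complex.I * (rt2 / 2) * (e' x * GB x) := by
    rw [k0x, k1x]
    linear_combination (-(Complex.I * z) * (A x - e' x * GA x)
      + Complex.I * (rt2 / 2) * (B x - e' x * GB x)) * hk
      + (-(Complex.I * rt2) - Complex.I ^ 2 * κ * (A x - e' x * GA x)) * hzi
      + (Complex.I ^ 2 * κ * (A x - e' x * GA x) / 4) * hr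
  have e₁ : -(Complex.I * (rt2 / 2)) * M₀ x + Complex.I * y * M₁ x =
      Complex.I * (rt2 / 2) * (e' x * GA x) - Complex.I * y * (e' x * GB x) := by
    rw [k0x, k1x]
    linear_combination (-(Complex.I * (rt2 / 2)) * (A x - e' x * GA x)
      + Complex.I * y * (B x - e' x * GB x)) * hk
      - (Complex.I ^ 2 * κ * (B x - e' x * GB x)) * hzi
      + (-(Complex.I * y / 2) + Complex.I ^ 2 * κ * (B x - e' x * GB x) / 4) * hr
  constructor
  · refine D₀'.congr_deriv ?_
    rw [hA0, hB0]
    linear_combination (-κ * (-(Complex.I * z) * (Complex.I * (star (q x) - rt2 / 2) * M₁ x)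
      + Complex.I * (rt2 / 2) * (-Complex.I * (q x - rt2 / 2) * M₀ x))) * hexp
      - (-(Complex.I * z) * (e' x * GA x) + Complex.I * (rt2 / 2) * (e' x * GB x)) * hκ1 - e₀
  · refine D₁'.congr_deriv ?_
    rw [hA0, hB0]
    linear_combination (-κ * (-(Complex.I * (rt2 / 2)) * (Complex.I * (star (q x) - rt2 / 2) * M₁ x)
      + Complex.I * y * (-Complex.I * (q x - rt2 / 2) * M₀ x))) * hexp
      - (-(Complex.I * (rt2 / 2)) * (e' x * GA x) + Complex.I * y * (e' x * GB x)) * hκ1 - e₁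

/-- Existence of the normalized Jost solution `m(x, z) = e^{-iζx} ψ₂`, with its regularity in the
uniformizer `z` and bounds that are uniform in `z`. -/
theorem RightTame.exists_jost {q : ℝ → ℂ} (hq : RightTame q) :
    ∃ (m : Fin 2 → ℝ → ℂ → ℂ) (C δ : ℝ → ℝ), Tendsto δ atTop (𝓝 0) ∧
      (∀ i x, ContinuousOn (m i x) sheet) ∧ (∀ i x, DifferentiableOn ℂ (m i x) upper) ∧
      (∀ z ∈ sheet, ∀ i x, ‖m i x z‖ ≤ (1 + 1 / ‖z‖) * C x) ∧
      (∀ z ∈ sheet, ∀ i x, 0 ≤ x →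
        ‖m i x z - (![rt2 / 2 / z, 1] : Fin 2 → ℂ) i‖ ≤ (1 + 1 / ‖z‖) * δ x) ∧
      ∀ z ∈ sheet, ∀ x,
        HasDerivAt (fun x => m 0 x z)
          (-(Complex.I * z) * m 0 x z + Complex.I * star (q x) * m 1 x z) x ∧
        HasDerivAt (fun x => m 1 x z)
          (Complex.I / (2 * z) * m 1 x z - Complex.I * q x * m 0 x z) x := by
  have hqc : Continuous q := hq.contDiff.continuous
  obtain ⟨H, hH⟩ := hq.exists_volterraKernel
  obtain ⟨u, hu, hui⟩ := hH.exists_solution ![1, 0] (fun i => by fin_cases i <;> simp)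
  obtain ⟨v, hv, hvi⟩ := hH.exists_solution ![0, 1] (fun i => by fin_cases i <;> simp)
  -- The limiting vector (√2/(2z), 1) depends on z, whereas the existence lemma takes constant data
  -- of norm at most one. The solution is therefore superposed from those with unit limits, whence
  -- the factor 1 + 1/|z|.
  set w : Fin 2 → ℝ → ℂ → ℂ := fun i x z => rt2 / 2 / z * u i x z + v i x z with hw
  have hr : ∀ z : ℂ, ‖rt2 / 2 / z‖ ≤ 1 / ‖z‖ := fun z => by
    rw [norm_div]; exact div_le_div_of_nonneg_right norm_rt2_half_le (norm_nonneg _)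
  have hcomb : ∀ (a b : ℂ) (c : ℝ) (z : ℂ), ‖a‖ ≤ c → ‖b‖ ≤ c →
      ‖rt2 / 2 / z * a + b‖ ≤ (1 + 1 / ‖z‖) * c := fun a b c z ha hb => by
    refine (norm_add_le _ _).trans ?_
    rw [norm_mul]
    have := mul_le_mul (hr z) ha (norm_nonneg _) (by positivity)
    linarith
  have hdiff : ∀ {w : Fin 2 → ℂ} {m : Fin 2 → ℝ → ℂ → ℂ},
      VolterraReg sheet upper (fun x => 1 + max (-x) 0) H 2 m →
      (∀ z ∈ sheet, ∀ i x, m i x z = w i + ∫ s in Set.Ioi x, ∑ j, jostKernel q i j x s z * m j s z) →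
      ∀ z ∈ sheet, ∀ i x, 0 ≤ x → ‖m i x z - w i‖ ≤ Real.exp (2 * H x) - 1 := by
    intro w m hm hmi z hz i x hx
    rw [hmi z hz i x, add_sub_cancel_left]
    have := (hH.reg_volterraOp (by norm_num) hm)
    have h1 : ‖∫ s in Set.Ioi x, ∑ j, jostKernel q i j x s z * m j s z‖ ≤
        ∫ s in Set.Ioi x, (1 + max (-x) 0) * (2 * (3 * (1 + |s|) * ‖q s - rt2 / 2‖
          * ((1 + max (-s) 0) * Real.exp (2 * H s)))) := by
      refine norm_integral_le_of_norm_le (((hH.integral_weight x).1.const_mul 2).const_mul _) ?_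
      filter_upwards [ae_restrict_mem measurableSet_Ioi] with s hs
      exact hH.sum_bound hm hz i (le_of_lt hs)
    rw [integral_const_mul, integral_const_mul, (hH.integral_weight x).2,
      max_eq_right (by linarith)] at h1
    linarith
  refine ⟨w, fun x => 2 * ((1 + max (-x) 0) * Real.exp (2 * H x)),
    fun x => Real.exp (2 * H x) - 1, ?_, ?_, ?_, ?_, ?_, ?_⟩
  · have := ((Real.continuous_exp.tendsto _).comp (hH.tendsto.const_mul 2)).sub_const 1
    simpa using this
  · intro i x
    refine ContinuousOn.add (ContinuousOn.mul (ContinuousOn.div continuousOn_const continuousOn_id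
      fun z hz => hz.2.1) (hu.contOn i x)) (hv.contOn i x)
  · intro i x
    refine DifferentiableOn.add (DifferentiableOn.mul (DifferentiableOn.div
      (differentiableOn_const _) differentiableOn_id
      fun z hz => (upper_subset_sheet hz).2.1) (hu.diffOn i x)) (hv.diffOn i x)
  · exact fun z hz i x => hcomb _ _ _ _ (hu.bound i x z hz) (hv.bound i x z hz)
  · intro z hz i x hx
    have h1 := hdiff hu hui z hz i x hx
    have h2 := hdiff hv hvi z hz i x hx
    have h3 := hcomb _ _ _ z h1 h2
    refine le_of_eq_of_le ?_ h3
    congr 1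
    fin_cases i <;> simp [hw] <;> ring
  · intro z hz x
    have hcu := hu.cont z hz
    have hcv := hv.cont z hz
    have hint : ∀ x i, IntegrableOn (fun s => ‖q s - rt2 / 2‖ * ‖w i s z‖) (Set.Ioi x) := by
      intro x i
      refine Integrable.mono' (((hH.integral_weight x).1.const_mul (2 * (1 + 1 / ‖z‖)))) ?_ ?_
      · refine Continuous.aestronglyMeasurable ?_
        have := hcu i; have := hcv i
        simp only [hw]; fun_prop
      · refine Eventually.of_forall fun s => ?_
        have h1 := hcomb _ _ _ z (hu.bound i s z hz) (hv.bound i s z hz)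
        have hn := norm_nonneg (q s - rt2 / 2)
        have habs := abs_nonneg s
        rw [norm_mul, norm_norm, norm_norm]
        calc ‖q s - rt2 / 2‖ * ‖w i s z‖ ≤ (3 * (1 + |s|) * ‖q s - rt2 / 2‖) *
              ((1 + 1 / ‖z‖) * (2 * ((1 + max (-s) 0) * Real.exp (2 * H s)))) := by
              refine mul_le_mul ?_ h1 (norm_nonneg _) (by positivity)
              nlinarith
          _ = _ := by ring
    have hw0 : Continuous fun x => w 0 x z := by
      have := hcu 0; have := hcv 0
      simp only [hw]; fun_prop
    have hw1 : Continuous fun x => w 1 x z := by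
      have := hcu 1; have := hcv 1
      simp only [hw]; fun_prop
    refine jost_ode hqc hz hw0 hw1 (fun x => ?_) (fun x => ?_) (fun x => ?_) (fun x => ?_) x
    · refine Integrable.mono' (hint x 1) (Continuous.aestronglyMeasurable ?_)
        (Eventually.of_forall fun s => ?_)
      · unfold potA; fun_prop
      · rw [norm_mul, norm_potA]
    · refine Integrable.mono' (hint x 0) (Continuous.aestronglyMeasurable ?_)
        (Eventually.of_forall fun s => ?_)
      · unfold potB; fun_prop
      · rw [norm_mul, norm_potB]
    all_goals
      simp only [hw]
      rw [hui z hz, hvi z hz, mul_add, ← integral_const_mul, add_add_add_comm, ← integral_add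
        ((hH.integrableOn hu hz _ x).const_mul _) (hH.integrableOn hv hz _ x)]
      simp only [Matrix.cons_val_zero, Matrix.cons_val_one, mul_one, mul_zero, add_zero, zero_add,
        Fin.sum_univ_two]
      congr 1
      refine integral_congr_ae (Eventually.of_forall fun s => ?_)
      simp only
      ring

/-! ### Solutions of the linear system -/

theorem isSolution_iff {q : ℝ → ℂ} {l : ℂ} {v : ℝ → Fin 2 → ℂ} :
    IsSolution q l v ↔ ∀ x,
      HasDerivAt (fun x => v x 0) (-(Complex.I * l) * v x 0 + Complex.I * star (q x) * v x 1) x ∧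
      HasDerivAt (fun x => v x 1) (Complex.I * l * v x 1 - Complex.I * q x * v x 0) x := by
  have hI := Complex.I_sq
  constructor
  · intro h x
    have h0 := (h.diff 0 x).hasDerivAt
    have h1 := (h.diff 1 x).hasDerivAt
    refine ⟨h0.congr_deriv ?_, h1.congr_deriv ?_⟩
    · have := h.eq_one x
      linear_combination (-Complex.I) * this + (deriv (fun t => v t 0) x) * hI
    · have := h.eq_two x
      linear_combination Complex.I * this + (deriv (fun t => v t 1) x) * hI
  · intro h
    refine ⟨fun k x => ?_, fun x => ?_, fun x => ?_⟩
    · fin_cases k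
      · exact (h x).1.differentiableAt
      · exact (h x).2.differentiableAt
    · rw [(h x).1.deriv]
      linear_combination (-l * v x 0 + star (q x) * v x 1) * hI
    · rw [(h x).2.deriv]
      linear_combination (-l * v x 1 + q x * v x 0) * hI

theorem IsSolution.smul {q : ℝ → ℂ} {l : ℂ} {v : ℝ → Fin 2 → ℂ} (hv : IsSolution q l v) (c : ℂ) :
    IsSolution q l (fun x => c • v x) := by
  rw [isSolution_iff] at *
  intro x
  simp only [Pi.smul_apply, smul_eq_mul]
  exact ⟨((hv x).1.const_mul c).congr_deriv (by ring),
    ((hv x).2.const_mul c).congr_deriv (by ring)⟩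

theorem IsSolution.sub {q : ℝ → ℂ} {l : ℂ} {v w : ℝ → Fin 2 → ℂ} (hv : IsSolution q l v)
    (hw : IsSolution q l w) : IsSolution q l (fun x => v x - w x) := by
  rw [isSolution_iff] at *
  intro x
  simp only [Pi.sub_apply]
  exact ⟨((hv x).1.sub (hw x).1).congr_deriv (by ring),
    ((hv x).2.sub (hw x).2).congr_deriv (by ring)⟩

theorem IsSolution.wronskian_eq {q : ℝ → ℂ} {l : ℂ} {v w : ℝ → Fin 2 → ℂ} (hv : IsSolution q l v)
    (hw : IsSolution q l w) (x : ℝ) : v x 0 * w x 1 - v x 1 * w x 0 = wronskian v w := by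
  rw [isSolution_iff] at hv hw
  have hd : ∀ x, HasDerivAt (fun x => v x 0 * w x 1 - v x 1 * w x 0) 0 x := fun x =>
    (((hv x).1.mul (hw x).2).sub ((hv x).2.mul (hw x).1)).congr_deriv (by ring)
  exact is_const_of_deriv_eq_zero (fun x => (hd x).differentiableAt) (fun x => (hd x).deriv) x 0

theorem IsSolution.unique {q : ℝ → ℂ} (hq : Continuous q) {l : ℂ} {v w : ℝ → Fin 2 → ℂ}
    (hv : IsSolution q l v) (hw : IsSolution q l w) {x₀ : ℝ} (h : v x₀ = w x₀) : v = w := by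
  rw [isSolution_iff] at hv hw
  funext x
  set A := min x x₀ - 1
  set B := max x x₀ + 1
  obtain ⟨M, hM⟩ := (isCompact_Icc (a := A) (b := B)).bddAbove_image hq.norm.continuousOn
  have hM' : ∀ t ∈ Set.Ioo A B, ‖q t‖ ≤ M := fun t ht => hM ⟨t, ⟨ht.1.le, ht.2.le⟩, rfl⟩
  have hx : x ∈ Set.Ioo A B := by
    constructor
    · have := min_le_left x x₀; simp only [A]; linarith
    · have := le_max_left x x₀; simp only [B]; linarith
  have hx₀ : x₀ ∈ Set.Ioo A B := by
    constructor
    · have := min_le_right x x₀; simp only [A]; linarith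
    · have := le_max_right x x₀; simp only [B]; linarith
  have hM0 : 0 ≤ M := (norm_nonneg _).trans (hM' x hx)
  let F : ℝ → (Fin 2 → ℂ) → (Fin 2 → ℂ) := fun t y =>
    ![-(Complex.I * l) * y 0 + Complex.I * star (q t) * y 1,
      Complex.I * l * y 1 - Complex.I * q t * y 0]
  have hF : ∀ t ∈ Set.Ioo A B, LipschitzOnWith (Real.toNNReal (‖l‖ + M)) (F t) Set.univ := by
    intro t ht
    refine LipschitzOnWith.of_dist_le_mul fun y _ y' _ => ?_
    rw [Real.coe_toNNReal _ (by positivity), dist_eq_norm, dist_eq_norm]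
    have hy : ∀ i, ‖y i - y' i‖ ≤ ‖y - y'‖ := fun i => norm_le_pi_norm (y - y') i
    have hn := norm_nonneg (y - y')
    refine (pi_norm_le_iff_of_nonneg (by positivity)).2 fun i => ?_
    have hqt := hM' t ht
    have hstar : ‖star (q t)‖ ≤ M := by rwa [norm_star]
    fin_cases i
    · have : (F t y - F t y') 0 =
          -(Complex.I * l) * (y 0 - y' 0) + Complex.I * star (q t) * (y 1 - y' 1) := by
        simp only [F, Pi.sub_apply, Matrix.cons_val_zero]; ring
      change ‖(F t y - F t y') 0‖ ≤ _
      rw [this]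
      refine (norm_add_le _ _).trans ?_
      rw [norm_mul, norm_mul, norm_neg, norm_mul, norm_mul, Complex.norm_I, one_mul, one_mul,
        add_mul]
      exact add_le_add (mul_le_mul_of_nonneg_left (hy 0) (norm_nonneg _))
        (mul_le_mul hstar (hy 1) (norm_nonneg _) hM0)
    · have : (F t y - F t y') 1 =
          Complex.I * l * (y 1 - y' 1) - Complex.I * q t * (y 0 - y' 0) := by
        change (Complex.I * l * y 1 - Complex.I * q t * y 0) -
          (Complex.I * l * y' 1 - Complex.I * q t * y' 0) = _
        ring
      change ‖(F t y - F t y') 1‖ ≤ _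
      rw [this]
      refine (norm_sub_le _ _).trans ?_
      rw [norm_mul, norm_mul, norm_mul, norm_mul, Complex.norm_I, one_mul, one_mul,
        add_mul]
      exact add_le_add (mul_le_mul_of_nonneg_left (hy 1) (norm_nonneg _))
        (mul_le_mul hqt (hy 0) (norm_nonneg _) hM0)
  have key : ∀ {v : ℝ → Fin 2 → ℂ}, (∀ x,
      HasDerivAt (fun x => v x 0) (-(Complex.I * l) * v x 0 + Complex.I * star (q x) * v x 1) x ∧
      HasDerivAt (fun x => v x 1) (Complex.I * l * v x 1 - Complex.I * q x * v x 0) x) →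
      ∀ t ∈ Set.Ioo A B, HasDerivAt v (F t (v t)) t ∧ v t ∈ Set.univ := by
    intro v hv t _
    refine ⟨hasDerivAt_pi.2 fun i => ?_, trivial⟩
    fin_cases i
    · exact (hv t).1
    · exact (hv t).2
  exact ODE_solution_unique_of_mem_Ioo hF hx₀ (key hv) (key hw) h hx

theorem exists_smul_of_cross_eq_zero {v w : Fin 2 → ℂ} (hw : w ≠ 0)
    (h : v 0 * w 1 - v 1 * w 0 = 0) : ∃ c : ℂ, v = c • w := by
  by_cases h0 : w 0 = 0
  · have h1 : w 1 ≠ 0 := fun h1 => hw (by ext i; fin_cases i <;> simp [h0, h1])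
    refine ⟨v 1 / w 1, ?_⟩
    ext i
    fin_cases i
    · have : v 0 * w 1 = 0 := by linear_combination h + v 1 * h0
      simpa [h0] using (mul_eq_zero.1 this).resolve_right h1
    · simp [h1]
  · refine ⟨v 0 / w 0, ?_⟩
    ext i
    fin_cases i
    · simp [h0]
    · simp only [Fin.mk_one, Pi.smul_apply, smul_eq_mul]
      field_simp
      linear_combination -h

theorem IsSolution.proportional {q : ℝ → ℂ} (hq : Continuous q) {l : ℂ} {v w : ℝ → Fin 2 → ℂ}
    (hv : IsSolution q l v) (hw : IsSolution q l w) {x₀ : ℝ} (hw0 : w x₀ ≠ 0)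
    (h : wronskian v w = 0) : ∃ c : ℂ, ∀ x, v x = c • w x := by
  obtain ⟨c, hc⟩ := exists_smul_of_cross_eq_zero hw0 ((hv.wronskian_eq hw x₀).trans h)
  exact ⟨c, fun x => congrFun (IsSolution.unique hq hv (hw.smul c) hc) x⟩

theorem IsJost.ne_zero {q : ℝ → ℂ} {l κ : ℂ} {W : Fin 2 → ℂ} (hW : W ≠ 0)
    {w : ℝ → Fin 2 → ℂ} (hw : IsJost q l atTop κ W w) : ∃ x₀, w x₀ ≠ 0 := by
  by_contra! h
  have := hw.2
  simp only [h, smul_zero] at this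
  exact hW (tendsto_nhds_unique this tendsto_const_nhds)

/-- The Wronskian of the difference d with w is e^{2κx} times a quantity tending to 0, and the
exponential is bounded because Re κ ≤ 0. So d is a multiple of w, and comparison of limits at
infinity makes the multiple zero. -/
theorem IsJost.unique {q : ℝ → ℂ} (hq : Continuous q) {l κ : ℂ} (hκ : κ.re ≤ 0) {W : Fin 2 → ℂ}
    (hW : W ≠ 0) {v w : ℝ → Fin 2 → ℂ} (hv : IsJost q l atTop κ W v)
    (hw : IsJost q l atTop κ W w) : v = w := by
  set d : ℝ → Fin 2 → ℂ := fun x => v x - w x with hd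
  have hds : IsSolution q l d := hv.1.sub hw.1
  have hdl : Tendsto (fun x : ℝ => Complex.exp (-(κ * (x : ℂ))) • d x) atTop (𝓝 0) := by
    have := hv.2.sub hw.2
    rw [sub_self] at this
    refine this.congr fun x => ?_
    rw [hd, smul_sub]
  have hd0 : ∀ i, Tendsto (fun x : ℝ => Complex.exp (-(κ * (x : ℂ))) * d x i) atTop (𝓝 0) :=
    fun i => by
      have := (tendsto_pi_nhds.1 hdl) i
      simpa using this
  have hw0 : ∀ i, Tendsto (fun x : ℝ => Complex.exp (-(κ * (x : ℂ))) * w x i) atTop (𝓝 (W i)) :=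
    fun i => by
      have := (tendsto_pi_nhds.1 hw.2) i
      simpa using this
  have hwr : wronskian d w = 0 := by
    have h1 := ((hd0 0).mul (hw0 1)).sub ((hd0 1).mul (hw0 0))
    simp only [zero_mul, sub_zero] at h1
    have h2 : Tendsto (fun x : ℝ => Complex.exp (2 * κ * x) * (Complex.exp (-(κ * (x : ℂ))) * d x 0
        * (Complex.exp (-(κ * (x : ℂ))) * w x 1) - Complex.exp (-(κ * (x : ℂ))) * d x 1
        * (Complex.exp (-(κ * (x : ℂ))) * w x 0))) atTop (𝓝 0) := by
      refine squeeze_zero_norm' ?_ (tendsto_zero_iff_norm_tendsto_zero.1 h1)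
      filter_upwards [eventually_ge_atTop 0] with x hx
      rw [norm_mul]
      refine mul_le_of_le_one_left (norm_nonneg _) ?_
      rw [Complex.norm_exp, Real.exp_le_one_iff]
      simp only [Complex.mul_re, Complex.mul_im, Complex.ofReal_re, Complex.ofReal_im,
        Complex.re_ofNat, Complex.im_ofNat]
      nlinarith
    refine tendsto_nhds_unique (Tendsto.congr (fun x => ?_) h2) tendsto_const_nhds |>.symm
    rw [← hds.wronskian_eq hw.1 x]
    have he : Complex.exp (2 * κ * x) * (Complex.exp (-(κ * (x : ℂ))) *
        Complex.exp (-(κ * (x : ℂ)))) = 1 := by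
      rw [← Complex.exp_add, ← Complex.exp_add, ← Complex.exp_zero]
      congr 1; ring
    linear_combination (d x 0 * w x 1 - d x 1 * w x 0) * he
  obtain ⟨x₀, hx₀⟩ := hw.ne_zero hW
  obtain ⟨c, hc⟩ := hds.proportional hq hw.1 hx₀ hwr
  have hc0 : c • W = 0 := by
    refine tendsto_nhds_unique ?_ hdl
    refine (hw.2.const_smul c).congr fun x => ?_
    rw [hc x, smul_comm]
  have : c = 0 := (smul_eq_zero.1 hc0).resolve_right hW
  funext x
  have h := hc x
  rw [this, zero_smul] at h
  exact sub_eq_zero.1 h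

/-! ### The Jost solutions -/

/-- The Jost solution `ψ₂` as a function of the uniformizer. -/
def jost (q : ℝ → ℂ) (z : ℂ) : ℝ → Fin 2 → ℂ := psi2 q (lam z) (zet z)

theorem rt2_mul_lam_sub_zet (z : ℂ) : rt2 * (lam z - zet z) = rt2 / 2 / z := by
  rw [lam_sub_zet]
  by_cases hz : z = 0
  · simp [hz]
  · field_simp

theorem I_mul_zet_re {z : ℂ} (hz : 0 ≤ z.im) : (Complex.I * zet z).re ≤ 0 := by
  have := zet_im_nonneg hz
  simpa using this

theorem vec_ne_zero (a : ℂ) : (![a, 1] : Fin 2 → ℂ) ≠ 0 := fun h => by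
  have := congrFun h 1
  simp at this

/-- A Jost solution from its normalized form `e^{-iζx} v`. -/
theorem isJost_of_normalized {q : ℝ → ℂ} {z : ℂ} {m : Fin 2 → ℝ → ℂ} (hm : ∀ x,
      HasDerivAt (m 0) (-(Complex.I * z) * m 0 x + Complex.I * star (q x) * m 1 x) x ∧
      HasDerivAt (m 1) (Complex.I / (2 * z) * m 1 x - Complex.I * q x * m 0 x) x)
    (hlim : ∀ i, Tendsto (m i) atTop (𝓝 ((![rt2 / 2 / z, 1] : Fin 2 → ℂ) i))) :
    IsJost q (lam z) atTop (Complex.I * zet z) ![rt2 / 2 / z, 1]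
      (fun x i => Complex.exp (Complex.I * zet z * x) * m i x) := by
  constructor
  · rw [isSolution_iff]
    intro x
    have he : HasDerivAt (fun x : ℝ => Complex.exp (Complex.I * zet z * x))
        (Complex.I * zet z * Complex.exp (Complex.I * zet z * x)) x := by
      have h1 : HasDerivAt (fun s : ℝ => Complex.I * zet z * (s : ℂ))
        (Complex.I * zet z * 1) x := (Complex.ofRealCLM.hasDerivAt).const_mul _
      refine h1.cexp.congr_deriv ?_
      ring
    have hl : lam z = z - zet z := by linear_combination lam_add_zet z
    have hl' : Complex.I / (2 * z) = Complex.I * (lam z - zet z) := by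
      rw [lam_sub_zet]; ring
    have hx := hm x
    refine ⟨(he.mul hx.1).congr_deriv ?_, (he.mul hx.2).congr_deriv ?_⟩
    · rw [hl]; ring
    · rw [hl']; ring
  · rw [tendsto_pi_nhds]
    intro i
    refine (hlim i).congr fun x => ?_
    rw [Pi.smul_apply, smul_eq_mul, ← mul_assoc, ← Complex.exp_add, neg_add_cancel,
      Complex.exp_zero, one_mul]

/-- The Jost solution is `e^{iζx}` times a function which is holomorphic in the uniformizer, with
uniform bounds. -/
theorem RightTame.jost_spec {q : ℝ → ℂ} (hq : RightTame q) :
    ∃ (m : Fin 2 → ℝ → ℂ → ℂ) (C δ : ℝ → ℝ), Tendsto δ atTop (𝓝 0) ∧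
      (∀ i x, ContinuousOn (m i x) sheet) ∧ (∀ i x, DifferentiableOn ℂ (m i x) upper) ∧
      (∀ z ∈ sheet, ∀ i x, ‖m i x z‖ ≤ (1 + 1 / ‖z‖) * C x) ∧
      (∀ z ∈ sheet, ∀ i x, 0 ≤ x →
        ‖m i x z - (![rt2 / 2 / z, 1] : Fin 2 → ℂ) i‖ ≤ (1 + 1 / ‖z‖) * δ x) ∧
      (∀ z ∈ sheet, ∀ x,
        HasDerivAt (fun x => m 0 x z)
          (-(Complex.I * z) * m 0 x z + Complex.I * star (q x) * m 1 x z) x ∧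
        HasDerivAt (fun x => m 1 x z)
          (Complex.I / (2 * z) * m 1 x z - Complex.I * q x * m 0 x z) x) ∧
      (∀ z ∈ sheet, IsJost q (lam z) atTop (Complex.I * zet z) ![rt2 / 2 / z, 1] (jost q z)) ∧
      ∀ z ∈ sheet, ∀ x i, jost q z x i = Complex.exp (Complex.I * zet z * x) * m i x z := by
  obtain ⟨m, C, δ, hδ, h1, h2, h3, h4, h5⟩ := hq.exists_jost
  have hJ : ∀ z ∈ sheet, IsJost q (lam z) atTop (Complex.I * zet z) ![rt2 / 2 / z, 1]
      (fun x i => Complex.exp (Complex.I * zet z * x) * m i x z) := by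
    intro z hz
    refine isJost_of_normalized (m := fun i x => m i x z) (h5 z hz) fun i => ?_
    rw [tendsto_iff_norm_sub_tendsto_zero]
    refine squeeze_zero' (Eventually.of_forall fun x => norm_nonneg _) ?_
      (by simpa only [mul_zero] using hδ.const_mul (1 + 1 / ‖z‖))
    filter_upwards [eventually_ge_atTop 0] with x hx using h4 z hz i x hx
  have hJ' : ∀ z ∈ sheet, IsJost q (lam z) atTop (Complex.I * zet z) ![rt2 / 2 / z, 1]
      (jost q z) := by
    intro z hz
    have e : jost q z = Classical.epsilon fun v =>
        IsJost q (lam z) atTop (Complex.I * zet z) ![rt2 / 2 / z, 1] v := by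
      rw [jost, psi2]
      simp only [rt2_mul_lam_sub_zet]
    rw [e]
    exact Classical.epsilon_spec (p := fun v =>
      IsJost q (lam z) atTop (Complex.I * zet z) ![rt2 / 2 / z, 1] v) ⟨_, hJ z hz⟩
  refine ⟨m, C, δ, hδ, h1, h2, h3, h4, h5, hJ', fun z hz x i => ?_⟩
  exact congrFun (congrFun (IsJost.unique hq.contDiff.continuous (I_mul_zet_re hz.1)
    (vec_ne_zero _) (hJ' z hz) (hJ z hz)) x) i

theorem RightTame.isJost {q : ℝ → ℂ} (hq : RightTame q) {z : ℂ} (hz : z ∈ sheet) :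
    IsJost q (lam z) atTop (Complex.I * zet z) ![rt2 / 2 / z, 1] (jost q z) := by
  obtain ⟨m, C, δ, -, -, -, -, -, -, h, -⟩ := hq.jost_spec
  exact h z hz

theorem RightTame.jost_unique {q : ℝ → ℂ} (hq : RightTame q) {z : ℂ} (hz : z ∈ sheet)
    {v : ℝ → Fin 2 → ℂ}
    (hv : IsJost q (lam z) atTop (Complex.I * zet z) ![rt2 / 2 / z, 1] v) : v = jost q z :=
  IsJost.unique hq.contDiff.continuous (I_mul_zet_re hz.1) (vec_ne_zero _) hv (hq.isJost hz)

theorem RightTame.continuousOn_jost {q : ℝ → ℂ} (hq : RightTame q) (x : ℝ) (i : Fin 2) :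
    ContinuousOn (fun z => jost q z x i) sheet := by
  obtain ⟨m, C, δ, -, hc, -, -, -, -, -, h⟩ := hq.jost_spec
  have hz : ContinuousOn zet sheet := continuousOn_zet.mono fun z hz => hz.2.1
  refine ContinuousOn.congr (f := fun z => Complex.exp (Complex.I * zet z * x) * m i x z) ?_
    fun z hz => h z hz x i
  have := hc i x
  fun_prop

theorem RightTame.differentiableOn_jost {q : ℝ → ℂ} (hq : RightTame q) (x : ℝ) (i : Fin 2) :
    DifferentiableOn ℂ (fun z => jost q z x i) upper := by
  obtain ⟨m, C, δ, -, -, hd, -, -, -, -, h⟩ := hq.jost_spec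
  have hz : DifferentiableOn ℂ zet upper := fun z hz =>
    (differentiableAt_zet (upper_subset_sheet hz).2.1).differentiableWithinAt
  refine DifferentiableOn.congr (f := fun z => Complex.exp (Complex.I * zet z * x) * m i x z) ?_
    fun z hz => h z (upper_subset_sheet hz) x i
  have := hd i x
  fun_prop

/-! ### Symmetries -/

/-- Reflection of a potential. -/
def refl (q : ℝ → ℂ) (x : ℝ) : ℂ := -star (q (-x))

/-- Reflection of a solution. -/
def reflSol (v : ℝ → Fin 2 → ℂ) (x : ℝ) : Fin 2 → ℂ := ![v (-x) 1, -v (-x) 0]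

/-- Conjugation of a solution. -/
def swapConj (v : ℝ → Fin 2 → ℂ) (x : ℝ) : Fin 2 → ℂ := ![star (v x 1), star (v x 0)]

/-- The symmetry of solutions that changes the sign of the spectral parameter. -/
def flipSol (v : ℝ → Fin 2 → ℂ) (x : ℝ) : Fin 2 → ℂ := ![v x 1, -v x 0]

theorem refl_refl (q : ℝ → ℂ) : refl (refl q) = q := by
  funext x; simp [refl]

theorem IsSolution.reflSol {q : ℝ → ℂ} {l : ℂ} {v : ℝ → Fin 2 → ℂ} (hv : IsSolution q l v) :
    IsSolution (refl q) l (reflSol v) := by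
  rw [isSolution_iff] at *
  intro x
  have h0 := (hv (-x)).1.scomp x (hasDerivAt_neg x)
  have h1 := (hv (-x)).2.scomp x (hasDerivAt_neg x)
  refine ⟨h1.congr_deriv ?_, h0.neg.congr_deriv ?_⟩
  · simp only [GPMarchenko.reflSol, refl, Matrix.cons_val_zero, Matrix.cons_val_one,
      Matrix.cons_val_fin_one, star_neg,
      star_star, neg_smul, one_smul]
    ring
  · simp only [GPMarchenko.reflSol, refl, Matrix.cons_val_zero, Matrix.cons_val_one,
      Matrix.cons_val_fin_one,
      neg_smul, one_smul]
    ring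

theorem IsSolution.swapConj {q : ℝ → ℂ} {l : ℂ} {v : ℝ → Fin 2 → ℂ} (hv : IsSolution q l v) :
    IsSolution q (star l) (swapConj v) := by
  rw [isSolution_iff] at *
  intro x
  have hI : star Complex.I = -Complex.I := Complex.conj_I
  refine ⟨(hv x).2.star.congr_deriv ?_, (hv x).1.star.congr_deriv ?_⟩ <;>
  · simp only [GPMarchenko.swapConj, Matrix.cons_val_zero, Matrix.cons_val_one,
      Matrix.cons_val_fin_one, star_neg, star_sub,
      star_add, star_mul, star_star, hI]
    ring

theorem IsSolution.flipSol {q : ℝ → ℂ} {l : ℂ} {v : ℝ → Fin 2 → ℂ} (hv : IsSolution q l v) :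
    IsSolution (fun x => star (q x)) (-l) (flipSol v) := by
  rw [isSolution_iff] at *
  intro x
  refine ⟨(hv x).2.congr_deriv ?_, (hv x).1.neg.congr_deriv ?_⟩ <;>
  · simp only [GPMarchenko.flipSol, Matrix.cons_val_zero, Matrix.cons_val_one,
      Matrix.cons_val_fin_one, star_star]
    ring

theorem zet_eq_zero_iff {z : ℂ} (hz : z ≠ 0) : zet z = 0 ↔ z ^ 2 = 1 / 2 := by
  have : zet z = (z ^ 2 - 1 / 2) / (2 * z) := by unfold zet; field_simp; ring
  rw [this, div_eq_zero_iff, or_iff_left (mul_ne_zero two_ne_zero hz), sub_eq_zero]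

/-- Two involutions of the half-plane are used. z ↦ 1/(2z*) acts as (λ, ζ) ↦ (λ*, −ζ*) and fixes the
circle |z|² = 1/2; z ↦ −1/(2z) acts as (λ, ζ) ↦ (−λ, ζ) and exchanges z = 0 with z = ∞. -/
theorem lam_inv_star {z : ℂ} (hz : z ≠ 0) : lam (1 / (2 * star z)) = star (lam z) := by
  have hz' : star z ≠ 0 := star_ne_zero.2 hz
  simp only [lam, star_add, star_div₀, star_mul, star_one, star_ofNat]
  field_simp
  ring

theorem zet_inv_star {z : ℂ} (hz : z ≠ 0) : zet (1 / (2 * star z)) = -star (zet z) := by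
  have hz' : star z ≠ 0 := star_ne_zero.2 hz
  simp only [zet, star_sub, star_div₀, star_mul, star_one, star_ofNat]
  field_simp
  ring

theorem lam_neg_inv {z : ℂ} (hz : z ≠ 0) : lam (-(1 / (2 * z))) = -lam z := by
  simp only [lam]
  field_simp
  ring

theorem zet_neg_inv {z : ℂ} (hz : z ≠ 0) : zet (-(1 / (2 * z))) = zet z := by
  simp only [zet]
  field_simp
  ring

theorem inv_star_im (z : ℂ) : (1 / (2 * star z)).im = z.im / (2 * Complex.normSq z) := by
  rw [one_div, mul_inv, ← one_div 2, show (1 / 2 : ℂ) = ((1 / 2 : ℝ) : ℂ) by push_cast; ring,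
    Complex.im_ofReal_mul, Complex.inv_im]
  simp only [RCLike.star_def, Complex.conj_im, neg_neg, Complex.normSq_conj]
  ring

theorem neg_inv_im (z : ℂ) : (-(1 / (2 * z))).im = z.im / (2 * Complex.normSq z) := by
  rw [one_div, mul_inv, ← one_div 2, show (1 / 2 : ℂ) = ((1 / 2 : ℝ) : ℂ) by push_cast; ring,
    Complex.neg_im, Complex.im_ofReal_mul, Complex.inv_im]
  ring

theorem inv_star_mem_sheet {z : ℂ} (hz : z ∈ sheet) : 1 / (2 * star z) ∈ sheet := by
  have hz' : star z ≠ 0 := star_ne_zero.2 hz.2.1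
  refine ⟨?_, by simpa using hz.2.1, ?_⟩
  · rw [inv_star_im]
    exact div_nonneg hz.1 (mul_nonneg zero_le_two (Complex.normSq_nonneg z))
  · rw [zet_inv_star hz.2.1]
    exact neg_ne_zero.2 (star_ne_zero.2 hz.2.2)

theorem neg_inv_mem_sheet {z : ℂ} (hz : z ∈ sheet) : -(1 / (2 * z)) ∈ sheet := by
  refine ⟨?_, by simpa using hz.2.1, ?_⟩
  · rw [neg_inv_im]
    exact div_nonneg hz.1 (mul_nonneg zero_le_two (Complex.normSq_nonneg z))
  · rw [zet_neg_inv hz.2.1]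
    exact hz.2.2

theorem inv_star_mem_upper {z : ℂ} (hz : z ∈ upper) : 1 / (2 * star z) ∈ upper := by
  have h0 := (upper_subset_sheet hz).2.1
  show 0 < (1 / (2 * star z)).im
  rw [inv_star_im]
  exact div_pos hz (mul_pos zero_lt_two (Complex.normSq_pos.2 h0))

theorem RightTame.conj {q : ℝ → ℂ} (hq : RightTame q) : RightTame fun x => star (q x) := by
  have hd : Differentiable ℝ q := hq.contDiff.differentiable (by norm_num)
  have h1 : ∀ f : ℝ → ℂ, Differentiable ℝ f →
      deriv (fun x => star (f x)) = fun x => star (deriv f x) := fun f hf => by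
    funext x
    exact (hf x).hasDerivAt.star.deriv
  have hd' : Differentiable ℝ (deriv q) :=
    hq.contDiff.differentiable_deriv_two
  obtain ⟨C, hC0, hC⟩ := hq.bound
  refine ⟨(starL' ℝ (A := ℂ)).contDiff.comp hq.contDiff, C, hC0, fun s hs => ?_⟩
  rw [h1 q hd, h1 _ hd']
  simp only [norm_star]
  have : star (q s) - rt2 / 2 = star (q s - rt2 / 2) := by
    rw [star_sub, star_div₀, star_rt2]; simp
  rw [this, norm_star]
  exact hC s hs

theorem refl_conj (q : ℝ → ℂ) : refl (fun x => star (q x)) = fun x => star (refl q x) := by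
  funext x; simp [refl]

theorem rt2_half_sq : rt2 / 2 * (rt2 / 2) = 1 / 2 := by
  linear_combination rt2_sq / 4

theorem rt2_half_ne : rt2 / 2 ≠ 0 := div_ne_zero rt2_ne_zero two_ne_zero

theorem star_rt2_half : star (rt2 / 2) = rt2 / 2 := by
  rw [star_div₀, star_rt2]; simp

/-- `swapConj` of a Jost solution solves the system with λ* and has the required exponential
behaviour, up to a scalar fixed by the normalization; uniqueness concludes. -/
theorem RightTame.jost_inv_star {q : ℝ → ℂ} (hq : RightTame q) {z : ℂ} (hz : z ∈ sheet) (x : ℝ) :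
    jost q (1 / (2 * star z)) x 0 = star z / (rt2 / 2) * star (jost q z x 1) ∧
      jost q (1 / (2 * star z)) x 1 = star z / (rt2 / 2) * star (jost q z x 0) := by
  have hz0 := hz.2.1
  have hz' : star z ≠ 0 := star_ne_zero.2 hz0
  have hr := rt2_half_ne
  have hr' := rt2_ne_zero
  have hJ := hq.isJost hz
  have : (fun x => (star z / (rt2 / 2)) • swapConj (jost q z) x) = jost q (1 / (2 * star z)) := by
    refine hq.jost_unique (inv_star_mem_sheet hz) ⟨?_, ?_⟩
    · rw [lam_inv_star hz0]
      exact hJ.1.swapConj.smul _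
    · have h := tendsto_pi_nhds.1 hJ.2
      have h0 : Tendsto (fun x : ℝ => star (Complex.exp (-(Complex.I * zet z * x)) * jost q z x 0))
          atTop (𝓝 (rt2 / 2 / star z)) := by
        have := (continuous_star.tendsto _).comp (h 0)
        simp only [Matrix.cons_val_zero] at this
        rw [star_div₀, star_rt2_half] at this
        exact this
      have h1 : Tendsto (fun x : ℝ => star (Complex.exp (-(Complex.I * zet z * x)) * jost q z x 1))
          atTop (𝓝 1) := by
        have := (continuous_star.tendsto _).comp (h 1)
        simp only [Matrix.cons_val_one, Matrix.cons_val_fin_one] at this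
        rw [star_one] at this
        exact this
      have he : ∀ x : ℝ, star (Complex.exp (-(Complex.I * zet z * x))) =
          Complex.exp (-(Complex.I * zet (1 / (2 * star z)) * x)) := fun x => by
        rw [zet_inv_star hz0, RCLike.star_def, ← Complex.exp_conj]
        congr 1
        simp only [map_neg, map_mul, Complex.conj_I, Complex.conj_ofReal]
        ring
      rw [tendsto_pi_nhds]
      intro i
      fin_cases i
      · have h2 := h1.const_mul (star z / (rt2 / 2))
        have e1 : (![rt2 / 2 / (1 / (2 * star z)), 1] : Fin 2 → ℂ) 0 = star z / (rt2 / 2) * 1 := by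
          simp only [Matrix.cons_val_zero]
          field_simp
          linear_combination rt2_sq
        simp only [Fin.zero_eta, e1]
        refine h2.congr fun x => ?_
        simp only [star_mul, he, swapConj, Pi.smul_apply, smul_eq_mul, Matrix.cons_val_zero]
        ring
      · have h2 := h0.const_mul (star z / (rt2 / 2))
        have e1 : (![rt2 / 2 / (1 / (2 * star z)), 1] : Fin 2 → ℂ) 1
            = star z / (rt2 / 2) * (rt2 / 2 / star z) := by
          simp only [Matrix.cons_val_one, Matrix.cons_val_fin_one]
          field_simp
        simp only [Fin.mk_one, e1]
        refine h2.congr fun x => ?_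
        simp only [star_mul, he, swapConj, Pi.smul_apply, smul_eq_mul, Matrix.cons_val_one,
          Matrix.cons_val_fin_one]
        ring
  rw [← this]
  simp [swapConj]

/-- Same argument with `flipSol`, which maps λ to −λ and q to q*. It converts the behaviour as z → 0
into the behaviour as z → ∞ for the conjugate potential. -/
theorem RightTame.jost_neg_inv {q : ℝ → ℂ} (hq : RightTame q) {z : ℂ} (hz : z ∈ sheet) (x : ℝ) :
    jost q z x 0 = rt2 / 2 / z * jost (fun x => star (q x)) (-(1 / (2 * z))) x 1 ∧
      jost q z x 1 = -(rt2 / 2 / z) * jost (fun x => star (q x)) (-(1 / (2 * z))) x 0 := by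
  have hz0 := hz.2.1
  have hr := rt2_half_ne
  have hr' := rt2_ne_zero
  have hJ := hq.isJost hz
  have : (fun x => (-(z / (rt2 / 2))) • flipSol (jost q z) x) =
      jost (fun x => star (q x)) (-(1 / (2 * z))) := by
    refine hq.conj.jost_unique (neg_inv_mem_sheet hz) ⟨?_, ?_⟩
    · rw [lam_neg_inv hz0]
      exact hJ.1.flipSol.smul _
    · have h := tendsto_pi_nhds.1 hJ.2
      rw [zet_neg_inv hz0, tendsto_pi_nhds]
      intro i
      fin_cases i
      · have h2 := (h 1).const_mul (-(z / (rt2 / 2)))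
        have e1 : (![rt2 / 2 / -(1 / (2 * z)), 1] : Fin 2 → ℂ) 0 = -(z / (rt2 / 2)) * 1 := by
          simp only [Matrix.cons_val_zero]
          field_simp
          linear_combination -rt2_sq
        simp only [Fin.zero_eta, e1]
        refine h2.congr fun x => ?_
        simp only [flipSol, Pi.smul_apply, smul_eq_mul, Matrix.cons_val_zero]
        ring
      · have h2 := (h 0).const_mul (z / (rt2 / 2))
        have e1 : (![rt2 / 2 / -(1 / (2 * z)), 1] : Fin 2 → ℂ) 1
            = z / (rt2 / 2) * (rt2 / 2 / z) := by
          simp only [Matrix.cons_val_one, Matrix.cons_val_fin_one]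
          field_simp
        simp only [Fin.mk_one, e1]
        refine h2.congr fun x => ?_
        simp only [flipSol, Pi.smul_apply, smul_eq_mul, Matrix.cons_val_one,
          Matrix.cons_val_fin_one]
        ring
  rw [← this]
  simp only [flipSol, Pi.smul_apply, smul_eq_mul, Matrix.cons_val_zero, Matrix.cons_val_one,
    Matrix.cons_val_fin_one]
  constructor <;> field_simp

/-! ### The remaining Jost solutions and the transition coefficients -/

/-- Decay at both ends. -/
structure Tame (q : ℝ → ℂ) : Prop where
  right : RightTame q
  left : RightTame (refl q)

theorem Tame.refl {q : ℝ → ℂ} (hq : Tame q) : Tame (refl q) :=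
  ⟨hq.left, by rw [refl_refl]; exact hq.right⟩

theorem Tame.conj {q : ℝ → ℂ} (hq : Tame q) : Tame fun x => star (q x) :=
  ⟨hq.right.conj, by rw [refl_conj]; exact hq.left.conj⟩

/-- Reflection carries the behaviour at −∞ to +∞, so existence and uniqueness for φ₁ are inherited
from `jost`. Every estimate for ψ₂ then also serves φ₁. -/
theorem Tame.phi1_eq {q : ℝ → ℂ} (hq : Tame q) {z : ℂ} (hz : z ∈ sheet) :
    phi1 q (lam z) (zet z) = reflSol (jost (GPMarchenko.refl q) z) := by
  set P : (ℝ → Fin 2 → ℂ) → Prop := fun v =>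
    IsJost q (lam z) atBot (-(Complex.I * zet z)) ![1, -(rt2 / 2 / z)] v with hP
  have hex : P (reflSol (jost (GPMarchenko.refl q) z)) := by
    have hJ := hq.left.isJost hz
    refine ⟨?_, ?_⟩
    · have := hJ.1.reflSol
      rwa [refl_refl] at this
    · have h := fun i => ((tendsto_pi_nhds.1 hJ.2) i).comp tendsto_neg_atBot_atTop
      rw [tendsto_pi_nhds]
      intro i
      fin_cases i
      · refine (h 1).congr fun x => ?_
        simp [reflSol]
      · refine (h 0).neg.congr fun x => ?_
        simp [reflSol]
  have hphi : P (phi1 q (lam z) (zet z)) := by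
    have e : phi1 q (lam z) (zet z) = Classical.epsilon P := by
      rw [phi1]; simp only [rt2_mul_lam_sub_zet, hP]
    rw [e]
    exact Classical.epsilon_spec ⟨_, hex⟩
  -- The sign is due to `reflSol` squaring to −1.
  have h2 : (fun x => (-1 : ℂ) • reflSol (phi1 q (lam z) (zet z)) x) =
      jost (GPMarchenko.refl q) z := by
    refine hq.left.jost_unique hz ⟨hphi.1.reflSol.smul _, ?_⟩
    have h := fun i => ((tendsto_pi_nhds.1 hphi.2) i).comp tendsto_neg_atTop_atBot
    rw [tendsto_pi_nhds]
    intro i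
    fin_cases i
    · have := (h 1).neg
      simp only [Matrix.cons_val_one, Matrix.cons_val_fin_one, neg_neg] at this
      refine this.congr fun x => ?_
      simp [reflSol]
    · refine (h 0).congr fun x => ?_
      simp [reflSol]
  rw [← h2]
  funext x i
  fin_cases i <;> simp [reflSol]

theorem RightTame.psi1_eq {q : ℝ → ℂ} (hq : RightTame q) {z : ℂ} (hz : z ∈ sheet)
    (hreal : star z = z) :
    psi1 q (lam z) (zet z) = swapConj (jost q z) := by
  have hl : star (lam z) = lam z := by
    rw [lam, star_add, star_div₀, star_div₀, star_mul, hreal]; simp [mul_comm]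
  have hζ : star (zet z) = zet z := by
    rw [zet, star_sub, star_div₀, star_div₀, star_mul, hreal]; simp [mul_comm]
  set P : (ℝ → Fin 2 → ℂ) → Prop := fun v =>
    IsJost q (lam z) atTop (-(Complex.I * zet z)) ![1, rt2 / 2 / z] v with hP
  have hex : P (swapConj (jost q z)) := by
    have hJ := hq.isJost hz
    refine ⟨?_, ?_⟩
    · have := hJ.1.swapConj
      rwa [hl] at this
    · have h := tendsto_pi_nhds.1 hJ.2
      have he : ∀ x : ℝ, star (Complex.exp (-(Complex.I * zet z * x))) =
          Complex.exp (-(-(Complex.I * zet z) * x)) := fun x => by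
        rw [RCLike.star_def, ← Complex.exp_conj]
        congr 1
        have : (starRingEnd ℂ) (zet z) = zet z := hζ
        simp only [map_neg, map_mul, Complex.conj_I, Complex.conj_ofReal, this]
        ring
      rw [tendsto_pi_nhds]
      intro i
      fin_cases i
      · have := (continuous_star.tendsto _).comp (h 1)
        simp only [Matrix.cons_val_one, Matrix.cons_val_fin_one, star_one] at this
        refine this.congr fun x => ?_
        simp only [Function.comp, Pi.smul_apply, smul_eq_mul, star_mul, he, swapConj,
          Fin.zero_eta, Matrix.cons_val_zero]
        ring
      · have := (continuous_star.tendsto _).comp (h 0)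
        simp only [Matrix.cons_val_zero, star_div₀ (rt2 / 2), star_rt2_half, hreal] at this
        refine this.congr fun x => ?_
        simp only [Function.comp, Pi.smul_apply, smul_eq_mul, star_mul, he, swapConj,
          Fin.mk_one, Matrix.cons_val_one, Matrix.cons_val_fin_one]
        ring
  have hpsi : P (psi1 q (lam z) (zet z)) := by
    have e : psi1 q (lam z) (zet z) = Classical.epsilon P := by
      rw [psi1]; simp only [rt2_mul_lam_sub_zet, hP]
    rw [e]
    exact Classical.epsilon_spec ⟨_, hex⟩
  have him : (zet z).im = 0 := Complex.conj_eq_iff_im.1 hζ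
  refine IsJost.unique hq.contDiff.continuous (by simp [him]) ?_ hpsi hex
  intro h
  have := congrFun h 0
  simp at this

/-- The Wronskian `{φ₁, ψ₂}` as a function of the uniformizer. -/
def wr (q : ℝ → ℂ) (z : ℂ) : ℂ :=
  jost q z 0 0 * jost (refl q) z 0 0 + jost q z 0 1 * jost (refl q) z 0 1

/-- The Wronskian `{φ₁, ψ₁}` as a function of the (real) uniformizer. -/
def wrB (q : ℝ → ℂ) (z : ℂ) : ℂ :=
  jost (refl q) z 0 1 * star (jost q z 0 0) + jost (refl q) z 0 0 * star (jost q z 0 1)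

theorem four_zet_mul {z : ℂ} (hz : z ≠ 0) : 4 * zet z * (lam z - zet z) = 1 - 1 / (2 * z ^ 2) := by
  rw [lam_sub_zet, zet]; field_simp; ring

theorem one_sub_ne_zero {z : ℂ} (hz : z ∈ sheet) : 1 - 1 / (2 * z ^ 2) ≠ 0 := by
  rw [← four_zet_mul hz.2.1, lam_sub_zet]
  exact mul_ne_zero (mul_ne_zero (by norm_num) hz.2.2)
    (one_div_ne_zero (mul_ne_zero two_ne_zero hz.2.1))

theorem Tame.coeffA_eq {q : ℝ → ℂ} (hq : Tame q) {z : ℂ} (hz : z ∈ sheet) :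
    coeffA q (lam z) (zet z) = wr q z / (1 - 1 / (2 * z ^ 2)) := by
  rw [coeffA, hq.phi1_eq hz, four_zet_mul hz.2.1]
  congr 1
  change wronskian _ (jost q z) = _
  simp only [wronskian, reflSol, wr, neg_zero, Matrix.cons_val_zero, Matrix.cons_val_one,
    Matrix.cons_val_fin_one]
  ring

theorem Tame.coeffB_eq {q : ℝ → ℂ} (hq : Tame q) {z : ℂ} (hz : z ∈ sheet) (hreal : star z = z) :
    coeffB q (lam z) (zet z) = -wrB q z / (1 - 1 / (2 * z ^ 2)) := by
  rw [coeffB, hq.phi1_eq hz, hq.right.psi1_eq hz hreal, four_zet_mul hz.2.1]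
  congr 1
  simp only [wronskian, reflSol, swapConj, wrB, neg_zero, Matrix.cons_val_zero,
    Matrix.cons_val_one, Matrix.cons_val_fin_one]
  ring

theorem Tame.wr_inv_star {q : ℝ → ℂ} (hq : Tame q) {z : ℂ} (hz : z ∈ sheet) :
    wr q (1 / (2 * star z)) = 2 * star z ^ 2 * star (wr q z) := by
  obtain ⟨h0, h1⟩ := hq.right.jost_inv_star hz 0
  obtain ⟨h0', h1'⟩ := hq.left.jost_inv_star hz 0
  have hr := rt2_ne_zero
  have : (star z / (rt2 / 2)) ^ 2 = 2 * star z ^ 2 := by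
    field_simp; linear_combination -star z ^ 2 * rt2_sq
  rw [wr, h0, h1, h0', h1', wr, star_add, star_mul, star_mul]
  linear_combination (star (jost q z 0 1) * star (jost (GPMarchenko.refl q) z 0 1)
    + star (jost q z 0 0) * star (jost (GPMarchenko.refl q) z 0 0)) * this

theorem Tame.wrB_inv_star {q : ℝ → ℂ} (hq : Tame q) {z : ℂ} (hz : z ∈ sheet) (hreal : star z = z) :
    wrB q (1 / (2 * z)) = 2 * z ^ 2 * star (wrB q z) := by
  obtain ⟨h0, h1⟩ := hq.right.jost_inv_star hz 0
  obtain ⟨h0', h1'⟩ := hq.left.jost_inv_star hz 0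
  rw [hreal] at h0 h1 h0' h1'
  have hr := rt2_ne_zero
  have : (z / (rt2 / 2)) ^ 2 = 2 * z ^ 2 := by
    field_simp; linear_combination -z ^ 2 * rt2_sq
  have hs : star (z / (rt2 / 2)) = z / (rt2 / 2) := by rw [star_div₀, star_rt2_half, hreal]
  rw [wrB, h0, h1, h0', h1', wrB, star_add]
  simp only [star_mul, hs, star_star]
  linear_combination (star (jost (GPMarchenko.refl q) z 0 0) * jost q z 0 1
    + star (jost (GPMarchenko.refl q) z 0 1) * jost q z 0 0) * this

theorem Tame.wr_neg_inv {q : ℝ → ℂ} (hq : Tame q) {z : ℂ} (hz : z ∈ sheet) :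
    wr q z = 1 / (2 * z ^ 2) * wr (fun x => star (q x)) (-(1 / (2 * z))) := by
  obtain ⟨h0, h1⟩ := hq.right.jost_neg_inv hz 0
  obtain ⟨h0', h1'⟩ := hq.left.jost_neg_inv hz 0
  have hz0 := hz.2.1
  have : (rt2 / 2 / z) ^ 2 = 1 / (2 * z ^ 2) := by
    field_simp; linear_combination rt2_sq
  rw [wr, h0, h1, h0', h1', wr, refl_conj, ← this]
  ring

theorem Tame.norm_wrB_neg_inv {q : ℝ → ℂ} (hq : Tame q) {z : ℂ} (hz : z ∈ sheet) :
    ‖wrB q z‖ = ‖1 / (2 * z ^ 2)‖ * ‖wrB (fun x => star (q x)) (-(1 / (2 * z)))‖ := by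
  obtain ⟨h0, h1⟩ := hq.right.jost_neg_inv hz 0
  obtain ⟨h0', h1'⟩ := hq.left.jost_neg_inv hz 0
  have hz0 := hz.2.1
  have : (rt2 / 2 / z) ^ 2 = 1 / (2 * z ^ 2) := by
    field_simp; linear_combination rt2_sq
  rw [← this, norm_pow, sq, ← norm_mul]
  have e : wrB q z = -((rt2 / 2 / z) * star (rt2 / 2 / z) *
      wrB (fun x => star (q x)) (-(1 / (2 * z)))) := by
    rw [wrB, h0, h1, h0', h1', wrB, refl_conj]
    simp only [star_mul, star_neg]
    ring
  rw [e, norm_neg, norm_mul, norm_mul, norm_star, ← norm_mul]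

/-! ### Energy estimates -/

/-- The indefinite energy `|v₂|² - |v₁|²` of a solution. -/
def energy (v : ℝ → Fin 2 → ℂ) (x : ℝ) : ℝ := Complex.normSq (v x 1) - Complex.normSq (v x 0)

theorem hasDerivAt_normSq {f : ℝ → ℂ} {f' : ℂ} {x : ℝ} (hf : HasDerivAt f f' x) :
    HasDerivAt (fun x => Complex.normSq (f x)) (2 * (star (f x) * f').re) x := by
  have h : HasDerivAt (fun x => star (f x) * f x) (star f' * f x + star (f x) * f') x :=
    hf.star.mul hf
  have h2 := (Complex.reCLM.hasFDerivAt.comp_hasDerivAt x h)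
  refine (h2.congr_of_eventuallyEq (Eventually.of_forall fun y => ?_)).congr_deriv ?_
  · simp [Complex.normSq_apply]
  · simp; ring

/-- The potential terms cancel in the indefinite form and only Im λ remains: the energy is constant
in x on the real hyperbola and monotone elsewhere. -/
theorem IsSolution.hasDerivAt_energy {q : ℝ → ℂ} {l : ℂ} {v : ℝ → Fin 2 → ℂ}
    (hv : IsSolution q l v) (x : ℝ) : HasDerivAt (energy v)
      (-(2 * l.im * (Complex.normSq (v x 0) + Complex.normSq (v x 1)))) x := by
  rw [isSolution_iff] at hv
  refine ((hasDerivAt_normSq (hv x).2).sub (hasDerivAt_normSq (hv x).1)).congr_deriv ?_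
  simp [Complex.normSq_apply]
  ring

theorem Tame.continuous {q : ℝ → ℂ} (hq : Tame q) : Continuous q := hq.right.contDiff.continuous

theorem RightTame.energy_jost_eq {q : ℝ → ℂ} (hq : RightTame q) {z : ℂ} (hz : z ∈ sheet)
    (hreal : star z = z) (x : ℝ) : (energy (jost q z) x : ℂ) = 1 - 1 / (2 * z ^ 2) := by
  have hzim : z.im = 0 := Complex.conj_eq_iff_im.1 hreal
  have hlam : (lam z).im = 0 := by rw [lam_im, hzim, zero_mul]
  have hzet : (zet z).im = 0 := by rw [zet_im, hzim, zero_mul]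
  have hJ := hq.isJost hz
  have hconst : ∀ y, energy (jost q z) y = energy (jost q z) x := fun y =>
    is_const_of_deriv_eq_zero (fun y => (hJ.1.hasDerivAt_energy y).differentiableAt)
      (fun y => by rw [(hJ.1.hasDerivAt_energy y).deriv, hlam]; ring) y x
  have h := fun i => (Complex.continuous_normSq.tendsto _).comp (tendsto_pi_nhds.1 hJ.2 i)
  have h2 := (h 1).sub (h 0)
  have h3 : Tendsto (fun _ : ℝ => energy (jost q z) x) atTop (𝓝 (Complex.normSq
      ((![rt2 / 2 / z, 1] : Fin 2 → ℂ) 1) - Complex.normSq ((![rt2 / 2 / z, 1] : Fin 2 → ℂ) 0))) := by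
    refine h2.congr fun y => ?_
    have he : Complex.normSq (Complex.exp (-(Complex.I * zet z * y))) = 1 := by
      rw [Complex.normSq_eq_norm_sq, Complex.norm_exp]
      simp [hzet]
    simp only [Function.comp, Pi.smul_apply, smul_eq_mul, Complex.normSq_mul, he, one_mul]
    exact hconst y
  rw [tendsto_nhds_unique tendsto_const_nhds h3]
  simp only [Matrix.cons_val_one, Matrix.cons_val_fin_one, Matrix.cons_val_zero]
  push_cast
  rw [← Complex.mul_conj, ← Complex.mul_conj]
  have : (starRingEnd ℂ) (rt2 / 2 / z) = rt2 / 2 / z := by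
    change star _ = _
    rw [star_div₀, star_rt2_half, hreal]
  rw [this, map_one, div_mul_div_comm, rt2_half_sq]
  have := hz.2.1
  field_simp

/-- The unitarity relation on the real axis. -/
theorem Tame.normSq_wr {q : ℝ → ℂ} (hq : Tame q) {z : ℂ} (hz : z ∈ sheet) (hreal : star z = z) :
    ‖wr q z‖ ^ 2 = ‖wrB q z‖ ^ 2 + ‖1 - 1 / (2 * z ^ 2)‖ ^ 2 := by
  have h1 := hq.right.energy_jost_eq hz hreal 0
  have h2 := hq.left.energy_jost_eq hz hreal 0
  -- Both energies equal the real number 1 − 1/(2z²), and the product of the energies at 0 is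
  -- |`wr`|² − |`wrB`|² by an identity of Lagrange type.
  have h12 : ‖1 - 1 / (2 * z ^ 2)‖ ^ 2 =
      energy (jost q z) 0 * energy (jost (GPMarchenko.refl q) z) 0 := by
    have hE : energy (jost q z) 0 = energy (jost (GPMarchenko.refl q) z) 0 := by
      exact_mod_cast h1.trans h2.symm
    rw [← h1, ← hE, Complex.norm_real, Real.norm_eq_abs, sq_abs, sq]
  rw [h12, ← Complex.normSq_eq_norm_sq, ← Complex.normSq_eq_norm_sq]
  simp [wr, wrB, energy, Complex.normSq_apply]
  ring

theorem norm_sq_lt_of_real {q : ℝ → ℂ} (hq : Tame q) {z : ℂ} (hz : z ∈ sheet)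
    (hreal : star z = z) : ‖wrB q z‖ ≤ ‖wr q z‖ ∧ wr q z ≠ 0 := by
  have h := hq.normSq_wr hz hreal
  have h0 : 0 < ‖1 - 1 / (2 * z ^ 2)‖ := norm_pos_iff.2 (one_sub_ne_zero hz)
  have h1 : 0 < ‖1 - 1 / (2 * z ^ 2)‖ ^ 2 := by positivity
  refine ⟨?_, ?_⟩
  · refine le_of_sq_le_sq ?_ (norm_nonneg _)
    linarith
  · rw [← norm_pos_iff]
    by_contra! hc
    have : ‖wr q z‖ = 0 := le_antisymm hc (norm_nonneg _)
    rw [this] at h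
    nlinarith [sq_nonneg ‖wrB q z‖]

/-- On and outside the circle Im λ ≥ 0, so the energy of ψ₂ decreases, with limit 0 at +∞. Beyond X
the second component has modulus at least e^{−Im ζ x}/2, hence the energy minus κ e^{−2 Im ζ x} is
still decreasing to 0 and is nonnegative at X. Only the ratio Im λ / Im ζ enters κ, which keeps the
bound uniform as z approaches the real line. -/
theorem RightTame.energy_lower_bound {q : ℝ → ℂ} (hq : RightTame q) {R : ℝ} (hR : 1 ≤ R) :
    ∃ c : ℝ, 0 < c ∧ ∀ z ∈ upper, 1 ≤ 2 * Complex.normSq z → ‖z‖ ≤ R →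
      c * (2 * Complex.normSq z - 1) ≤ energy (jost q z) 0 := by
  obtain ⟨m, C, δ, hδ, -, -, -, hm, -, hJ, hJm⟩ := hq.jost_spec
  -- Since 1/|z| ≤ 2 in the region, the factor 1 + 1/|z| is at most 3, and 1/6 leaves an error of at
  -- most 1/2 around the limit 1.
  obtain ⟨X, hX0, hX⟩ : ∃ X : ℝ, 0 ≤ X ∧ ∀ x ≥ X, δ x ≤ 1 / 6 := by
    obtain ⟨X, hX⟩ := eventually_atTop.1 (hδ.eventually (ge_mem_nhds (by norm_num :
      (0 : ℝ) < 1 / 6)))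
    exact ⟨max X 0, le_max_right _ _, fun x hx => hX x ((le_max_left _ _).trans hx)⟩
  refine ⟨Real.exp (-(2 * R * X)) / (4 * (2 * R ^ 2 + 1)), by positivity, fun z hz hz1 hzR => ?_⟩
  have hzs := upper_subset_sheet hz
  have hz0 : 0 < z.im := hz
  set N := Complex.normSq z with hN
  have hN0 : 0 < N := by linarith
  have hNR : N ≤ R ^ 2 := by
    rw [hN, Complex.normSq_eq_norm_sq]
    exact pow_le_pow_left₀ (norm_nonneg _) hzR 2
  have hzn : 1 / ‖z‖ ≤ 2 := by
    have : (1 / 2 : ℝ) ≤ ‖z‖ := by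
      rw [hN, Complex.normSq_eq_norm_sq] at hz1
      nlinarith [norm_nonneg z]
    rw [div_le_iff₀ (by linarith)]
    linarith
  have hζ : 0 < (zet z).im := zet_im_pos hz
  have hζR : (zet z).im ≤ R := by
    rw [zet_im]
    have h1 : 1 / (4 * N) ≤ 1 / 2 := by
      rw [div_le_div_iff₀ (by positivity) (by norm_num)]; linarith
    have h2 : z.im ≤ R := ((le_abs_self _).trans (Complex.abs_im_le_norm z)).trans hzR
    nlinarith
  have hl : (lam z).im = (2 * N - 1) / (2 * N + 1) * (zet z).im := by
    rw [lam_im, zet_im, ← hN]; field_simp; ring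
  have hl0 : 0 ≤ (lam z).im := by
    rw [hl]
    exact mul_nonneg (div_nonneg (by linarith) (by linarith)) hζ.le
  set κ := (2 * N - 1) / (2 * N + 1) / 4 with hκ
  have hκ0 : 0 ≤ κ := div_nonneg (div_nonneg (by linarith) (by linarith)) (by norm_num)
  have hE := (hJ z hzs).1.hasDerivAt_energy
  have hsq : ∀ x i, Complex.normSq (jost q z x i) =
      Real.exp (-(2 * (zet z).im * x)) * ‖m i x z‖ ^ 2 := by
    intro x i
    rw [hJm z hzs, Complex.normSq_mul, Complex.normSq_eq_norm_sq, Complex.normSq_eq_norm_sq,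
      Complex.norm_exp, ← Real.exp_nat_mul]
    congr 2
    simp
    ring
  have hlow : ∀ x ≥ X, Real.exp (-(2 * (zet z).im * x)) / 4 ≤ Complex.normSq (jost q z x 1) := by
    intro x hx
    have h1 := hm z hzs 1 x (hX0.trans hx)
    simp only [Matrix.cons_val_one, Matrix.cons_val_fin_one] at h1
    have h2 : ‖m 1 x z - 1‖ ≤ 1 / 2 := by
      refine h1.trans ?_
      have := hX x hx
      have : 0 ≤ 1 / ‖z‖ := by positivity
      nlinarith
    have h3 : 1 / 2 ≤ ‖m 1 x z‖ := by
      have := norm_sub_norm_le (1 : ℂ) (m 1 x z)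
      rw [norm_one, norm_sub_rev] at this
      linarith
    rw [hsq]
    have : (1 / 4 : ℝ) ≤ ‖m 1 x z‖ ^ 2 := by nlinarith
    have := Real.exp_pos (-(2 * (zet z).im * x))
    nlinarith
  have hlim : Tendsto (energy (jost q z)) atTop (𝓝 0) := by
    have hexp : Tendsto (fun x : ℝ => Real.exp (-(2 * (zet z).im * x))) atTop (𝓝 0) :=
      Real.tendsto_exp_neg_atTop_nhds_zero.comp
        (tendsto_id.const_mul_atTop (by linarith : 0 < 2 * (zet z).im))
    have hb : ∀ i, Tendsto (fun x => m i x z) atTop (𝓝 ((![rt2 / 2 / z, 1] : Fin 2 → ℂ) i)) := by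
      intro i
      rw [tendsto_iff_norm_sub_tendsto_zero]
      refine squeeze_zero' (Eventually.of_forall fun x => norm_nonneg _) ?_
        (by simpa only [mul_zero] using hδ.const_mul (1 + 1 / ‖z‖))
      filter_upwards [eventually_ge_atTop 0] with x hx using hm z hzs i x hx
    have := (hexp.mul ((hb 1).norm.pow 2)).sub (hexp.mul ((hb 0).norm.pow 2))
    simp only [zero_mul, sub_zero] at this
    refine this.congr fun x => ?_
    rw [energy, hsq, hsq]
  have hg : ∀ x, HasDerivAt (fun x => energy (jost q z) x - κ * Real.exp (-(2 * (zet z).im * x)))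
      (-(2 * (lam z).im * (Complex.normSq (jost q z x 0) + Complex.normSq (jost q z x 1)))
        + 2 * (zet z).im * κ * Real.exp (-(2 * (zet z).im * x))) x := by
    intro x
    have h1 : HasDerivAt (fun x : ℝ => -(2 * (zet z).im * x)) (-(2 * (zet z).im * 1)) x :=
      ((hasDerivAt_id x).const_mul _).neg
    exact ((hE x).sub (h1.exp.const_mul κ)).congr_deriv (by ring)
  have hanti : AntitoneOn (fun x => energy (jost q z) x - κ * Real.exp (-(2 * (zet z).im * x)))
      (Set.Ici X) := by
    refine antitoneOn_of_deriv_nonpos (convex_Ici X)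
      (fun x _ => (hg x).continuousAt.continuousWithinAt)
      (fun x _ => (hg x).differentiableAt.differentiableWithinAt) fun x hx => ?_
    rw [interior_Ici] at hx
    rw [(hg x).deriv]
    have h1 := hlow x (le_of_lt hx)
    have h2 := Complex.normSq_nonneg (jost q z x 0)
    have h3 : 2 * (zet z).im * κ = (lam z).im / 2 := by rw [hl, hκ]; ring
    rw [h3]
    nlinarith
  have hgX : 0 ≤ energy (jost q z) X - κ * Real.exp (-(2 * (zet z).im * X)) := by
    have hlim2 : Tendsto (fun x => energy (jost q z) x - κ * Real.exp (-(2 * (zet z).im * x)))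
        atTop (𝓝 0) := by
      have hexp : Tendsto (fun x : ℝ => Real.exp (-(2 * (zet z).im * x))) atTop (𝓝 0) :=
        Real.tendsto_exp_neg_atTop_nhds_zero.comp
          (tendsto_id.const_mul_atTop (by linarith : 0 < 2 * (zet z).im))
      simpa using hlim.sub (hexp.const_mul κ)
    refine le_of_tendsto hlim2 ?_
    filter_upwards [eventually_ge_atTop X] with x hx
    exact hanti Set.self_mem_Ici hx hx
  have hE0 : energy (jost q z) X ≤ energy (jost q z) 0 := by
    refine (antitone_of_hasDerivAt_nonpos hE fun x => ?_) hX0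
    have h1 := Complex.normSq_nonneg (jost q z x 0)
    have h2 := Complex.normSq_nonneg (jost q z x 1)
    have := mul_nonneg hl0 (add_nonneg h1 h2)
    simp only [Pi.zero_apply]
    linarith
  have hexpR : Real.exp (-(2 * R * X)) ≤ Real.exp (-(2 * (zet z).im * X)) := by
    refine Real.exp_le_exp.2 ?_
    nlinarith
  have hκR : (2 * N - 1) / (4 * (2 * R ^ 2 + 1)) ≤ κ := by
    rw [hκ, div_div]
    exact div_le_div_of_nonneg_left (by linarith) (by positivity) (by linarith)
  have hfin : (2 * N - 1) / (4 * (2 * R ^ 2 + 1)) * Real.exp (-(2 * R * X)) ≤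
      κ * Real.exp (-(2 * (zet z).im * X)) :=
    mul_le_mul hκR hexpR (Real.exp_pos _).le hκ0
  calc _ = (2 * N - 1) / (4 * (2 * R ^ 2 + 1)) * Real.exp (-(2 * R * X)) := by ring
    _ ≤ _ := by linarith

/-- The difference of (a² + d)(b² + d) and (ab + d)² is d(a − b)². -/
theorem add_le_mul_of_sq {A B a b d : ℝ} (hA : 0 ≤ A) (hB : 0 ≤ B) (hd : 0 ≤ d)
    (h1 : a ^ 2 + d ≤ A ^ 2) (h2 : b ^ 2 + d ≤ B ^ 2) : a * b + d ≤ A * B := by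
  refine le_of_sq_le_sq ?_ (mul_nonneg hA hB)
  have : (a ^ 2 + d) * (b ^ 2 + d) ≤ A ^ 2 * B ^ 2 :=
    mul_le_mul h1 h2 (by positivity) (by positivity)
  nlinarith [sq_nonneg (a - b)]

/-- The Wronskian is the product of the second components plus the product of the first ones. The
energy bounds for both Jost solutions make the former product dominate with the margin d. -/
theorem Tame.wr_lower_bound_aux {q : ℝ → ℂ} (hq : Tame q) {R : ℝ} (hR : 1 ≤ R) :
    ∃ c : ℝ, 0 < c ∧ ∀ z ∈ upper, 1 ≤ 2 * Complex.normSq z → ‖z‖ ≤ R →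
      c * (2 * Complex.normSq z - 1) ≤ ‖wr q z‖ := by
  obtain ⟨c₁, hc₁, h₁⟩ := hq.right.energy_lower_bound hR
  obtain ⟨c₂, hc₂, h₂⟩ := hq.left.energy_lower_bound hR
  refine ⟨min c₁ c₂, lt_min hc₁ hc₂, fun z hz hz1 hzR => ?_⟩
  have hn : 0 ≤ 2 * Complex.normSq z - 1 := by linarith
  have e₁ := (mul_le_mul_of_nonneg_right (min_le_left c₁ c₂) hn).trans (h₁ z hz hz1 hzR)
  have e₂ := (mul_le_mul_of_nonneg_right (min_le_right c₁ c₂) hn).trans (h₂ z hz hz1 hzR)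
  have hd : 0 ≤ min c₁ c₂ * (2 * Complex.normSq z - 1) := mul_nonneg (lt_min hc₁ hc₂).le hn
  simp only [energy, Complex.normSq_eq_norm_sq] at e₁ e₂
  simp only [Complex.normSq_eq_norm_sq] at hd ⊢
  have key := add_le_mul_of_sq (norm_nonneg (jost q z 0 1))
    (norm_nonneg (jost (GPMarchenko.refl q) z 0 1)) hd
    (a := ‖jost q z 0 0‖) (b := ‖jost (GPMarchenko.refl q) z 0 0‖) (by linarith) (by linarith)
  have := norm_sub_le (wr q z) (jost q z 0 0 * jost (GPMarchenko.refl q) z 0 0)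
  rw [wr, add_sub_cancel_left, norm_mul, norm_mul] at this
  rw [wr]
  linarith

/-- Inside the circle the estimate is transported from outside by z ↦ 1/(2z*). -/
theorem Tame.wr_lower_bound {q : ℝ → ℂ} (hq : Tame q) {R : ℝ} (hR : 1 ≤ R) :
    ∃ c : ℝ, 0 < c ∧ ∀ z ∈ upper, 1 / (2 * R) ≤ ‖z‖ → ‖z‖ ≤ R →
      c * |2 * Complex.normSq z - 1| ≤ ‖wr q z‖ := by
  obtain ⟨c, hc, h⟩ := hq.wr_lower_bound_aux hR
  refine ⟨c, hc, fun z hz hz1 hzR => ?_⟩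
  rcases le_total 1 (2 * Complex.normSq z) with h1 | h1
  · rw [abs_of_nonneg (by linarith)]
    exact h z hz h1 hzR
  · have hz0 := (upper_subset_sheet hz).2.1
    have hN : 0 < Complex.normSq z := Complex.normSq_pos.2 hz0
    have hzn : 0 < ‖z‖ := norm_pos_iff.2 hz0
    have hN' : Complex.normSq (1 / (2 * star z)) = 1 / (4 * Complex.normSq z) := by
      have : Complex.normSq (star z) = Complex.normSq z := Complex.normSq_conj z
      rw [Complex.normSq_div, Complex.normSq_mul, this, Complex.normSq_one, Complex.normSq_ofNat]
      norm_num
    have h2 := h _ (inv_star_mem_upper hz) (by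
      rw [hN', mul_one_div, le_div_iff₀ (by positivity)]; linarith) (by
      rw [norm_div, norm_mul, norm_star, norm_one, Complex.norm_ofNat, div_le_iff₀ (by positivity)]
      rw [div_le_iff₀ (by positivity)] at hz1
      linarith)
    rw [hq.wr_inv_star (upper_subset_sheet hz), norm_mul, norm_mul, norm_pow, norm_star, norm_star,
      Complex.norm_ofNat, hN', ← Complex.normSq_eq_norm_sq] at h2
    rw [abs_of_nonpos (by linarith)]
    have e : 2 * (1 / (4 * Complex.normSq z)) - 1 =
        (1 - 2 * Complex.normSq z) / (2 * Complex.normSq z) := by field_simp; ring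
    rw [e, mul_div_assoc', div_le_iff₀ (by positivity)] at h2
    have hW := norm_nonneg (wr q z)
    have h3 : 2 * Complex.normSq z * ‖wr q z‖ * (2 * Complex.normSq z) ≤ ‖wr q z‖ := by
      have : (2 * Complex.normSq z) * (2 * Complex.normSq z) ≤ 1 := by nlinarith
      nlinarith
    linarith

theorem Tame.differentiableOn_wr {q : ℝ → ℂ} (hq : Tame q) : DifferentiableOn ℂ (wr q) upper := by
  have h1 := hq.right.differentiableOn_jost 0
  have h2 := hq.left.differentiableOn_jost 0
  exact ((h1 0).mul (h2 0)).add ((h1 1).mul (h2 1))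

theorem Tame.continuousOn_wr {q : ℝ → ℂ} (hq : Tame q) : ContinuousOn (wr q) sheet := by
  have h1 := hq.right.continuousOn_jost 0
  have h2 := hq.left.continuousOn_jost 0
  exact ((h1 0).mul (h2 0)).add ((h1 1).mul (h2 1))

theorem Tame.continuousOn_wrB {q : ℝ → ℂ} (hq : Tame q) : ContinuousOn (wrB q) sheet := by
  have h1 := hq.right.continuousOn_jost 0
  have h2 := hq.left.continuousOn_jost 0
  exact ((h2 1).mul (h1 0).star).add ((h2 0).mul (h1 1).star)

/-- Zeros of the Wronskian in the upper half-plane lie on the circle over the spectral gap. -/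
theorem Tame.normSq_zero {q : ℝ → ℂ} (hq : Tame q) {z₀ : ℂ} (hz₀ : z₀ ∈ upper)
    (h0 : wr q z₀ = 0) : Complex.normSq z₀ = 1 / 2 := by
  have hz := (upper_subset_sheet hz₀).2.1
  have hzn : 0 < ‖z₀‖ := norm_pos_iff.2 hz
  obtain ⟨c, hc, h⟩ := hq.wr_lower_bound (R := max (max 1 ‖z₀‖) (1 / (2 * ‖z₀‖)))
    ((le_max_left _ _).trans (le_max_left _ _))
  have h1 := h z₀ hz₀ (by
    have h1 : 1 / (2 * ‖z₀‖) ≤ max (max 1 ‖z₀‖) (1 / (2 * ‖z₀‖)) := le_max_right _ _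
    rw [div_le_iff₀ (by positivity)] at h1 ⊢
    linarith) ((le_max_right _ _).trans (le_max_left _ _))
  rw [h0, norm_zero] at h1
  have h2 : |2 * Complex.normSq z₀ - 1| ≤ 0 := nonpos_of_mul_nonpos_right h1 hc
  have := abs_nonpos_iff.1 h2
  linarith

/-- Zeros of the Wronskian in the upper half-plane are simple. -/
theorem Tame.deriv_wr_ne_zero {q : ℝ → ℂ} (hq : Tame q) {z₀ : ℂ} (hz₀ : z₀ ∈ upper)
    (h0 : wr q z₀ = 0) : deriv (wr q) z₀ ≠ 0 := by
  intro hd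
  have hN := hq.normSq_zero hz₀ h0
  have hz := (upper_subset_sheet hz₀).2.1
  have hzn : ‖z₀‖ ≤ 1 := by
    rw [Complex.normSq_eq_norm_sq] at hN
    nlinarith [norm_nonneg z₀]
  have hzn' : 1 / 2 ≤ ‖z₀‖ := by
    rw [Complex.normSq_eq_norm_sq] at hN
    nlinarith [norm_nonneg z₀]
  obtain ⟨c, hc, h⟩ := hq.wr_lower_bound (R := 2) (by norm_num)
  have hder : HasDerivAt (wr q) 0 z₀ := by
    rw [← hd]
    exact ((hq.differentiableOn_wr z₀ hz₀).differentiableAt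
      (isOpen_upper.mem_nhds hz₀)).hasDerivAt
  rw [hasDerivAt_iff_isLittleO] at hder
  have hev := hder.def hc
  -- z₀ is approached radially from outside, where 2|z|² − 1 = 2t + t². This linear lower bound
  -- contradicts a Wronskian that is o(t).
  have htend : Tendsto (fun t : ℝ => z₀ + (t : ℂ) * z₀) (𝓝[>] 0) (𝓝 z₀) := by
    have : Continuous fun t : ℝ => z₀ + (t : ℂ) * z₀ := by fun_prop
    have h1 := this.tendsto 0
    simp only [Complex.ofReal_zero, zero_mul, add_zero] at h1
    exact h1.mono_left nhdsWithin_le_nhds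
  have h1 := (htend.eventually hev).and (Ioo_mem_nhdsGT (zero_lt_one' ℝ))
  obtain ⟨t, ht, ht0, ht1⟩ := h1.exists
  have hzt : z₀ + (t : ℂ) * z₀ = ((1 + t : ℝ) : ℂ) * z₀ := by push_cast; ring
  have hnt : ‖z₀ + (t : ℂ) * z₀‖ = (1 + t) * ‖z₀‖ := by
    rw [hzt, norm_mul, Complex.norm_real, Real.norm_of_nonneg (by linarith)]
  have hup : z₀ + (t : ℂ) * z₀ ∈ upper := by
    rw [hzt]
    show 0 < (((1 + t : ℝ) : ℂ) * z₀).im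
    rw [Complex.im_ofReal_mul]
    exact mul_pos (by linarith) hz₀
  have h2 := h _ hup (by rw [hnt]; nlinarith) (by rw [hnt]; nlinarith)
  rw [h0, sub_zero, smul_zero, sub_zero, add_sub_cancel_left, norm_mul, Complex.norm_real,
    Real.norm_of_nonneg ht0.le] at ht
  have hNt : Complex.normSq (z₀ + (t : ℂ) * z₀) = (1 + t) ^ 2 * (1 / 2) := by
    rw [hzt, Complex.normSq_mul, hN, Complex.normSq_ofReal]; ring
  rw [hNt, abs_of_nonneg (by nlinarith)] at h2
  have h3 : t * ‖z₀‖ ≤ t := by nlinarith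
  have h4 : c * (2 * ((1 + t) ^ 2 * (1 / 2)) - 1) = c * (2 * t + t ^ 2) := by ring
  have h5 : c * (t * ‖z₀‖) ≤ c * t := mul_le_mul_of_nonneg_left h3 hc.le
  nlinarith [mul_pos hc ht0, mul_pos hc (pow_pos ht0 2)]

/-! ### Asymptotics for large spectral parameter -/

theorem hasDerivAt_const_div_pow (A : ℝ) (n : ℕ) {s : ℝ} (hs : 0 ≤ s) :
    HasDerivAt (fun s : ℝ => A / (1 + s) ^ n) (-(n * A / (1 + s) ^ (n + 1))) s := by
  have h0 : (1 + s) ≠ 0 := by positivity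
  have h1 : HasDerivAt (fun s : ℝ => (1 + s) ^ n) (n * (1 + s) ^ (n - 1) * 1) s :=
    ((hasDerivAt_id s).const_add 1).pow n
  refine ((hasDerivAt_const s A).div h1 (pow_ne_zero n h0)).congr_deriv ?_
  rcases n with _ | k
  · simp
  · simp only [Nat.add_sub_cancel]
    field_simp
    ring

/-- Duhamel's principle from infinity, with polynomial weights. -/
theorem norm_le_of_decay {A : ℝ} (hA : 0 ≤ A) {n : ℕ} (hn : 1 ≤ n) {ζ : ℂ} (hζ : 0 ≤ ζ.im)
    {ℓ g : ℝ → ℂ} (hder : ∀ s, 0 ≤ s → HasDerivAt ℓ (-(2 * Complex.I * ζ) * ℓ s + g s) s)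
    (hg : ∀ s, 0 ≤ s → ‖g s‖ ≤ A / (1 + s) ^ (n + 1)) (hℓ : Tendsto ℓ atTop (𝓝 0))
    {x : ℝ} (hx : 0 ≤ x) : ‖ℓ x‖ ≤ A / (1 + x) ^ n := by
  -- Integrating factor normalized to 1 at x; its modulus is at most 1 for s ≥ x because Im ζ ≥ 0.
  set e : ℝ → ℂ := fun s => Complex.exp (2 * Complex.I * ζ * ((s : ℂ) - x)) with he
  have hen : ∀ s, x ≤ s → ‖e s‖ ≤ 1 := fun s hs => by
    rw [he, Complex.norm_exp, Real.exp_le_one_iff]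
    have : (2 * Complex.I * ζ * ((s : ℂ) - x)).re = -(2 * ζ.im * (s - x)) := by
      simp
    rw [this]
    have := mul_nonneg hζ (sub_nonneg.2 hs)
    linarith
  have hed : ∀ s, HasDerivAt e (2 * Complex.I * ζ * e s) s := fun s => by
    have h1 : HasDerivAt (fun s : ℝ => 2 * Complex.I * ζ * ((s : ℂ) - x))
        (2 * Complex.I * ζ) s := by
      simpa using (((hasDerivAt_id s).ofReal_comp).sub_const (x : ℂ)).const_mul
        (2 * Complex.I * ζ)
    exact h1.cexp.congr_deriv (mul_comm _ _)
  have hE : ∀ s, 0 ≤ s → HasDerivAt (fun s => e s * ℓ s) (e s * g s) s := fun s hs =>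
    ((hed s).mul (hder s hs)).congr_deriv (by ring)
  have key : ∀ T, x ≤ T → ‖e T * ℓ T - e x * ℓ x‖ ≤ A / (1 + x) ^ n - A / (1 + T) ^ n := by
    intro T hT
    refine image_norm_le_of_norm_deriv_right_le_deriv_boundary'
      (f := fun s => e s * ℓ s - e x * ℓ x) (f' := fun s => e s * g s)
      (B := fun s => A / (1 + x) ^ n - A / (1 + s) ^ n)
      (B' := fun s => n * A / (1 + s) ^ (n + 1)) (a := x) (b := T) ?_ ?_ ?_ ?_ ?_ ?_ ⟨hT, le_rfl⟩
    · intro s hs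
      exact ((hE s (hx.trans hs.1)).sub_const _).continuousAt.continuousWithinAt
    · intro s hs
      exact ((hE s (hx.trans hs.1)).sub_const _).hasDerivWithinAt
    · simp
    · intro s hs
      exact ((hasDerivAt_const_div_pow A n (hx.trans hs.1)).const_sub
        _).continuousAt.continuousWithinAt
    · intro s hs
      exact (((hasDerivAt_const_div_pow A n (hx.trans hs.1)).const_sub
        _).congr_deriv (by ring)).hasDerivWithinAt
    · intro s hs
      have hs0 := hx.trans hs.1
      rw [norm_mul]
      calc ‖e s‖ * ‖g s‖ ≤ 1 * (A / (1 + s) ^ (n + 1)) :=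
            mul_le_mul (hen s hs.1) (hg s hs0) (norm_nonneg _) zero_le_one
        _ ≤ n * A / (1 + s) ^ (n + 1) := by
            rw [one_mul]
            have : (1 : ℝ) ≤ n := by exact_mod_cast hn
            gcongr
            nlinarith
  have hex : e x = 1 := by simp [he]
  have hlim : Tendsto (fun T => A / (1 + x) ^ n + ‖ℓ T‖) atTop (𝓝 (A / (1 + x) ^ n + 0)) :=
    tendsto_const_nhds.add (by simpa using hℓ.norm)
  rw [add_zero] at hlim
  refine ge_of_tendsto hlim ((eventually_ge_atTop x).mono fun T hT => ?_)
  have h1 := key T hT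
  rw [hex, one_mul] at h1
  have h2 : ‖e T * ℓ T‖ ≤ ‖ℓ T‖ := by
    rw [norm_mul]
    exact mul_le_of_le_one_left (norm_nonneg _) (hen T hT)
  have h3 : 0 ≤ A / (1 + T) ^ n := by have : 0 ≤ T := hx.trans hT; positivity
  have h4 := norm_sub_norm_le (ℓ x) (e T * ℓ T)
  rw [norm_sub_rev] at h4
  linarith

theorem exists_bound_of_tendsto {f : ℝ → ℂ} (hf : ∀ s, 0 ≤ s → ContinuousAt f s) {L : ℂ}
    (hL : Tendsto f atTop (𝓝 L)) : ∃ B, 0 ≤ B ∧ ∀ x, 0 ≤ x → ‖f x‖ ≤ B := by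
  have h1 : ∀ᶠ x in atTop, ‖f x‖ < ‖L‖ + 1 := hL.norm.eventually (gt_mem_nhds (by linarith))
  obtain ⟨X, hX⟩ := eventually_atTop.1 h1
  obtain ⟨B, hB⟩ := (isCompact_Icc (a := (0 : ℝ)) (b := X)).exists_bound_of_continuousOn
    (f := f) fun s hs => (hf s hs.1).continuousWithinAt
  refine ⟨max B (‖L‖ + 1), le_max_of_le_right (by positivity), fun x hx => ?_⟩
  rcases le_total x X with h | h
  · exact (hB x ⟨hx, h⟩).trans (le_max_left _ _)
  · exact (hX x h).le.trans (le_max_right _ _)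

/-- A bounded function whose bounds self-improve is bounded by the fixed point. -/
theorem bound_of_improve {f : ℝ → ℂ} (hf : ∃ B, 0 ≤ B ∧ ∀ x, 0 ≤ x → ‖f x‖ ≤ B) {a : ℝ}
    (h : ∀ B, 0 ≤ B → (∀ x, 0 ≤ x → ‖f x‖ ≤ B) → ∀ x, 0 ≤ x → ‖f x‖ ≤ a + B / 2)
    {x : ℝ} (hx : 0 ≤ x) : ‖f x‖ ≤ 2 * a := by
  obtain ⟨B, hB0, hB⟩ := hf
  set S := (fun x => ‖f x‖) '' Set.Ici 0 with hS
  have hbdd : BddAbove S := ⟨B, by rintro _ ⟨y, hy, rfl⟩; exact hB y hy⟩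
  have hle : ∀ y, 0 ≤ y → ‖f y‖ ≤ sSup S := fun y hy => le_csSup hbdd ⟨y, hy, rfl⟩
  have h1 := h (sSup S) ((norm_nonneg _).trans (hle x hx)) hle
  have h2 : sSup S ≤ a + sSup S / 2 :=
    csSup_le ⟨_, x, hx, rfl⟩ (by rintro _ ⟨y, hy, rfl⟩; exact h1 y hy)
  linarith [hle x hx]

theorem div_pow_le_div_pow {C s : ℝ} (hC : 0 ≤ C) (hs : 0 ≤ s) {m n : ℕ} (h : m ≤ n) :
    C / (1 + s) ^ n ≤ C / (1 + s) ^ m := by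
  gcongr
  linarith

/-- Constants controlling a potential on the right half-line. -/
theorem RightTame.exists_bounds {q : ℝ → ℂ} (hq : RightTame q) : ∃ K : ℝ, 1 ≤ K ∧ ∀ s, 0 ≤ s →
    ‖q s‖ ≤ K ∧ ‖star (q s) * q s - 1 / 2‖ ≤ K / (1 + s) ^ 4 ∧
    ‖deriv q s‖ ≤ K / (1 + s) ^ 4 ∧ ‖deriv (deriv q) s‖ ≤ K / (1 + s) ^ 4 := by
  obtain ⟨C, hC, h⟩ := hq.bound
  refine ⟨(C + 1) * (C + 2), by nlinarith, fun s hs => ?_⟩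
  obtain ⟨h1, h2, h3⟩ := h s hs
  have hp : (1 : ℝ) ≤ (1 + s) ^ 4 := one_le_pow₀ (by linarith)
  have h1' : ‖q s - rt2 / 2‖ ≤ C := h1.trans (div_le_self hC hp)
  have hqn : ‖q s‖ ≤ C + 1 := by
    have := norm_add_le (q s - rt2 / 2) (rt2 / 2)
    rw [sub_add_cancel] at this
    linarith [norm_rt2_half_le]
  have hCK : C ≤ (C + 1) * (C + 2) := by nlinarith
  refine ⟨by nlinarith, ?_, h2.trans (by gcongr), h3.trans (by gcongr)⟩
  have e : star (q s) * q s - 1 / 2 =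
      star (q s) * (q s - rt2 / 2) + rt2 / 2 * star (q s - rt2 / 2) := by
    rw [star_sub, star_rt2_half]
    linear_combination rt2_half_sq
  rw [e]
  calc _ ≤ ‖star (q s)‖ * ‖q s - rt2 / 2‖ + ‖rt2 / 2‖ * ‖star (q s - rt2 / 2)‖ := by
        refine (norm_add_le _ _).trans ?_
        rw [norm_mul, norm_mul]
    _ ≤ (C + 1) * (C / (1 + s) ^ 4) + 1 * (C / (1 + s) ^ 4) := by
        rw [norm_star, norm_star]
        gcongr
        exact norm_rt2_half_le
    _ = (C * (C + 2)) / (1 + s) ^ 4 := by ring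
    _ ≤ _ := by gcongr; linarith

/-- The quantity n = z m₀ − q* m₁ oscillates at the rate −2iζ, with source −(q*)'m₁ plus a term
O(1/z). Duhamel's principle first bounds n and m₁ through self-improving estimates. One further
order, with q'' in the source, then gives n(0) = O(1/z). -/
theorem asymptotics_aux {q : ℝ → ℂ} (hq2 : ContDiff ℝ 2 q) {K : ℝ} (hK : 1 ≤ K)
    (hb : ∀ s, 0 ≤ s → ‖q s‖ ≤ K ∧ ‖star (q s) * q s - 1 / 2‖ ≤ K / (1 + s) ^ 4 ∧
      ‖deriv q s‖ ≤ K / (1 + s) ^ 4 ∧ ‖deriv (deriv q) s‖ ≤ K / (1 + s) ^ 4)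
    (hqlim : Tendsto q atTop (𝓝 (rt2 / 2)))
    {z : ℂ} (hz : z ∈ sheet) (hzK : 10 * K ^ 2 ≤ ‖z‖) {m0 m1 : ℝ → ℂ}
    (h0 : ∀ x, HasDerivAt m0 (-(Complex.I * z) * m0 x + Complex.I * star (q x) * m1 x) x)
    (h1 : ∀ x, HasDerivAt m1 (Complex.I / (2 * z) * m1 x - Complex.I * q x * m0 x) x)
    (hl0 : Tendsto m0 atTop (𝓝 (rt2 / 2 / z))) (hl1 : Tendsto m1 atTop (𝓝 1)) :
    ‖m1 0 - 1‖ ≤ 10 * K ^ 2 / ‖z‖ ∧ ‖z * m0 0 - star (q 0) * m1 0‖ ≤ 50 * K ^ 2 / ‖z‖ := by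
  have hz0 := hz.2.1
  have hζ := zet_im_nonneg hz.1
  have hKz : 10 * K ≤ ‖z‖ := by nlinarith
  have hzp : 0 < ‖z‖ := by linarith
  set n : ℝ → ℂ := fun s => z * m0 s - star (q s) * m1 s with hn
  set η : ℝ → ℂ := fun s => star (q s) * q s - 1 / 2 with hη
  have hqd : ∀ s, HasDerivAt q (deriv q s) s := fun s =>
    (hq2.differentiable (by norm_num) s).hasDerivAt
  have hqd2 : ∀ s, HasDerivAt (deriv q) (deriv (deriv q) s) s := fun s => by
    have : ContDiff ℝ 1 (deriv q) := by
      have h2 : ContDiff ℝ (1 + 1) q := by simpa [one_add_one_eq_two] using hq2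
      exact (contDiff_succ_iff_deriv.1 h2).2.2
    exact (this.differentiable (by norm_num) s).hasDerivAt
  have hm1 : ∀ s, HasDerivAt m1 (-(Complex.I / z) * (η s * m1 s + q s * n s)) s := fun s => by
    refine (h1 s).congr_deriv ?_
    simp only [hη, hn]; field_simp; ring
  set f : ℝ → ℂ := fun s => Complex.I / z * (η s * (n s + star (q s) * m1 s)) with hf
  have hnd : ∀ s, HasDerivAt n (-(2 * Complex.I * zet z) * n s +
      (f s - star (deriv q s) * m1 s)) s := fun s => by
    refine (((h0 s).const_mul z).sub ((hqd s).star.mul (hm1 s))).congr_deriv ?_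
    simp only [hf, hη, hn, zet]; field_simp; ring
  have hnlim : Tendsto n atTop (𝓝 0) := by
    have := (hl0.const_mul z).sub (hqlim.star.mul hl1)
    rwa [star_rt2_half, mul_one, mul_div_cancel₀ _ hz0, sub_self] at this
  have hI : ‖Complex.I / z‖ = 1 / ‖z‖ := by rw [norm_div, Complex.norm_I]
  have hz1 : 0 ≤ 1 / ‖z‖ := by positivity
  have hKz' : 1 / ‖z‖ * (10 * K) ≤ 1 := by
    rw [one_div, inv_mul_le_iff₀ hzp]; linarith
  have hfb : ∀ M N, 0 ≤ M → 0 ≤ N → (∀ s, 0 ≤ s → ‖m1 s‖ ≤ M) → (∀ s, 0 ≤ s → ‖n s‖ ≤ N) →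
      ∀ s, 0 ≤ s → ‖f s‖ ≤ 1 / ‖z‖ * K * (N + K * M) / (1 + s) ^ 4 := by
    intro M N hM hN hMb hNb s hs
    obtain ⟨b1, b2, b3, b4⟩ := hb s hs
    rw [hf]
    calc _ = 1 / ‖z‖ * (‖η s‖ * ‖n s + star (q s) * m1 s‖) := by rw [norm_mul, norm_mul, hI]
      _ ≤ 1 / ‖z‖ * (K / (1 + s) ^ 4 * (N + K * M)) := by
        gcongr
        · refine (norm_add_le _ _).trans ?_
          rw [norm_mul, norm_star]
          gcongr
          exacts [hNb s hs, hMb s hs]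
      _ = _ := by ring
  have hnb : ∀ M, 0 ≤ M → (∀ s, 0 ≤ s → ‖m1 s‖ ≤ M) →
      ∀ s, 0 ≤ s → ‖n s‖ ≤ 4 * K * M / (1 + s) ^ 3 := by
    intro M hM hMb
    have step : ∀ N, 0 ≤ N → (∀ s, 0 ≤ s → ‖n s‖ ≤ N) → ∀ s, 0 ≤ s →
        ‖n s‖ ≤ (N / 2 + 2 * K * M) / (1 + s) ^ 3 := by
      intro N hN hNb s hs
      refine norm_le_of_decay (by positivity) (by norm_num) hζ (fun s _ => hnd s) ?_ hnlim hs
      intro s hs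
      obtain ⟨b1, b2, b3, b4⟩ := hb s hs
      calc ‖f s - star (deriv q s) * m1 s‖ ≤ ‖f s‖ + ‖star (deriv q s) * m1 s‖ := norm_sub_le _ _
        _ ≤ 1 / ‖z‖ * K * (N + K * M) / (1 + s) ^ 4 + K / (1 + s) ^ 4 * M := by
          rw [norm_mul (star _), norm_star]
          gcongr
          exacts [hfb M N hM hN hMb hNb s hs, hMb s hs]
        _ = (1 / ‖z‖ * K * (N + K * M) + K * M) / (1 + s) ^ 4 := by ring
        _ ≤ _ := by
          refine div_le_div_of_nonneg_right ?_ (by positivity)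
          have : 1 / ‖z‖ * K * (N + K * M) ≤ 1 / 2 * (N + K * M) := by
            gcongr
            linarith
          nlinarith [mul_nonneg (by linarith : (0 : ℝ) ≤ K) hM]
    have hbd : ∃ B, 0 ≤ B ∧ ∀ x, 0 ≤ x → ‖n x‖ ≤ B :=
      exists_bound_of_tendsto (fun s _ => (hnd s).continuousAt) hnlim
    have h4 : ∀ s, 0 ≤ s → ‖n s‖ ≤ 2 * (2 * K * M) := fun s hs =>
      bound_of_improve hbd (fun N hN hNb s hs => (step N hN hNb s hs).trans (by
        rw [add_comm]
        refine div_le_self (by positivity) (one_le_pow₀ (by linarith)))) hs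
    intro s hs
    refine (step _ (by positivity) h4 s hs).trans (le_of_eq ?_)
    ring
  have hmb : ∀ M, 0 ≤ M → (∀ s, 0 ≤ s → ‖m1 s‖ ≤ M) → ∀ s, 0 ≤ s →
      ‖-(Complex.I / z) * (η s * m1 s + q s * n s)‖ ≤ 1 / ‖z‖ * (5 * K ^ 2 * M) / (1 + s) ^ 3 := by
    intro M hM hMb s hs
    obtain ⟨b1, b2, b3, b4⟩ := hb s hs
    have b2' : ‖η s‖ ≤ K / (1 + s) ^ 3 := b2.trans (div_pow_le_div_pow (by linarith) hs (by norm_num))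
    calc _ = 1 / ‖z‖ * ‖η s * m1 s + q s * n s‖ := by rw [norm_mul, norm_neg, hI]
      _ ≤ 1 / ‖z‖ * (K / (1 + s) ^ 3 * M + K * (4 * K * M / (1 + s) ^ 3)) := by
        gcongr
        refine (norm_add_le _ _).trans ?_
        rw [norm_mul, norm_mul]
        gcongr
        exacts [hMb s hs, hnb M hM hMb s hs]
      _ = 1 / ‖z‖ * (K * M + 4 * K ^ 2 * M) / (1 + s) ^ 3 := by ring
      _ ≤ _ := by
        gcongr
        nlinarith [mul_nonneg (mul_nonneg (by linarith : (0 : ℝ) ≤ K - 1)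
          (by linarith : (0 : ℝ) ≤ K)) hM]
  have hm1lim : Tendsto (fun s => m1 s - 1) atTop (𝓝 0) := by simpa using hl1.sub_const 1
  have hmd : ∀ M, 0 ≤ M → (∀ s, 0 ≤ s → ‖m1 s‖ ≤ M) → ∀ s, 0 ≤ s →
      ‖m1 s - 1‖ ≤ 1 / ‖z‖ * (5 * K ^ 2 * M) := by
    intro M hM hMb s hs
    refine (norm_le_of_decay (A := 1 / ‖z‖ * (5 * K ^ 2 * M)) (n := 2) (ζ := 0)
      (by positivity) (by norm_num) (by simp)
      (fun s _ => ((hm1 s).sub_const 1).congr_deriv (by simp)) (hmb M hM hMb) hm1lim hs).trans ?_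
    exact div_le_self (by positivity) (one_le_pow₀ (by linarith))
  have hK2 : 1 / ‖z‖ * (10 * K ^ 2) ≤ 1 := by
    rw [one_div, inv_mul_le_iff₀ hzp]; linarith
  have hM2 : ∀ s, 0 ≤ s → ‖m1 s‖ ≤ 2 := by
    intro s hs
    have := bound_of_improve (a := 1)
      (exists_bound_of_tendsto (fun s _ => (hm1 s).continuousAt) hl1) (fun M hM hMb s hs => ?_) hs
    · simpa using this
    · have h2 := hmd M hM hMb s hs
      have h3 := norm_add_le (m1 s - 1) 1
      rw [sub_add_cancel, norm_one] at h3
      nlinarith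
  have hN : ∀ s, 0 ≤ s → ‖n s‖ ≤ 8 * K := fun s hs =>
    (hnb 2 (by norm_num) hM2 s hs).trans ((div_le_self (by positivity)
      (one_le_pow₀ (by linarith))).trans (by linarith))
  refine ⟨(hmd 2 (by norm_num) hM2 0 le_rfl).trans (le_of_eq (by ring)), ?_⟩
  have hinv : ‖1 / (2 * z)‖ ≤ ‖z‖ / 2 := by
    rw [norm_div, norm_mul, norm_one, Complex.norm_ofNat,
      div_le_div_iff₀ (by positivity) (by norm_num)]
    nlinarith
  have h2ζ : 2 * zet z = z - 1 / (2 * z) := by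
    rw [zet]; field_simp; ring
  have hζu : ‖2 * zet z‖ ≤ 2 * ‖z‖ := by
    rw [h2ζ]
    exact (norm_sub_le _ _).trans (by linarith)
  have hζl : ‖z‖ / 2 ≤ ‖2 * zet z‖ := by
    rw [h2ζ]
    have := norm_sub_norm_le z (1 / (2 * z))
    linarith
  -- Removing the leading forced response of n: ℓ obeys the same oscillatory equation, and its
  -- source contains q'' and is bounded uniformly in z. A bound on ℓ(0) therefore gains the factor
  -- 1/ζ for n(0).
  set ℓ : ℝ → ℂ := fun s => 2 * Complex.I * zet z * n s + star (deriv q s) * m1 s with hℓ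
  have hℓd : ∀ s, HasDerivAt ℓ (-(2 * Complex.I * zet z) * ℓ s +
      (2 * zet z * (Complex.I * f s) + star (deriv (deriv q) s) * m1 s +
        star (deriv q s) * (-(Complex.I / z) * (η s * m1 s + q s * n s)))) s := fun s => by
    refine (((hnd s).const_mul (2 * Complex.I * zet z)).add
      ((hqd2 s).star.mul (hm1 s))).congr_deriv ?_
    simp only [hℓ]; ring
  have hdq : Tendsto (deriv q) atTop (𝓝 0) := by
    have hlim : Tendsto (fun s : ℝ => K / (1 + s)) atTop (𝓝 0) :=
      tendsto_const_nhds.div_atTop (tendsto_atTop_add_const_left _ _ tendsto_id)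
    refine squeeze_zero_norm' ((eventually_ge_atTop 0).mono fun s hs => ?_) hlim
    have := (hb s hs).2.2.1.trans (div_pow_le_div_pow (by linarith) hs (by norm_num : 1 ≤ 4))
    simpa using this
  have hℓlim : Tendsto ℓ atTop (𝓝 0) := by
    have := (hnlim.const_mul (2 * Complex.I * zet z)).add (hdq.star.mul hl1)
    rwa [mul_zero, star_zero, zero_mul, add_zero] at this
  have hℓb : ‖ℓ 0‖ ≤ 23 * K ^ 2 / (1 + 0) ^ 3 := by
    refine norm_le_of_decay (by positivity) (by norm_num) hζ (fun s _ => hℓd s) ?_ hℓlim le_rfl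
    intro s hs
    obtain ⟨b1, b2, b3, b4⟩ := hb s hs
    have c1 : ‖2 * zet z * (Complex.I * f s)‖ ≤ 20 * K ^ 2 / (1 + s) ^ 4 := by
      rw [norm_mul, norm_mul Complex.I, Complex.norm_I, one_mul]
      calc _ ≤ 2 * ‖z‖ * (1 / ‖z‖ * K * (8 * K + K * 2) / (1 + s) ^ 4) := by
            gcongr
            exact hfb 2 (8 * K) (by norm_num) (by linarith) hM2 hN s hs
        _ = _ := by field_simp; ring
    have c2 : ‖star (deriv (deriv q) s) * m1 s‖ ≤ K / (1 + s) ^ 4 * 2 := by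
      rw [norm_mul, norm_star]
      exact mul_le_mul b4 (hM2 s hs) (norm_nonneg _) (by positivity)
    have c3 : ‖star (deriv q s) * (-(Complex.I / z) * (η s * m1 s + q s * n s))‖ ≤
        K / (1 + s) ^ 4 * 1 := by
      rw [norm_mul, norm_star]
      refine mul_le_mul b3 ?_ (norm_nonneg _) (by positivity)
      refine (hmb 2 (by norm_num) hM2 s hs).trans ((div_le_self (by positivity)
        (one_le_pow₀ (by linarith))).trans ?_)
      linarith
    calc _ ≤ 20 * K ^ 2 / (1 + s) ^ 4 + K / (1 + s) ^ 4 * 2 + K / (1 + s) ^ 4 * 1 :=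
          (norm_add₃_le).trans (add_le_add (add_le_add c1 c2) c3)
      _ = (20 * K ^ 2 + 3 * K) / (1 + s) ^ 4 := by ring
      _ ≤ _ := by gcongr; nlinarith
  have hfin : ‖2 * zet z‖ * ‖n 0‖ ≤ 25 * K ^ 2 := by
    have e : 2 * Complex.I * zet z * n 0 = ℓ 0 - star (deriv q 0) * m1 0 := by
      simp only [hℓ]; ring
    have e2 : ‖2 * zet z‖ * ‖n 0‖ = ‖2 * Complex.I * zet z * n 0‖ := by
      rw [norm_mul, norm_mul, norm_mul, norm_mul, Complex.norm_I, mul_one]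
    rw [e2, e]
    refine (norm_sub_le _ _).trans ?_
    rw [norm_mul, norm_star]
    have c1 : ‖deriv q 0‖ ≤ K := by simpa using (hb 0 le_rfl).2.2.1
    have c2 := mul_le_mul c1 (hM2 0 le_rfl) (norm_nonneg _) (by linarith)
    norm_num at hℓb
    nlinarith
  rw [le_div_iff₀ hzp]
  have := mul_le_mul_of_nonneg_right hζl (norm_nonneg (n 0))
  linarith

/-- The Jost solution at the origin for large spectral parameter. -/
theorem RightTame.jost_asymptotics {q : ℝ → ℂ} (hq : RightTame q) :
    ∃ K : ℝ, 1 ≤ K ∧ ‖q 0‖ ≤ K ∧ ∀ z ∈ sheet, 10 * K ^ 2 ≤ ‖z‖ →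
      ‖jost q z 0 1 - 1‖ ≤ 10 * K ^ 2 / ‖z‖ ∧
      ‖z * jost q z 0 0 - star (q 0) * jost q z 0 1‖ ≤ 50 * K ^ 2 / ‖z‖ := by
  obtain ⟨K, hK, hb⟩ := hq.exists_bounds
  obtain ⟨m, C, δ, hδ, -, -, -, h1, h2, -, h3⟩ := hq.jost_spec
  refine ⟨K, hK, (hb 0 le_rfl).1, fun z hz hzK => ?_⟩
  have hlim : ∀ i, Tendsto (fun x => m i x z) atTop (𝓝 ((![rt2 / 2 / z, 1] : Fin 2 → ℂ) i)) := by
    intro i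
    rw [tendsto_iff_norm_sub_tendsto_zero]
    refine squeeze_zero' (Eventually.of_forall fun x => norm_nonneg _)
      ((eventually_ge_atTop 0).mono fun x hx => h1 z hz i x hx) ?_
    simpa only [mul_zero] using hδ.const_mul (1 + 1 / ‖z‖)
  have hqlim : Tendsto q atTop (𝓝 (rt2 / 2)) := by
    obtain ⟨C, hC, h⟩ := hq.bound
    have hlim : Tendsto (fun s : ℝ => C / (1 + s)) atTop (𝓝 0) :=
      tendsto_const_nhds.div_atTop (tendsto_atTop_add_const_left _ _ tendsto_id)
    rw [tendsto_iff_norm_sub_tendsto_zero]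
    refine squeeze_zero' (Eventually.of_forall fun x => norm_nonneg _)
      ((eventually_ge_atTop 0).mono fun s hs => ?_) hlim
    have := (h s hs).1.trans (div_pow_le_div_pow hC hs (by norm_num : 1 ≤ 4))
    simpa using this
  have := asymptotics_aux hq.contDiff hK hb hqlim hz hzK (fun x => (h2 z hz x).1)
    (fun x => (h2 z hz x).2) (by simpa using hlim 0) (by simpa using hlim 1)
  simpa [h3 z hz] using this

theorem Tame.large_bounds {q : ℝ → ℂ} (hq : Tame q) : ∃ R : ℝ, 1 ≤ R ∧ ∀ z ∈ sheet, R ≤ ‖z‖ →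
    1 / 2 ≤ ‖wr q z‖ ∧ (star z = z → ‖wrB q z‖ ≤ R / ‖z‖ ^ 2) := by
  obtain ⟨K₁, hK₁, hq₁, h₁⟩ := hq.right.jost_asymptotics
  obtain ⟨K₂, hK₂, -, h₂⟩ := hq.left.jost_asymptotics
  set K := max K₁ K₂ with hKdef
  have hK : 1 ≤ K := hK₁.trans (le_max_left _ _)
  have e1 : K₁ ^ 2 ≤ K ^ 2 := pow_le_pow_left₀ (by linarith) (le_max_left _ _) 2
  have e2 : K₂ ^ 2 ≤ K ^ 2 := pow_le_pow_left₀ (by linarith) (le_max_right _ _) 2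
  have hqK : ‖q 0‖ ≤ K := hq₁.trans (le_max_left _ _)
  refine ⟨200 * K ^ 2, by nlinarith, fun z hz hzR => ?_⟩
  have hzp : 0 < ‖z‖ := by nlinarith
  have hz0 := hz.2.1
  set a0 := jost q z 0 0
  set a1 := jost q z 0 1
  set b0 := jost (GPMarchenko.refl q) z 0 0
  set b1 := jost (GPMarchenko.refl q) z 0 1
  have H₁ := h₁ z hz (by nlinarith)
  have H₂ := h₂ z hz (by nlinarith)
  have hrefl : star (GPMarchenko.refl q 0) = -q 0 := by simp [GPMarchenko.refl]
  rw [hrefl] at H₂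
  have A1 : ‖a1 - 1‖ ≤ 10 * K ^ 2 / ‖z‖ := H₁.1.trans (by gcongr)
  have B1 : ‖b1 - 1‖ ≤ 10 * K ^ 2 / ‖z‖ := H₂.1.trans (by gcongr)
  have A0 : ‖z * a0 - star (q 0) * a1‖ ≤ 50 * K ^ 2 / ‖z‖ := H₁.2.trans (by gcongr)
  have B0 : ‖z * b0 - -q 0 * b1‖ ≤ 50 * K ^ 2 / ‖z‖ := H₂.2.trans (by gcongr)
  have hd : K ^ 2 / ‖z‖ ≤ 1 / 200 := by rw [div_le_div_iff₀ hzp (by norm_num)]; linarith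
  have hdK : K ^ 2 / ‖z‖ ≤ K := by nlinarith
  simp only [mul_div_assoc] at A1 B1 A0 B0
  set d := K ^ 2 / ‖z‖
  have hd0 : 0 ≤ d := by positivity
  have a1n : ‖a1‖ ≤ 2 := by
    have := norm_add_le (a1 - 1) 1
    rw [sub_add_cancel, norm_one] at this
    linarith
  have b1n : ‖b1‖ ≤ 2 := by
    have := norm_add_le (b1 - 1) 1
    rw [sub_add_cancel, norm_one] at this
    linarith
  constructor
  · have a0n : ‖z * a0‖ ≤ 3 * K := by
      have := norm_add_le (z * a0 - star (q 0) * a1) (star (q 0) * a1)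
      rw [sub_add_cancel, norm_mul (star _), norm_star] at this
      nlinarith [mul_le_mul hqK a1n (norm_nonneg _) (by linarith)]
    have b0n : ‖z * b0‖ ≤ 3 * K := by
      have := norm_add_le (z * b0 - -q 0 * b1) (-q 0 * b1)
      rw [sub_add_cancel, norm_mul (-q 0), norm_neg] at this
      nlinarith [mul_le_mul hqK b1n (norm_nonneg _) (by linarith)]
    have hab : ‖a0 * b0‖ ≤ 1 / 4 := by
      have : ‖z‖ ^ 2 * ‖a0 * b0‖ = ‖z * a0‖ * ‖z * b0‖ := by
        simp only [norm_mul]; ring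
      have h3 : ‖z * a0‖ * ‖z * b0‖ ≤ 3 * K * (3 * K) :=
        mul_le_mul a0n b0n (norm_nonneg _) (by positivity)
      rw [← this] at h3
      have h4 : (200 * K ^ 2) ^ 2 ≤ ‖z‖ ^ 2 := pow_le_pow_left₀ (by positivity) hzR 2
      have h5 := norm_nonneg (a0 * b0)
      have h6 : 36 * K ^ 2 ≤ ‖z‖ ^ 2 := by
        have : (1 : ℝ) ≤ K ^ 2 := one_le_pow₀ hK
        nlinarith
      have h7 := mul_le_mul_of_nonneg_right h6 h5
      have h8 : 0 < K ^ 2 := by positivity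
      by_contra! hcon
      nlinarith [mul_lt_mul_of_pos_left hcon h8]
    have h1 : wr q z = 1 + (a0 * b0 + (a1 - 1) * b1 + (b1 - 1)) := by
      simp only [wr, a0, a1, b0, b1]; ring
    have h2 : ‖a0 * b0 + (a1 - 1) * b1 + (b1 - 1)‖ ≤ 1 / 2 := by
      refine (norm_add₃_le).trans ?_
      rw [norm_mul (a1 - 1)]
      have := mul_le_mul A1 b1n (norm_nonneg _) (by positivity)
      linarith
    rw [h1]
    have := norm_sub_norm_le (1 : ℂ) (-(a0 * b0 + (a1 - 1) * b1 + (b1 - 1)))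
    rw [sub_neg_eq_add, norm_neg, norm_one] at this
    linarith
  · intro hreal
    -- The two terms with q(0) cancel because `refl q` at 0 equals −q(0)*. Both remaining brackets
    -- are O(1/z), which is the source of the quadratic decay.
    have e : z * wrB q z = b1 * star (z * a0 - star (q 0) * a1) + (z * b0 - -q 0 * b1) * star a1 := by
      simp only [wrB, star_sub, star_mul, star_star, hreal]
      ring
    have h1 : ‖z‖ * ‖wrB q z‖ ≤ 200 * K ^ 2 / ‖z‖ := by
      rw [← norm_mul, e]
      refine (norm_add_le _ _).trans ?_
      rw [norm_mul, norm_mul, norm_star, norm_star]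
      have c1 := mul_le_mul b1n A0 (norm_nonneg _) (by norm_num)
      have c2 := mul_le_mul B0 a1n (norm_nonneg _) (by positivity)
      rw [mul_div_assoc]
      linarith
    rw [le_div_iff₀ (by positivity)]
    rw [le_div_iff₀ hzp] at h1
    linarith

theorem norm_neg_inv (z : ℂ) : ‖-(1 / (2 * z))‖ = 1 / (2 * ‖z‖) := by
  rw [norm_neg, norm_div, norm_mul, norm_one, Complex.norm_ofNat]

theorem norm_one_div_two_sq (z : ℂ) : ‖1 / (2 * z ^ 2)‖ = 1 / (2 * ‖z‖ ^ 2) := by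
  rw [norm_div, norm_mul, norm_one, Complex.norm_ofNat, norm_pow]

/-- This is `large_bounds` for the conjugate potential at −1/(2z). -/
theorem Tame.small_bounds {q : ℝ → ℂ} (hq : Tame q) : ∃ R : ℝ, 1 ≤ R ∧ ∀ z ∈ sheet,
    ‖z‖ ≤ 1 / (2 * R) →
    1 / (4 * ‖z‖ ^ 2) ≤ ‖wr q z‖ ∧ (star z = z → ‖wrB q z‖ ≤ 2 * R) := by
  obtain ⟨R, hR, h⟩ := hq.conj.large_bounds
  refine ⟨R, hR, fun z hz hzR => ?_⟩
  have hzp : 0 < ‖z‖ := norm_pos_iff.2 hz.2.1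
  have h1 := h _ (neg_inv_mem_sheet hz) (by
    rw [norm_neg_inv, le_div_iff₀ (by positivity)]
    rw [le_div_iff₀ (by positivity)] at hzR
    linarith)
  constructor
  · rw [hq.wr_neg_inv hz, norm_mul, norm_one_div_two_sq]
    calc 1 / (4 * ‖z‖ ^ 2) = 1 / (2 * ‖z‖ ^ 2) * (1 / 2) := by field_simp; norm_num
      _ ≤ _ := by gcongr; exact h1.1
  · intro hreal
    have h2 := h1.2 (by
      simp only [star_neg, star_div₀, star_mul, star_one, hreal, star_ofNat]
      ring)
    rw [hq.norm_wrB_neg_inv hz, norm_one_div_two_sq]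
    rw [norm_neg_inv] at h2
    calc _ ≤ 1 / (2 * ‖z‖ ^ 2) * (R / (1 / (2 * ‖z‖)) ^ 2) := by gcongr
      _ = 2 * R := by field_simp

theorem two_zet {z : ℂ} (hz : z ≠ 0) : 2 * zet z = z - 1 / (2 * z) := by
  rw [zet]; field_simp; ring

theorem norm_zet_le (z : ℂ) : ‖zet z‖ ≤ ‖z‖ / 2 + 1 / (4 * ‖z‖) := by
  refine (norm_sub_le _ _).trans ?_
  rw [norm_div, norm_div, norm_mul, norm_one, Complex.norm_ofNat, Complex.norm_ofNat]

/-- The reflection coefficient is bounded by one and decays quadratically in `ζ`. -/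
theorem Tame.reflection_bound {q : ℝ → ℂ} (hq : Tame q) : ∃ C : ℝ, 0 ≤ C ∧ ∀ z ∈ sheet,
    star z = z → (1 + ‖zet z‖ ^ 2) * ‖wrB q z / wr q z‖ ≤ C := by
  obtain ⟨R₁, hR₁, h₁⟩ := hq.large_bounds
  obtain ⟨R₂, hR₂, h₂⟩ := hq.small_bounds
  refine ⟨16 * R₁ + 32 * R₂ + (1 + (R₁ + R₂) ^ 2), by positivity, fun z hz hreal => ?_⟩
  have hzp : 0 < ‖z‖ := norm_pos_iff.2 hz.2.1
  have hζ := norm_zet_le z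
  have hζ0 := norm_nonneg (zet z)
  rw [norm_div]
  by_cases c1 : R₁ ≤ ‖z‖
  · obtain ⟨b1, b2⟩ := h₁ z hz c1
    have b2 := b2 hreal
    have b3 : ‖wrB q z‖ / ‖wr q z‖ ≤ 2 * (R₁ / ‖z‖ ^ 2) := by
      rw [div_le_iff₀ (by linarith)]
      nlinarith [norm_nonneg (wrB q z), (by positivity : 0 ≤ R₁ / ‖z‖ ^ 2)]
    have b4 : ‖zet z‖ ≤ ‖z‖ := by
      have : 1 / (4 * ‖z‖) ≤ ‖z‖ / 2 := by
        rw [div_le_div_iff₀ (by positivity) (by norm_num)]; nlinarith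
      linarith
    calc _ ≤ (‖z‖ ^ 2 + ‖z‖ ^ 2) * (2 * (R₁ / ‖z‖ ^ 2)) := by
          gcongr; nlinarith
      _ = 4 * R₁ := by field_simp; norm_num
      _ ≤ _ := by nlinarith [sq_nonneg (R₁ + R₂)]
  by_cases c2 : ‖z‖ ≤ 1 / (2 * R₂)
  · obtain ⟨b1, b2⟩ := h₂ z hz c2
    have b2 := b2 hreal
    have hz12 : ‖z‖ ≤ 1 / 2 := c2.trans (by
      rw [div_le_div_iff₀ (by positivity) (by norm_num)]; linarith)
    have b1' : 1 ≤ ‖wr q z‖ * (4 * ‖z‖ ^ 2) := by rwa [div_le_iff₀ (by positivity)] at b1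
    have hwp : 0 < ‖wr q z‖ := lt_of_lt_of_le (by positivity) b1
    have b3 : ‖wrB q z‖ / ‖wr q z‖ ≤ 2 * R₂ * (4 * ‖z‖ ^ 2) := by
      rw [div_le_iff₀ hwp]
      nlinarith
    have b4 : ‖zet z‖ ≤ 1 / ‖z‖ := by
      refine hζ.trans ?_
      rw [le_div_iff₀ hzp]
      have : (‖z‖ / 2 + 1 / (4 * ‖z‖)) * ‖z‖ = ‖z‖ ^ 2 / 2 + 1 / 4 := by field_simp
      rw [this]; nlinarith
    calc _ ≤ ((1 / ‖z‖) ^ 2 + (1 / ‖z‖) ^ 2) * (2 * R₂ * (4 * ‖z‖ ^ 2)) := by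
          gcongr
          apply one_le_pow₀
          rw [le_div_iff₀ hzp]; linarith
      _ = 16 * R₂ := by field_simp; norm_num
      _ ≤ _ := by nlinarith [sq_nonneg (R₁ + R₂)]
  -- On the compact remainder ζ is bounded, and unitarity gives a quotient at most one, even at the
  -- thresholds.
  · push Not at c1 c2
    have b1 := (norm_sq_lt_of_real hq hz hreal).1
    have b2 : ‖wrB q z‖ / ‖wr q z‖ ≤ 1 := div_le_one_of_le₀ b1 (norm_nonneg _)
    have b3 : ‖zet z‖ ≤ R₁ + R₂ := by
      have : 1 / (4 * ‖z‖) ≤ R₂ / 2 := by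
        rw [div_lt_iff₀ (by positivity)] at c2
        rw [div_le_div_iff₀ (by positivity) (by norm_num)]
        linarith
      linarith
    calc _ ≤ (1 + (R₁ + R₂) ^ 2) * 1 := by gcongr
      _ ≤ _ := by nlinarith

/-! ### Bound on the inverse of the transmission coefficient -/

/-- Control of `1/a` near the points over `ζ = 0`. -/
theorem Tame.bound_near_threshold {q : ℝ → ℂ} (hq : Tame q) {z₀ : ℂ} (hz₀ : z₀ ∈ upper)
    (huniq : ∀ z ∈ upper, wr q z = 0 → z = z₀) {t : ℝ} (ht : t ^ 2 = 1 / 2) :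
    ∃ δ C : ℝ, 0 < δ ∧ 0 ≤ C ∧ ∀ z ∈ upper, ‖z - t‖ < δ → ‖1 - 1 / (2 * z ^ 2)‖ ≤ C * ‖wr q z‖ := by
  obtain ⟨c, hc, hlow⟩ := hq.wr_lower_bound (R := 1) le_rfl
  have hne : z₀ - t ≠ 0 := by
    intro h
    have := congrArg Complex.im h
    simp at this
    exact (ne_of_gt hz₀) this
  have hd0 : 0 < ‖z₀ - t‖ := norm_pos_iff.2 hne
  have htn : 0.7 < |t| ∧ |t| < 0.71 := by
    have h0 := abs_nonneg t
    rw [← sq_abs] at ht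
    constructor <;> nlinarith
  -- Within this radius the disc about z of radius Im z / 2 used below misses z₀ and stays in 1/2 ≤
  -- |w| ≤ 1, since 1/10 + 1/20 = 3/20.
  refine ⟨min (1 / 10) (‖z₀ - t‖ / 2), 32 / c, lt_min (by norm_num) (by linarith),
    by positivity, fun z hz hzd => ?_⟩
  have hzd1 : ‖z - t‖ < 1 / 10 := hzd.trans_le (min_le_left _ _)
  have hzd2 : ‖z - t‖ < ‖z₀ - t‖ / 2 := hzd.trans_le (min_le_right _ _)
  have hy : 0 < z.im := hz
  have hyle : z.im ≤ ‖z - t‖ := by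
    have := Complex.abs_im_le_norm (z - t)
    simp at this
    exact (le_abs_self _).trans this
  set x := z.re - t with hx
  have hxle : |x| ≤ ‖z - t‖ := by
    have := Complex.abs_re_le_norm (z - t)
    simpa using this
  have hsum : ‖z - t‖ ≤ |x| + z.im := by
    have := Complex.norm_le_abs_re_add_abs_im (z - t)
    simpa [abs_of_pos hy] using this
  have htc : ‖(t : ℂ)‖ = |t| := by rw [Complex.norm_real, Real.norm_eq_abs]
  have hnear : ∀ w : ℂ, ‖w - t‖ ≤ 3 / 20 → 1 / 2 ≤ ‖w‖ ∧ ‖w‖ ≤ 1 := by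
    intro w hw
    have h1 := norm_sub_norm_le (t : ℂ) w
    have h2 := norm_add_le (w - t) t
    rw [sub_add_cancel] at h2
    rw [norm_sub_rev] at h1
    constructor <;> linarith
  obtain ⟨hzl, hzu⟩ := hnear z (by linarith)
  have hz0 := (upper_subset_sheet hz).2.1
  have hD : ‖1 - 1 / (2 * z ^ 2)‖ ≤ 8 * ‖z - t‖ := by
    have e : 1 - 1 / (2 * z ^ 2) = (z - t) * (z + t) / z ^ 2 := by
      have : (t : ℂ) ^ 2 = 1 / 2 := by rw [← Complex.ofReal_pow, ht]; norm_num
      field_simp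
      linear_combination 2 * this
    rw [e, norm_div, norm_mul, norm_pow, div_le_iff₀ (by positivity)]
    have h1 : ‖z + t‖ ≤ 2 := (norm_add_le _ _).trans (by linarith)
    have h2 : 1 / 4 ≤ ‖z‖ ^ 2 := by nlinarith
    nlinarith [norm_nonneg (z - t), mul_le_mul_of_nonneg_left h1 (norm_nonneg (z - t)),
      mul_le_mul_of_nonneg_left h2 (norm_nonneg (z - t))]
  suffices h : c / 4 * ‖z - t‖ ≤ ‖wr q z‖ by
    calc _ ≤ 8 * ‖z - t‖ := hD
      _ = 32 / c * (c / 4 * ‖z - t‖) := by field_simp; ring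
      _ ≤ _ := by gcongr
  have hnsq : 2 * Complex.normSq z - 1 = 2 * (x * (2 * t + x) + z.im ^ 2) := by
    have : z.re = t + x := by rw [hx]; ring
    rw [Complex.normSq_apply, this]
    linear_combination 2 * ht
  -- When z − t is mostly horizontal, |2|z|² − 1| is comparable to |z − t| and the energy bound
  -- suffices. In the other case z may lie on the circle, where that bound is void, and the maximum
  -- principle takes over.
  by_cases hcase : z.im ≤ |x|
  · have h1 := hlow z hz (by linarith) hzu
    have h2 : |x| ≤ |2 * Complex.normSq z - 1| := by
      rw [hnsq, abs_mul, abs_two]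
      have h3 : |x * (2 * t + x)| ≤ |x * (2 * t + x) + z.im ^ 2| + z.im ^ 2 := by
        have := abs_sub_abs_le_abs_sub (x * (2 * t + x)) (-z.im ^ 2)
        rw [abs_neg, abs_of_nonneg (sq_nonneg z.im)] at this
        have e : x * (2 * t + x) - -z.im ^ 2 = x * (2 * t + x) + z.im ^ 2 := by ring
        rw [e] at this
        linarith
      have h4 : 1.2 ≤ |2 * t + x| := by
        have := abs_sub_abs_le_abs_sub (2 * t) (-x)
        rw [abs_neg, abs_mul, abs_two, sub_neg_eq_add] at this
        linarith
      rw [abs_mul] at h3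
      nlinarith [abs_nonneg x, mul_le_mul_of_nonneg_left h4 (abs_nonneg x)]
    nlinarith [mul_le_mul_of_nonneg_left h2 hc.le]
  · push Not at hcase
    set ρ := z.im / 2 with hρ
    have hρ0 : 0 < ρ := by positivity
    set κ : ℝ := Complex.normSq z - 1 / 2 + ρ ^ 2 with hκ
    -- On the circle |w − z| = ρ one has w* = z* + ρ²/(w − z), and there this polynomial equals (w −
    -- z)(|w|² − 1/2). The energy bound thus gives |g/`wr`| ≤ ρ/(2c) on the circle; at the centre
    -- g(z) = zρ² does not vanish.
    set g : ℂ → ℂ := fun w => star z * (w - z) ^ 2 + κ * (w - z) + z * (ρ : ℂ) ^ 2 with hg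
    have hball : ∀ w ∈ Metric.closedBall z ρ, w ∈ upper ∧ wr q w ≠ 0 ∧ 1 / 2 ≤ ‖w‖ ∧ ‖w‖ ≤ 1 := by
      intro w hw
      rw [Metric.mem_closedBall, dist_eq_norm] at hw
      have him : w ∈ upper := by
        have := Complex.abs_im_le_norm (w - z)
        rw [Complex.sub_im] at this
        have := (abs_le.1 (this.trans hw)).1
        show 0 < w.im
        linarith
      have hwt : ‖w - t‖ ≤ ‖w - z‖ + ‖z - t‖ := by
        have := norm_add_le (w - z) (z - t)
        rwa [sub_add_sub_cancel] at this
      refine ⟨him, fun h => ?_, hnear w (by linarith)⟩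
      rw [huniq w him h] at hwt hw
      linarith
    have hmax := Complex.norm_le_of_forall_mem_frontier_norm_le
      (f := fun w => g w / wr q w) (C := ρ / (2 * c)) (U := Metric.ball z ρ) Metric.isBounded_ball
      (DifferentiableOn.diffContOnCl (by
        rw [closure_ball z hρ0.ne']
        refine DifferentiableOn.div ?_ (hq.differentiableOn_wr.mono fun w hw => (hball w hw).1)
          fun w hw => (hball w hw).2.1
        rw [hg]; fun_prop)) (fun w hw => ?_)
      (subset_closure (Metric.mem_ball_self hρ0))
    · have hwz : wr q z ≠ 0 := (hball z (Metric.mem_closedBall_self hρ0.le)).2.1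
      rw [norm_div, div_le_div_iff₀ (norm_pos_iff.2 hwz) (by positivity)] at hmax
      have hgz : ‖g z‖ = ‖z‖ * ρ ^ 2 := by
        simp [hg, abs_of_pos hρ0]
      rw [hgz] at hmax
      have h1 : ‖z‖ * ρ * (2 * c) ≤ ‖wr q z‖ := by
        have : ‖z‖ * ρ * (2 * c) * ρ ≤ ‖wr q z‖ * ρ := by linarith
        exact le_of_mul_le_mul_right this hρ0
      have h2 : 1 / 2 * ρ * (2 * c) ≤ ‖z‖ * ρ * (2 * c) := by gcongr
      nlinarith
    · rw [frontier_ball z hρ0.ne'] at hw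
      obtain ⟨hwu, hwn, hwl, hwr⟩ := hball w (Metric.sphere_subset_closedBall hw)
      rw [Metric.mem_sphere, dist_eq_norm] at hw
      have h1 := hlow w hwu (by linarith) hwr
      have h2 : ‖g w‖ = ρ * |Complex.normSq w - 1 / 2| := by
        have hs : (w - z) * star (w - z) = (ρ : ℂ) ^ 2 := by
          rw [RCLike.star_def, Complex.mul_conj, Complex.normSq_eq_norm_sq, hw]; push_cast; ring
        have e : g w = (w - z) * ((Complex.normSq w - 1 / 2 : ℝ) : ℂ) := by
          have e1 : ((Complex.normSq w : ℝ) : ℂ) = w * star w := (Complex.mul_conj w).symm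
          have e2 : ((Complex.normSq z : ℝ) : ℂ) = z * star z := (Complex.mul_conj z).symm
          simp only [hg, hκ]
          push_cast
          rw [e1, e2]
          rw [star_sub] at hs
          linear_combination (-w) * hs
        rw [e, norm_mul, hw, Complex.norm_real, Real.norm_eq_abs]
      rw [norm_div, h2, div_le_div_iff₀ (norm_pos_iff.2 hwn) (by positivity)]
      have h3 : |2 * Complex.normSq w - 1| = 2 * |Complex.normSq w - 1 / 2| := by
        rw [← abs_two, ← abs_mul, abs_two]; congr 1; ring
      rw [h3] at h1
      nlinarith

/-- For large and small z the explicit bounds apply. On the compact rest local bounds are glued: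
near a threshold by `bound_near_threshold`, elsewhere by continuity on `sheet`, where `wr` is
nonzero on the real axis by unitarity and off it by uniqueness of the zero. -/
theorem Tame.transmission_bound {q : ℝ → ℂ} (hq : Tame q) {z₀ : ℂ} (hz₀ : z₀ ∈ upper)
    (huniq : ∀ z ∈ upper, wr q z = 0 → z = z₀) {ρ : ℝ} (hρ : 0 < ρ) :
    ∃ C : ℝ, 0 ≤ C ∧ ∀ z ∈ upper, ρ ≤ ‖z - z₀‖ → ‖1 - 1 / (2 * z ^ 2)‖ ≤ C * ‖wr q z‖ := by
  obtain ⟨R₁, hR₁, h₁⟩ := hq.large_bounds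
  obtain ⟨R₂, hR₂, h₂⟩ := hq.small_bounds
  set A : Set ℂ := {z | 0 ≤ z.im ∧ 1 / (2 * R₂) ≤ ‖z‖ ∧ ρ ≤ ‖z - z₀‖} ∩ Metric.closedBall 0 R₁
    with hA
  have hAc : IsCompact A := by
    refine (isCompact_closedBall 0 R₁).inter_left ?_
    exact (isClosed_le continuous_const Complex.continuous_im).inter
      ((isClosed_le continuous_const continuous_norm).inter
      (isClosed_le continuous_const (continuous_id.sub continuous_const).norm))
  have key : ∃ C : ℝ, 0 ≤ C ∧ ∀ z ∈ A, z ∈ upper → ‖1 - 1 / (2 * z ^ 2)‖ ≤ C * ‖wr q z‖ := by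
    refine hAc.induction_on (p := fun s => ∃ C : ℝ, 0 ≤ C ∧ ∀ z ∈ s, z ∈ upper →
      ‖1 - 1 / (2 * z ^ 2)‖ ≤ C * ‖wr q z‖) ⟨0, le_rfl, by simp⟩ ?_ ?_ ?_
    · rintro s t hst ⟨C, hC, h⟩
      exact ⟨C, hC, fun z hz => h z (hst hz)⟩
    · rintro s t ⟨C, hC, h⟩ ⟨C', hC', h'⟩
      refine ⟨max C C', le_max_of_le_left hC, ?_⟩
      rintro z (hz | hz) hzu
      · exact (h z hz hzu).trans (by gcongr; exact le_max_left _ _)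
      · exact (h' z hz hzu).trans (by gcongr; exact le_max_right _ _)
    · rintro p ⟨⟨hp1, hp2, hp3⟩, hp4⟩
      have hp0 : p ≠ 0 := by
        rintro rfl
        rw [norm_zero] at hp2
        have : 0 < 1 / (2 * R₂) := by positivity
        linarith
      by_cases hζ : zet p = 0
      · rw [zet_eq_zero_iff hp0] at hζ
        have him : p.im = 0 := by
          have hre := congrArg Complex.re hζ
          have him := congrArg Complex.im hζ
          simp [sq, Complex.mul_re, Complex.mul_im] at hre him
          by_contra h
          have : p.re = 0 := by
            have : p.re * p.im = 0 := by linarith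
            exact (mul_eq_zero.1 this).resolve_right h
          rw [this] at hre
          nlinarith [sq_nonneg p.im]
        have hpr : (p.re : ℂ) = p := Complex.ext (by simp) (by simp [him])
        have ht : p.re ^ 2 = 1 / 2 := by
          rw [← hpr] at hζ
          have := congrArg Complex.re hζ
          rw [← Complex.ofReal_pow, Complex.ofReal_re] at this
          simpa using this
        obtain ⟨δ, C, hδ, hC, h⟩ := hq.bound_near_threshold hz₀ huniq ht
        rw [hpr] at h
        refine ⟨Metric.ball p δ, mem_nhdsWithin_of_mem_nhds (Metric.ball_mem_nhds p hδ), C, hC, ?_⟩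
        intro z hz hzu
        exact h z hzu (by rwa [Metric.mem_ball, dist_eq_norm] at hz)
      · have hps : p ∈ sheet := ⟨hp1, hp0, hζ⟩
        have hw : wr q p ≠ 0 := by
          rcases hp1.lt_or_eq with h | h
          · intro hw0
            have := huniq p h hw0
            rw [this, sub_self, norm_zero] at hp3
            linarith
          · exact (norm_sq_lt_of_real hq hps (Complex.conj_eq_iff_im.2 h.symm)).2
        have hcont : ContinuousWithinAt (fun z => (1 - 1 / (2 * z ^ 2)) / wr q z) sheet p := by
          refine ContinuousWithinAt.div ?_ (hq.continuousOn_wr p hps) hw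
          have : (2 : ℂ) * p ^ 2 ≠ 0 := mul_ne_zero two_ne_zero (pow_ne_zero 2 hp0)
          exact ContinuousAt.continuousWithinAt (by fun_prop (disch := assumption))
        have hev : ∀ᶠ z in 𝓝[sheet] p, ‖(1 - 1 / (2 * z ^ 2)) / wr q z‖ <
            ‖(1 - 1 / (2 * p ^ 2)) / wr q p‖ + 1 :=
          hcont.norm.eventually (gt_mem_nhds (by linarith))
        have hev2 : ∀ᶠ z in 𝓝[sheet] p, wr q z ≠ 0 := (hq.continuousOn_wr p hps).eventually_ne hw
        have hev3 := hev.and hev2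
        rw [eventually_nhdsWithin_iff] at hev3
        refine ⟨_, mem_nhdsWithin_of_mem_nhds hev3, ‖(1 - 1 / (2 * p ^ 2)) / wr q p‖ + 1,
          by positivity, fun z hz hzu => ?_⟩
        obtain ⟨h1, h2⟩ := hz (upper_subset_sheet hzu)
        rw [norm_div, div_lt_iff₀ (norm_pos_iff.2 h2)] at h1
        exact h1.le
  obtain ⟨C, hC, h⟩ := key
  refine ⟨C + 6, by positivity, fun z hz hzρ => ?_⟩
  have hzp : 0 < ‖z‖ := norm_pos_iff.2 (upper_subset_sheet hz).2.1
  have hW := norm_nonneg (wr q z)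
  have hDn : ‖1 - 1 / (2 * z ^ 2)‖ ≤ 1 + 1 / (2 * ‖z‖ ^ 2) := by
    have := norm_sub_le 1 (1 / (2 * z ^ 2))
    rwa [norm_one, norm_one_div_two_sq] at this
  by_cases c1 : R₁ ≤ ‖z‖
  · have b1 := (h₁ z (upper_subset_sheet hz) c1).1
    have b2 : 1 / (2 * ‖z‖ ^ 2) ≤ 1 := by
      rw [div_le_one (by positivity)]; nlinarith
    nlinarith
  by_cases c2 : ‖z‖ ≤ 1 / (2 * R₂)
  · have b1 := (h₂ z (upper_subset_sheet hz) c2).1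
    have hz12 : ‖z‖ ≤ 1 / 2 := c2.trans (by
      rw [div_le_div_iff₀ (by positivity) (by norm_num)]; linarith)
    have b2 : 1 ≤ 1 / (4 * ‖z‖ ^ 2) := by
      rw [le_div_iff₀ (by positivity)]; nlinarith
    have b3 : 1 / (2 * ‖z‖ ^ 2) = 2 * (1 / (4 * ‖z‖ ^ 2)) := by field_simp; norm_num
    nlinarith
  · push Not at c1 c2
    have := h z ⟨⟨le_of_lt hz, c2.le, hzρ⟩, by simpa using c1.le⟩ hz
    nlinarith

/-! ### Transport equations on a half-plane -/

section Slices

theorem continuousOn_slice {E : Type*} [NormedAddCommGroup E] {G : ℝ → ℝ → E} {S : Set ℝ}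
    (hG : ContinuousOn (fun P : ℝ × ℝ => G P.1 P.2) {P | P.2 ∈ S}) (x : ℝ) :
    ContinuousOn (G x) S :=
  hG.comp (f := fun t => (x, t)) (by fun_prop) fun _ ht => ht

variable {E : Type*} [NormedAddCommGroup E]

theorem intervalIntegrable_slice {G : ℝ → ℝ → E}
    (hG : ContinuousOn (fun P : ℝ × ℝ => G P.1 P.2) {P | 0 < P.2}) (x : ℝ) {δ L : ℝ} (hδ : 0 < δ)
    (hL : δ ≤ L) : IntervalIntegrable (G x) volume δ L := by
  refine ContinuousOn.intervalIntegrable ?_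
  rw [Set.uIcc_of_le hL]
  exact (continuousOn_slice (S := Set.Ioi 0) hG x).mono fun t ht => hδ.trans_le ht.1

theorem hasDerivAt_integral_slice [NormedSpace ℝ E] {F F' : ℝ → ℝ → E}
    (hF : ContinuousOn (fun P : ℝ × ℝ => F P.1 P.2) {P | 0 < P.2})
    (hF' : ContinuousOn (fun P : ℝ × ℝ => F' P.1 P.2) {P | 0 < P.2})
    (hd : ∀ x t, 0 < t → HasDerivAt (fun x => F x t) (F' x t) x) {δ L : ℝ} (hδ : 0 < δ)
    (hL : δ ≤ L) (x : ℝ) :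
    HasDerivAt (fun x => ∫ t in δ..L, F x t) (∫ t in δ..L, F' x t) x := by
  have hsub : ∀ t ∈ Set.uIoc δ L, 0 < t := fun t ht => by
    rw [Set.uIoc_of_le hL] at ht
    exact hδ.trans ht.1
  have hcomp : IsCompact (Set.Icc (x - 1) (x + 1) ×ˢ Set.Icc δ L) :=
    isCompact_Icc.prod isCompact_Icc
  obtain ⟨B, hB⟩ := hcomp.exists_bound_of_continuousOn
    (hF'.mono fun P hP => hδ.trans_le hP.2.1)
  refine (intervalIntegral.hasDerivAt_integral_of_dominated_loc_of_deriv_le (bound := fun _ => B)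
    (Icc_mem_nhds (by linarith : x - 1 < x) (by linarith : x < x + 1))
    (Eventually.of_forall fun y => ?_) (intervalIntegrable_slice hF x hδ hL) ?_
    (Eventually.of_forall fun t ht y hy => ?_) intervalIntegrable_const
    (Eventually.of_forall fun t ht y hy => hd y t (hsub t ht))).2
  · exact (intervalIntegrable_iff.1 (intervalIntegrable_slice hF y hδ hL)).aestronglyMeasurable
  · exact (intervalIntegrable_iff.1 (intervalIntegrable_slice hF' x hδ hL)).aestronglyMeasurable
  · rw [Set.uIoc_of_le hL] at ht
    exact hB (y, t) ⟨hy, ht.1.le, ht.2⟩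

end Slices

/-- `f` solves `(∂ₓ - 2σ∂ₜ) f = g` on `t > 0` and is continuous up to `t = 0`. -/
structure Transport (σ : ℝ) (f g : ℝ → ℝ → ℂ) : Prop where
  cont : ContinuousOn (fun P : ℝ × ℝ => f P.1 P.2) {P | 0 ≤ P.2}
  cont_src : ContinuousOn (fun P : ℝ × ℝ => g P.1 P.2) {P | 0 ≤ P.2}
  exists_deriv : ∃ fx ft : ℝ → ℝ → ℂ,
    ContinuousOn (fun P : ℝ × ℝ => fx P.1 P.2) {P | 0 < P.2} ∧
    ContinuousOn (fun P : ℝ × ℝ => ft P.1 P.2) {P | 0 < P.2} ∧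
    ∀ x t, 0 < t → HasDerivAt (fun x => f x t) (fx x t) x ∧ HasDerivAt (f x) (ft x t) t ∧
      fx x t = g x t + 2 * σ * ft x t

theorem pos_subset_nonneg : {P : ℝ × ℝ | 0 < P.2} ⊆ {P | 0 ≤ P.2} := fun P hP => le_of_lt (show 0 < P.2 from hP)

/-- The t-derivative is integrated by parts, which leaves traces at δ and L and a multiple of the
transform itself. -/
theorem Transport.hasDerivAt_integral {σ : ℝ} {f g : ℝ → ℝ → ℂ} (h : Transport σ f g) (κ : ℂ)
    {δ L : ℝ} (hδ : 0 < δ) (hL : δ ≤ L) (x : ℝ) :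
    HasDerivAt (fun x => ∫ t in δ..L, f x t * Complex.exp (κ * t))
      ((∫ t in δ..L, g x t * Complex.exp (κ * t)) + 2 * σ * (f x L * Complex.exp (κ * L) -
        f x δ * Complex.exp (κ * δ) - κ * ∫ t in δ..L, f x t * Complex.exp (κ * t))) x := by
  obtain ⟨fx, ft, cx, ct, hd⟩ := h.exists_deriv
  have cf := h.cont.mono pos_subset_nonneg
  have cg := h.cont_src.mono pos_subset_nonneg
  have hec : Continuous fun P : ℝ × ℝ => Complex.exp (κ * (P.2 : ℂ)) := by fun_prop
  have hed : ∀ t : ℝ, HasDerivAt (fun t : ℝ => Complex.exp (κ * t)) (κ * Complex.exp (κ * t)) t :=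
    fun t => by
      have h1 : HasDerivAt (fun s : ℝ => κ * (s : ℂ)) κ t := by
        simpa using ((hasDerivAt_id t).ofReal_comp).const_mul κ
      exact h1.cexp.congr_deriv (mul_comm _ _)
  have c1 : ContinuousOn (fun P : ℝ × ℝ => f P.1 P.2 * Complex.exp (κ * (P.2 : ℂ))) {P | 0 < P.2} :=
    cf.mul hec.continuousOn
  have c2 : ContinuousOn (fun P : ℝ × ℝ => g P.1 P.2 * Complex.exp (κ * (P.2 : ℂ))) {P | 0 < P.2} :=
    cg.mul hec.continuousOn
  have c3 : ContinuousOn (fun P : ℝ × ℝ => ft P.1 P.2 * Complex.exp (κ * (P.2 : ℂ))) {P | 0 < P.2} :=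
    ct.mul hec.continuousOn
  have c4 : ContinuousOn (fun P : ℝ × ℝ => fx P.1 P.2 * Complex.exp (κ * (P.2 : ℂ))) {P | 0 < P.2} :=
    cx.mul hec.continuousOn
  refine (hasDerivAt_integral_slice (F := fun x t => f x t * Complex.exp (κ * t))
    (F' := fun x t => fx x t * Complex.exp (κ * t)) c1 c4
    (fun x t ht => (hd x t ht).1.mul_const _) hδ hL x).congr_deriv ?_
  have i1 := intervalIntegrable_slice (G := fun x t => f x t * Complex.exp (κ * t)) c1 x hδ hL
  have i2 := intervalIntegrable_slice (G := fun x t => g x t * Complex.exp (κ * t)) c2 x hδ hL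
  have i3 := intervalIntegrable_slice (G := fun x t => ft x t * Complex.exp (κ * t)) c3 x hδ hL
  have hftc : ∫ t in δ..L, (ft x t * Complex.exp (κ * t) + f x t * (κ * Complex.exp (κ * t))) =
      f x L * Complex.exp (κ * L) - f x δ * Complex.exp (κ * δ) := by
    refine intervalIntegral.integral_eq_sub_of_hasDerivAt
      (f := fun t : ℝ => f x t * Complex.exp (κ * t)) (fun t ht => ?_) ?_
    · rw [Set.uIcc_of_le hL] at ht
      exact (hd x t (hδ.trans_le ht.1)).2.1.mul (hed t)
    · refine i3.add ((i1.const_mul κ).congr fun t _ => ?_)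
      ring
  have e1 : ∫ t in δ..L, (ft x t * Complex.exp (κ * t) + f x t * (κ * Complex.exp (κ * t))) =
      (∫ t in δ..L, ft x t * Complex.exp (κ * t)) + κ * ∫ t in δ..L, f x t * Complex.exp (κ * t) := by
    rw [← intervalIntegral.integral_const_mul, ← intervalIntegral.integral_add i3 (i1.const_mul κ)]
    refine intervalIntegral.integral_congr fun t _ => ?_
    ring
  have e2 : ∫ t in δ..L, fx x t * Complex.exp (κ * t) =
      (∫ t in δ..L, g x t * Complex.exp (κ * t)) +
        2 * σ * ∫ t in δ..L, ft x t * Complex.exp (κ * t) := by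
    rw [← intervalIntegral.integral_const_mul, ← intervalIntegral.integral_add i2 (i3.const_mul _)]
    refine intervalIntegral.integral_congr fun t ht => ?_
    rw [Set.uIcc_of_le hL] at ht
    simp only [(hd x t (hδ.trans_le ht.1)).2.2]
    ring
  rw [e2]
  rw [e1] at hftc
  linear_combination 2 * (σ : ℂ) * hftc

/-- The regularized modulus `√(|w|² + ε²)`. -/
def smoothNorm (ε : ℝ) (w : ℂ) : ℝ := Real.sqrt (Complex.normSq w + ε ^ 2)

theorem smoothNorm_pos {ε : ℝ} (hε : 0 < ε) (w : ℂ) : 0 < smoothNorm ε w :=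
  Real.sqrt_pos.2 (add_pos_of_nonneg_of_pos (Complex.normSq_nonneg w) (by positivity))

theorem norm_le_smoothNorm (ε : ℝ) (w : ℂ) : ‖w‖ ≤ smoothNorm ε w := by
  refine Real.le_sqrt_of_sq_le ?_
  rw [Complex.normSq_eq_norm_sq]
  nlinarith [sq_nonneg ε]

theorem smoothNorm_le {ε : ℝ} (hε : 0 < ε) (w : ℂ) : smoothNorm ε w ≤ ‖w‖ + ε := by
  refine Real.sqrt_le_iff.2 ⟨by positivity, ?_⟩
  rw [Complex.normSq_eq_norm_sq]
  nlinarith [mul_nonneg (norm_nonneg w) hε.le]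

theorem continuous_smoothNorm (ε : ℝ) : Continuous (smoothNorm ε) :=
  Real.continuous_sqrt.comp (Complex.continuous_normSq.add continuous_const)

theorem hasDerivAt_smoothNorm {ε : ℝ} (hε : 0 < ε) {f : ℝ → ℂ} {f' : ℂ} {x : ℝ}
    (hf : HasDerivAt f f' x) :
    HasDerivAt (fun x => smoothNorm ε (f x)) ((star (f x) * f').re / smoothNorm ε (f x)) x := by
  have h1 := (hasDerivAt_normSq hf).add_const (ε ^ 2)
  refine (h1.sqrt (ne_of_gt (add_pos_of_nonneg_of_pos (Complex.normSq_nonneg _)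
    (by positivity)))).congr_deriv ?_
  rw [smoothNorm]
  field_simp

/-- The regularized modulus makes the L¹ norm differentiable, and the transport term becomes a
difference of traces. The trace at t = L enters with a favourable sign and is dropped, so no decay
in t is needed. -/
theorem Transport.hasDerivAt_smoothNorm {σ : ℝ} {f g : ℝ → ℝ → ℂ} (h : Transport σ f g)
    (hσ0 : 0 ≤ σ) (hσ1 : σ ≤ 1) {ε : ℝ} (hε : 0 < ε)
    {δ L : ℝ} (hδ : 0 < δ) (hL : δ ≤ L) (x : ℝ) : ∃ D : ℝ,
    HasDerivAt (fun x => ∫ t in δ..L, smoothNorm ε (f x t)) D x ∧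
      -(∫ t in δ..L, ‖g x t‖) - 2 * (‖f x δ‖ + ε) ≤ D := by
  obtain ⟨fx, ft, cx, ct, hd⟩ := h.exists_deriv
  have cf := h.cont.mono pos_subset_nonneg
  have cg := h.cont_src.mono pos_subset_nonneg
  have cs : ContinuousOn (fun P : ℝ × ℝ => smoothNorm ε (f P.1 P.2)) {P | 0 < P.2} :=
    (continuous_smoothNorm ε).comp_continuousOn cf
  have hn : ∀ w : ℂ, smoothNorm ε w ≠ 0 := fun w => (smoothNorm_pos hε w).ne'
  have cdiv : ∀ {k : ℝ → ℝ → ℂ}, ContinuousOn (fun P : ℝ × ℝ => k P.1 P.2) {P | 0 < P.2} →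
      ContinuousOn (fun P : ℝ × ℝ => (star (f P.1 P.2) * k P.1 P.2).re /
        smoothNorm ε (f P.1 P.2)) {P | 0 < P.2} := fun hk =>
    (Complex.continuous_re.comp_continuousOn (cf.star.mul hk)).div cs fun P _ => hn _
  refine ⟨_, hasDerivAt_integral_slice (F := fun x t => smoothNorm ε (f x t))
    (F' := fun x t => (star (f x t) * fx x t).re / smoothNorm ε (f x t)) cs (cdiv cx)
    (fun x t ht => GPMarchenko.hasDerivAt_smoothNorm hε (hd x t ht).1) hδ hL x, ?_⟩
  have i2 := intervalIntegrable_slice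
    (G := fun x t => (star (f x t) * g x t).re / smoothNorm ε (f x t)) (cdiv cg) x hδ hL
  have i3 := intervalIntegrable_slice
    (G := fun x t => (star (f x t) * ft x t).re / smoothNorm ε (f x t)) (cdiv ct) x hδ hL
  have i4 := intervalIntegrable_slice (G := fun x t => ‖g x t‖) cg.norm x hδ hL
  have hftc : ∫ t in δ..L, (star (f x t) * ft x t).re / smoothNorm ε (f x t) =
      smoothNorm ε (f x L) - smoothNorm ε (f x δ) := by
    refine intervalIntegral.integral_eq_sub_of_hasDerivAt
      (f := fun t : ℝ => smoothNorm ε (f x t)) (fun t ht => ?_) i3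
    rw [Set.uIcc_of_le hL] at ht
    exact GPMarchenko.hasDerivAt_smoothNorm hε (hd x t (hδ.trans_le ht.1)).2.1
  have e2 : ∫ t in δ..L, (star (f x t) * fx x t).re / smoothNorm ε (f x t) =
      (∫ t in δ..L, (star (f x t) * g x t).re / smoothNorm ε (f x t)) +
        2 * σ * ∫ t in δ..L, (star (f x t) * ft x t).re / smoothNorm ε (f x t) := by
    rw [← intervalIntegral.integral_const_mul, ← intervalIntegral.integral_add i2 (i3.const_mul _)]
    refine intervalIntegral.integral_congr fun t ht => ?_
    rw [Set.uIcc_of_le hL] at ht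
    simp only [(hd x t (hδ.trans_le ht.1)).2.2]
    have : (star (f x t) * (g x t + 2 * σ * ft x t)).re =
        (star (f x t) * g x t).re + 2 * σ * (star (f x t) * ft x t).re := by
      have : star (f x t) * (g x t + 2 * σ * ft x t) =
          star (f x t) * g x t + ((2 * σ : ℝ) : ℂ) * (star (f x t) * ft x t) := by
        push_cast; ring
      rw [this, Complex.add_re, Complex.re_ofReal_mul]
    rw [this]
    ring
  have e3 : -(∫ t in δ..L, ‖g x t‖) ≤
      ∫ t in δ..L, (star (f x t) * g x t).re / smoothNorm ε (f x t) := by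
    rw [← intervalIntegral.integral_neg]
    refine intervalIntegral.integral_mono_on hL i4.neg i2 fun t _ => ?_
    rw [neg_le, ← neg_div, div_le_iff₀ (smoothNorm_pos hε _)]
    have h1 := (neg_le_abs _).trans (Complex.abs_re_le_norm (star (f x t) * g x t))
    rw [norm_mul, norm_star] at h1
    have h2 := norm_le_smoothNorm ε (f x t)
    nlinarith [norm_nonneg (g x t)]
  rw [e2, hftc]
  have h1 := smoothNorm_le hε (f x δ)
  have h2 := (smoothNorm_pos hε (f x L)).le
  have h3 := (smoothNorm_pos hε (f x δ)).le
  nlinarith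

/-- Backward Gronwall inequality. -/
theorem backward_gronwall {E D : ℝ → ℝ} {a b c B : ℝ} (hc : 0 < c)
    (hE : ∀ x, HasDerivAt E (D x) x) (hD : ∀ x, a ≤ x → x ≤ b → -c * E x - B ≤ D x) {x : ℝ}
    (hax : a ≤ x) (hxb : x ≤ b) :
    E x ≤ Real.exp (c * (b - x)) * (E b + B / c) - B / c := by
  have hd : ∀ y, HasDerivAt (fun y => Real.exp (c * y) * (E y + B / c))
      (Real.exp (c * y) * (c * E y + B + D y)) y := fun y => by
    have h1 : HasDerivAt (fun y => Real.exp (c * y)) (Real.exp (c * y) * c) y := by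
      simpa using ((hasDerivAt_id y).const_mul c).exp
    refine (h1.mul ((hE y).add_const _)).congr_deriv ?_
    field_simp
  have hmono : MonotoneOn (fun y => Real.exp (c * y) * (E y + B / c)) (Set.Icc a b) := by
    refine monotoneOn_of_deriv_nonneg (convex_Icc a b)
      (fun y _ => (hd y).continuousAt.continuousWithinAt)
      (fun y _ => (hd y).differentiableAt.differentiableWithinAt) fun y hy => ?_
    rw [interior_Icc] at hy
    rw [(hd y).deriv]
    have := hD y hy.1.le hy.2.le
    exact mul_nonneg (Real.exp_pos _).le (by linarith)
  have h1 := hmono ⟨hax, hxb⟩ ⟨hax.trans hxb, le_rfl⟩ hxb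
  simp only at h1
  have h2 : Real.exp (c * (b - x)) = Real.exp (c * b) * Real.exp (-(c * x)) := by
    rw [← Real.exp_add]; congr 1; ring
  have h3 : Real.exp (-(c * x)) * Real.exp (c * x) = 1 := by rw [← Real.exp_add]; simp
  rw [h2]
  have h4 := mul_le_mul_of_nonneg_left h1 (Real.exp_pos (-(c * x))).le
  have h5 : Real.exp (-(c * x)) * (Real.exp (c * x) * (E x + B / c)) = E x + B / c := by
    rw [← mul_assoc, h3, one_mul]
  rw [h5] at h4
  linarith

section Family

variable {ι : Type*} [Fintype ι] {σ : ι → ℝ} {f g : ι → ℝ → ℝ → ℂ}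

theorem intervalIntegrable_fun_sum {F : ι → ℝ → ℝ} {a b : ℝ}
    (h : ∀ i, IntervalIntegrable (F i) volume a b) :
    IntervalIntegrable (fun t => ∑ i, F i t) volume a b := by
  have := IntervalIntegrable.sum Finset.univ fun i _ => h i
  exact this.congr fun t _ => by simp

theorem Transport.intervalIntegrable_norm {s : ℝ} {f g : ℝ → ℝ → ℂ} (h : Transport s f g)
    (x : ℝ) {δ L : ℝ} (hδ : 0 < δ) (hL : δ ≤ L) :
    IntervalIntegrable (fun t => ‖f x t‖) volume δ L :=
  (intervalIntegrable_slice (h.cont.mono pos_subset_nonneg) x hδ hL).norm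

/-- Propagation of integrability to the left for a system of transport equations. -/
theorem Transport.local_bound (h : ∀ i, Transport (σ i) (f i) (g i))
    (hσ : ∀ i, 0 ≤ σ i ∧ σ i ≤ 1) {a b c : ℝ} (hab : a ≤ b) (hc : 0 < c)
    (hg : ∀ x ∈ Set.Icc a b, ∀ t, 0 < t → ∑ i, ‖g i x t‖ ≤ c * ∑ i, ‖f i x t‖)
    (hint : ∀ i, IntegrableOn (f i b) (Set.Ioi 0)) :
    ∃ C, 0 ≤ C ∧ ∀ x ∈ Set.Icc a b, ∀ δ L, 0 < δ → δ ≤ 1 → 1 ≤ L →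
      ∀ i, ∫ t in δ..L, ‖f i x t‖ ≤ C := by
  have hcomp : IsCompact (Set.Icc a b ×ˢ Set.Icc (0 : ℝ) 1) := isCompact_Icc.prod isCompact_Icc
  have hB : ∀ i, ∃ B, ∀ P ∈ Set.Icc a b ×ˢ Set.Icc (0 : ℝ) 1, ‖f i P.1 P.2‖ ≤ B := fun i =>
    hcomp.exists_bound_of_continuousOn ((h i).cont.mono fun P hP => hP.2.1)
  choose B hB using hB
  have hB0 : ∀ i, 0 ≤ B i := fun i =>
    (norm_nonneg _).trans (hB i (a, 0) ⟨⟨le_rfl, hab⟩, le_rfl, zero_le_one⟩)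
  set B' : ℝ := ∑ i, 2 * (B i + 1) with hB'
  have hB'0 : 0 ≤ B' := Finset.sum_nonneg fun i _ => by have := hB0 i; positivity
  set I₀ : ℝ := ∑ i, ((∫ t in Set.Ioi 0, ‖f i b t‖) + 1) with hI₀
  have hI₀0 : 0 ≤ I₀ := Finset.sum_nonneg fun i _ => by
    have : 0 ≤ ∫ t in Set.Ioi 0, ‖f i b t‖ := integral_nonneg fun t => norm_nonneg _
    positivity
  refine ⟨Real.exp (c * (b - a)) * (I₀ + B' / c), by positivity, fun x hx δ L hδ hδ1 hL i => ?_⟩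
  have hδL : δ ≤ L := hδ1.trans hL
  have hL0 : 0 < L := by linarith
  -- With ε = 1/L the regularization adds at most 1 to the integral over (δ, L), uniformly in L.
  set ε : ℝ := 1 / L with hε
  have hε0 : 0 < ε := by positivity
  have hε1 : ε ≤ 1 := by rw [hε, div_le_one hL0]; exact hL
  choose D hD1 hD2 using fun (x : ℝ) (i : ι) =>
    (h i).hasDerivAt_smoothNorm (hσ i).1 (hσ i).2 hε0 hδ hδL x
  set E : ℝ → ℝ := fun x => ∑ i, ∫ t in δ..L, smoothNorm ε (f i x t) with hE
  have hsn : ∀ i x, IntervalIntegrable (fun t => smoothNorm ε (f i x t)) volume δ L := fun i x =>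
    intervalIntegrable_slice (G := fun x t => smoothNorm ε (f i x t))
      ((continuous_smoothNorm ε).comp_continuousOn ((h i).cont.mono pos_subset_nonneg)) x hδ hδL
  have hle : ∀ i x, ∫ t in δ..L, ‖f i x t‖ ≤ ∫ t in δ..L, smoothNorm ε (f i x t) := fun i x =>
    intervalIntegral.integral_mono_on hδL ((h i).intervalIntegrable_norm x hδ hδL) (hsn i x)
      fun t _ => norm_le_smoothNorm _ _
  have hgr := backward_gronwall (E := E) (D := fun x => ∑ i, D x i) (a := a) (b := b) (B := B') hc
    (fun x => HasDerivAt.fun_sum fun i _ => hD1 x i) (fun y hay hyb => by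
      have hgi : ∀ i, IntervalIntegrable (fun t => ‖g i y t‖) volume δ L := fun i =>
        (intervalIntegrable_slice ((h i).cont_src.mono pos_subset_nonneg) y hδ hδL).norm
      have h1 : ∑ i, ∫ t in δ..L, ‖g i y t‖ ≤ c * E y := by
        rw [← intervalIntegral.integral_finsetSum fun i _ => hgi i]
        calc _ ≤ ∫ t in δ..L, c * ∑ i, ‖f i y t‖ := by
              refine intervalIntegral.integral_mono_on hδL
                (intervalIntegrable_fun_sum fun i => hgi i)
                ((intervalIntegrable_fun_sum fun i =>
                  (h i).intervalIntegrable_norm y hδ hδL).const_mul c) fun t ht => ?_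
              exact hg y ⟨hay, hyb⟩ t (hδ.trans_le ht.1)
          _ = c * ∑ i, ∫ t in δ..L, ‖f i y t‖ := by
              rw [intervalIntegral.integral_const_mul, intervalIntegral.integral_finsetSum
                fun i _ => (h i).intervalIntegrable_norm y hδ hδL]
          _ ≤ _ := by
              exact mul_le_mul_of_nonneg_left (Finset.sum_le_sum fun i _ => hle i y) hc.le
      have h2 : ∑ i, (-(∫ t in δ..L, ‖g i y t‖) - 2 * (B i + 1)) ≤ ∑ i, D y i :=
        Finset.sum_le_sum fun i _ => by
          have h3 := hB i (y, δ) ⟨⟨hay, hyb⟩, hδ.le, hδ1⟩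
          have h4 := hD2 y i
          simp only at h3
          linarith
      rw [Finset.sum_sub_distrib, Finset.sum_neg_distrib] at h2
      linarith) hx.1 hx.2
  have hEb : E b ≤ I₀ := by
    refine Finset.sum_le_sum fun i _ => ?_
    calc _ ≤ ∫ t in δ..L, (‖f i b t‖ + ε) := by
          refine intervalIntegral.integral_mono_on hδL (hsn i b)
            (((h i).intervalIntegrable_norm b hδ hδL).add intervalIntegrable_const)
            fun t _ => smoothNorm_le hε0 _
      _ = (∫ t in δ..L, ‖f i b t‖) + (L - δ) * ε := by
          rw [intervalIntegral.integral_add ((h i).intervalIntegrable_norm b hδ hδL)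
            intervalIntegrable_const, intervalIntegral.integral_const, smul_eq_mul]
      _ ≤ _ := by
          refine add_le_add ?_ ?_
          · rw [intervalIntegral.integral_of_le hδL]
            refine setIntegral_mono_set (hint i).norm
              (Eventually.of_forall fun t => norm_nonneg _) ?_
            exact (show Set.Ioc δ L ⊆ Set.Ioi 0 from fun t ht => hδ.trans ht.1).eventuallyLE
          · rw [hε, mul_one_div, div_le_one hL0]; linarith
  calc ∫ t in δ..L, ‖f i x t‖ ≤ ∫ t in δ..L, smoothNorm ε (f i x t) := hle i x
    _ ≤ E x := Finset.single_le_sum (f := fun i => ∫ t in δ..L, smoothNorm ε (f i x t))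
        (fun j _ => intervalIntegral.integral_nonneg hδL fun t _ => (smoothNorm_pos hε0 _).le)
        (Finset.mem_univ i)
    _ ≤ Real.exp (c * (b - x)) * (E b + B' / c) - B' / c := hgr
    _ ≤ Real.exp (c * (b - x)) * (E b + B' / c) := by
        have : 0 ≤ B' / c := by positivity
        linarith
    _ ≤ Real.exp (c * (b - a)) * (I₀ + B' / c) := by
        have hEb0 : 0 ≤ E b := Finset.sum_nonneg fun j _ =>
          intervalIntegral.integral_nonneg hδL fun t _ => (smoothNorm_pos hε0 _).le
        have := hx.1
        gcongr

/-- The trace on a far away line is small in the mean. -/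
theorem exists_small_trace {n : ℝ → ℝ → ℝ}
    (hn : ContinuousOn (fun P : ℝ × ℝ => n P.1 P.2) {P | 0 < P.2}) (hn0 : ∀ x t, 0 ≤ n x t)
    {a b C : ℝ} (hab : a ≤ b) (hC : ∀ x ∈ Set.Icc a b, ∀ L, 1 ≤ L → ∫ t in (1 : ℝ)..L, n x t ≤ C)
    {ε : ℝ} (hε : 0 < ε) {T : ℝ} (hT : 1 ≤ T) : ∃ L, T ≤ L ∧ ∫ x in a..b, n x L < ε := by
  by_contra! hcon
  -- If every trace on [T, L] were at least ε in the mean, Fubini would give an integral of at least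
  -- C(b − a) + 1, against the upper bound C(b − a).
  set L := T + (C * (b - a) + 1) / ε with hL
  have hC0 : 0 ≤ C := by simpa using hC a ⟨le_rfl, hab⟩ 1 le_rfl
  have hba : 0 ≤ b - a := sub_nonneg.2 hab
  have hTL : T ≤ L := by
    have : 0 ≤ (C * (b - a) + 1) / ε := by positivity
    linarith
  have h1L : (1 : ℝ) ≤ L := hT.trans hTL
  have hI : IntegrableOn (fun P : ℝ × ℝ => n P.1 P.2) (Set.Icc a b ×ˢ Set.Icc 1 L) := by
    refine ContinuousOn.integrableOn_compact (isCompact_Icc.prod isCompact_Icc) ?_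
    exact hn.mono fun P hP => lt_of_lt_of_le one_pos hP.2.1
  have hI' : Integrable (fun P : ℝ × ℝ => n P.1 P.2)
      ((volume.restrict (Set.Ioc a b)).prod (volume.restrict (Set.Ioc 1 L))) := by
    rw [Measure.prod_restrict]
    exact hI.mono_set (Set.prod_mono Set.Ioc_subset_Icc_self Set.Ioc_subset_Icc_self)
  have hswap : ∫ x in a..b, (∫ t in (1 : ℝ)..L, n x t) = ∫ t in (1 : ℝ)..L, ∫ x in a..b, n x t := by
    simp only [intervalIntegral.integral_of_le hab, intervalIntegral.integral_of_le h1L]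
    exact integral_integral_swap hI'
  have hii : IntervalIntegrable (fun t => ∫ x in a..b, n x t) volume 1 L := by
    rw [intervalIntegrable_iff_integrableOn_Ioc_of_le h1L]
    simp only [intervalIntegral.integral_of_le hab]
    exact hI'.integral_prod_right
  have hii2 : IntervalIntegrable (fun x => ∫ t in (1 : ℝ)..L, n x t) volume a b := by
    rw [intervalIntegrable_iff_integrableOn_Ioc_of_le hab]
    simp only [intervalIntegral.integral_of_le h1L]
    exact hI'.integral_prod_left
  have hupper : ∫ x in a..b, (∫ t in (1 : ℝ)..L, n x t) ≤ C * (b - a) := by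
    calc _ ≤ ∫ x in a..b, C := intervalIntegral.integral_mono_on hab hii2
          intervalIntegrable_const fun x hx => hC x hx L h1L
      _ = _ := by rw [intervalIntegral.integral_const, smul_eq_mul, mul_comm]
  have hsub : Set.uIcc T L ⊆ Set.uIcc 1 L := by
    rw [Set.uIcc_of_le hTL, Set.uIcc_of_le h1L]
    exact Set.Icc_subset_Icc_left hT
  have hlow : ε * (L - T) ≤ ∫ t in (1 : ℝ)..L, ∫ x in a..b, n x t := by
    calc ε * (L - T) = ∫ t in T..L, ε := by
          rw [intervalIntegral.integral_const, smul_eq_mul, mul_comm]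
      _ ≤ ∫ t in T..L, ∫ x in a..b, n x t :=
          intervalIntegral.integral_mono_on hTL intervalIntegrable_const (hii.mono_set hsub)
            fun t ht => hcon t ht.1
      _ ≤ _ := by
          rw [intervalIntegral.integral_of_le hTL, intervalIntegral.integral_of_le h1L]
          refine setIntegral_mono_set hii.1 (Eventually.of_forall fun t =>
            intervalIntegral.integral_nonneg hab fun x _ => hn0 x t) ?_
          exact (Set.Ioc_subset_Ioc_left hT).eventuallyLE
  have : ε * (L - T) = C * (b - a) + 1 := by
    rw [hL]; field_simp; ring
  linarith

end Family

/-- The limit passage for the kernel yields only an integrated equation. This gives continuity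
first; the right-hand side is then continuous, and `hasDerivAt_of_integral_eq` recovers the
differential equation. -/
theorem continuous_of_integral_eq {y F : ℝ → ℂ}
    (h : ∀ a b, a ≤ b → IntervalIntegrable F volume a b ∧ y b - y a = ∫ t in a..b, F t) :
    Continuous y := by
  have hi : ∀ a b, IntervalIntegrable F volume a b := fun a b => by
    rcases le_total a b with hab | hab
    exacts [(h a b hab).1, (h b a hab).1.symm]
  have e : y = fun b => y 0 + ∫ t in (0 : ℝ)..b, F t := by
    funext b
    rcases le_total 0 b with hb | hb
    · rw [← (h 0 b hb).2]; ring
    · rw [intervalIntegral.integral_symm, ← (h b 0 hb).2]; ring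
  rw [e]
  exact continuous_const.add (intervalIntegral.continuous_primitive hi 0)

theorem hasDerivAt_of_integral_eq {y F : ℝ → ℂ}
    (h : ∀ a b, a ≤ b → IntervalIntegrable F volume a b ∧ y b - y a = ∫ t in a..b, F t)
    (hF : Continuous F) (x : ℝ) : HasDerivAt y (F x) x := by
  have e : y = fun b => y 0 + ∫ t in (0 : ℝ)..b, F t := by
    funext b
    rcases le_total 0 b with hb | hb
    · rw [← (h 0 b hb).2]; ring
    · rw [intervalIntegral.integral_symm, ← (h b 0 hb).2]; ring
  rw [e]
  exact (intervalIntegral.integral_hasDerivAt_right (hF.intervalIntegrable _ _)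
    hF.stronglyMeasurable.stronglyMeasurableAtFilter hF.continuousAt).const_add _

theorem tendsto_intervalIntegral_Ioi {φ : ℝ → ℂ} (hφ : IntegrableOn φ (Set.Ioi 0))
    {δ L : ℕ → ℝ} (hδ : Tendsto δ atTop (𝓝 0)) (hδ0 : ∀ n, 0 < δ n) (hL : Tendsto L atTop atTop)
    (hδL : ∀ n, δ n ≤ L n) :
    Tendsto (fun n => ∫ t in δ n..L n, φ t) atTop (𝓝 (∫ t in Set.Ioi 0, φ t)) := by
  have hcov : AECover (volume.restrict (Set.Ioi (0 : ℝ))) atTop fun n => Set.Ioc (δ n) (L n) := by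
    refine ⟨?_, fun n => measurableSet_Ioc⟩
    refine (ae_restrict_iff' measurableSet_Ioi).2 (Eventually.of_forall fun t ht => ?_)
    filter_upwards [hδ.eventually (gt_mem_nhds (show (0 : ℝ) < t from ht)),
      hL.eventually (eventually_ge_atTop t)] with n h1 h2
    exact ⟨h1, h2⟩
  refine (hcov.integral_tendsto_of_countably_generated hφ).congr fun n => ?_
  rw [intervalIntegral.integral_of_le (hδL n), Measure.restrict_restrict measurableSet_Ioc]
  congr 2
  exact Set.inter_eq_left.2 fun t ht => (hδ0 n).trans ht.1

/-! ### Kernel representation of the Jost solution -/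

/-- Entries of a kernel in the coordinates `(x, y - x)`. -/
def shear (K : ℝ → ℝ → Matrix (Fin 2) (Fin 2) ℂ) (i j : Fin 2) (x t : ℝ) : ℂ := K x (x + t) i j

/-- In the variables (x, t) with t = y − x, the x-derivative is ∂ₓ + ∂_y and the t-derivative is
∂_y. Hence ∂ₓ + ∂_y becomes ∂ₓ and ∂ₓ − ∂_y becomes ∂ₓ − 2∂ₜ: diagonal entries have σ = 0,
off-diagonal ones σ = 1. -/
theorem Transport.of_contDiffOn {K : ℝ → ℝ → Matrix (Fin 2) (Fin 2) ℂ} {i j : Fin 2}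
    (hK : ContDiffOn ℝ 1 (fun P : ℝ × ℝ => K P.1 P.2 i j) {P | P.1 ≤ P.2}) {σ : ℝ}
    {g : ℝ → ℝ → ℂ} (hg : ContinuousOn (fun P : ℝ × ℝ => g P.1 P.2) {P | 0 ≤ P.2})
    (h : ∀ x y, x < y → dX K i j x y + dY K i j x y = g x (y - x) + 2 * σ * dY K i j x y) :
    Transport σ (shear K i j) g := by
  set k : ℝ × ℝ → ℂ := fun P => K P.1 P.2 i j with hk
  have hopen : IsOpen {P : ℝ × ℝ | P.1 < P.2} := isOpen_lt continuous_fst continuous_snd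
  have hk1 : ContDiffOn ℝ 1 k {P : ℝ × ℝ | P.1 < P.2} := hK.mono fun P hP => le_of_lt (show P.1 < P.2 from hP)
  have hfd := hk1.continuousOn_fderiv_of_isOpen hopen le_rfl
  have hshear : Continuous fun P : ℝ × ℝ => (P.1, P.1 + P.2) := by fun_prop
  have hd : ∀ P : ℝ × ℝ, P.1 < P.2 → HasFDerivAt k (fderiv ℝ k P) P := fun P hP =>
    ((hk1.differentiableOn (by norm_num) P hP).differentiableAt (hopen.mem_nhds hP)).hasFDerivAt
  have hX : ∀ x y, x < y → dX K i j x y = fderiv ℝ k (x, y) (1, 0) := fun x y hxy => by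
    have h1 : HasDerivAt (fun t : ℝ => (t, y)) ((1 : ℝ), (0 : ℝ)) x :=
      (hasDerivAt_id x).prodMk (hasDerivAt_const x y)
    exact ((hd (x, y) hxy).comp_hasDerivAt x h1).deriv
  have hY : ∀ x y, x < y → dY K i j x y = fderiv ℝ k (x, y) (0, 1) := fun x y hxy => by
    have h1 : HasDerivAt (fun t : ℝ => (x, t)) ((0 : ℝ), (1 : ℝ)) y :=
      (hasDerivAt_const y x).prodMk (hasDerivAt_id y)
    exact ((hd (x, y) hxy).comp_hasDerivAt y h1).deriv
  refine ⟨?_, hg, fun x t => fderiv ℝ k (x, x + t) (1, 1), fun x t => fderiv ℝ k (x, x + t) (0, 1),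
    ?_, ?_, fun x t ht => ?_⟩
  · refine hK.continuousOn.comp (f := fun P : ℝ × ℝ => (P.1, P.1 + P.2)) hshear.continuousOn
      fun P hP => ?_
    have : 0 ≤ P.2 := hP
    show P.1 ≤ P.1 + P.2
    linarith
  · refine ContinuousOn.clm_apply (hfd.comp (f := fun P : ℝ × ℝ => (P.1, P.1 + P.2))
      hshear.continuousOn fun P hP => ?_) continuousOn_const
    have : 0 < P.2 := hP
    show P.1 < P.1 + P.2
    linarith
  · refine ContinuousOn.clm_apply (hfd.comp (f := fun P : ℝ × ℝ => (P.1, P.1 + P.2))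
      hshear.continuousOn fun P hP => ?_) continuousOn_const
    have : 0 < P.2 := hP
    show P.1 < P.1 + P.2
    linarith
  · have hxt : x < x + t := by linarith
    refine ⟨?_, ?_, ?_⟩
    · have h1 : HasDerivAt (fun s : ℝ => (s, s + t)) ((1 : ℝ), (1 : ℝ)) x :=
        (hasDerivAt_id x).prodMk ((hasDerivAt_id x).add_const t)
      exact (hd (x, x + t) hxt).comp_hasDerivAt x h1
    · have h1 : HasDerivAt (fun s : ℝ => (x, x + s)) ((0 : ℝ), (1 : ℝ)) t :=
        (hasDerivAt_const t x).prodMk ((hasDerivAt_id t).const_add x)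
      exact (hd (x, x + t) hxt).comp_hasDerivAt t h1
    · have h1 := h x (x + t) hxt
      rw [hX _ _ hxt, hY _ _ hxt, add_sub_cancel_left] at h1
      rw [← h1, ← map_add]
      simp

/-- The right-hand sides of the kernel equations. -/
def shearSrc (q : ℝ → ℂ) (K : ℝ → ℝ → Matrix (Fin 2) (Fin 2) ℂ) (i j : Fin 2) (x t : ℝ) : ℂ :=
  Complex.I * (![-(rt2 / 2) * shear K 0 (j + 1) x t + star (q x) * shear K 1 j x t,
    -q x * shear K 0 j x t + rt2 / 2 * shear K 1 (j + 1) x t] : Fin 2 → ℂ) i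

/-- Twice the speed of the characteristics of the entries. -/
def shearSpeed (i j : Fin 2) : ℝ := if i = j then 0 else 1

theorem IsRightKernel.continuousOn_shear {q : ℝ → ℂ} {K : ℝ → ℝ → Matrix (Fin 2) (Fin 2) ℂ}
    (hK : IsRightKernel q K) (i j : Fin 2) :
    ContinuousOn (fun P : ℝ × ℝ => shear K i j P.1 P.2) {P | 0 ≤ P.2} := by
  refine (hK.smooth i j).continuousOn.comp (f := fun P : ℝ × ℝ => (P.1, P.1 + P.2))
    (by fun_prop) fun P hP => ?_
  have : 0 ≤ P.2 := hP
  show P.1 ≤ P.1 + P.2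
  linarith

/-- In `shearSrc` the index j + 1 is the other element of `Fin 2`, so that one formula covers the
four equations. -/
theorem IsRightKernel.transport {q : ℝ → ℂ} (hq : Continuous q)
    {K : ℝ → ℝ → Matrix (Fin 2) (Fin 2) ℂ} (hK : IsRightKernel q K) (i j : Fin 2) :
    Transport (shearSpeed i j) (shear K i j) (shearSrc q K i j) := by
  have hq1 : Continuous fun P : ℝ × ℝ => q P.1 := hq.comp continuous_fst
  have hc := hK.continuousOn_shear
  refine Transport.of_contDiffOn (hK.smooth i j) ?_ fun x y hxy => ?_
  · fin_cases i
    · exact continuousOn_const.mul ((continuousOn_const.mul (hc 0 (j + 1))).add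
        (hq1.star.continuousOn.mul (hc 1 j)))
    · exact continuousOn_const.mul ((hq1.neg.continuousOn.mul (hc 0 j)).add
        (continuousOn_const.mul (hc 1 (j + 1))))
  · have e : x + (y - x) = y := by ring
    have h11 := hK.eq_11 x y hxy
    have h22 := hK.eq_22 x y hxy
    have h12 := hK.eq_12 x y hxy
    have h21 := hK.eq_21 x y hxy
    fin_cases i <;> fin_cases j <;>
      simp [shearSrc, shearSpeed, shear, e] <;>
      simp only [RCLike.star_def] at h11 h22 h12 h21
    · linear_combination h11
    · linear_combination h12
    · linear_combination h21
    · linear_combination h22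

theorem integrableOn_shift {φ : ℝ → ℂ} {x : ℝ} (h : IntegrableOn φ (Set.Ioi x)) :
    IntegrableOn (fun t => φ (x + t)) (Set.Ioi 0) := by
  have := ((measurePreserving_add_left volume x).integrableOn_comp_preimage
    (measurableEmbedding_addLeft x)).2 h
  simpa [Function.comp_def] using this

theorem integral_shift {E : Type*} [NormedAddCommGroup E] [NormedSpace ℝ E] (φ : ℝ → E) (x : ℝ) :
    ∫ t in Set.Ioi 0, φ (x + t) = ∫ s in Set.Ioi x, φ s := by
  have := (measurePreserving_add_left volume x).setIntegral_preimage_emb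
    (measurableEmbedding_addLeft x) φ (Set.Ioi x)
  simpa using this

theorem IsRightKernel.integrable_shear {q : ℝ → ℂ} {K : ℝ → ℝ → Matrix (Fin 2) (Fin 2) ℂ}
    (hK : IsRightKernel q K) (i j : Fin 2) (x : ℝ) :
    IntegrableOn (shear K i j x) (Set.Ioi 0) := integrableOn_shift (hK.integrable i j x)

/-- The kernel is assumed integrable in y only for each x separately. Dominated convergence in x
needs a locally uniform bound, obtained by propagating integrability from b to the left. -/
theorem IsRightKernel.local_bound {q : ℝ → ℂ} (hq : Continuous q)
    {K : ℝ → ℝ → Matrix (Fin 2) (Fin 2) ℂ} (hK : IsRightKernel q K) {a b : ℝ} (hab : a ≤ b) :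
    ∃ C, 0 ≤ C ∧ ∀ x ∈ Set.Icc a b, ∀ δ L, 0 < δ → δ ≤ 1 → 1 ≤ L →
      ∀ i j, ∫ t in δ..L, ‖shear K i j x t‖ ≤ C := by
  obtain ⟨Q, hQ⟩ := (isCompact_Icc (a := a) (b := b)).exists_bound_of_continuousOn hq.continuousOn
  obtain ⟨C, hC, h⟩ := Transport.local_bound (ι := Fin 2 × Fin 2)
    (σ := fun p => shearSpeed p.1 p.2) (f := fun p => shear K p.1 p.2)
    (g := fun p => shearSrc q K p.1 p.2) (fun p => hK.transport hq p.1 p.2)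
    (fun p => by unfold shearSpeed; split_ifs <;> norm_num) hab
    (c := 2 * (|Q| + 1)) (by positivity) (fun x hx t _ => by
      have hqx : ‖q x‖ ≤ |Q| + 1 := (hQ x hx).trans ((le_abs_self Q).trans (by linarith))
      have hr : ‖rt2 / 2‖ ≤ |Q| + 1 := norm_rt2_half_le.trans (by linarith [abs_nonneg Q])
      have hb : ∀ (α β u v : ℂ), ‖α‖ ≤ |Q| + 1 → ‖β‖ ≤ |Q| + 1 →
          ‖Complex.I * (α * u + β * v)‖ ≤ (|Q| + 1) * ‖u‖ + (|Q| + 1) * ‖v‖ := by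
        intro α β u v hα hβ
        rw [norm_mul, Complex.norm_I, one_mul]
        refine (norm_add_le _ _).trans ?_
        rw [norm_mul, norm_mul]
        gcongr
      rw [Fintype.sum_prod_type, Fintype.sum_prod_type]
      simp only [Fin.sum_univ_two]
      have b00 := hb (-(rt2 / 2)) (star (q x)) (shear K 0 1 x t) (shear K 1 0 x t)
        (by rwa [norm_neg]) (by rwa [norm_star])
      have b01 := hb (-(rt2 / 2)) (star (q x)) (shear K 0 0 x t) (shear K 1 1 x t)
        (by rwa [norm_neg]) (by rwa [norm_star])
      have b10 := hb (-q x) (rt2 / 2) (shear K 0 0 x t) (shear K 1 1 x t)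
        (by rwa [norm_neg]) hr
      have b11 := hb (-q x) (rt2 / 2) (shear K 0 1 x t) (shear K 1 0 x t)
        (by rwa [norm_neg]) hr
      have e00 : shearSrc q K 0 0 x t = Complex.I * (-(rt2 / 2) * shear K 0 1 x t +
        star (q x) * shear K 1 0 x t) := rfl
      have e01 : shearSrc q K 0 1 x t = Complex.I * (-(rt2 / 2) * shear K 0 0 x t +
        star (q x) * shear K 1 1 x t) := rfl
      have e10 : shearSrc q K 1 0 x t = Complex.I * (-q x * shear K 0 0 x t +
        rt2 / 2 * shear K 1 1 x t) := rfl
      have e11 : shearSrc q K 1 1 x t = Complex.I * (-q x * shear K 0 1 x t +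
        rt2 / 2 * shear K 1 0 x t) := rfl
      rw [e00, e01, e10, e11]
      linarith) (fun p => hK.integrable_shear p.1 p.2 b)
  exact ⟨C, hC, fun x hx δ L h1 h2 h3 i j => h x hx δ L h1 h2 h3 (i, j)⟩

/-- Passage to the limit in the fundamental theorem of calculus. -/
theorem integral_eq_of_tendsto {y h r : ℕ → ℝ → ℂ} {Y H : ℝ → ℂ} {a b B : ℝ} (hab : a ≤ b)
    (hd : ∀ n x, HasDerivAt (y n) (h n x + r n x) x) (hh : ∀ n, Continuous (h n))
    (hr : ∀ n, Continuous (r n)) (hY : ∀ x ∈ Set.Icc a b, Tendsto (fun n => y n x) atTop (𝓝 (Y x)))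
    (hH : ∀ x ∈ Set.Icc a b, Tendsto (fun n => h n x) atTop (𝓝 (H x)))
    (hB : ∀ n, ∀ x ∈ Set.Icc a b, ‖h n x‖ ≤ B)
    (hr0 : Tendsto (fun n => ∫ x in a..b, ‖r n x‖) atTop (𝓝 0)) :
    IntervalIntegrable H volume a b ∧ Y b - Y a = ∫ x in a..b, H x := by
  have hsub : Set.uIoc a b ⊆ Set.Icc a b := by
    rw [Set.uIoc_of_le hab]; exact Set.Ioc_subset_Icc_self
  have hlim := intervalIntegral.tendsto_integral_filter_of_dominated_convergence (μ := volume)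
    (F := h) (f := H) (a := a) (b := b) (l := atTop) (fun _ => B)
    (Eventually.of_forall fun n => (hh n).aestronglyMeasurable)
    (Eventually.of_forall fun n => Eventually.of_forall fun x hx => hB n x (hsub hx))
    intervalIntegrable_const (Eventually.of_forall fun x hx => hH x (hsub hx))
  constructor
  · rw [intervalIntegrable_iff]
    have hmeas : AEStronglyMeasurable H (volume.restrict (Set.uIoc a b)) := by
      refine aestronglyMeasurable_of_tendsto_ae atTop (f := h)
        (fun n => (hh n).aestronglyMeasurable) ?_
      exact (ae_restrict_iff' measurableSet_uIoc).2
        (Eventually.of_forall fun x hx => hH x (hsub hx))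
    refine Integrable.mono' (g := fun _ => B) (intervalIntegrable_iff.1 intervalIntegrable_const) hmeas ?_
    refine (ae_restrict_iff' measurableSet_uIoc).2 (Eventually.of_forall fun x hx => ?_)
    exact le_of_tendsto (hH x (hsub hx)).norm (Eventually.of_forall fun n => hB n x (hsub hx))
  · have hftc : ∀ n, y n b - y n a = (∫ x in a..b, h n x) + ∫ x in a..b, r n x := fun n => by
      rw [← intervalIntegral.integral_add ((hh n).intervalIntegrable _ _)
        ((hr n).intervalIntegrable _ _)]
      exact (intervalIntegral.integral_eq_sub_of_hasDerivAt (fun x _ => hd n x)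
        (((hh n).add (hr n)).intervalIntegrable _ _)).symm
    have hr1 : Tendsto (fun n => ∫ x in a..b, r n x) atTop (𝓝 0) :=
      squeeze_zero_norm (fun n => intervalIntegral.norm_integral_le_integral_norm hab) hr0
    have h1 := (hY b ⟨hab, le_rfl⟩).sub (hY a ⟨le_rfl, hab⟩)
    have h2 := hlim.add hr1
    rw [add_zero] at h2
    exact tendsto_nhds_unique h1 (h2.congr fun n => (hftc n).symm)

/-- The truncated Laplace transform of a kernel entry. -/
def lapTrunc (K : ℝ → ℝ → Matrix (Fin 2) (Fin 2) ℂ) (κ : ℂ) (δ L : ℝ) (i j : Fin 2) (x : ℝ) : ℂ :=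
  ∫ t in δ..L, shear K i j x t * Complex.exp (κ * t)

/-- The Laplace transform of a kernel entry. -/
def lap (K : ℝ → ℝ → Matrix (Fin 2) (Fin 2) ℂ) (κ : ℂ) (i j : Fin 2) (x : ℝ) : ℂ :=
  ∫ t in Set.Ioi (0 : ℝ), shear K i j x t * Complex.exp (κ * t)

theorem norm_exp_mul_le_one {κ : ℂ} (hκ : κ.re ≤ 0) {t : ℝ} (ht : 0 ≤ t) :
    ‖Complex.exp (κ * t)‖ ≤ 1 := by
  rw [Complex.norm_exp, Real.exp_le_one_iff, Complex.re_mul_ofReal]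
  exact mul_nonpos_of_nonpos_of_nonneg hκ ht

theorem integrableOn_mul_exp {φ : ℝ → ℂ} (hφ : IntegrableOn φ (Set.Ioi 0)) {κ : ℂ}
    (hκ : κ.re ≤ 0) : IntegrableOn (fun t : ℝ => φ t * Complex.exp (κ * t)) (Set.Ioi 0) := by
  refine Integrable.mul_bdd (c := 1) hφ (by fun_prop) ?_
  exact (ae_restrict_iff' measurableSet_Ioi).2 (Eventually.of_forall fun t ht =>
    norm_exp_mul_le_one hκ (le_of_lt ht))

section

variable {q : ℝ → ℂ} {K : ℝ → ℝ → Matrix (Fin 2) (Fin 2) ℂ}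

theorem IsRightKernel.hasDerivAt_lapTrunc (hq : Continuous q) (hK : IsRightKernel q K) (κ : ℂ)
    {δ L : ℝ} (hδ : 0 < δ) (hL : δ ≤ L) (x : ℝ) :
    let A := lapTrunc K κ δ L
    HasDerivAt (A 0 0) (Complex.I * (-(rt2 / 2) * A 0 1 x + star (q x) * A 1 0 x)) x ∧
    HasDerivAt (A 1 1) (Complex.I * (-q x * A 0 1 x + rt2 / 2 * A 1 0 x)) x ∧
    HasDerivAt (A 0 1) (Complex.I * (-(rt2 / 2) * A 0 0 x + star (q x) * A 1 1 x) +
      2 * (shear K 0 1 x L * Complex.exp (κ * L) - shear K 0 1 x δ * Complex.exp (κ * δ) -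
        κ * A 0 1 x)) x ∧
    HasDerivAt (A 1 0) (Complex.I * (-q x * A 0 0 x + rt2 / 2 * A 1 1 x) +
      2 * (shear K 1 0 x L * Complex.exp (κ * L) - shear K 1 0 x δ * Complex.exp (κ * δ) -
        κ * A 1 0 x)) x := by
  intro A
  have hint : ∀ i j, IntervalIntegrable (fun t => shear K i j x t * Complex.exp (κ * t))
      volume δ L := fun i j =>
    (intervalIntegrable_slice ((hK.continuousOn_shear i j).mono pos_subset_nonneg) x hδ
      hL).mul_continuousOn (by fun_prop)
  have hsrc : ∀ (α β : ℂ) (i j k l : Fin 2),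
      ∫ t in δ..L, Complex.I * (α * shear K i j x t + β * shear K k l x t) * Complex.exp (κ * t) =
        Complex.I * (α * A i j x + β * A k l x) := fun α β i j k l => by
    simp only [A, lapTrunc]
    rw [← intervalIntegral.integral_const_mul, ← intervalIntegral.integral_const_mul,
      ← intervalIntegral.integral_add ((hint i j).const_mul α) ((hint k l).const_mul β),
      ← intervalIntegral.integral_const_mul]
    refine intervalIntegral.integral_congr fun t _ => ?_
    ring
  have h := fun i j => (hK.transport hq i j).hasDerivAt_integral κ hδ hL x
  refine ⟨(h 0 0).congr_deriv ?_, (h 1 1).congr_deriv ?_, (h 0 1).congr_deriv ?_,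
    (h 1 0).congr_deriv ?_⟩
  · rw [← hsrc]; simp [shearSpeed, shearSrc]
  · rw [← hsrc]; simp [shearSpeed, shearSrc]
  · rw [← hsrc]; simp [shearSpeed, shearSrc, A, lapTrunc]
  · rw [← hsrc]; simp [shearSpeed, shearSrc, A, lapTrunc]

theorem IsRightKernel.continuous_shear (hK : IsRightKernel q K) (i j : Fin 2) {t : ℝ} (ht : 0 ≤ t) :
    Continuous fun x => shear K i j x t := by
  have := (hK.continuousOn_shear i j).comp (f := fun x : ℝ => (x, t)) (s := Set.univ) (by fun_prop)
    fun x _ => ht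
  exact continuousOn_univ.1 this

theorem IsRightKernel.norm_lapTrunc_le (hK : IsRightKernel q K) {κ : ℂ} (hκ : κ.re ≤ 0) {δ L : ℝ}
    (hδ : 0 < δ) (hL : δ ≤ L) (i j : Fin 2) (x : ℝ) :
    ‖lapTrunc K κ δ L i j x‖ ≤ ∫ t in δ..L, ‖shear K i j x t‖ := by
  have hi := intervalIntegrable_slice ((hK.continuousOn_shear i j).mono pos_subset_nonneg) x hδ hL
  refine (intervalIntegral.norm_integral_le_integral_norm hL).trans ?_
  refine intervalIntegral.integral_mono_on hL
    (hi.mul_continuousOn (by fun_prop)).norm hi.norm fun t ht => ?_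
  rw [norm_mul]
  exact mul_le_of_le_one_right (norm_nonneg _)
    (norm_exp_mul_le_one hκ (hδ.le.trans ht.1))

/-- The integrated form of the equations satisfied by the Laplace transform of the kernel. -/
theorem IsRightKernel.integral_identity (hq : Continuous q) (hK : IsRightKernel q K) {z : ℂ}
    (hz : z ∈ sheet) {a b : ℝ} (hab : a ≤ b) :
    let A := lap K (Complex.I * zet z)
    let w := rt2 / 2 / z
    let Y : Fin 2 → ℝ → ℂ := fun i x => w * A i 0 x + A i 1 x
    let F0 := fun x => -(Complex.I * z) * Y 0 x + Complex.I * star (q x) * Y 1 x -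
      2 * shear K 0 1 x 0
    let F1 := fun x => Complex.I / (2 * z) * Y 1 x - Complex.I * q x * Y 0 x -
      2 * w * shear K 1 0 x 0
    (IntervalIntegrable F0 volume a b ∧ Y 0 b - Y 0 a = ∫ t in a..b, F0 t) ∧
    (IntervalIntegrable F1 volume a b ∧ Y 1 b - Y 1 a = ∫ t in a..b, F1 t) := by
  intro A w Y F0 F1
  have hz0 := hz.2.1
  set κ := Complex.I * zet z with hκ
  have hκre : κ.re ≤ 0 := I_mul_zet_re hz.1
  obtain ⟨C, hC, hbd⟩ := hK.local_bound hq hab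
  set n : ℝ → ℝ → ℝ := fun x t => ‖shear K 0 1 x t‖ + ‖shear K 1 0 x t‖ with hn
  have hnc : ContinuousOn (fun P : ℝ × ℝ => n P.1 P.2) {P | 0 < P.2} :=
    ((hK.continuousOn_shear 0 1).mono pos_subset_nonneg).norm.add
      ((hK.continuousOn_shear 1 0).mono pos_subset_nonneg).norm
  have hnint : ∀ x ∈ Set.Icc a b, ∀ L, 1 ≤ L → ∫ t in (1 : ℝ)..L, n x t ≤ C + C := by
    intro x hx L hL
    have hi := fun i j => intervalIntegrable_slice
      ((hK.continuousOn_shear i j).mono pos_subset_nonneg) x one_pos hL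
    rw [intervalIntegral.integral_add (hi 0 1).norm (hi 1 0).norm]
    exact add_le_add (hbd x hx 1 L one_pos le_rfl hL 0 1) (hbd x hx 1 L one_pos le_rfl hL 1 0)
  -- The cut-offs L k are chosen where the off-diagonal traces are small in the mean over [a, b];
  -- the boundary terms at L k then disappear in the integrated equation.
  choose L hLn hLε using fun k : ℕ => exists_small_trace hnc (fun x t => by positivity) hab hnint
    (ε := 1 / ((k : ℝ) + 1)) (by positivity) (T := (k : ℝ) + 1) (by
      have := Nat.cast_nonneg (α := ℝ) k; linarith)
  set δ : ℕ → ℝ := fun k => 1 / ((k : ℝ) + 1) with hδ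
  have hδ0 : ∀ k, 0 < δ k := fun k => by rw [hδ]; positivity
  have hδ1 : ∀ k, δ k ≤ 1 := fun k => by
    rw [hδ]; simp only
    rw [div_le_one (by positivity)]
    have := Nat.cast_nonneg (α := ℝ) k; linarith
  have hL1 : ∀ k, 1 ≤ L k := fun k => by
    have := Nat.cast_nonneg (α := ℝ) k; have := hLn k; linarith
  have hδL : ∀ k, δ k ≤ L k := fun k => (hδ1 k).trans (hL1 k)
  have hδlim : Tendsto δ atTop (𝓝 0) := tendsto_one_div_add_atTop_nhds_zero_nat
  have hLlim : Tendsto L atTop atTop :=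
    tendsto_atTop_mono hLn (tendsto_natCast_atTop_atTop.atTop_add tendsto_const_nhds)
  set An : ℕ → Fin 2 → Fin 2 → ℝ → ℂ := fun k => lapTrunc K κ (δ k) (L k) with hAn
  have hAlim : ∀ i j x, Tendsto (fun k => An k i j x) atTop (𝓝 (A i j x)) := fun i j x =>
    tendsto_intervalIntegral_Ioi (integrableOn_mul_exp (hK.integrable_shear i j x) hκre) hδlim hδ0
      hLlim hδL
  have hAbd : ∀ k i j, ∀ x ∈ Set.Icc a b, ‖An k i j x‖ ≤ C := fun k i j x hx =>
    (hK.norm_lapTrunc_le hκre (hδ0 k) (hδL k) i j x).trans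
      (hbd x hx _ _ (hδ0 k) (hδ1 k) (hL1 k) i j)
  have hder := fun k x => hK.hasDerivAt_lapTrunc hq κ (hδ0 k) (hδL k) x
  simp only at hder
  have hAc : ∀ k i j, Continuous (An k i j) := fun k i j => by
    rw [continuous_iff_continuousAt]
    intro x
    obtain ⟨h1, h2, h3, h4⟩ := hder k x
    fin_cases i <;> fin_cases j
    exacts [h1.continuousAt, h3.continuousAt, h4.continuousAt, h2.continuousAt]
  -- With w = √2/(2z) one has (√2/2)w = 1/(2z) and zw = √2/2. These relations close the system of
  -- four transforms into two equations of Jost type, with a trace at t = 0 as source.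
  set Yn : ℕ → Fin 2 → ℝ → ℂ := fun k i x => w * An k i 0 x + An k i 1 x with hYn
  have hYlim : ∀ i x, Tendsto (fun k => Yn k i x) atTop (𝓝 (Y i x)) := fun i x =>
    ((hAlim i 0 x).const_mul w).add (hAlim i 1 x)
  have hYc : ∀ k i, Continuous (Yn k i) := fun k i =>
    (continuous_const.mul (hAc k i 0)).add (hAc k i 1)
  have hYbd : ∀ k i, ∀ x ∈ Set.Icc a b, ‖Yn k i x‖ ≤ ‖w‖ * C + C := fun k i x hx => by
    refine (norm_add_le _ _).trans ?_
    rw [norm_mul]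
    gcongr
    exacts [hAbd k i 0 x hx, hAbd k i 1 x hx]
  have hw : rt2 / 2 * w = 1 / (2 * z) := by
    simp only [w]
    rw [← mul_div_assoc, rt2_half_sq, div_div]
  have hwz : z * w - rt2 / 2 = 0 := by simp only [w]; field_simp; ring
  have h2κ : 2 * κ = Complex.I * z - Complex.I / (2 * z) := by
    rw [hκ]
    have := two_zet hz0
    linear_combination Complex.I * this
  obtain ⟨Q, hQ⟩ := (isCompact_Icc (a := a) (b := b)).exists_bound_of_continuousOn hq.continuousOn
  have hQ0 : 0 ≤ Q := (norm_nonneg _).trans (hQ a ⟨le_rfl, hab⟩)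
  have htr : ∀ i j, ∃ B, 0 ≤ B ∧ ∀ k, ∀ x ∈ Set.Icc a b, ‖shear K i j x (δ k)‖ ≤ B := fun i j => by
    obtain ⟨B, hB⟩ := ((isCompact_Icc (a := a) (b := b)).prod
      (isCompact_Icc (a := (0 : ℝ)) (b := 1))).exists_bound_of_continuousOn
      ((hK.continuousOn_shear i j).mono fun P hP => hP.2.1)
    exact ⟨B, (norm_nonneg _).trans (hB (a, 0) ⟨⟨le_rfl, hab⟩, le_rfl, zero_le_one⟩),
      fun k x hx => hB (x, δ k) ⟨hx, (hδ0 k).le, hδ1 k⟩⟩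
  have htrlim : ∀ i j x, Tendsto (fun k => shear K i j x (δ k) * Complex.exp (κ * δ k)) atTop
      (𝓝 (shear K i j x 0)) := fun i j x => by
    have h1 : Tendsto (fun k => shear K i j x (δ k)) atTop (𝓝 (shear K i j x 0)) := by
      have hc := (continuousOn_slice (S := Set.Ici 0) (hK.continuousOn_shear i j) x) 0
        (Set.self_mem_Ici)
      exact hc.tendsto.comp (tendsto_nhdsWithin_iff.2
        ⟨hδlim, Eventually.of_forall fun k => (hδ0 k).le⟩)
    have h2 : Tendsto (fun k => Complex.exp (κ * (δ k : ℂ))) atTop (𝓝 1) := by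
      have hc : Continuous fun t : ℝ => Complex.exp (κ * t) := by fun_prop
      have := (hc.tendsto 0).comp hδlim
      simpa [Function.comp_def] using this
    simpa using h1.mul h2
  have hrlim : ∀ i j, (∀ k x, ‖shear K i j x (L k)‖ ≤ n x (L k)) → ∀ c : ℂ,
      Tendsto (fun k => ∫ x in a..b, ‖c * (shear K i j x (L k) * Complex.exp (κ * L k))‖) atTop
        (𝓝 0) := fun i j hle c => by
    have hz : Tendsto (fun k => ‖c‖ * δ k) atTop (𝓝 0) := by
      simpa only [mul_zero] using hδlim.const_mul ‖c‖
    refine squeeze_zero (fun k => intervalIntegral.integral_nonneg hab fun x _ => norm_nonneg _)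
      (fun k => ?_) hz
    have hcn : Continuous fun x => n x (L k) :=
      (hK.continuous_shear 0 1 (by linarith [hL1 k])).norm.add
        (hK.continuous_shear 1 0 (by linarith [hL1 k])).norm
    calc _ ≤ ∫ x in a..b, ‖c‖ * n x (L k) := by
          refine intervalIntegral.integral_mono_on hab ?_
            ((continuous_const.mul hcn).intervalIntegrable _ _) fun x _ => ?_
          · exact Continuous.intervalIntegrable (continuous_const.mul
              ((hK.continuous_shear i j (by linarith [hL1 k])).mul continuous_const)).norm _ _
          · rw [norm_mul, norm_mul]
            gcongr
            exact (mul_le_of_le_one_right (norm_nonneg _)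
              (norm_exp_mul_le_one hκre (by linarith [hL1 k]))).trans (hle k x)
      _ = ‖c‖ * ∫ x in a..b, n x (L k) := intervalIntegral.integral_const_mul _ _
      _ ≤ _ := by gcongr; exact (hLε k).le
  obtain ⟨B01, hB01, hb01⟩ := htr 0 1
  obtain ⟨B10, hB10, hb10⟩ := htr 1 0
  have hexp1 : ∀ k, ‖Complex.exp (κ * δ k)‖ ≤ 1 := fun k => norm_exp_mul_le_one hκre (hδ0 k).le
  constructor
  · refine integral_eq_of_tendsto (y := fun k => Yn k 0)
      (h := fun k x => -(Complex.I * z) * Yn k 0 x + Complex.I * star (q x) * Yn k 1 x -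
        2 * (shear K 0 1 x (δ k) * Complex.exp (κ * δ k)))
      (r := fun k x => 2 * (shear K 0 1 x (L k) * Complex.exp (κ * L k)))
      (B := ‖z‖ * (‖w‖ * C + C) + Q * (‖w‖ * C + C) + 2 * B01) hab ?_ ?_ ?_ ?_ ?_ ?_ ?_
    · intro k x
      obtain ⟨h1, h2, h3, h4⟩ := hder k x
      refine ((h1.const_mul w).add h3).congr_deriv ?_
      simp only [hYn, hAn]
      linear_combination (-Complex.I * lapTrunc K κ (δ k) (L k) 0 1 x) * hw -
        lapTrunc K κ (δ k) (L k) 0 1 x * h2κ + Complex.I * lapTrunc K κ (δ k) (L k) 0 0 x * hwz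
    · intro k
      have := hK.continuous_shear 0 1 (hδ0 k).le
      have h0 := hYc k 0
      have h1 := hYc k 1
      have h2 := hq.star
      fun_prop
    · intro k
      have := hK.continuous_shear 0 1 (t := L k) (by linarith [hL1 k])
      fun_prop
    · exact fun x _ => hYlim 0 x
    · exact fun x _ => (((hYlim 0 x).const_mul _).add ((hYlim 1 x).const_mul _)).sub
        ((htrlim 0 1 x).const_mul 2)
    · intro k x hx
      refine (norm_sub_le _ _).trans (add_le_add ((norm_add_le _ _).trans (add_le_add ?_ ?_)) ?_)
      · rw [norm_mul, norm_neg, norm_mul, Complex.norm_I, one_mul]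
        gcongr
        exact hYbd k 0 x hx
      · rw [norm_mul, norm_mul, Complex.norm_I, one_mul, norm_star]
        gcongr
        exacts [hQ x hx, hYbd k 1 x hx]
      · rw [norm_mul, norm_mul, Complex.norm_ofNat]
        gcongr
        exact (mul_le_of_le_one_right (norm_nonneg _) (hexp1 k)).trans (hb01 k x hx)
    · exact hrlim 0 1 (fun k x => le_add_of_nonneg_right (norm_nonneg _)) 2
  · refine integral_eq_of_tendsto (y := fun k => Yn k 1)
      (h := fun k x => Complex.I / (2 * z) * Yn k 1 x - Complex.I * q x * Yn k 0 x -
        2 * w * (shear K 1 0 x (δ k) * Complex.exp (κ * δ k)))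
      (r := fun k x => 2 * w * (shear K 1 0 x (L k) * Complex.exp (κ * L k)))
      (B := ‖Complex.I / (2 * z)‖ * (‖w‖ * C + C) + Q * (‖w‖ * C + C) + ‖2 * w‖ * B10)
      hab ?_ ?_ ?_ ?_ ?_ ?_ ?_
    · intro k x
      obtain ⟨h1, h2, h3, h4⟩ := hder k x
      refine ((h4.const_mul w).add h2).congr_deriv ?_
      simp only [hYn, hAn]
      linear_combination (Complex.I * lapTrunc K κ (δ k) (L k) 1 1 x) * hw -
        w * lapTrunc K κ (δ k) (L k) 1 0 x * h2κ - Complex.I * lapTrunc K κ (δ k) (L k) 1 0 x * hwz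
    · intro k
      have := hK.continuous_shear 1 0 (hδ0 k).le
      have h0 := hYc k 0
      have h1 := hYc k 1
      fun_prop
    · intro k
      have := hK.continuous_shear 1 0 (t := L k) (by linarith [hL1 k])
      fun_prop
    · exact fun x _ => hYlim 1 x
    · exact fun x _ => (((hYlim 1 x).const_mul _).sub ((hYlim 0 x).const_mul _)).sub
        ((htrlim 1 0 x).const_mul _)
    · intro k x hx
      refine (norm_sub_le _ _).trans (add_le_add ((norm_sub_le _ _).trans (add_le_add ?_ ?_)) ?_)
      · rw [norm_mul]
        gcongr
        exact hYbd k 1 x hx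
      · rw [norm_mul, norm_mul, Complex.norm_I, one_mul]
        gcongr
        exacts [hQ x hx, hYbd k 0 x hx]
      · rw [norm_mul, norm_mul (shear _ _ _ _ _)]
        gcongr
        exact (mul_le_of_le_one_right (norm_nonneg _) (hexp1 k)).trans (hb10 k x hx)
    · exact hrlim 1 0 (fun k x => le_add_of_nonneg_left (norm_nonneg _)) (2 * w)

/-- The kernel represents the Jost solution. -/
theorem IsRightKernel.jost_eq (hq : RightTame q) (hK : IsRightKernel q K) {z : ℂ}
    (hz : z ∈ sheet) (x : ℝ) :
    jost q z x 0 = Complex.exp (Complex.I * zet z * x) * (rt2 / 2 / z) -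
      ∫ s in Set.Ioi x, (rt2 / 2 / z * K x s 0 0 + K x s 0 1) *
        Complex.exp (Complex.I * zet z * s) := by
  have hqc := hq.contDiff.continuous
  have hz0 := hz.2.1
  set κ := Complex.I * zet z with hκ
  have hκre : κ.re ≤ 0 := I_mul_zet_re hz.1
  set w := rt2 / 2 / z with hw
  set Y : Fin 2 → ℝ → ℂ := fun i x => w * lap K κ i 0 x + lap K κ i 1 x with hY
  have hid := fun (a b : ℝ) (hab : a ≤ b) => hK.integral_identity hqc hz hab
  simp only at hid
  have hc0 : Continuous (Y 0) := continuous_of_integral_eq fun a b hab => (hid a b hab).1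
  have hc1 : Continuous (Y 1) := continuous_of_integral_eq fun a b hab => (hid a b hab).2
  have hs01 := hK.continuous_shear 0 1 le_rfl
  have hs10 := hK.continuous_shear 1 0 le_rfl
  have hstar := hqc.star
  have hd0 := hasDerivAt_of_integral_eq (fun a b hab => (hid a b hab).1) (by
    change Continuous fun x => -(Complex.I * z) * Y 0 x + Complex.I * star (q x) * Y 1 x -
      2 * shear K 0 1 x 0
    fun_prop)
  have hd1 := hasDerivAt_of_integral_eq (fun a b hab => (hid a b hab).2) (by
    change Continuous fun x => Complex.I / (2 * z) * Y 1 x - Complex.I * q x * Y 0 x -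
      2 * w * shear K 1 0 x 0
    fun_prop)
  have hdiag12 : ∀ x, shear K 0 1 x 0 = Complex.I / 2 * (star (q x) - rt2 / 2) := fun x => by
    have h1 := congrArg star (hK.diag_12 x)
    rw [star_star] at h1
    rw [shear, add_zero, h1, star_mul, star_sub, star_rt2_half, star_neg, star_div₀, star_ofNat,
      RCLike.star_def, Complex.conj_I]
    ring
  have hdiag21 : ∀ x, shear K 1 0 x 0 = -(Complex.I / 2) * (q x - rt2 / 2) := fun x => by
    rw [shear, add_zero, hK.diag_21 x]
  -- The diagonal values of the kernel are such that the traces compensate exactly the defect of the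
  -- constant vector (w, 1), so the difference solves the homogeneous system.
  set m : Fin 2 → ℝ → ℂ := fun i x => (![w, 1] : Fin 2 → ℂ) i - Y i x with hm
  have hwz : z * w - rt2 / 2 = 0 := by rw [hw]; field_simp; ring
  have hw2 : rt2 / 2 * w = 1 / (2 * z) := by
    rw [hw, ← mul_div_assoc, rt2_half_sq, div_div]
  have hode : ∀ x,
      HasDerivAt (m 0) (-(Complex.I * z) * m 0 x + Complex.I * star (q x) * m 1 x) x ∧
      HasDerivAt (m 1) (Complex.I / (2 * z) * m 1 x - Complex.I * q x * m 0 x) x := fun x => by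
    refine ⟨((hd0 x).const_sub _).congr_deriv ?_, ((hd1 x).const_sub _).congr_deriv ?_⟩
    · simp only [hm, hY, hdiag12, Matrix.cons_val_zero, Matrix.cons_val_one,
        Matrix.cons_val_fin_one]
      linear_combination Complex.I * hwz
    · simp only [hm, hY, hdiag21, Matrix.cons_val_zero, Matrix.cons_val_one,
        Matrix.cons_val_fin_one]
      linear_combination Complex.I * hw2
  -- The decay of the L¹ norms as x → +∞ selects the normalization of the solution.
  have hlap0 : ∀ i j, Tendsto (lap K κ i j) atTop (𝓝 0) := fun i j => by
    refine squeeze_zero_norm (fun x => ?_) (hK.decay i j)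
    have hi := hK.integrable_shear i j x
    calc ‖lap K κ i j x‖ ≤ ∫ t in Set.Ioi 0, ‖shear K i j x t * Complex.exp (κ * t)‖ :=
          norm_integral_le_integral_norm _
      _ ≤ ∫ t in Set.Ioi 0, ‖shear K i j x t‖ := by
          refine setIntegral_mono_on (integrableOn_mul_exp hi hκre).norm hi.norm
            measurableSet_Ioi fun t ht => ?_
          rw [norm_mul]
          exact mul_le_of_le_one_right (norm_nonneg _) (norm_exp_mul_le_one hκre (le_of_lt ht))
      _ = _ := integral_shift (fun y => ‖K x y i j‖) x
  have hlim : ∀ i, Tendsto (m i) atTop (𝓝 ((![w, 1] : Fin 2 → ℂ) i)) := fun i => by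
    have h1 : Tendsto (Y i) atTop (𝓝 (w * 0 + 0)) := ((hlap0 i 0).const_mul w).add (hlap0 i 1)
    rw [mul_zero, add_zero] at h1
    simpa only [sub_zero] using h1.const_sub ((![w, 1] : Fin 2 → ℂ) i)
  rw [← hq.jost_unique hz (isJost_of_normalized hode hlim), ← integral_shift]
  have e : ∫ t in Set.Ioi (0 : ℝ), (w * K x (x + t) 0 0 + K x (x + t) 0 1) *
      Complex.exp (κ * ((x + t : ℝ) : ℂ)) = Complex.exp (κ * x) * Y 0 x := by
    have i0 := integrableOn_mul_exp (hK.integrable_shear 0 0 x) hκre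
    have i1 := integrableOn_mul_exp (hK.integrable_shear 0 1 x) hκre
    simp only [hY, lap]
    rw [← integral_const_mul, ← integral_add (i0.const_mul w) i1, ← integral_const_mul]
    refine integral_congr_ae (Eventually.of_forall fun t => ?_)
    simp only [shear]
    rw [Complex.ofReal_add, mul_add, Complex.exp_add]
    ring
  rw [e]
  simp only [hm, Matrix.cons_val_zero]
  ring

end

/-! ### Contour integration in the upper half-plane -/

theorem add_mul_I_mem_upper (t : ℝ) {η : ℝ} (hη : 0 < η) : (t : ℂ) + η * Complex.I ∈ upper := by
  show 0 < ((t : ℂ) + η * Complex.I).im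
  simpa using hη

theorem le_norm_add_mul_I (t η : ℝ) : |t| ≤ ‖(t : ℂ) + η * Complex.I‖ := by
  have := Complex.abs_re_le_norm ((t : ℂ) + η * Complex.I)
  simpa using this

theorem le_norm_add_mul_I' (t η : ℝ) : |η| ≤ ‖(t : ℂ) + η * Complex.I‖ := by
  have := Complex.abs_im_le_norm ((t : ℂ) + η * Complex.I)
  simpa using this

theorem div_le_div_one_add_sq {C a : ℝ} (hC : 0 ≤ C) {z : ℂ} (h : |a| ≤ ‖z‖) :
    C / (1 + ‖z‖ ^ 2) ≤ C / (1 + a ^ 2) := by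
  have : a ^ 2 ≤ ‖z‖ ^ 2 := by
    rw [← sq_abs a]; exact pow_le_pow_left₀ (abs_nonneg a) h 2
  gcongr

/-- Cauchy's theorem on a horizontal line. -/
theorem integral_horizontal_eq_zero {f : ℂ → ℂ} {C : ℝ} (hC : 0 ≤ C)
    (hf : DifferentiableOn ℂ f upper) (hb : ∀ z ∈ upper, ‖f z‖ ≤ C / (1 + ‖z‖ ^ 2)) {η : ℝ}
    (hη : 0 < η) : ∫ t : ℝ, f (t + η * Complex.I) = 0 := by
  have hcont : Continuous fun t : ℝ => f (t + η * Complex.I) :=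
    continuousOn_univ.1 (hf.continuousOn.comp (f := fun t : ℝ => (t : ℂ) + η * Complex.I)
      (by fun_prop) fun t _ => add_mul_I_mem_upper t hη)
  have hint : Integrable fun t : ℝ => f (t + η * Complex.I) := by
    refine Integrable.mono' (integrable_inv_one_add_sq.const_mul C) hcont.aestronglyMeasurable
      (Eventually.of_forall fun t => ?_)
    rw [← div_eq_mul_inv]
    exact (hb _ (add_mul_I_mem_upper t hη)).trans
      (div_le_div_one_add_sq hC (le_norm_add_mul_I t η))
  have h1 := intervalIntegral_tendsto_integral hint tendsto_neg_atTop_atBot tendsto_id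
  have hlim : Tendsto (fun R : ℝ => 4 * C * (R / (1 + R ^ 2))) atTop (𝓝 0) := by
    have h2 : Tendsto (fun R : ℝ => 4 * C * R⁻¹) atTop (𝓝 0) := by
      simpa only [mul_zero] using tendsto_inv_atTop_zero.const_mul (4 * C)
    refine squeeze_zero' ((eventually_gt_atTop 0).mono fun R hR => by positivity)
      ((eventually_gt_atTop 0).mono fun R hR => ?_) h2
    gcongr
    rw [div_le_iff₀ (by positivity), inv_mul_eq_div, le_div_iff₀ hR]
    nlinarith
  have h2 : Tendsto (fun R : ℝ => ∫ t in (-R)..R, f (t + η * Complex.I)) atTop (𝓝 0) := by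
    refine squeeze_zero_norm' ((eventually_gt_atTop 0).mono fun R hR => ?_) hlim
    -- Rectangle of width 2R and height R: the three other sides have total length 4R and modulus at
    -- least R, so they contribute O(1/R).
    have hrect := Complex.integral_boundary_rect_eq_zero_of_differentiableOn f
      ((-R : ℝ) + η * Complex.I) ((R : ℝ) + (η + R : ℝ) * Complex.I) (hf.mono fun w hw => by
        have := hw.2
        simp only [Set.mem_preimage, Complex.add_im, Complex.ofReal_im, Complex.mul_im,
          Complex.ofReal_re, Complex.I_im, Complex.I_re, mul_one, mul_zero, zero_add,
          add_zero] at this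
        rw [Set.uIcc_of_le (by linarith)] at this
        exact hη.trans_le this.1)
    simp only [Complex.add_re, Complex.add_im, Complex.ofReal_im, Complex.mul_im, Complex.mul_re,
      Complex.ofReal_re, Complex.I_im, Complex.I_re, mul_one, mul_zero, zero_add,
      add_zero, sub_zero] at hrect
    have hb1 : ‖∫ t in (-R)..R, f (t + (η + R : ℝ) * Complex.I)‖ ≤ C / (1 + R ^ 2) * |R - -R| := by
      refine intervalIntegral.norm_integral_le_of_norm_le_const fun t _ => ?_
      refine (hb _ (add_mul_I_mem_upper t (by linarith))).trans ?_
      refine (div_le_div_one_add_sq hC (le_norm_add_mul_I' t (η + R))).trans ?_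
      gcongr
      linarith
    have hb2 : ∀ s : ℝ, |s| = R →
        ‖∫ y in η..(η + R), f (s + y * Complex.I)‖ ≤ C / (1 + R ^ 2) * |η + R - η| := fun s hs => by
      refine intervalIntegral.norm_integral_le_of_norm_le_const fun y hy => ?_
      rw [Set.uIoc_of_le (by linarith)] at hy
      refine (hb _ (add_mul_I_mem_upper s (hη.trans hy.1))).trans ?_
      refine div_le_div_one_add_sq hC ?_
      rw [abs_of_pos hR, ← hs]
      exact le_norm_add_mul_I s y
    have e : ∫ t in (-R)..R, f (t + η * Complex.I) =
        (∫ t in (-R)..R, f (t + (η + R : ℝ) * Complex.I)) -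
        Complex.I • (∫ y in η..(η + R), f ((R : ℝ) + y * Complex.I)) +
        Complex.I • (∫ y in η..(η + R), f ((-R : ℝ) + y * Complex.I)) := by
      linear_combination hrect
    rw [e]
    have hb2a := hb2 R (abs_of_pos hR)
    have hb2b := hb2 (-R) (by rw [abs_neg, abs_of_pos hR])
    refine (norm_add_le _ _).trans ((add_le_add (norm_sub_le _ _) le_rfl).trans ?_)
    rw [norm_smul, norm_smul, Complex.norm_I, one_mul, one_mul]
    have e1 : |R - -R| = 2 * R := by rw [abs_of_pos (by linarith)]; ring
    have e2 : |η + R - η| = R := by rw [add_sub_cancel_left, abs_of_pos hR]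
    rw [e1] at hb1
    rw [e2] at hb2a hb2b
    have e3 : 4 * C * (R / (1 + R ^ 2)) = C / (1 + R ^ 2) * (2 * R) + C / (1 + R ^ 2) * R +
      C / (1 + R ^ 2) * R := by ring
    rw [e3]
    linarith
  exact tendsto_nhds_unique h1 h2

/-- The difference of two simple poles at conjugate points. -/
def polePair (z₀ z : ℂ) : ℂ := 1 / (z - z₀) - 1 / (z - star z₀)

theorem polePair_ofReal {z₀ : ℂ} (hz₀ : z₀ ∈ upper) (t : ℝ) : polePair z₀ t =
    2 * Complex.I / z₀.im * ((1 + ((t - z₀.re) / z₀.im) ^ 2)⁻¹ : ℝ) := by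
  have hy : z₀.im ≠ 0 := ne_of_gt hz₀
  have hy' : (z₀.im : ℂ) ≠ 0 := by exact_mod_cast hy
  have e1 : (t : ℂ) - z₀ = (t - z₀.re : ℝ) - z₀.im * Complex.I := by
    apply Complex.ext <;> simp
  have e2 : (t : ℂ) - star z₀ = (t - z₀.re : ℝ) + z₀.im * Complex.I := by
    apply Complex.ext <;> simp
  have h1 : (t : ℂ) - z₀ ≠ 0 := fun h => hy (by simpa using congrArg Complex.im h)
  have h2 : (t : ℂ) - star z₀ ≠ 0 := fun h => hy (by simpa using congrArg Complex.im h)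
  have h3 : ((t : ℂ) - z₀) * ((t : ℂ) - star z₀) = ((t - z₀.re) ^ 2 + z₀.im ^ 2 : ℝ) := by
    rw [e1, e2]; push_cast
    linear_combination -(z₀.im : ℂ) ^ 2 * Complex.I_sq
  have h4 : (((t - z₀.re) ^ 2 + z₀.im ^ 2 : ℝ) : ℂ) ≠ 0 := by rw [← h3]; exact mul_ne_zero h1 h2
  have h5 : (1 + ((t - z₀.re) / z₀.im) ^ 2)⁻¹ = z₀.im ^ 2 / ((t - z₀.re) ^ 2 + z₀.im ^ 2) := by
    have : (t - z₀.re) ^ 2 + z₀.im ^ 2 ≠ 0 := by exact_mod_cast h4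
    field_simp
    rw [add_comm]
  have h6 : polePair z₀ t = (z₀ - star z₀) / (((t : ℂ) - z₀) * ((t : ℂ) - star z₀)) := by
    rw [polePair]; field_simp; ring
  have h7 : z₀ - star z₀ = 2 * Complex.I * z₀.im := by
    apply Complex.ext <;> simp; ring
  rw [h5, h6, h3, h7, Complex.ofReal_div]
  push_cast
  field_simp

/-- Pairing the pole with its conjugate gives decay like |z|⁻², which a single pole lacks. On the
real line the pair is 2i times a Poisson kernel of mass π, whence 2πi. -/
theorem integral_polePair {z₀ : ℂ} (hz₀ : z₀ ∈ upper) :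
    Integrable (fun t : ℝ => polePair z₀ t) ∧
      ∫ t : ℝ, polePair z₀ t = 2 * Real.pi * Complex.I := by
  have hy : 0 < z₀.im := hz₀
  have hy' : (z₀.im : ℂ) ≠ 0 := by exact_mod_cast hy.ne'
  have hi : Integrable fun t : ℝ => (1 + ((t - z₀.re) / z₀.im) ^ 2)⁻¹ :=
    (integrable_inv_one_add_sq.comp_div hy.ne').comp_sub_right z₀.re
  have hI : ∫ t : ℝ, (1 + ((t - z₀.re) / z₀.im) ^ 2)⁻¹ = z₀.im * Real.pi := by
    rw [integral_sub_right_eq_self (fun t : ℝ => (1 + (t / z₀.im) ^ 2)⁻¹) z₀.re,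
      Measure.integral_comp_div (fun t : ℝ => (1 + t ^ 2)⁻¹), integral_univ_inv_one_add_sq,
      abs_of_pos hy, smul_eq_mul]
  simp only [polePair_ofReal hz₀]
  refine ⟨hi.ofReal.const_mul _, ?_⟩
  rw [integral_const_mul, integral_complex_ofReal, hI]
  push_cast
  field_simp

/-- The residue theorem on the upper half-plane for a simple pole. -/
theorem integral_real_eq_residue {f H : ℂ → ℂ} {z₀ : ℂ} (hz₀ : z₀ ∈ upper)
    (hH : DifferentiableOn ℂ H upper) (hf : ∀ z ∈ upper, z ≠ z₀ → f z = H z / (z - z₀))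
    (hb : ∀ ρ : ℝ, 0 < ρ → ∃ C : ℝ, 0 ≤ C ∧ ∀ z ∈ upper, ρ ≤ ‖z - z₀‖ → ‖f z‖ ≤ C / (1 + ‖z‖ ^ 2))
    (hlim : ∀ᵐ t : ℝ, Tendsto (fun η : ℝ => f (t + η * Complex.I)) (𝓝[>] 0) (𝓝 (f t))) :
    Integrable (fun t : ℝ => f t) ∧ ∫ t : ℝ, f t = 2 * Real.pi * Complex.I * H z₀ := by
  have hy : 0 < z₀.im := hz₀
  set ρ : ℝ := z₀.im / 2 with hρ
  have hρ0 : 0 < ρ := by positivity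
  obtain ⟨C, hC, hCb⟩ := hb ρ hρ0
  -- Away from z₀ this is f − H(z₀) `polePair z₀`, in a form that is visibly holomorphic at z₀.
  set g : ℂ → ℂ := fun z => dslope H z₀ z + H z₀ / (z - star z₀) with hg
  have hstar : ∀ z ∈ upper, z - star z₀ ≠ 0 := fun z hz h => by
    have h1 := congrArg Complex.im h
    simp at h1
    have : 0 < z.im := hz
    linarith
  have hgd : DifferentiableOn ℂ g upper := by
    refine ((Complex.differentiableOn_dslope (isOpen_upper.mem_nhds hz₀)).2 hH).add ?_
    refine DifferentiableOn.div (by fun_prop) (by fun_prop) hstar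
  have hgf : ∀ z ∈ upper, z ≠ z₀ → g z = f z - H z₀ * polePair z₀ z := fun z hz hne => by
    have h1 := hstar z hz
    have h2 : z - z₀ ≠ 0 := sub_ne_zero.2 hne
    rw [hg, hf z hz hne, polePair]
    simp only
    rw [dslope_of_ne _ hne, slope_def_field]
    field_simp
    ring
  have hpp : ∀ z ∈ upper, ρ ≤ ‖z - z₀‖ →
      ‖polePair z₀ z‖ ≤ 2 * z₀.im * (1 / ρ ^ 2 + (1 + ‖z₀‖ / ρ) ^ 2) / (1 + ‖z‖ ^ 2) := by
    intro z hz hzρ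
    have h1 := hstar z hz
    have hd : 0 < ‖z - z₀‖ := by linarith
    have h2 : z - z₀ ≠ 0 := norm_pos_iff.1 hd
    have h3 : ‖z - z₀‖ ≤ ‖z - star z₀‖ := by
      rw [← sq_le_sq₀ (norm_nonneg _) (norm_nonneg _), ← Complex.normSq_eq_norm_sq,
        ← Complex.normSq_eq_norm_sq, Complex.normSq_apply, Complex.normSq_apply]
      have : 0 < z.im := hz
      simp only [Complex.sub_re, Complex.sub_im, RCLike.star_def, Complex.conj_re, Complex.conj_im]
      nlinarith
    have h6 : polePair z₀ z = (z₀ - star z₀) / ((z - z₀) * (z - star z₀)) := by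
      rw [polePair]; field_simp; ring
    have h7 : ‖z₀ - star z₀‖ = 2 * z₀.im := by
      have : z₀ - star z₀ = ((2 * z₀.im : ℝ) : ℂ) * Complex.I := by
        apply Complex.ext <;> simp; ring
      rw [this, norm_mul, Complex.norm_I, Complex.norm_real, Real.norm_of_nonneg (by linarith),
        mul_one]
    rw [h6, norm_div, h7, norm_mul]
    have h8 : 1 + ‖z‖ ^ 2 ≤ ‖z - z₀‖ ^ 2 * (1 / ρ ^ 2 + (1 + ‖z₀‖ / ρ) ^ 2) := by
      have k1 : 1 ≤ ‖z - z₀‖ / ρ := (one_le_div hρ0).2 hzρ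
      have k2 : ‖z‖ ≤ ‖z - z₀‖ * (1 + ‖z₀‖ / ρ) := by
        have k3 := norm_add_le (z - z₀) z₀
        rw [sub_add_cancel] at k3
        have k4 := mul_le_mul_of_nonneg_left k1 (norm_nonneg z₀)
        have k5 : ‖z - z₀‖ * (1 + ‖z₀‖ / ρ) = ‖z - z₀‖ + ‖z₀‖ * (‖z - z₀‖ / ρ) := by ring
        linarith
      have k6 : ‖z‖ ^ 2 ≤ ‖z - z₀‖ ^ 2 * (1 + ‖z₀‖ / ρ) ^ 2 := by
        rw [← mul_pow]; exact pow_le_pow_left₀ (norm_nonneg _) k2 2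
      have k7 : 1 ≤ ‖z - z₀‖ ^ 2 * (1 / ρ ^ 2) := by
        rw [mul_one_div, ← div_pow]; exact one_le_pow₀ k1
      linarith
    rw [div_le_div_iff₀ (mul_pos hd (hd.trans_le h3)) (by positivity)]
    have h9 : ‖z - z₀‖ ^ 2 ≤ ‖z - z₀‖ * ‖z - star z₀‖ := by rw [sq]; gcongr
    have h10 : 0 ≤ 1 / ρ ^ 2 + (1 + ‖z₀‖ / ρ) ^ 2 := by positivity
    nlinarith [mul_le_mul_of_nonneg_right h9 h10]
  set C₁ := C + ‖H z₀‖ * (2 * z₀.im * (1 / ρ ^ 2 + (1 + ‖z₀‖ / ρ) ^ 2)) with hC₁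
  have hC₁0 : 0 ≤ C₁ := by positivity
  have hfar : ∀ z ∈ upper, ρ ≤ ‖z - z₀‖ → ‖f z - H z₀ * polePair z₀ z‖ ≤ C₁ / (1 + ‖z‖ ^ 2) := by
    intro z hz hzρ
    refine (norm_sub_le _ _).trans ?_
    rw [norm_mul, hC₁, add_div, mul_div_assoc]
    gcongr
    exacts [hCb z hz hzρ, hpp z hz hzρ]
  -- Away from z₀ the bound on g comes from f and the pole pair; near z₀ it comes from continuity of
  -- g on a closed disc inside the half-plane.
  obtain ⟨B, hB⟩ := (isCompact_closedBall z₀ ρ).exists_bound_of_continuousOn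
    (f := fun z => (1 + ‖z‖ ^ 2 : ℝ) • g z) (by
      have : ContinuousOn g (Metric.closedBall z₀ ρ) := hgd.continuousOn.mono fun w hw => by
        rw [Metric.mem_closedBall, dist_eq_norm] at hw
        have h1 := (abs_le.1 ((Complex.abs_im_le_norm (w - z₀)).trans hw)).1
        rw [Complex.sub_im] at h1
        show 0 < w.im
        linarith
      fun_prop)
  have hgb : ∀ z ∈ upper, ‖g z‖ ≤ max C₁ B / (1 + ‖z‖ ^ 2) := by
    intro z hz
    rcases le_or_gt ρ ‖z - z₀‖ with h | h
    · have hne : z ≠ z₀ := by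
        rintro rfl
        rw [sub_self, norm_zero] at h
        linarith
      rw [hgf z hz hne]
      refine (hfar z hz h).trans ?_
      gcongr
      exact le_max_left _ _
    · have := hB z (by rw [Metric.mem_closedBall, dist_eq_norm]; exact h.le)
      rw [norm_smul, Real.norm_of_nonneg (by positivity)] at this
      rw [le_div_iff₀ (by positivity), mul_comm]
      exact this.trans (le_max_right _ _)
  set M := max C₁ B with hM
  have hM0 : 0 ≤ M := le_max_of_le_left hC₁0
  obtain ⟨hPi, hPI⟩ := integral_polePair hz₀
  have hzero : ∀ᶠ η : ℝ in 𝓝[>] 0, ∫ t : ℝ, g (t + η * Complex.I) = 0 :=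
    eventually_mem_nhdsWithin.mono fun η hη => integral_horizontal_eq_zero hM0 hgd hgb hη
  have hgc : ∀ η : ℝ, 0 < η → Continuous fun t : ℝ => g (t + η * Complex.I) := fun η hη =>
    continuousOn_univ.1 (hgd.continuousOn.comp (f := fun t : ℝ => (t : ℂ) + η * Complex.I)
      (by fun_prop) fun t _ => add_mul_I_mem_upper t hη)
  set h : ℝ → ℂ := fun t => f t - H z₀ * polePair z₀ t with hh
  have hptw : ∀ᵐ t : ℝ, Tendsto (fun η : ℝ => g (t + η * Complex.I)) (𝓝[>] 0) (𝓝 (h t)) := by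
    filter_upwards [hlim] with t ht
    have hpc : Tendsto (fun η : ℝ => polePair z₀ (t + η * Complex.I)) (𝓝[>] 0)
        (𝓝 (polePair z₀ t)) := by
      have hc : ContinuousAt (fun η : ℝ => polePair z₀ (t + η * Complex.I)) 0 := by
        have h1 : (t : ℂ) + ((0 : ℝ) : ℂ) * Complex.I - z₀ ≠ 0 := fun h => by
          have := congrArg Complex.im h
          simp at this
          linarith
        have h2 : (t : ℂ) + ((0 : ℝ) : ℂ) * Complex.I - star z₀ ≠ 0 := fun h => by
          have := congrArg Complex.im h
          simp at this
          linarith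
        unfold polePair
        fun_prop (disch := assumption)
      have := hc.tendsto
      simp only [Complex.ofReal_zero, zero_mul, add_zero] at this
      exact this.mono_left nhdsWithin_le_nhds
    refine (ht.sub (hpc.const_mul (H z₀))).congr' ?_
    filter_upwards [Ioo_mem_nhdsGT hy] with η hη
    refine (hgf _ (add_mul_I_mem_upper t hη.1) fun h => ?_).symm
    have := congrArg Complex.im h
    simp at this
    linarith [hη.2]
  -- The integrals over the lines Im z = η vanish, and the common dominating function M/(1 + t²)
  -- allows η to tend to 0.
  have hdom := tendsto_integral_filter_of_dominated_convergence (μ := volume)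
    (F := fun η : ℝ => fun t : ℝ => g (t + η * Complex.I)) (f := h) (l := 𝓝[>] (0 : ℝ))
    (fun t => M * (1 + t ^ 2)⁻¹)
    (eventually_mem_nhdsWithin.mono fun η hη => (hgc η hη).aestronglyMeasurable)
    (eventually_mem_nhdsWithin.mono fun η hη => Eventually.of_forall fun t => by
      rw [← div_eq_mul_inv]
      exact (hgb _ (add_mul_I_mem_upper t hη)).trans
        (div_le_div_one_add_sq hM0 (le_norm_add_mul_I t η)))
    (integrable_inv_one_add_sq.const_mul M) hptw
  have hint0 : ∫ t, h t = 0 :=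
    tendsto_nhds_unique hdom (tendsto_const_nhds.congr' (hzero.mono fun η hη => hη.symm))
  have hseq : Tendsto (fun n : ℕ => (1 : ℝ) / ((n : ℝ) + 1)) atTop (𝓝[>] 0) :=
    tendsto_nhdsWithin_iff.2 ⟨tendsto_one_div_add_atTop_nhds_zero_nat,
      Eventually.of_forall fun n => Set.mem_Ioi.2 Nat.one_div_pos_of_nat⟩
  have hhint : Integrable h := by
    refine Integrable.mono' (integrable_inv_one_add_sq.const_mul M) ?_ ?_
    · refine aestronglyMeasurable_of_tendsto_ae atTop
        (f := fun (n : ℕ) (t : ℝ) => g (t + (1 / ((n : ℝ) + 1) : ℝ) * Complex.I))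
        (fun n => (hgc _ Nat.one_div_pos_of_nat).aestronglyMeasurable) ?_
      filter_upwards [hptw] with t ht using ht.comp hseq
    · filter_upwards [hptw] with t ht
      refine le_of_tendsto ht.norm (eventually_mem_nhdsWithin.mono fun η hη => ?_)
      rw [← div_eq_mul_inv]
      exact (hgb _ (add_mul_I_mem_upper t hη)).trans
        (div_le_div_one_add_sq hM0 (le_norm_add_mul_I t η))
  have e : (fun t : ℝ => f t) = fun t => h t + H z₀ * polePair z₀ t := by
    funext t; simp only [hh]; ring
  rw [e]
  refine ⟨hhint.add (hPi.const_mul _), ?_⟩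
  rw [integral_add hhint (hPi.const_mul _), hint0, integral_const_mul, hPI]
  ring

/-! ### Fourier duality with test functions -/

theorem integral_swap_of_bounded {μ ν : Measure ℝ} [SFinite μ] [SFinite ν] {φ k : ℝ → ℂ}
    (hφ : Integrable φ μ) (hk : Integrable k ν) {e : ℝ → ℝ → ℂ}
    (he : Continuous fun P : ℝ × ℝ => e P.1 P.2) {B : ℝ} (hB : ∀ a b, ‖e a b‖ ≤ B) :
    ∫ a, φ a * ∫ b, k b * e a b ∂ν ∂μ = ∫ b, k b * ∫ a, φ a * e a b ∂μ ∂ν := by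
  have hi : Integrable (fun P : ℝ × ℝ => φ P.1 * k P.2 * e P.1 P.2) (μ.prod ν) :=
    (hφ.mul_prod hk).mul_bdd (c := B) he.aestronglyMeasurable
      (Eventually.of_forall fun P => hB P.1 P.2)
  have := integral_integral_swap (f := fun a b => φ a * k b * e a b) hi
  simp only [mul_assoc] at this
  simp only [integral_const_mul] at this
  rw [this]
  refine integral_congr_ae (Eventually.of_forall fun b => ?_)
  simp only
  rw [← integral_const_mul]
  refine integral_congr_ae (Eventually.of_forall fun a => ?_)
  simp only
  ring

/-- The inverse Fourier transform, in the normalization `(1/2π) ∫ A(ζ) e^{iζz} dζ`. -/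
def invF (A : ℝ → ℂ) (z : ℝ) : ℂ :=
  1 / (2 * (Real.pi : ℂ)) * ∫ ζ : ℝ, A ζ * Complex.exp (Complex.I * (ζ : ℂ) * (z : ℂ))

theorem norm_exp_I_mul (a b : ℝ) : ‖Complex.exp (Complex.I * (a : ℂ) * (b : ℂ))‖ = 1 := by
  rw [mul_assoc, ← Complex.ofReal_mul, mul_comm, Complex.norm_exp_ofReal_mul_I]

theorem integrable_mul_exp {A : ℝ → ℂ} (hA : Integrable A) (z : ℝ) :
    Integrable fun ζ : ℝ => A ζ * Complex.exp (Complex.I * (ζ : ℂ) * (z : ℂ)) :=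
  hA.mul_bdd (c := 1) (by fun_prop) (Eventually.of_forall fun ζ => (norm_exp_I_mul ζ z).le)

theorem continuous_invF {A : ℝ → ℂ} (hA : Integrable A) : Continuous (invF A) := by
  refine continuous_const.mul (continuous_of_dominated (bound := fun ζ => ‖A ζ‖)
    (fun z => (integrable_mul_exp hA z).aestronglyMeasurable)
    (fun z => Eventually.of_forall fun ζ => ?_) hA.norm
    (Eventually.of_forall fun ζ => by fun_prop))
  rw [norm_mul, norm_exp_I_mul, mul_one]

theorem norm_invF_le (A : ℝ → ℂ) (z : ℝ) : ‖invF A z‖ ≤ ‖1 / (2 * (Real.pi : ℂ))‖ * ∫ ζ, ‖A ζ‖ := by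
  rw [invF, norm_mul]
  gcongr
  refine (norm_integral_le_integral_norm _).trans (le_of_eq ?_)
  simp only [norm_mul, norm_exp_I_mul, mul_one]

theorem hasDerivAt_invF {A : ℝ → ℂ} (hA : Integrable A)
    (hA' : Integrable fun ζ : ℝ => (ζ : ℂ) * A ζ) (z : ℝ) :
    HasDerivAt (invF A) (Complex.I * invF (fun ζ : ℝ => (ζ : ℂ) * A ζ) z) z := by
  have h := hasDerivAt_integral_of_dominated_loc_of_deriv_le (𝕜 := ℝ) (μ := volume)
    (F := fun (z : ℝ) (ζ : ℝ) => A ζ * Complex.exp (Complex.I * (ζ : ℂ) * (z : ℂ)))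
    (F' := fun (z : ℝ) (ζ : ℝ) => Complex.I *
      ((ζ : ℂ) * A ζ * Complex.exp (Complex.I * (ζ : ℂ) * (z : ℂ))))
    (x₀ := z) (s := Set.univ) (bound := fun ζ : ℝ => ‖(ζ : ℂ) * A ζ‖) univ_mem
    (Eventually.of_forall fun z => (integrable_mul_exp hA z).aestronglyMeasurable)
    (integrable_mul_exp hA z) ((integrable_mul_exp hA' z).const_mul _).aestronglyMeasurable
    (Eventually.of_forall fun ζ z _ => by
      rw [norm_mul, Complex.norm_I, one_mul, norm_mul, norm_exp_I_mul, mul_one]) hA'.norm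
    (Eventually.of_forall fun ζ z _ => by
      have h1 : HasDerivAt (fun z : ℝ => Complex.I * (ζ : ℂ) * (z : ℂ))
          (Complex.I * (ζ : ℂ) * 1) z := (Complex.ofRealCLM.hasDerivAt).const_mul _
      refine (h1.cexp.const_mul (A ζ)).congr_deriv ?_
      ring)
  refine (h.2.const_mul (1 / (2 * (Real.pi : ℂ)))).congr_deriv ?_
  rw [integral_const_mul, invF]
  ring

/-- Test functions supported in `(x, ∞)`. -/
structure IsTest (x : ℝ) (χ : ℝ → ℝ) : Prop where
  smooth : ContDiff ℝ (⊤ : ℕ∞) χ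
  compact : HasCompactSupport χ
  supp : tsupport χ ⊆ Set.Ioi x

theorem IsTest.deriv {x : ℝ} {χ : ℝ → ℝ} (h : IsTest x χ) : IsTest x (deriv χ) :=
  ⟨(contDiff_infty_iff_deriv.1 h.smooth).2, h.compact.deriv,
    tsupport_deriv_subset.trans h.supp⟩

/-- The transform `∫ χ(y) e^{iζy} dy`. -/
def testX (χ : ℝ → ℝ) (ζ : ℂ) : ℂ := ∫ y : ℝ, (χ y : ℂ) * Complex.exp (Complex.I * ζ * (y : ℂ))

section

variable {x : ℝ} {χ : ℝ → ℝ}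

theorem IsTest.integrable (h : IsTest x χ) : Integrable fun y => (χ y : ℂ) :=
  (h.smooth.continuous.integrable_of_hasCompactSupport h.compact).ofReal

theorem IsTest.integrable_mul (h : IsTest x χ) {e : ℝ → ℂ} (he : Continuous e) :
    Integrable fun y => (χ y : ℂ) * e y := by
  refine Continuous.integrable_of_hasCompactSupport
    ((Complex.continuous_ofReal.comp h.smooth.continuous).mul he) ?_
  have : HasCompactSupport fun y => (χ y : ℂ) :=
    h.compact.comp_left (g := fun t : ℝ => (t : ℂ)) Complex.ofReal_zero
  exact this.mul_right

theorem IsTest.eq_zero (h : IsTest x χ) {y : ℝ} (hy : y ≤ x) : χ y = 0 := by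
  by_contra hne
  exact absurd (h.supp (subset_tsupport χ hne)) (not_lt.2 hy)

/-- The support in (x, ∞) yields the factor e^{−Im ζ x}, which is exactly what the growth of φ₁ at x
costs in the contour integral. -/
theorem IsTest.norm_testX_le (h : IsTest x χ) {ζ : ℂ} (hζ : 0 ≤ ζ.im) :
    ‖testX χ ζ‖ ≤ (∫ y, |χ y|) * Real.exp (-(ζ.im * x)) := by
  refine (norm_integral_le_integral_norm _).trans ?_
  rw [← integral_mul_const]
  refine integral_mono (h.integrable_mul (by fun_prop)).norm
    ((h.smooth.continuous.integrable_of_hasCompactSupport h.compact).abs.mul_const _) fun y => ?_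
  simp only
  rw [norm_mul, Complex.norm_real, Real.norm_eq_abs, Complex.norm_exp]
  have e : (Complex.I * ζ * (y : ℂ)).re = -(ζ.im * y) := by simp
  rw [e]
  rcases le_or_gt y x with hy | hy
  · rw [h.eq_zero hy, abs_zero, zero_mul, zero_mul]
  · gcongr

theorem IsTest.mul_testX (h : IsTest x χ) (ζ : ℂ) :
    Complex.I * ζ * testX χ ζ = -testX (_root_.deriv χ) ζ := by
  have hd : ∀ y : ℝ, HasDerivAt (fun y : ℝ => Complex.exp (Complex.I * ζ * (y : ℂ)))
      (Complex.I * ζ * Complex.exp (Complex.I * ζ * (y : ℂ))) y := fun y => by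
    have h1 : HasDerivAt (fun z : ℝ => Complex.I * ζ * (z : ℂ)) (Complex.I * ζ * 1) y :=
      (Complex.ofRealCLM.hasDerivAt).const_mul _
    exact h1.cexp.congr_deriv (by ring)
  have hu : ∀ y, HasDerivAt (fun y => (χ y : ℂ)) ((_root_.deriv χ y : ℝ) : ℂ) y := fun y =>
    ((h.smooth.differentiable (by simp)) y).hasDerivAt.ofReal_comp
  have key := integral_mul_deriv_eq_deriv_mul_of_integrable (fun y _ => hu y) (fun y _ => hd y)
    (h.integrable_mul (by fun_prop)) (h.deriv.integrable_mul (by fun_prop))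
    (h.integrable_mul (by fun_prop))
  rw [testX, testX, ← key, ← integral_const_mul]
  refine integral_congr_ae (Eventually.of_forall fun y => ?_)
  simp only
  ring

theorem IsTest.pow_mul_testX_le (h : IsTest x χ) (n : ℕ) : ∃ C : ℝ, 0 ≤ C ∧ ∀ ζ : ℂ, 0 ≤ ζ.im →
    ‖ζ‖ ^ n * ‖testX χ ζ‖ ≤ C * Real.exp (-(ζ.im * x)) := by
  induction n generalizing χ with
  | zero =>
    refine ⟨∫ y, |χ y|, integral_nonneg fun y => abs_nonneg _, fun ζ hζ => ?_⟩
    rw [pow_zero, one_mul]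
    exact h.norm_testX_le hζ
  | succ n ih =>
    obtain ⟨C, hC, hb⟩ := ih h.deriv
    refine ⟨C, hC, fun ζ hζ => ?_⟩
    have := congrArg norm (h.mul_testX ζ)
    rw [norm_mul, norm_mul, Complex.norm_I, one_mul, norm_neg] at this
    rw [pow_succ, mul_assoc, this]
    exact hb ζ hζ

theorem IsTest.exists_testX_le (h : IsTest x χ) (n : ℕ) : ∃ C : ℝ, 0 ≤ C ∧ ∀ ζ : ℂ, 0 ≤ ζ.im →
    (2 * ‖ζ‖ + 1) ^ n * ‖testX χ ζ‖ ≤ C * Real.exp (-(ζ.im * x)) := by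
  obtain ⟨C, hC, h1⟩ := h.pow_mul_testX_le n
  obtain ⟨C', hC', h2⟩ := h.pow_mul_testX_le 0
  refine ⟨2 ^ (n - 1) * (2 ^ n * C + C'), by positivity, fun ζ hζ => ?_⟩
  have h3 := add_pow_le (by positivity : 0 ≤ 2 * ‖ζ‖) zero_le_one n
  rw [one_pow, mul_pow] at h3
  have h4 := h1 ζ hζ
  have h5 := h2 ζ hζ
  rw [pow_zero, one_mul] at h5
  calc _ ≤ 2 ^ (n - 1) * (2 ^ n * ‖ζ‖ ^ n + 1) * ‖testX χ ζ‖ := by gcongr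
    _ = 2 ^ (n - 1) * (2 ^ n * (‖ζ‖ ^ n * ‖testX χ ζ‖) + ‖testX χ ζ‖) := by ring
    _ ≤ 2 ^ (n - 1) * (2 ^ n * (C * Real.exp (-(ζ.im * x))) + C' * Real.exp (-(ζ.im * x))) := by
        gcongr
    _ = _ := by ring

theorem IsTest.differentiable_testX (h : IsTest x χ) : Differentiable ℂ (testX χ) := by
  intro ζ₀
  have hU : IsOpen (Metric.ball (0 : ℂ) (‖ζ₀‖ + 1)) := Metric.isOpen_ball
  have hmem : ζ₀ ∈ Metric.ball (0 : ℂ) (‖ζ₀‖ + 1) := by simp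
  have hb : Integrable fun y : ℝ => ‖(χ y : ℂ) * (Real.exp ((‖ζ₀‖ + 1) * |y|) : ℂ)‖ :=
    (h.integrable_mul (by fun_prop)).norm
  have hle : ∀ y : ℝ, ∀ z ∈ Metric.ball (0 : ℂ) (‖ζ₀‖ + 1),
      ‖(χ y : ℂ) * Complex.exp (Complex.I * z * (y : ℂ))‖ ≤
        ‖(χ y : ℂ) * (Real.exp ((‖ζ₀‖ + 1) * |y|) : ℂ)‖ := fun y z hz => by
    rw [mem_ball_zero_iff] at hz
    rw [norm_mul, norm_mul, Complex.norm_exp, Complex.norm_real (Real.exp _),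
      Real.norm_of_nonneg (Real.exp_pos _).le]
    gcongr
    refine (Complex.re_le_norm _).trans ?_
    rw [norm_mul, norm_mul, Complex.norm_I, one_mul, Complex.norm_real, Real.norm_eq_abs]
    gcongr
  exact (differentiableOn_integral_of_dominated hU hb
    (fun z _ => (h.integrable_mul (by fun_prop)).aestronglyMeasurable)
    (fun z hz => Eventually.of_forall fun y => hle y z hz)
    (Eventually.of_forall hle)
    (Eventually.of_forall fun y => by fun_prop) ζ₀ hmem).differentiableAt (hU.mem_nhds hmem)

theorem IsTest.integrable_testX (h : IsTest x χ) : Integrable fun ζ : ℝ => testX χ ζ := by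
  obtain ⟨C, hC, hb⟩ := h.exists_testX_le 2
  refine Integrable.mono' (integrable_inv_one_add_sq.const_mul C)
    (h.differentiable_testX.continuous.comp Complex.continuous_ofReal).aestronglyMeasurable
    (Eventually.of_forall fun ζ => ?_)
  have := hb ζ (by simp)
  rw [Complex.ofReal_im, zero_mul, neg_zero, Real.exp_zero, mul_one, Complex.norm_real,
    Real.norm_eq_abs] at this
  rw [← div_eq_mul_inv, le_div_iff₀ (by positivity)]
  have h1 : 1 + ζ ^ 2 ≤ (2 * |ζ| + 1) ^ 2 := by
    rw [← sq_abs ζ]; nlinarith [abs_nonneg ζ]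
  nlinarith [norm_nonneg (testX χ ζ), mul_le_mul_of_nonneg_right h1 (norm_nonneg (testX χ ζ))]

theorem IsTest.bounded_testX (h : IsTest x χ) : ∃ C : ℝ, ∀ ζ : ℝ, ‖testX χ ζ‖ ≤ C := by
  refine ⟨∫ y, |χ y|, fun ζ => ?_⟩
  simpa using h.norm_testX_le (ζ := ζ) (by simp)

open scoped FourierTransform in
theorem IsTest.inversion (h : IsTest x χ) (s : ℝ) :
    ∫ ζ : ℝ, testX χ ζ * Complex.exp (-(Complex.I * (ζ : ℂ) * (s : ℂ))) =
      2 * Real.pi * (χ s : ℂ) := by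
  set f : ℝ → ℂ := fun y => (χ y : ℂ) with hf
  have hpi := Real.pi_pos
  have hfc : Continuous f := Complex.continuous_ofReal.comp h.smooth.continuous
  have hF : ∀ w : ℝ, 𝓕 f w = testX χ ((-(2 * Real.pi) * w : ℝ) : ℂ) := fun w => by
    rw [Real.fourier_real_eq_integral_exp_smul, testX]
    refine integral_congr_ae (Eventually.of_forall fun y => ?_)
    simp only [smul_eq_mul, hf]
    rw [mul_comm]
    congr 2
    push_cast
    ring
  have hFi : Integrable (𝓕 f) := by
    have := h.integrable_testX.comp_mul_left' (R := -(2 * Real.pi)) (by linarith)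
    refine this.congr (Eventually.of_forall fun w => ?_)
    exact (hF w).symm
  have hinv := congrFun (hfc.fourierInv_fourier_eq h.integrable hFi) s
  rw [Real.fourierInv_eq'] at hinv
  have hsub := Measure.integral_comp_mul_left
    (fun ζ : ℝ => testX χ ζ * Complex.exp (-(Complex.I * (ζ : ℂ) * (s : ℂ)))) (-(2 * Real.pi))
  have e : ∫ w : ℝ, testX χ ((-(2 * Real.pi) * w : ℝ) : ℂ) *
      Complex.exp (-(Complex.I * ((-(2 * Real.pi) * w : ℝ) : ℂ) * (s : ℂ))) = χ s := by
    rw [show ((χ s : ℝ) : ℂ) = f s from rfl, ← hinv]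
    refine integral_congr_ae (Eventually.of_forall fun w => ?_)
    simp only [hF, smul_eq_mul]
    rw [mul_comm]
    congr 2
    simp
    ring
  rw [e, abs_inv, abs_neg, abs_of_pos (by positivity), Complex.real_smul] at hsub
  rw [hsub, ← mul_assoc, ← Complex.ofReal_ofNat, ← Complex.ofReal_mul, ← Complex.ofReal_mul,
    mul_inv_cancel₀ (by positivity), Complex.ofReal_one, one_mul]

/-- By Fubini and inversion, pairing with e^{−iζs} evaluates χ at s. -/
theorem IsTest.duality_kernel (h : IsTest x χ) {k : ℝ → ℂ} (hk : IntegrableOn k (Set.Ioi x)) :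
    ∫ ζ : ℝ, testX χ ζ * ∫ s in Set.Ioi x, k s * Complex.exp (-(Complex.I * (ζ : ℂ) * (s : ℂ))) =
      2 * Real.pi * ∫ y in Set.Ioi x, (χ y : ℂ) * k y := by
  rw [integral_swap_of_bounded h.integrable_testX hk
    (e := fun ζ s => Complex.exp (-(Complex.I * (ζ : ℂ) * (s : ℂ)))) (by fun_prop) (B := 1)
    fun a b => by rw [Complex.exp_neg, norm_inv, norm_exp_I_mul, inv_one]]
  simp only [h.inversion]
  rw [← integral_const_mul]
  refine integral_congr_ae (Eventually.of_forall fun y => ?_)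
  simp only
  ring

theorem IsTest.integral_eq_setIntegral (h : IsTest x χ) (g : ℝ → ℂ) :
    ∫ y, (χ y : ℂ) * g y = ∫ y in Set.Ioi x, (χ y : ℂ) * g y := by
  refine (setIntegral_eq_integral_of_forall_compl_eq_zero fun y hy => ?_).symm
  rw [h.eq_zero (not_lt.1 hy), Complex.ofReal_zero, zero_mul]

/-- The transform of χ carries e^{iζy} and the other factor carries e^{iζs}: the exponents add,
which is why the Marchenko kernels depend on s + y. -/
theorem IsTest.duality_point (h : IsTest x χ) {A : ℝ → ℂ} (hA : Integrable A) (s : ℝ) :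
    ∫ ζ : ℝ, testX χ ζ * A ζ * Complex.exp (Complex.I * (ζ : ℂ) * (s : ℂ)) =
      2 * Real.pi * ∫ y in Set.Ioi x, (χ y : ℂ) * invF A (s + y) := by
  have h1 := integral_swap_of_bounded (integrable_mul_exp hA s) h.integrable
    (e := fun ζ y => Complex.exp (Complex.I * (ζ : ℂ) * (y : ℂ))) (by fun_prop) (B := 1)
    fun a b => (norm_exp_I_mul a b).le
  rw [← h.integral_eq_setIntegral, ← integral_const_mul]
  have hpi : (Real.pi : ℂ) ≠ 0 := by exact_mod_cast Real.pi_pos.ne'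
  calc _ = ∫ ζ : ℝ, A ζ * Complex.exp (Complex.I * (ζ : ℂ) * (s : ℂ)) *
        ∫ y, (χ y : ℂ) * Complex.exp (Complex.I * (ζ : ℂ) * (y : ℂ)) := by
        refine integral_congr_ae (Eventually.of_forall fun ζ => ?_)
        simp only [testX]
        ring
    _ = _ := by
        rw [h1]
        refine integral_congr_ae (Eventually.of_forall fun y => ?_)
        simp only [invF]
        rw [show ∫ ζ : ℝ, A ζ * Complex.exp (Complex.I * (ζ : ℂ) * ((s + y : ℝ) : ℂ)) =
          ∫ ζ : ℝ, A ζ * Complex.exp (Complex.I * (ζ : ℂ) * (s : ℂ)) *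
            Complex.exp (Complex.I * (ζ : ℂ) * (y : ℂ)) from by
          refine integral_congr_ae (Eventually.of_forall fun ζ => ?_)
          simp only
          rw [mul_assoc (A ζ), ← Complex.exp_add]
          congr 2
          push_cast
          ring]
        rw [mul_left_comm, ← mul_assoc (2 * (Real.pi : ℂ)), mul_one_div_cancel (by simp [hpi]),
          one_mul]

theorem IsTest.integrable_testX_mul (h : IsTest x χ) {A : ℝ → ℂ} (hA : Integrable A) :
    Integrable fun ζ : ℝ => testX χ ζ * A ζ := by
  obtain ⟨C, hC⟩ := h.bounded_testX
  exact hA.bdd_mul (c := C)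
    (h.differentiable_testX.continuous.comp Complex.continuous_ofReal).aestronglyMeasurable
    (Eventually.of_forall hC)

theorem IsTest.duality_convolution (h : IsTest x χ) {A k : ℝ → ℂ} (hA : Integrable A)
    (hk : IntegrableOn k (Set.Ioi x)) :
    ∫ ζ : ℝ, testX χ ζ * A ζ * ∫ s in Set.Ioi x, k s * Complex.exp (Complex.I * (ζ : ℂ) * (s : ℂ)) =
      2 * Real.pi * ∫ y in Set.Ioi x, (χ y : ℂ) * ∫ s in Set.Ioi x, k s * invF A (s + y) := by
  rw [integral_swap_of_bounded (h.integrable_testX_mul hA) hk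
    (e := fun ζ s => Complex.exp (Complex.I * (ζ : ℂ) * (s : ℂ))) (by fun_prop) (B := 1)
    fun a b => (norm_exp_I_mul a b).le]
  simp only [h.duality_point hA]
  have hc : Continuous fun P : ℝ × ℝ => invF A (P.1 + P.2) :=
    (continuous_invF hA).comp (by fun_prop)
  have h1 := integral_swap_of_bounded (μ := volume.restrict (Set.Ioi x))
    (ν := volume.restrict (Set.Ioi x)) hk h.integrable.integrableOn
    (e := fun s y => invF A (s + y)) hc fun a b => norm_invF_le A (a + b)
  rw [← h1, ← integral_const_mul]
  refine integral_congr_ae (Eventually.of_forall fun y => ?_)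
  simp only
  ring

end

/-! ### From a spectral identity to an integral equation -/

/-- The fundamental lemma of the calculus of variations gives vanishing almost everywhere on the
open half-line; continuity then includes the endpoint y = x. -/
theorem eq_zero_of_forall_isTest {x : ℝ} {E : ℝ → ℂ} (hE : ContinuousOn E (Set.Ici x))
    (h : ∀ χ, IsTest x χ → ∫ y in Set.Ioi x, (χ y : ℂ) * E y = 0) {y : ℝ} (hy : x ≤ y) :
    E y = 0 := by
  have hloc : LocallyIntegrableOn E (Set.Ioi x) :=
    (hE.mono Set.Ioi_subset_Ici_self).locallyIntegrableOn measurableSet_Ioi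
  have hae := isOpen_Ioi.ae_eq_zero_of_integral_contDiff_smul_eq_zero hloc fun g h1 h2 h3 => by
    have ht : IsTest x g := ⟨h1, h2, h3⟩
    have := h g ht
    rw [← ht.integral_eq_setIntegral] at this
    simpa only [Complex.real_smul] using this
  rw [← ae_restrict_iff' measurableSet_Ioi, restrict_Ioi_eq_restrict_Ici] at hae
  refine Measure.eqOn_of_ae_eq (g := fun _ => 0) hae hE continuousOn_const ?_ hy
  rw [interior_Ici, closure_Ioi]

/-- An inverse Fourier transform with the contribution of a pole subtracted. -/
def poleF (A : ℝ → ℂ) (α κ : ℂ) (z : ℝ) : ℂ := invF A z - α * Complex.exp (Complex.I * κ * z)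

section

variable {x : ℝ}

theorem integrable_kernel_exp {k : ℝ → ℂ} (hk : IntegrableOn k (Set.Ioi x)) {κ : ℂ}
    (hκ : 0 ≤ κ.im) :
    IntegrableOn (fun s : ℝ => k s * Complex.exp (Complex.I * κ * s)) (Set.Ioi x) := by
  refine Integrable.mul_bdd (c := Real.exp (-(κ.im * x))) hk (by fun_prop)
    ((ae_restrict_iff' measurableSet_Ioi).2 (Eventually.of_forall fun s hs => ?_))
  rw [Complex.norm_exp]
  have e : (Complex.I * κ * (s : ℂ)).re = -(κ.im * s) := by simp
  rw [e]
  have : x < s := hs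
  gcongr

theorem integrable_kernel_invF {k A : ℝ → ℂ} (hk : IntegrableOn k (Set.Ioi x)) (hA : Integrable A)
    (y : ℝ) : IntegrableOn (fun s : ℝ => k s * invF A (s + y)) (Set.Ioi x) :=
  Integrable.mul_bdd hk ((continuous_invF hA).comp (by fun_prop)).aestronglyMeasurable
    (Eventually.of_forall fun s => norm_invF_le A (s + y))

theorem continuous_conv_invF {k A : ℝ → ℂ} (hk : IntegrableOn k (Set.Ioi x)) (hA : Integrable A) :
    Continuous fun y => ∫ s in Set.Ioi x, k s * invF A (s + y) := by
  refine continuous_of_dominated (bound := fun s => ‖k s‖ * (‖1 / (2 * (Real.pi : ℂ))‖ * ∫ ζ, ‖A ζ‖))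
    (fun y => (integrable_kernel_invF hk hA y).aestronglyMeasurable)
    (fun y => Eventually.of_forall fun s => ?_) (hk.norm.mul_const _)
    (Eventually.of_forall fun s =>
      continuous_const.mul ((continuous_invF hA).comp (by fun_prop)))
  rw [norm_mul]
  gcongr
  exact norm_invF_le A _

theorem kernel_mul_poleF (k A : ℝ → ℂ) (α κ : ℂ) (y s : ℝ) : k s * poleF A α κ (s + y) =
    k s * invF A (s + y) -
      Complex.exp (Complex.I * κ * y) * α * (k s * Complex.exp (Complex.I * κ * s)) := by
  have : Complex.exp (Complex.I * κ * ((s + y : ℝ) : ℂ)) =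
      Complex.exp (Complex.I * κ * s) * Complex.exp (Complex.I * κ * y) := by
    rw [← Complex.exp_add]; congr 1; push_cast; ring
  rw [poleF, this]
  ring

theorem integrable_kernel_poleF {k A : ℝ → ℂ} (hk : IntegrableOn k (Set.Ioi x))
    (hA : Integrable A) {κ : ℂ} (hκ : 0 ≤ κ.im) (α : ℂ) (y : ℝ) :
    IntegrableOn (fun s => k s * poleF A α κ (s + y)) (Set.Ioi x) := by
  simp only [kernel_mul_poleF]
  exact (integrable_kernel_invF hk hA y).sub ((integrable_kernel_exp hk hκ).const_mul _)

theorem integral_kernel_poleF {k A : ℝ → ℂ} (hk : IntegrableOn k (Set.Ioi x))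
    (hA : Integrable A) {κ : ℂ} (hκ : 0 ≤ κ.im) (α : ℂ) (y : ℝ) :
    ∫ s in Set.Ioi x, k s * poleF A α κ (s + y) = (∫ s in Set.Ioi x, k s * invF A (s + y)) -
      Complex.exp (Complex.I * κ * y) *
        (α * ∫ s in Set.Ioi x, k s * Complex.exp (Complex.I * κ * s)) := by
  simp only [kernel_mul_poleF]
  rw [integral_sub (integrable_kernel_invF hk hA y) ((integrable_kernel_exp hk hκ).const_mul _),
    integral_const_mul, mul_assoc]

theorem bounded_continuous_kernel_exp {k : ℝ → ℂ} (hk : IntegrableOn k (Set.Ioi x)) {e : ℝ → ℝ → ℂ}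
    (he : Continuous fun P : ℝ × ℝ => e P.1 P.2) (hB : ∀ a b, ‖e a b‖ ≤ 1) :
    (Continuous fun ζ : ℝ => ∫ s in Set.Ioi x, k s * e ζ s) ∧
      ∀ ζ, ‖∫ s in Set.Ioi x, k s * e ζ s‖ ≤ ∫ s in Set.Ioi x, ‖k s‖ := by
  have hle : ∀ ζ s, ‖k s * e ζ s‖ ≤ ‖k s‖ := fun ζ s => by
    rw [norm_mul]; exact mul_le_of_le_one_right (norm_nonneg _) (hB ζ s)
  have hm : ∀ ζ, AEStronglyMeasurable (fun s => k s * e ζ s) (volume.restrict (Set.Ioi x)) :=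
    fun ζ => hk.aestronglyMeasurable.mul
      (by exact (he.comp (by fun_prop : Continuous fun s : ℝ => (ζ, s))).aestronglyMeasurable)
  refine ⟨continuous_of_dominated hm (fun ζ => Eventually.of_forall (hle ζ)) hk.norm
    (Eventually.of_forall fun s => continuous_const.mul
      (he.comp (by fun_prop : Continuous fun ζ : ℝ => (ζ, s)))), fun ζ => ?_⟩
  exact (norm_integral_le_integral_norm _).trans (integral_mono_of_nonneg
    (Eventually.of_forall fun s => norm_nonneg _) hk.norm (Eventually.of_forall (hle ζ)))

theorem bounded_continuous_kernel_exp_pos {k : ℝ → ℂ} (hk : IntegrableOn k (Set.Ioi x)) :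
    (Continuous fun ζ : ℝ =>
        ∫ s in Set.Ioi x, k s * Complex.exp (Complex.I * (ζ : ℂ) * (s : ℂ))) ∧
      ∀ ζ : ℝ, ‖∫ s in Set.Ioi x, k s * Complex.exp (Complex.I * (ζ : ℂ) * (s : ℂ))‖ ≤
        ∫ s in Set.Ioi x, ‖k s‖ :=
  bounded_continuous_kernel_exp (e := fun ζ s => Complex.exp (Complex.I * (ζ : ℂ) * (s : ℂ))) hk
    (by fun_prop) fun a b => (norm_exp_I_mul a b).le

theorem bounded_continuous_kernel_exp_neg {k : ℝ → ℂ} (hk : IntegrableOn k (Set.Ioi x)) :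
    (Continuous fun ζ : ℝ =>
        ∫ s in Set.Ioi x, k s * Complex.exp (-(Complex.I * (ζ : ℂ) * (s : ℂ)))) ∧
      ∀ ζ : ℝ, ‖∫ s in Set.Ioi x, k s * Complex.exp (-(Complex.I * (ζ : ℂ) * (s : ℂ)))‖ ≤
        ∫ s in Set.Ioi x, ‖k s‖ :=
  bounded_continuous_kernel_exp (e := fun ζ s => Complex.exp (-(Complex.I * (ζ : ℂ) * (s : ℂ)))) hk
    (by fun_prop) fun a b => by rw [Complex.exp_neg, norm_inv, norm_exp_I_mul, inv_one]

theorem integral_lin {μ : Measure ℝ} {f₁ f₂ f₃ f₄ f₅ : ℝ → ℂ} (h₁ : Integrable f₁ μ)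
    (h₂ : Integrable f₂ μ) (h₃ : Integrable f₃ μ) (h₄ : Integrable f₄ μ) (h₅ : Integrable f₅ μ)
    (a₁ a₂ a₃ a₄ a₅ : ℂ) :
    ∫ t, (a₁ * f₁ t + a₂ * f₂ t + a₃ * f₃ t + a₄ * f₄ t + a₅ * f₅ t) ∂μ =
      a₁ * ∫ t, f₁ t ∂μ + a₂ * ∫ t, f₂ t ∂μ + a₃ * ∫ t, f₃ t ∂μ + a₄ * ∫ t, f₄ t ∂μ +
        a₅ * ∫ t, f₅ t ∂μ := by
  have i₁ := h₁.const_mul a₁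
  have i₂ := h₂.const_mul a₂
  have i₃ := h₃.const_mul a₃
  have i₄ := h₄.const_mul a₄
  have i₅ := h₅.const_mul a₅
  have e₄ := integral_add (((i₁.add i₂).add i₃).add i₄) i₅
  have e₃ := integral_add ((i₁.add i₂).add i₃) i₄
  have e₂ := integral_add (i₁.add i₂) i₃
  have e₁ := integral_add i₁ i₂
  simp only [Pi.add_apply] at e₁ e₂ e₃ e₄
  rw [e₄, e₃, e₂, e₁]
  simp only [integral_const_mul]

/-- A spectral identity tested against all test functions gives a linear integral equation. -/
theorem integral_equation_of_spectral {K₁ K₂ k A B : ℝ → ℂ} (hK₁ : IntegrableOn K₁ (Set.Ioi x))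
    (hK₂ : IntegrableOn K₂ (Set.Ioi x)) (hk : IntegrableOn k (Set.Ioi x))
    (hkc : ContinuousOn k (Set.Ici x)) (hA : Integrable A) (hB : Integrable B) {κ : ℂ}
    (hκ : 0 ≤ κ.im) {α β c d : ℂ}
    (h : ∀ χ, IsTest x χ → ∫ ζ : ℝ, testX χ ζ *
        (c * Complex.exp (-(Complex.I * (ζ : ℂ) * (x : ℂ))) -
          d * (∫ s in Set.Ioi x, k s * Complex.exp (-(Complex.I * (ζ : ℂ) * (s : ℂ)))) +
          A ζ * (Complex.exp (Complex.I * (ζ : ℂ) * (x : ℂ)) -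
            ∫ s in Set.Ioi x, K₁ s * Complex.exp (Complex.I * (ζ : ℂ) * (s : ℂ))) -
          B ζ * ∫ s in Set.Ioi x, K₂ s * Complex.exp (Complex.I * (ζ : ℂ) * (s : ℂ))) =
      2 * Real.pi * (testX χ κ * (α * Complex.exp (Complex.I * κ * x) -
        (α * (∫ s in Set.Ioi x, K₁ s * Complex.exp (Complex.I * κ * s)) +
          β * ∫ s in Set.Ioi x, K₂ s * Complex.exp (Complex.I * κ * s))))) {y : ℝ} (hy : x ≤ y) :
    IntegrableOn (fun s => K₁ s * poleF A α κ (s + y) + K₂ s * poleF B β κ (s + y)) (Set.Ioi x) ∧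
    d * k y = poleF A α κ (x + y) -
      ∫ s in Set.Ioi x, (K₁ s * poleF A α κ (s + y) + K₂ s * poleF B β κ (s + y)) := by
  have i1 := fun y => integrable_kernel_poleF hK₁ hA hκ α y
  have i2 := fun y => integrable_kernel_poleF hK₂ hB hκ β y
  refine ⟨(i1 y).add (i2 y), ?_⟩
  rw [integral_add (i1 y) (i2 y), integral_kernel_poleF hK₁ hA hκ, integral_kernel_poleF hK₂ hB hκ]
  set L₁ := ∫ s in Set.Ioi x, K₁ s * Complex.exp (Complex.I * κ * s)
  set L₂ := ∫ s in Set.Ioi x, K₂ s * Complex.exp (Complex.I * κ * s)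
  set M : ℂ := α * Complex.exp (Complex.I * κ * x) - (α * L₁ + β * L₂)
  let E : ℝ → ℂ := fun y => d * k y - invF A (x + y) + (∫ s in Set.Ioi x, K₁ s * invF A (s + y)) +
    (∫ s in Set.Ioi x, K₂ s * invF B (s + y)) + Complex.exp (Complex.I * κ * y) * M
  have cA : Continuous fun y => invF A (x + y) := (continuous_invF hA).comp (by fun_prop)
  have c1 := continuous_conv_invF hK₁ hA
  have c2 := continuous_conv_invF hK₂ hB
  have hEc : ContinuousOn E (Set.Ici x) :=
    ((((hkc.const_mul d).sub cA.continuousOn).add c1.continuousOn).add c2.continuousOn).add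
      (by fun_prop)
  suffices hE : E y = 0 by
    have e : Complex.exp (Complex.I * κ * ((x + y : ℝ) : ℂ)) =
        Complex.exp (Complex.I * κ * x) * Complex.exp (Complex.I * κ * y) := by
      rw [← Complex.exp_add]; congr 1; push_cast; ring
    simp only [E, M] at hE
    rw [poleF, e]
    linear_combination hE
  refine eq_zero_of_forall_isTest hEc (fun χ hχ => ?_) hy
  have hπ : (2 * Real.pi : ℂ) ≠ 0 := by
    exact_mod_cast (by positivity : (2 * Real.pi : ℝ) ≠ 0)
  have hX := hχ.integrable_testX
  have b1 := bounded_continuous_kernel_exp_neg hk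
  have bp₁ := bounded_continuous_kernel_exp_pos hK₁
  have bp₂ := bounded_continuous_kernel_exp_pos hK₂
  have j0 : Integrable fun ζ : ℝ =>
      testX χ ζ * Complex.exp (-(Complex.I * (ζ : ℂ) * (x : ℂ))) :=
    hX.mul_bdd (c := 1) (by fun_prop) (Eventually.of_forall fun ζ => by
      rw [Complex.exp_neg, norm_inv, norm_exp_I_mul, inv_one])
  have j1 : Integrable fun ζ : ℝ => testX χ ζ *
      ∫ s in Set.Ioi x, k s * Complex.exp (-(Complex.I * (ζ : ℂ) * (s : ℂ))) :=
    hX.mul_bdd b1.1.aestronglyMeasurable (Eventually.of_forall b1.2)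
  have jA := hχ.integrable_testX_mul hA
  have jB := hχ.integrable_testX_mul hB
  have j2 := integrable_mul_exp jA x
  have j3 := jA.mul_bdd bp₁.1.aestronglyMeasurable (Eventually.of_forall bp₁.2)
  have j4 := jB.mul_bdd bp₂.1.aestronglyMeasurable (Eventually.of_forall bp₂.2)
  have lhs : ∫ ζ : ℝ, testX χ ζ *
        (c * Complex.exp (-(Complex.I * (ζ : ℂ) * (x : ℂ))) -
          d * (∫ s in Set.Ioi x, k s * Complex.exp (-(Complex.I * (ζ : ℂ) * (s : ℂ)))) +
          A ζ * (Complex.exp (Complex.I * (ζ : ℂ) * (x : ℂ)) -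
            ∫ s in Set.Ioi x, K₁ s * Complex.exp (Complex.I * (ζ : ℂ) * (s : ℂ))) -
          B ζ * ∫ s in Set.Ioi x, K₂ s * Complex.exp (Complex.I * (ζ : ℂ) * (s : ℂ))) =
      2 * Real.pi * (-(d * ∫ y in Set.Ioi x, (χ y : ℂ) * k y) +
        (∫ y in Set.Ioi x, (χ y : ℂ) * invF A (x + y)) -
        (∫ y in Set.Ioi x, (χ y : ℂ) * ∫ s in Set.Ioi x, K₁ s * invF A (s + y)) -
        ∫ y in Set.Ioi x, (χ y : ℂ) * ∫ s in Set.Ioi x, K₂ s * invF B (s + y)) := by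
    refine (integral_congr_ae (Eventually.of_forall fun ζ => ?_)).trans
      ((integral_lin j0 j1 j2 j3 j4 c (-d) 1 (-1) (-1)).trans ?_)
    · ring
    -- The free term with coefficient c inverts to 2πcχ(x), which is zero by the support condition.
    · rw [hχ.inversion, hχ.eq_zero le_rfl, hχ.duality_kernel hk, hχ.duality_point hA,
        hχ.duality_convolution hA hK₁, hχ.duality_convolution hB hK₂, Complex.ofReal_zero]
      ring
  have key := (lhs.symm.trans (h χ hχ))
  have key := mul_left_cancel₀ hπ key
  have hXκ : testX χ κ = ∫ y in Set.Ioi x, (χ y : ℂ) * Complex.exp (Complex.I * κ * y) := by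
    rw [← hχ.integral_eq_setIntegral, testX]
  have n1 : IntegrableOn (fun y => (χ y : ℂ) * k y) (Set.Ioi x) := by
    obtain ⟨C, hC⟩ := hχ.compact.exists_bound_of_continuous hχ.smooth.continuous
    refine Integrable.bdd_mul (c := C) hk
      (Complex.continuous_ofReal.comp hχ.smooth.continuous).aestronglyMeasurable
      (Eventually.of_forall fun y => ?_)
    rw [Complex.norm_real]
    exact hC y
  have n2 := (hχ.integrable_mul cA).integrableOn (s := Set.Ioi x)
  have n3 := (hχ.integrable_mul c1).integrableOn (s := Set.Ioi x)
  have n4 := (hχ.integrable_mul c2).integrableOn (s := Set.Ioi x)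
  have n5 := (hχ.integrable_mul (e := fun y : ℝ => Complex.exp (Complex.I * κ * y))
    (by fun_prop)).integrableOn (s := Set.Ioi x)
  refine (integral_congr_ae (Eventually.of_forall fun y => ?_)).trans
    ((integral_lin n1 n2 n3 n4 n5 d (-1) 1 1 M).trans ?_)
  · simp only [E]
    ring
  · rw [← hXκ]
    linear_combination -key

end

/-! ### The scattering relation and the contour integral -/

theorem star_lam_of_real {z : ℂ} (hreal : star z = z) : star (lam z) = lam z := by
  refine Complex.conj_eq_iff_im.2 ?_
  rw [lam_im, Complex.conj_eq_iff_im.1 hreal, zero_mul]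

/-- The reflection coefficient `c = b / a` as a function of the real uniformizer. -/
def reflCoef (q : ℝ → ℂ) (z : ℂ) : ℂ := -wrB q z / wr q z

theorem Tame.cRight_eq {q : ℝ → ℂ} (hq : Tame q) {z : ℂ} (hz : z ∈ sheet) (hreal : star z = z) :
    cRight q (lam z) (zet z) = reflCoef q z := by
  rw [cRight, hq.coeffA_eq hz, hq.coeffB_eq hz hreal, reflCoef,
    div_div_div_cancel_right₀ (one_sub_ne_zero hz)]

theorem Tame.isSolution_left {q : ℝ → ℂ} (hq : Tame q) {z : ℂ} (hz : z ∈ sheet) :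
    IsSolution q (lam z) (reflSol (jost (GPMarchenko.refl q) z)) := by
  have h := (hq.left.isJost hz).1.reflSol
  rwa [refl_refl] at h

theorem Tame.wronskian_left_right {q : ℝ → ℂ} (hq : Tame q) {z : ℂ} (hz : z ∈ sheet) (x : ℝ) :
    jost (GPMarchenko.refl q) z (-x) 1 * jost q z x 1 +
      jost (GPMarchenko.refl q) z (-x) 0 * jost q z x 0 = wr q z := by
  have h := (hq.isSolution_left hz).wronskian_eq (hq.right.isJost hz).1 x
  simp only [wronskian, reflSol, wr, neg_zero, Matrix.cons_val_zero, Matrix.cons_val_one,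
    Matrix.cons_val_fin_one] at h ⊢
  linear_combination h

theorem Tame.wronskian_left_conj {q : ℝ → ℂ} (hq : Tame q) {z : ℂ} (hz : z ∈ sheet)
    (hreal : star z = z) (x : ℝ) :
    jost (GPMarchenko.refl q) z (-x) 1 * star (jost q z x 0) +
      jost (GPMarchenko.refl q) z (-x) 0 * star (jost q z x 1) = wrB q z := by
  have h2 := (hq.right.isJost hz).1.swapConj
  rw [star_lam_of_real hreal] at h2
  have h := (hq.isSolution_left hz).wronskian_eq h2 x
  simp only [wronskian, reflSol, swapConj, wrB, neg_zero, Matrix.cons_val_zero,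
    Matrix.cons_val_one, Matrix.cons_val_fin_one] at h ⊢
  linear_combination h

/-- The scattering relation on the real line. -/
theorem Tame.scattering {q : ℝ → ℂ} (hq : Tame q) {z : ℂ} (hz : z ∈ sheet) (hreal : star z = z)
    (x : ℝ) : (1 - 1 / (2 * z ^ 2)) * jost (GPMarchenko.refl q) z (-x) 1 / wr q z =
      rt2 / 2 / z * jost q (1 / (2 * z)) x 0 + reflCoef q z * jost q z x 0 := by
  have h0 := hq.wronskian_left_right hz x
  have h1 := hq.wronskian_left_conj hz hreal x
  have hw := (norm_sq_lt_of_real hq hz hreal).2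
  have hE := hq.right.energy_jost_eq hz hreal x
  simp only [energy] at hE
  push_cast at hE
  rw [← Complex.mul_conj, ← Complex.mul_conj] at hE
  change _ * star _ - _ * star _ = _ at hE
  have hs := (hq.right.jost_inv_star hz x).1
  rw [hreal] at hs
  have hr := rt2_half_ne
  have hz0 := hz.2.1
  have hs' : rt2 / 2 / z * jost q (1 / (2 * z)) x 0 = star (jost q z x 1) := by
    rw [hs, ← mul_assoc, div_mul_div_cancel₀ hz0, div_self hr, one_mul]
  have hc : reflCoef q z * jost q z x 0 * wr q z = -wrB q z * jost q z x 0 := by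
    rw [reflCoef]; field_simp
  rw [hs', div_eq_iff hw, add_mul, hc]
  -- Cramer's rule: the two Wronskians expand φ₁ in the basis formed by ψ₂ and its conjugate, whose
  -- determinant is the energy 1 − 1/(2z²).
  linear_combination -jost (GPMarchenko.refl q) z (-x) 1 * hE + star (jost q z x 1) * h0 -
    jost q z x 0 * h1

/-- The integrand of the contour integral. -/
def contourFun (q : ℝ → ℂ) (x : ℝ) (χ : ℝ → ℝ) (p : ℂ → ℂ) (z : ℂ) : ℂ :=
  p z * (1 - 1 / (2 * z ^ 2)) * jost (refl q) z (-x) 1 * testX χ (zet z) / (z * wr q z)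

theorem RightTame.norm_jost_le {q : ℝ → ℂ} (hq : RightTame q) (x : ℝ) : ∃ C : ℝ, 0 ≤ C ∧
    ∀ z ∈ sheet, ∀ i, ‖jost q z x i‖ ≤ Real.exp (-((zet z).im * x)) * ((1 + 1 / ‖z‖) * C) := by
  obtain ⟨m, C, δ, -, -, -, hb, -, -, -, hm⟩ := hq.jost_spec
  refine ⟨max (C x) 0, le_max_right _ _, fun z hz i => ?_⟩
  rw [hm z hz x i, norm_mul, Complex.norm_exp]
  have e : (Complex.I * zet z * (x : ℂ)).re = -((zet z).im * x) := by simp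
  rw [e]
  gcongr
  exact (hb z hz i x).trans (by gcongr; exact le_max_left _ _)

/-- The zero-free bound on 1/a removes the Wronskian, and the exponentials of φ₁ and of the test
transform cancel. Rapid decay of the transform pays for the rest. -/
theorem Tame.contourFun_bound {q : ℝ → ℂ} (hq : Tame q) {z₀ : ℂ} (hz₀ : z₀ ∈ upper)
    (huniq : ∀ z ∈ upper, wr q z = 0 → z = z₀) {x : ℝ} {χ : ℝ → ℝ} (hχ : IsTest x χ) {p : ℂ → ℂ}
    {A : ℝ} (hA : 0 ≤ A) (hp : ∀ z, ‖p z‖ ≤ A * (1 + ‖z‖)) {ρ : ℝ} (hρ : 0 < ρ) :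
    ∃ C : ℝ, 0 ≤ C ∧ ∀ z ∈ upper, ρ ≤ ‖z - z₀‖ → ‖contourFun q x χ p z‖ ≤ C / (1 + ‖z‖ ^ 2) := by
  obtain ⟨C₁, hC₁, h1⟩ := hq.transmission_bound hz₀ huniq hρ
  obtain ⟨C₂, hC₂, h2⟩ := hq.left.norm_jost_le (-x)
  -- Five powers of 2|ζ| + 1: one for p, one for 1 + 1/|z|, one for 1/|z|, and two for the required
  -- decay 1 + |z|².
  obtain ⟨C₃, hC₃, h3⟩ := hχ.exists_testX_le 5
  refine ⟨24 * A * C₁ * C₂ * C₃, by positivity, fun z hz hzρ => ?_⟩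
  have hz0 : z ≠ 0 := (upper_subset_sheet hz).2.1
  have hw : 0 < ‖wr q z‖ := norm_pos_iff.2 fun h => by
    rw [huniq z hz h, sub_self, norm_zero] at hzρ
    exact absurd hzρ (not_le.2 hρ)
  have hn : 0 < ‖z‖ := norm_pos_iff.2 hz0
  set w := 2 * ‖zet z‖ + 1 with hwdef
  have hw1 : 1 ≤ w := by have := norm_nonneg (zet z); linarith
  have b1 : ‖z‖ ≤ w := norm_le_zet hz0
  have b2 : 1 / ‖z‖ ≤ 2 * w := by
    have := norm_inv_le_zet hz0
    rw [norm_div, norm_mul, norm_one, Complex.norm_ofNat] at this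
    have e : 1 / ‖z‖ = 2 * (1 / (2 * ‖z‖)) := by field_simp
    rw [e]
    linarith
  have t1 := h1 z hz hzρ
  have t2 := h2 z (upper_subset_sheet hz) 1
  have t3 := h3 (zet z) (zet_im_nonneg (le_of_lt hz))
  have e1 : -((zet z).im * -x) = (zet z).im * x := by ring
  rw [e1] at t2
  have hee : Real.exp ((zet z).im * x) * Real.exp (-((zet z).im * x)) = 1 := by
    rw [← Real.exp_add, add_neg_cancel, Real.exp_zero]
  have h5 : 0 < 1 + ‖z‖ ^ 2 := by positivity
  rw [contourFun, norm_div, norm_mul, norm_mul, norm_mul, norm_mul z]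
  have s1 : (1 + ‖z‖) * (1 + 1 / ‖z‖) * (1 / ‖z‖) * (1 + ‖z‖ ^ 2) ≤ 24 * w ^ 5 := by
    have a1 : 1 + ‖z‖ ≤ 2 * w := by linarith
    have a2 : 1 + 1 / ‖z‖ ≤ 3 * w := by linarith
    have a3 : 1 + ‖z‖ ^ 2 ≤ 2 * w ^ 2 := by nlinarith
    calc _ ≤ (2 * w) * (3 * w) * (2 * w) * (2 * w ^ 2) := by gcongr
      _ = _ := by ring
  have hX := norm_nonneg (testX χ (zet z))
  rw [le_div_iff₀ h5]
  calc ‖p z‖ * ‖1 - 1 / (2 * z ^ 2)‖ * ‖jost (GPMarchenko.refl q) z (-x) 1‖ * ‖testX χ (zet z)‖ /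
        (‖z‖ * ‖wr q z‖) * (1 + ‖z‖ ^ 2)
      ≤ (A * (1 + ‖z‖)) * (C₁ * ‖wr q z‖) *
        (Real.exp ((zet z).im * x) * ((1 + 1 / ‖z‖) * C₂)) * ‖testX χ (zet z)‖ /
        (‖z‖ * ‖wr q z‖) * (1 + ‖z‖ ^ 2) := by
        gcongr
        exact hp z
    _ = A * C₁ * C₂ * Real.exp ((zet z).im * x) *
        ((1 + ‖z‖) * (1 + 1 / ‖z‖) * (1 / ‖z‖) * (1 + ‖z‖ ^ 2)) * ‖testX χ (zet z)‖ := by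
        field_simp
    _ ≤ A * C₁ * C₂ * Real.exp ((zet z).im * x) * (24 * w ^ 5) * ‖testX χ (zet z)‖ := by
        gcongr
    _ = 24 * A * C₁ * C₂ * Real.exp ((zet z).im * x) * (w ^ 5 * ‖testX χ (zet z)‖) := by ring
    _ ≤ 24 * A * C₁ * C₂ * Real.exp ((zet z).im * x) * (C₃ * Real.exp (-((zet z).im * x))) := by
        gcongr
    _ = 24 * A * C₁ * C₂ * C₃ := by linear_combination (24 * A * C₁ * C₂ * C₃) * hee

theorem ofReal_mem_sheet {t : ℝ} (h0 : t ≠ 0) (h1 : zet t ≠ 0) : (t : ℂ) ∈ sheet :=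
  ⟨by simp, by exact_mod_cast h0, h1⟩

theorem ae_mem_sheet : ∀ᵐ t : ℝ, (t : ℂ) ∈ sheet := by
  have hs : (t : ℝ) → t ∉ ({0, Real.sqrt 2 / 2, -(Real.sqrt 2 / 2)} : Set ℝ) →
      (t : ℂ) ∈ sheet := fun t ht => by
    simp only [Set.mem_insert_iff, Set.mem_singleton_iff, not_or] at ht
    refine ofReal_mem_sheet ht.1 fun h => ?_
    have h2 := (zet_eq_zero_iff (by exact_mod_cast ht.1)).1 h
    have h3 : t ^ 2 = (Real.sqrt 2 / 2) ^ 2 := by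
      rw [div_pow, Real.sq_sqrt (by norm_num)]
      have h2' : t ^ 2 = 1 / 2 := by
        have : ((t ^ 2 : ℝ) : ℂ) = ((1 / 2 : ℝ) : ℂ) := by push_cast; exact h2
        exact_mod_cast this
      rw [h2']; norm_num
    rcases sq_eq_sq_iff_eq_or_eq_neg.1 h3 with h | h
    · exact ht.2.1 h
    · exact ht.2.2 h
  have hc : ({0, Real.sqrt 2 / 2, -(Real.sqrt 2 / 2)} : Set ℝ).Countable := by simp
  filter_upwards [hc.ae_notMem volume] with t ht using hs t ht

/-- Dividing `wr` by z − z₀ through `dslope` leaves a function without zeros in the half-plane,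
because z₀ is the only zero and is simple. This exhibits the integrand as a holomorphic function
over z − z₀. -/
theorem Tame.integral_contourFun {q : ℝ → ℂ} (hq : Tame q) {z₀ : ℂ} (hz₀ : z₀ ∈ upper)
    (hzero : wr q z₀ = 0) (huniq : ∀ z ∈ upper, wr q z = 0 → z = z₀) {x : ℝ} {χ : ℝ → ℝ}
    (hχ : IsTest x χ) {p : ℂ → ℂ} (hpd : Differentiable ℂ p) {A : ℝ} (hA : 0 ≤ A)
    (hp : ∀ z, ‖p z‖ ≤ A * (1 + ‖z‖)) :
    Integrable (fun t : ℝ => contourFun q x χ p t) ∧ ∫ t : ℝ, contourFun q x χ p t =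
      2 * Real.pi * Complex.I * (p z₀ * (1 - 1 / (2 * z₀ ^ 2)) *
        jost (GPMarchenko.refl q) z₀ (-x) 1 * testX χ (zet z₀) / z₀ / deriv (wr q) z₀) := by
  have hne : ∀ z ∈ sheet, z ≠ 0 := fun z hz => hz.2.1
  have hneu : ∀ z ∈ upper, z ≠ 0 := fun z hz => hne z (upper_subset_sheet hz)
  have hX : Differentiable ℂ (testX χ) := hχ.differentiable_testX
  have hd : DifferentiableOn ℂ (dslope (wr q) z₀) upper :=
    (Complex.differentiableOn_dslope (isOpen_upper.mem_nhds hz₀)).2 hq.differentiableOn_wr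
  have hdn : ∀ z ∈ upper, dslope (wr q) z₀ z ≠ 0 := fun z hz => by
    rcases eq_or_ne z z₀ with rfl | hzz
    · rw [dslope_same]; exact hq.deriv_wr_ne_zero hz₀ hzero
    · rw [dslope_of_ne _ hzz, slope_def_field, hzero, sub_zero]
      exact div_ne_zero (fun h => hzz (huniq z hz h)) (sub_ne_zero.2 hzz)
  have hzet : DifferentiableOn ℂ zet upper := fun z hz =>
    (differentiableAt_zet (hneu z hz)).differentiableWithinAt
  have hD : DifferentiableOn ℂ (fun z : ℂ => 1 - 1 / (2 * z ^ 2)) upper := fun z hz => by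
    have := hneu z hz
    refine DifferentiableAt.differentiableWithinAt ?_
    fun_prop (disch := simp [this])
  have key := integral_real_eq_residue (f := contourFun q x χ p) (H := fun z =>
      p z * (1 - 1 / (2 * z ^ 2)) * jost (GPMarchenko.refl q) z (-x) 1 * testX χ (zet z) / z /
        dslope (wr q) z₀ z) hz₀
    ((((((hpd.differentiableOn).mul hD).mul (hq.left.differentiableOn_jost (-x) 1)).mul
      (hX.differentiableOn.comp hzet (Set.mapsTo_univ _ _))).div differentiableOn_id hneu).div
      hd hdn)
    (fun z hz hzz => by
      have h1 : dslope (wr q) z₀ z = wr q z / (z - z₀) := by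
        rw [dslope_of_ne _ hzz, slope_def_field, hzero, sub_zero]
      have h2 : z - z₀ ≠ 0 := sub_ne_zero.2 hzz
      have h3 : wr q z ≠ 0 := fun h => hzz (huniq z hz h)
      have h4 := hneu z hz
      simp only [contourFun, h1]
      field_simp)
    (fun ρ hρ => hq.contourFun_bound hz₀ huniq hχ hA hp hρ)
    (by
      filter_upwards [ae_mem_sheet] with t ht
      have hreal : star (t : ℂ) = t := Complex.conj_ofReal t
      have hw := (norm_sq_lt_of_real hq ht hreal).2
      have c1 : ContinuousWithinAt (fun z : ℂ => 1 - 1 / (2 * z ^ 2)) sheet t := by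
        have := hne _ ht
        refine ContinuousAt.continuousWithinAt ?_
        fun_prop (disch := simp [this])
      have c2 : ContinuousWithinAt (fun z => testX χ (zet z)) sheet t :=
        hX.continuous.continuousAt.comp_continuousWithinAt
          (differentiableAt_zet (hne _ ht)).continuousAt.continuousWithinAt
      have hcont : ContinuousWithinAt (contourFun q x χ p) sheet t :=
        (((hpd.continuous.continuousWithinAt.mul c1).mul
          (hq.left.continuousOn_jost (-x) 1 _ ht)).mul c2).div
          (continuousWithinAt_id.mul (hq.continuousOn_wr _ ht)) (mul_ne_zero (hne _ ht) hw)
      refine hcont.tendsto.comp (tendsto_nhdsWithin_iff.2 ⟨?_, ?_⟩)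
      · have : Tendsto (fun η : ℝ => (t : ℂ) + η * Complex.I) (𝓝 0)
            (𝓝 ((t : ℂ) + ((0 : ℝ) : ℂ) * Complex.I)) := by
          refine Continuous.tendsto ?_ _
          fun_prop
        rw [Complex.ofReal_zero, zero_mul, add_zero] at this
        exact this.mono_left nhdsWithin_le_nhds
      · filter_upwards [self_mem_nhdsWithin] with η hη
        exact upper_subset_sheet (add_mul_I_mem_upper t hη))
  simpa only [dslope_same] using key

/-! ### The two branches of the real hyperbola -/

/-- `λ(ζ)` as a real number. -/
def lamR (ζ : ℝ) : ℝ := Real.sqrt (ζ ^ 2 + 1 / 2)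

/-- The uniformizer of the point `(λ(ζ), ζ)`. -/
def zPos (ζ : ℝ) : ℝ := ζ + lamR ζ

/-- The uniformizer of the point `(-λ(ζ), ζ)`. -/
def zNeg (ζ : ℝ) : ℝ := ζ - lamR ζ

theorem lamR_sq (ζ : ℝ) : lamR ζ ^ 2 = ζ ^ 2 + 1 / 2 := Real.sq_sqrt (by positivity)

theorem lamR_pos (ζ : ℝ) : 0 < lamR ζ := Real.sqrt_pos.2 (by positivity)

theorem abs_lt_lamR (ζ : ℝ) : |ζ| < lamR ζ :=
  abs_lt_of_sq_lt_sq (by rw [lamR_sq]; linarith) (lamR_pos ζ).le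

theorem zPos_pos (ζ : ℝ) : 0 < zPos ζ := by
  have := neg_abs_le ζ
  have := abs_lt_lamR ζ
  rw [zPos]; linarith

theorem zNeg_neg (ζ : ℝ) : zNeg ζ < 0 := by
  have := le_abs_self ζ
  have := abs_lt_lamR ζ
  rw [zNeg]; linarith

theorem zPos_mul_zNeg (ζ : ℝ) : zPos ζ * zNeg ζ = -(1 / 2) := by
  rw [zPos, zNeg]; linear_combination -lamR_sq ζ

theorem quarter_eq {ζ t : ℝ} (ht : t ≠ 0) (h : t ^ 2 - 2 * ζ * t = 1 / 2) :
    t / 2 - 1 / (4 * t) = ζ ∧ t / 2 + 1 / (4 * t) = t - ζ := by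
  have : 1 / (4 * t) = t / 2 - ζ := by field_simp; linear_combination (-4 : ℝ) * h
  constructor <;> linarith

theorem quadratic_zPos (ζ : ℝ) : zPos ζ ^ 2 - 2 * ζ * zPos ζ = 1 / 2 := by
  rw [zPos]; linear_combination lamR_sq ζ

theorem quadratic_zNeg (ζ : ℝ) : zNeg ζ ^ 2 - 2 * ζ * zNeg ζ = 1 / 2 := by
  rw [zNeg]; linear_combination lamR_sq ζ

theorem zet_ofReal (t : ℝ) : zet t = ((t / 2 - 1 / (4 * t) : ℝ) : ℂ) := by rw [zet]; push_cast; rfl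

theorem lam_ofReal (t : ℝ) : lam t = ((t / 2 + 1 / (4 * t) : ℝ) : ℂ) := by rw [lam]; push_cast; rfl

theorem zet_zPos (ζ : ℝ) : zet (zPos ζ) = ζ := by
  rw [zet_ofReal, (quarter_eq (zPos_pos ζ).ne' (quadratic_zPos ζ)).1]

theorem zet_zNeg (ζ : ℝ) : zet (zNeg ζ) = ζ := by
  rw [zet_ofReal, (quarter_eq (zNeg_neg ζ).ne (quadratic_zNeg ζ)).1]

theorem lam_zPos (ζ : ℝ) : lam (zPos ζ) = lamOf ζ := by
  rw [lam_ofReal, (quarter_eq (zPos_pos ζ).ne' (quadratic_zPos ζ)).2, zPos, add_sub_cancel_left]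
  rfl

theorem lam_zNeg (ζ : ℝ) : lam (zNeg ζ) = -lamOf ζ := by
  rw [lam_ofReal, (quarter_eq (zNeg_neg ζ).ne (quadratic_zNeg ζ)).2, zNeg, sub_sub_cancel_left]
  push_cast
  rfl

theorem zPos_mem {ζ : ℝ} (hζ : ζ ≠ 0) : ((zPos ζ : ℝ) : ℂ) ∈ sheet :=
  ofReal_mem_sheet (zPos_pos ζ).ne' (by rw [zet_zPos]; exact_mod_cast hζ)

theorem zNeg_mem {ζ : ℝ} (hζ : ζ ≠ 0) : ((zNeg ζ : ℝ) : ℂ) ∈ sheet :=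
  ofReal_mem_sheet (zNeg_neg ζ).ne (by rw [zet_zNeg]; exact_mod_cast hζ)

theorem hasDerivAt_lamR (ζ : ℝ) : HasDerivAt lamR (ζ / lamR ζ) ζ := by
  have h : HasDerivAt (fun ζ : ℝ => ζ ^ 2 + 1 / 2) (2 * ζ) ζ := by
    simpa using (hasDerivAt_pow 2 ζ).add_const (1 / 2)
  refine (h.sqrt (by positivity)).congr_deriv ?_
  rw [mul_div_mul_left _ _ two_ne_zero]
  rfl

theorem hasDerivAt_zPos (ζ : ℝ) : HasDerivAt zPos (zPos ζ / lamR ζ) ζ := by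
  refine ((hasDerivAt_id ζ).add (hasDerivAt_lamR ζ)).congr_deriv ?_
  have := (lamR_pos ζ).ne'
  rw [zPos]; field_simp; ring

theorem hasDerivAt_zNeg (ζ : ℝ) : HasDerivAt zNeg (-zNeg ζ / lamR ζ) ζ := by
  refine ((hasDerivAt_id ζ).sub (hasDerivAt_lamR ζ)).congr_deriv ?_
  have := (lamR_pos ζ).ne'
  rw [zNeg]; field_simp; ring

theorem continuous_zPos : Continuous zPos :=
  continuous_iff_continuousAt.2 fun ζ => (hasDerivAt_zPos ζ).continuousAt

theorem continuous_zNeg : Continuous zNeg :=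
  continuous_iff_continuousAt.2 fun ζ => (hasDerivAt_zNeg ζ).continuousAt

theorem zPos_injective : Function.Injective zPos := fun a b h => by
  have := congrArg (fun t : ℝ => zet t) h
  simp only [zet_zPos] at this
  exact_mod_cast this

theorem zNeg_injective : Function.Injective zNeg := fun a b h => by
  have := congrArg (fun t : ℝ => zet t) h
  simp only [zet_zNeg] at this
  exact_mod_cast this

theorem lamR_of_quadratic {t : ℝ} (ht : t ≠ 0) : lamR (t / 2 - 1 / (4 * t)) = |t / 2 + 1 / (4 * t)| := by
  rw [lamR, ← Real.sqrt_sq_eq_abs]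
  congr 1
  field_simp
  ring

theorem image_zPos : zPos '' Set.univ = Set.Ioi 0 := by
  refine Set.Subset.antisymm (fun t ⟨ζ, _, h⟩ => h ▸ zPos_pos ζ) fun t ht => ?_
  have ht : 0 < t := ht
  refine ⟨t / 2 - 1 / (4 * t), trivial, ?_⟩
  rw [zPos, lamR_of_quadratic ht.ne', abs_of_pos (by positivity)]
  ring

theorem image_zNeg : zNeg '' Set.univ = Set.Iio 0 := by
  refine Set.Subset.antisymm (fun t ⟨ζ, _, h⟩ => h ▸ zNeg_neg ζ) fun t ht => ?_
  have ht : t < 0 := ht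
  refine ⟨t / 2 - 1 / (4 * t), trivial, ?_⟩
  have : 1 / (4 * t) < 0 := one_div_neg.2 (by linarith)
  rw [zNeg, lamR_of_quadratic ht.ne, abs_of_neg (by linarith)]
  ring

/-- On the two branches dz/z pulls back to dζ/λ and −dζ/λ; the latter reverses orientation, hence
the minus sign. -/
theorem integral_branches {g : ℝ → ℂ} (hg : Integrable g) :
    ∫ t, g t = ∫ ζ, ((zPos ζ : ℂ) * g (zPos ζ) - zNeg ζ * g (zNeg ζ)) / lamOf ζ := by
  have e1 : ∀ ζ, |zPos ζ / lamR ζ| = zPos ζ / lamR ζ := fun ζ =>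
    abs_of_pos (div_pos (zPos_pos ζ) (lamR_pos ζ))
  have e2 : ∀ ζ, |-zNeg ζ / lamR ζ| = -zNeg ζ / lamR ζ := fun ζ =>
    abs_of_pos (div_pos (neg_pos.2 (zNeg_neg ζ)) (lamR_pos ζ))
  have h1 := integral_image_eq_integral_abs_deriv_smul MeasurableSet.univ
    (fun ζ _ => (hasDerivAt_zPos ζ).hasDerivWithinAt) zPos_injective.injOn g
  have h2 := integral_image_eq_integral_abs_deriv_smul MeasurableSet.univ
    (fun ζ _ => (hasDerivAt_zNeg ζ).hasDerivWithinAt) zNeg_injective.injOn g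
  have i1 := (integrableOn_image_iff_integrableOn_abs_deriv_smul MeasurableSet.univ
    (fun ζ _ => (hasDerivAt_zPos ζ).hasDerivWithinAt) zPos_injective.injOn g).1 hg.integrableOn
  have i2 := (integrableOn_image_iff_integrableOn_abs_deriv_smul MeasurableSet.univ
    (fun ζ _ => (hasDerivAt_zNeg ζ).hasDerivWithinAt) zNeg_injective.injOn g).1 hg.integrableOn
  rw [image_zPos] at h1
  rw [image_zNeg] at h2
  simp only [e1, e2, setIntegral_univ] at h1 h2 i1 i2
  rw [integrableOn_univ] at i1 i2
  have h3 := integral_add_compl (measurableSet_Ioi (a := (0 : ℝ))) hg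
  rw [Set.compl_Ioi, setIntegral_congr_set Iio_ae_eq_Iic.symm, h1, h2, ← integral_add i1 i2] at h3
  rw [← h3]
  refine integral_congr_ae (Eventually.of_forall fun ζ => ?_)
  simp only [Complex.real_smul, lamOf]
  push_cast
  rw [lamR]
  ring

/-! ### The scattering functions on the real line -/

section

variable {q : ℝ → ℂ}

theorem Tame.cRight_pos (hq : Tame q) {ζ : ℝ} (hζ : ζ ≠ 0) :
    cRight q (lamOf ζ) ζ = reflCoef q (zPos ζ) := by
  rw [← hq.cRight_eq (zPos_mem hζ) (Complex.conj_ofReal _), lam_zPos, zet_zPos]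

theorem Tame.cRight_neg (hq : Tame q) {ζ : ℝ} (hζ : ζ ≠ 0) :
    cRight q (-lamOf ζ) ζ = reflCoef q (zNeg ζ) := by
  rw [← hq.cRight_eq (zNeg_mem hζ) (Complex.conj_ofReal _), lam_zNeg, zet_zNeg]

theorem ae_ne_zero : ∀ᵐ ζ : ℝ, ζ ≠ 0 := by
  simpa using (Set.countable_singleton (0 : ℝ)).ae_notMem volume

theorem Tame.exists_reflCoef_le (hq : Tame q) : ∃ C : ℝ, 0 ≤ C ∧ ∀ ζ : ℝ, ζ ≠ 0 →
    ‖reflCoef q (zPos ζ)‖ ≤ C * (1 + ζ ^ 2)⁻¹ ∧ ‖reflCoef q (zNeg ζ)‖ ≤ C * (1 + ζ ^ 2)⁻¹ := by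
  obtain ⟨C, hC, hb⟩ := hq.reflection_bound
  refine ⟨C, hC, fun ζ hζ => ?_⟩
  have h1 := hb _ (zPos_mem hζ) (Complex.conj_ofReal _)
  have h2 := hb _ (zNeg_mem hζ) (Complex.conj_ofReal _)
  rw [zet_zPos, Complex.norm_real, Real.norm_eq_abs, sq_abs] at h1
  rw [zet_zNeg, Complex.norm_real, Real.norm_eq_abs, sq_abs] at h2
  rw [reflCoef, reflCoef, neg_div, norm_neg, neg_div, norm_neg, ← div_eq_mul_inv,
    le_div_iff₀' (by positivity), le_div_iff₀' (by positivity)]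
  exact ⟨h1, h2⟩

theorem Tame.aestronglyMeasurable_reflCoef (hq : Tame q) {w : ℝ → ℝ} (hw : Continuous w)
    (hmem : ∀ ζ, ζ ≠ 0 → ((w ζ : ℝ) : ℂ) ∈ sheet) :
    AEStronglyMeasurable (fun ζ : ℝ => reflCoef q (w ζ)) := by
  have hmaps : Set.MapsTo (fun ζ : ℝ => ((w ζ : ℝ) : ℂ)) {0}ᶜ sheet := fun ζ hζ => hmem ζ hζ
  have hc : ContinuousOn (fun ζ : ℝ => reflCoef q (w ζ)) {0}ᶜ := by
    have hwc : ContinuousOn (fun ζ : ℝ => ((w ζ : ℝ) : ℂ)) {0}ᶜ :=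
      (Complex.continuous_ofReal.comp hw).continuousOn
    exact ((hq.continuousOn_wrB.comp hwc hmaps).neg).div (hq.continuousOn_wr.comp hwc hmaps)
      fun ζ hζ => (norm_sq_lt_of_real hq (hmem ζ hζ) (Complex.conj_ofReal _)).2
  have := hc.aestronglyMeasurable (μ := volume) (measurableSet_singleton 0).compl
  rwa [Measure.restrict_eq_self_of_ae_mem (s := {0}ᶜ) ae_ne_zero] at this

theorem Tame.integrable_cRight (hq : Tame q) {f : ℝ → ℂ} (hf : Continuous f) {B : ℝ}
    (hB : ∀ ζ, ‖f ζ‖ ≤ B) : Integrable (fun ζ : ℝ => f ζ * reflCoef q (zPos ζ)) ∧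
      Integrable fun ζ : ℝ => f ζ * reflCoef q (zNeg ζ) := by
  obtain ⟨C, hC, hb⟩ := hq.exists_reflCoef_le
  have hi := integrable_inv_one_add_sq.const_mul C
  exact ⟨(hi.mono' (hq.aestronglyMeasurable_reflCoef continuous_zPos fun ζ h => zPos_mem h)
    (ae_ne_zero.mono fun ζ h => (hb ζ h).1)).bdd_mul hf.aestronglyMeasurable
      (Eventually.of_forall hB),
    (hi.mono' (hq.aestronglyMeasurable_reflCoef continuous_zNeg fun ζ h => zNeg_mem h)
    (ae_ne_zero.mono fun ζ h => (hb ζ h).2)).bdd_mul hf.aestronglyMeasurable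
      (Eventually.of_forall hB)⟩

theorem lamOf_eq (ζ : ℝ) : lamOf ζ = (lamR ζ : ℂ) := rfl

theorem lamOf_ne_zero (ζ : ℝ) : lamOf ζ ≠ 0 := by
  rw [lamOf_eq]; exact_mod_cast (lamR_pos ζ).ne'

theorem continuous_lamOf : Continuous lamOf := by
  unfold lamOf
  fun_prop

theorem Tame.cRight1_eq (hq : Tame q) {ζ : ℝ} (hζ : ζ ≠ 0) :
    cRight1 q ζ = reflCoef q (zPos ζ) + reflCoef q (zNeg ζ) := by
  rw [cRight1, hq.cRight_pos hζ, hq.cRight_neg hζ]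

theorem Tame.cRight2_eq (hq : Tame q) {ζ : ℝ} (hζ : ζ ≠ 0) :
    cRight2 q ζ = (reflCoef q (zPos ζ) - reflCoef q (zNeg ζ)) / lamOf ζ := by
  rw [cRight2, hq.cRight_pos hζ, hq.cRight_neg hζ]

theorem Tame.integrable_cRight1 (hq : Tame q) : Integrable (cRight1 q) := by
  obtain ⟨h1, h2⟩ := hq.integrable_cRight (f := fun _ => 1) continuous_const (B := 1) (by simp)
  refine (h1.add h2).congr (ae_ne_zero.mono fun ζ h => ?_)
  rw [hq.cRight1_eq h, Pi.add_apply, one_mul, one_mul]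

theorem one_half_le_lamR (ζ : ℝ) : 1 / 2 ≤ lamR ζ :=
  Real.le_sqrt_of_sq_le (by nlinarith [sq_nonneg ζ])

theorem Tame.integrable_cRight2 (hq : Tame q) : Integrable (cRight2 q) := by
  obtain ⟨h1, h2⟩ := hq.integrable_cRight (f := fun ζ => 1 / lamOf ζ)
    (continuous_const.div continuous_lamOf lamOf_ne_zero) (B := 2) fun ζ => by
      rw [norm_div, norm_one, lamOf_eq, Complex.norm_real, Real.norm_of_nonneg (lamR_pos ζ).le,
        div_le_iff₀ (lamR_pos ζ)]
      linarith [one_half_le_lamR ζ]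
  refine (h1.sub h2).congr (ae_ne_zero.mono fun ζ h => ?_)
  rw [hq.cRight2_eq h, Pi.sub_apply]
  ring

/-- The division by λ in c₂ absorbs the factor ζ, since |ζ| < λ. This integrability is what makes F₂
differentiable. -/
theorem Tame.integrable_mul_cRight2 (hq : Tame q) :
    Integrable fun ζ : ℝ => (ζ : ℂ) * cRight2 q ζ := by
  obtain ⟨h1, h2⟩ := hq.integrable_cRight (f := fun ζ => ζ / lamOf ζ)
    (Complex.continuous_ofReal.div continuous_lamOf lamOf_ne_zero) (B := 1) fun ζ => by
      rw [norm_div, lamOf_eq, Complex.norm_real, Complex.norm_real,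
        Real.norm_of_nonneg (lamR_pos ζ).le, div_le_iff₀ (lamR_pos ζ), one_mul]
      exact (abs_lt_lamR ζ).le
  refine (h1.sub h2).congr (ae_ne_zero.mono fun ζ h => ?_)
  simp only [hq.cRight2_eq h, Pi.sub_apply]
  ring

end

/-! ### The right Marchenko system in spectral form -/

section

variable {q : ℝ → ℂ}

/-- The transmitted solution on the real line, in terms of the kernel. -/
theorem Tame.scattering_kernel (hq : Tame q) {K : ℝ → ℝ → Matrix (Fin 2) (Fin 2) ℂ}
    (hK : IsRightKernel q K) {z : ℂ} (hz : z ∈ sheet) (hreal : star z = z) {ζ : ℝ}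
    (hζ : zet z = ζ) (x : ℝ) :
    (1 - 1 / (2 * z ^ 2)) * jost (GPMarchenko.refl q) z (-x) 1 / wr q z =
      (Complex.exp (-(Complex.I * (ζ : ℂ) * (x : ℂ))) -
        ∫ s in Set.Ioi x, K x s 0 0 * Complex.exp (-(Complex.I * (ζ : ℂ) * (s : ℂ)))) -
      rt2 / 2 / z *
        (∫ s in Set.Ioi x, K x s 0 1 * Complex.exp (-(Complex.I * (ζ : ℂ) * (s : ℂ)))) +
      reflCoef q z * (rt2 / 2 / z * (Complex.exp (Complex.I * (ζ : ℂ) * (x : ℂ)) -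
        ∫ s in Set.Ioi x, K x s 0 0 * Complex.exp (Complex.I * (ζ : ℂ) * (s : ℂ))) -
        ∫ s in Set.Ioi x, K x s 0 1 * Complex.exp (Complex.I * (ζ : ℂ) * (s : ℂ))) := by
  have hz0 := hz.2.1
  have hr := rt2_half_ne
  have hinv := inv_star_mem_sheet hz
  -- For real z the point 1/(2z) has the same λ and the opposite ζ. Evaluating the kernel
  -- representation there produces the exponentials e^{−iζs}.
  have hzi := zet_inv_star hz0
  have hsζ : star (ζ : ℂ) = ζ := Complex.conj_ofReal ζ
  rw [hreal] at hinv hzi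
  rw [hζ, hsζ] at hzi
  have expand : ∀ (w κ : ℂ), 0 ≤ κ.im → ∫ s in Set.Ioi x, (w * K x s 0 0 + K x s 0 1) *
        Complex.exp (Complex.I * κ * s) =
      w * (∫ s in Set.Ioi x, K x s 0 0 * Complex.exp (Complex.I * κ * s)) +
        ∫ s in Set.Ioi x, K x s 0 1 * Complex.exp (Complex.I * κ * s) := fun w κ hκ => by
    rw [← integral_const_mul, ← integral_add
      ((integrable_kernel_exp (hK.integrable 0 0 x) hκ).const_mul w)
      (integrable_kernel_exp (hK.integrable 0 1 x) hκ)]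
    refine integral_congr_ae (Eventually.of_forall fun s => ?_)
    simp only
    ring
  have e1 := hK.jost_eq hq.right hz x
  have e2 := hK.jost_eq hq.right hinv x
  rw [hζ, expand _ _ (by simp)] at e1
  rw [hzi, expand _ _ (by simp)] at e2
  simp only [mul_neg, neg_mul] at e2
  have hw : rt2 / 2 / z * (rt2 / 2 / (1 / (2 * z))) = 1 := by
    have e : rt2 / 2 / z * (rt2 / 2 / (1 / (2 * z))) = rt2 / 2 * (rt2 / 2) * 2 := by
      field_simp
    rw [e, rt2_half_sq]; norm_num
  rw [hq.scattering hz hreal, e1, e2]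
  linear_combination (Complex.exp (-(Complex.I * (ζ : ℂ) * (x : ℂ))) -
    ∫ s in Set.Ioi x, K x s 0 0 * Complex.exp (-(Complex.I * (ζ : ℂ) * (s : ℂ)))) * hw

theorem contourFun_eq (x : ℝ) (χ : ℝ → ℝ) (p : ℂ → ℂ) {z : ℂ} (hz : z ≠ 0) :
    z * contourFun q x χ p z = testX χ (zet z) *
      (p z * ((1 - 1 / (2 * z ^ 2)) * jost (refl q) z (-x) 1 / wr q z)) := by
  rw [contourFun]
  field_simp

/-- The residue identity on the two branches of the hyperbola. -/
theorem Tame.spectral_identity (hq : Tame q) {z₀ : ℂ} (hz₀ : z₀ ∈ upper)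
    (hzero : wr q z₀ = 0) (huniq : ∀ z ∈ upper, wr q z = 0 → z = z₀)
    {K : ℝ → ℝ → Matrix (Fin 2) (Fin 2) ℂ} (hK : IsRightKernel q K) {b m : ℂ}
    (hb : ∀ x, jost (GPMarchenko.refl q) z₀ (-x) 1 = b * jost q z₀ x 0)
    (hm : m = Complex.I * b * (1 - 1 / (2 * z₀ ^ 2)) / (z₀ * deriv (wr q) z₀)) {x : ℝ} {χ : ℝ → ℝ}
    (hχ : IsTest x χ) {p : ℂ → ℂ} (hpd : Differentiable ℂ p) {C : ℝ} (hC : 0 ≤ C)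
    (hp : ∀ z, ‖p z‖ ≤ C * (1 + ‖z‖)) {A B : ℝ → ℂ} {c d : ℂ} {k : ℝ → ℂ}
    (h : ∀ ζ : ℝ, ζ ≠ 0 → ∀ E₁ E₂ L₁ L₂ : ℂ,
      p (zPos ζ) * (E₁ - rt2 / 2 / zPos ζ * E₂ +
          reflCoef q (zPos ζ) * (rt2 / 2 / zPos ζ * L₁ - L₂)) -
        p (zNeg ζ) * (E₁ - rt2 / 2 / zNeg ζ * E₂ +
          reflCoef q (zNeg ζ) * (rt2 / 2 / zNeg ζ * L₁ - L₂)) =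
      lamOf ζ * (c * E₁ - d * E₂ + A ζ * L₁ - B ζ * L₂))
    (hk : ∀ ζ : ℝ, (c * (Complex.exp (-(Complex.I * (ζ : ℂ) * (x : ℂ))) -
        ∫ s in Set.Ioi x, K x s 0 0 * Complex.exp (-(Complex.I * (ζ : ℂ) * (s : ℂ)))) -
        d * ∫ s in Set.Ioi x, K x s 0 1 * Complex.exp (-(Complex.I * (ζ : ℂ) * (s : ℂ)))) =
      c * Complex.exp (-(Complex.I * (ζ : ℂ) * (x : ℂ))) -
        (c + d) * ∫ s in Set.Ioi x, k s * Complex.exp (-(Complex.I * (ζ : ℂ) * (s : ℂ)))) :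
    ∫ ζ : ℝ, testX χ ζ *
        (c * Complex.exp (-(Complex.I * (ζ : ℂ) * (x : ℂ))) -
          (c + d) * (∫ s in Set.Ioi x, k s * Complex.exp (-(Complex.I * (ζ : ℂ) * (s : ℂ)))) +
          A ζ * (Complex.exp (Complex.I * (ζ : ℂ) * (x : ℂ)) -
            ∫ s in Set.Ioi x, K x s 0 0 * Complex.exp (Complex.I * (ζ : ℂ) * (s : ℂ))) -
          B ζ * ∫ s in Set.Ioi x, K x s 0 1 * Complex.exp (Complex.I * (ζ : ℂ) * (s : ℂ))) =
      2 * Real.pi * (testX χ (zet z₀) *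
        (m * p z₀ * (rt2 / 2 / z₀) * Complex.exp (Complex.I * zet z₀ * x) -
        (m * p z₀ * (rt2 / 2 / z₀) *
            (∫ s in Set.Ioi x, K x s 0 0 * Complex.exp (Complex.I * zet z₀ * s)) +
          m * p z₀ * ∫ s in Set.Ioi x, K x s 0 1 * Complex.exp (Complex.I * zet z₀ * s)))) := by
  obtain ⟨hint, hval⟩ := hq.integral_contourFun hz₀ hzero huniq hχ hpd hC hp
  -- The residue theorem holds on the z-line. Folded onto the ζ-axis, the integrand becomes the
  -- difference of the two branch values, which hypothesis `h` rewrites in terms of λ, A and B.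
  rw [integral_branches hint] at hval
  have hs₀ := upper_subset_sheet hz₀
  have hz0 := hs₀.2.1
  have hκ := zet_im_nonneg hs₀.1
  have hj := hK.jost_eq hq.right hs₀ x
  have expand : ∫ s in Set.Ioi x, (rt2 / 2 / z₀ * K x s 0 0 + K x s 0 1) *
        Complex.exp (Complex.I * zet z₀ * s) =
      rt2 / 2 / z₀ * (∫ s in Set.Ioi x, K x s 0 0 * Complex.exp (Complex.I * zet z₀ * s)) +
        ∫ s in Set.Ioi x, K x s 0 1 * Complex.exp (Complex.I * zet z₀ * s) := by
    rw [← integral_const_mul, ← integral_add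
      ((integrable_kernel_exp (hK.integrable 0 0 x) hκ).const_mul _)
      (integrable_kernel_exp (hK.integrable 0 1 x) hκ)]
    refine integral_congr_ae (Eventually.of_forall fun s => ?_)
    simp only
    ring
  rw [expand] at hj
  have hw' := hq.deriv_wr_ne_zero hz₀ hzero
  calc _ = ∫ ζ : ℝ, ((zPos ζ : ℂ) * contourFun q x χ p (zPos ζ) -
        zNeg ζ * contourFun q x χ p (zNeg ζ)) / lamOf ζ := by
        refine integral_congr_ae (ae_ne_zero.mono fun ζ hζ => ?_)
        simp only
        rw [contourFun_eq x χ p (zPos_mem hζ).2.1, contourFun_eq x χ p (zNeg_mem hζ).2.1,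
          hq.scattering_kernel hK (zPos_mem hζ) (Complex.conj_ofReal _) (zet_zPos ζ) x,
          hq.scattering_kernel hK (zNeg_mem hζ) (Complex.conj_ofReal _) (zet_zNeg ζ) x,
          zet_zPos, zet_zNeg, ← mul_sub, h ζ hζ, ← hk ζ]
        have := lamOf_ne_zero ζ
        field_simp
    _ = _ := by
        rw [hval, hb x, hj, hm]
        field_simp

end

/-- As the two points over ζ have product −1/2, inverse powers of z become polynomial in ζ and λ. -/
theorem rt2_half_div_zPos (ζ : ℝ) : rt2 / 2 / zPos ζ = -(rt2 * zNeg ζ) := by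
  have h : (zPos ζ : ℂ) * zNeg ζ = -(1 / 2) := by
    have := congrArg Complex.ofReal (zPos_mul_zNeg ζ)
    push_cast at this
    exact this
  have h0 : (zPos ζ : ℂ) ≠ 0 := by exact_mod_cast (zPos_pos ζ).ne'
  rw [div_eq_iff h0]
  linear_combination rt2 * h

theorem rt2_half_div_zNeg (ζ : ℝ) : rt2 / 2 / zNeg ζ = -(rt2 * zPos ζ) := by
  have h : (zPos ζ : ℂ) * zNeg ζ = -(1 / 2) := by
    have := congrArg Complex.ofReal (zPos_mul_zNeg ζ)
    push_cast at this
    exact this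
  have h0 : (zNeg ζ : ℂ) ≠ 0 := by exact_mod_cast (zNeg_neg ζ).ne
  rw [div_eq_iff h0]
  linear_combination rt2 * h

theorem ofReal_zPos (ζ : ℝ) : (zPos ζ : ℂ) = ζ + lamOf ζ := by rw [lamOf_eq, zPos]; push_cast; rfl

theorem ofReal_zNeg (ζ : ℝ) : (zNeg ζ : ℂ) = ζ - lamOf ζ := by rw [lamOf_eq, zNeg]; push_cast; rfl

theorem lamOf_sq (ζ : ℝ) : lamOf ζ ^ 2 = (ζ : ℂ) ^ 2 + 1 / 2 := by
  have := congrArg Complex.ofReal (lamR_sq ζ)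
  push_cast at this
  exact this

section

variable {q : ℝ → ℂ}

theorem Tame.lamOf_mul_cRight2 (hq : Tame q) {ζ : ℝ} (hζ : ζ ≠ 0) :
    lamOf ζ * cRight2 q ζ = reflCoef q (zPos ζ) - reflCoef q (zNeg ζ) := by
  rw [hq.cRight2_eq hζ, mul_div_cancel₀ _ (lamOf_ne_zero ζ)]

/-- The symbol of `√2 (F₁ + i F₂')`. -/
def symbPlus (q : ℝ → ℂ) (ζ : ℝ) : ℂ := rt2 * (cRight1 q ζ - ζ * cRight2 q ζ)

/-- The symbol of `√2 (F₁ - i F₂')`. -/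
def symbMinus (q : ℝ → ℂ) (ζ : ℝ) : ℂ := rt2 * (cRight1 q ζ + ζ * cRight2 q ζ)

theorem Tame.integrable_symbPlus (hq : Tame q) : Integrable (symbPlus q) :=
  (hq.integrable_cRight1.sub hq.integrable_mul_cRight2).const_mul rt2

theorem Tame.integrable_symbMinus (hq : Tame q) : Integrable (symbMinus q) :=
  (hq.integrable_cRight1.add hq.integrable_mul_cRight2).const_mul rt2

theorem IsRightKernel.continuousOn_row {K : ℝ → ℝ → Matrix (Fin 2) (Fin 2) ℂ}
    (hK : IsRightKernel q K) (i j : Fin 2) (x : ℝ) :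
    ContinuousOn (fun y => K x y i j) (Set.Ici x) :=
  (hK.smooth i j).continuousOn.comp (f := fun y : ℝ => (x, y)) (by fun_prop) fun _ hy => hy

/-- Taking p = √2 z makes p(z) · √2/(2z) constant, so the free term with Ψ₁₂ cancels between
branches, while √2(z₊ − z₋) = 2√2 λ leaves 2√2 Ψ₁₁. Taking p = 1 cancels the free term with Ψ₁₁ and
leaves 2√2 Ψ₁₂ in the same way. The reflection terms combine into the symbols of F₂ and √2(F₁ ±
iF₂'). -/
theorem Tame.right_system (hq : Tame q) {z₀ : ℂ} (hz₀ : z₀ ∈ upper)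
    (hzero : wr q z₀ = 0) (huniq : ∀ z ∈ upper, wr q z = 0 → z = z₀)
    {K : ℝ → ℝ → Matrix (Fin 2) (Fin 2) ℂ} (hK : IsRightKernel q K) {b m : ℂ}
    (hb : ∀ x, jost (GPMarchenko.refl q) z₀ (-x) 1 = b * jost q z₀ x 0)
    (hm : m = Complex.I * b * (1 - 1 / (2 * z₀ ^ 2)) / (z₀ * deriv (wr q) z₀)) {x y : ℝ}
    (hxy : x ≤ y) :
    (IntegrableOn (fun s => K x s 0 0 * poleF (cRight2 q) m (zet z₀) (s + y) +
        K x s 0 1 * poleF (symbMinus q) (m * (rt2 * z₀)) (zet z₀) (s + y)) (Set.Ioi x) ∧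
      2 * rt2 * K x y 0 0 = poleF (cRight2 q) m (zet z₀) (x + y) -
        ∫ s in Set.Ioi x, (K x s 0 0 * poleF (cRight2 q) m (zet z₀) (s + y) +
          K x s 0 1 * poleF (symbMinus q) (m * (rt2 * z₀)) (zet z₀) (s + y))) ∧
    (IntegrableOn (fun s => K x s 0 0 * poleF (symbPlus q) (m * (rt2 / 2 / z₀)) (zet z₀) (s + y) +
        K x s 0 1 * poleF (cRight2 q) m (zet z₀) (s + y)) (Set.Ioi x) ∧
      2 * rt2 * K x y 0 1 = poleF (symbPlus q) (m * (rt2 / 2 / z₀)) (zet z₀) (x + y) -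
        ∫ s in Set.Ioi x, (K x s 0 0 * poleF (symbPlus q) (m * (rt2 / 2 / z₀)) (zet z₀) (s + y) +
          K x s 0 1 * poleF (cRight2 q) m (zet z₀) (s + y))) := by
  have hs₀ := upper_subset_sheet hz₀
  have hz0 := hs₀.2.1
  have hκ := zet_im_nonneg hs₀.1
  constructor
  · have hα : m * (rt2 * z₀) * (rt2 / 2 / z₀) = m := by
      field_simp
      linear_combination m * rt2_sq
    refine integral_equation_of_spectral (hK.integrable 0 0 x) (hK.integrable 0 1 x)
      (hK.integrable 0 0 x) (hK.continuousOn_row 0 0 x) hq.integrable_cRight2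
      hq.integrable_symbMinus hκ (c := 2 * rt2) (fun χ hχ => ?_) hxy
    have key := hq.spectral_identity hz₀ hzero huniq hK hb hm hχ (p := fun z => rt2 * z)
      (by fun_prop) (C := 2) (by norm_num) (fun z => by
        rw [norm_mul, norm_rt2]
        have : Real.sqrt 2 ≤ 2 := Real.sqrt_le_iff.2 (by norm_num)
        nlinarith [norm_nonneg z]) (A := cRight2 q) (B := symbMinus q) (c := 2 * rt2) (d := 0)
      (k := fun s => K x s 0 0) (fun ζ hζ E₁ E₂ L₁ L₂ => by
        have h2 := hq.lamOf_mul_cRight2 hζ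
        have h1 := hq.cRight1_eq hζ
        have hl := lamOf_sq ζ
        have hr := rt2_sq
        rw [rt2_half_div_zPos, rt2_half_div_zNeg, symbMinus]
        generalize reflCoef q (zPos ζ : ℂ) = c₁ at h2 h1 ⊢
        generalize reflCoef q (zNeg ζ : ℂ) = c₂ at h2 h1 ⊢
        rw [ofReal_zPos, ofReal_zNeg, h1]
        linear_combination (rt2 * L₂ * ζ - L₁) * h2 +
          (lamOf ζ ^ 2 - ζ ^ 2) * L₁ * (c₁ - c₂) * hr + 2 * L₁ * (c₁ - c₂) * hl)
      (fun ζ => by ring)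
    simp only [hα, add_zero] at key
    exact key
  · refine integral_equation_of_spectral (hK.integrable 0 0 x) (hK.integrable 0 1 x)
      (hK.integrable 0 1 x) (hK.continuousOn_row 0 1 x) hq.integrable_symbPlus
      hq.integrable_cRight2 hκ (c := 0) (fun χ hχ => ?_) hxy
    have key := hq.spectral_identity hz₀ hzero huniq hK hb hm hχ (p := fun _ => 1)
      (by fun_prop) (C := 1) (by norm_num) (fun z => by
        rw [norm_one]
        nlinarith [norm_nonneg z]) (A := symbPlus q) (B := cRight2 q) (c := 0) (d := 2 * rt2)
      (k := fun s => K x s 0 1) (fun ζ hζ E₁ E₂ L₁ L₂ => by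
        have h2 := hq.lamOf_mul_cRight2 hζ
        have h1 := hq.cRight1_eq hζ
        rw [rt2_half_div_zPos, rt2_half_div_zNeg, symbPlus]
        generalize reflCoef q (zPos ζ : ℂ) = c₁ at h2 h1 ⊢
        generalize reflCoef q (zNeg ζ : ℂ) = c₂ at h2 h1 ⊢
        rw [ofReal_zPos, ofReal_zNeg, h1]
        linear_combination (L₂ + rt2 * L₁ * ζ) * h2)
      (fun ζ => by ring)
    simp only [mul_one, zero_add] at key
    exact key

end

/-! ### The bound state -/

/-- `z₀` is the only zero of the Wronskian in the upper half-plane, lying over `l₀`. -/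
structure IsBoundState (q : ℝ → ℂ) (l₀ z₀ : ℂ) : Prop where
  mem : z₀ ∈ upper
  zero : wr q z₀ = 0
  uniq : ∀ z ∈ upper, wr q z = 0 → z = z₀
  lam_eq : lam z₀ = l₀
  zet_eq : zetaUp l₀ = zet z₀

theorem nu_sq (l : ℂ) : nu l ^ 2 = 1 / 2 - l ^ 2 := by
  rw [nu, ← Complex.cpow_nat_mul]
  norm_num

theorem zetaUp_sq (l : ℂ) : zetaUp l ^ 2 = l ^ 2 - 1 / 2 := by
  rw [zetaUp, mul_pow, Complex.I_sq, nu_sq]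
  ring

/-- Converse of the parametrization: every point of the upper sheet comes from z = λ + ζ, and Im z >
0 because Im ζ is a positive multiple of Im z. -/
theorem uniformize {l ζ : ℂ} (h : l ^ 2 - ζ ^ 2 = 1 / 2) (hζ : 0 < ζ.im) :
    l + ζ ∈ upper ∧ lam (l + ζ) = l ∧ zet (l + ζ) = ζ := by
  have hm : (l + ζ) * (l - ζ) = 1 / 2 := by linear_combination h
  have h0 : l + ζ ≠ 0 := fun h0 => by rw [h0, zero_mul] at hm; norm_num at hm
  have hi : 1 / (4 * (l + ζ)) = (l - ζ) / 2 := by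
    field_simp
    linear_combination -4 * hm
  have h1 : lam (l + ζ) = l := by rw [lam, hi]; ring
  have h2 : zet (l + ζ) = ζ := by rw [zet, hi]; ring
  refine ⟨?_, h1, h2⟩
  have h3 := zet_im (l + ζ)
  rw [h2] at h3
  have h4 : 0 ≤ 1 / (4 * Complex.normSq (l + ζ)) := by
    have := Complex.normSq_nonneg (l + ζ)
    positivity
  by_contra hc
  have hc : (l + ζ).im ≤ 0 := not_lt.1 hc
  nlinarith [mul_nonneg (neg_nonneg.2 hc)
    (by linarith : (0 : ℝ) ≤ 1 / 2 + 1 / (4 * Complex.normSq (l + ζ)))]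

section

variable {q : ℝ → ℂ} {l₀ z₀ : ℂ}

theorem Tame.wr_eq_zero_iff (hq : Tame q) {z : ℂ} (hz : z ∈ upper) :
    wr q z = 0 ↔ coeffA q (lam z) (zet z) = 0 := by
  have hs := upper_subset_sheet hz
  rw [hq.coeffA_eq hs, div_eq_zero_iff, or_iff_left (one_sub_ne_zero hs)]

theorem Tame.exists_isBoundState (hq : Tame q)
    (hzero : {P : ℂ × ℂ | P ∈ upperSheet ∧ coeffA q P.1 P.2 = 0} = {(l₀, zetaUp l₀)}) :
    ∃ z₀, IsBoundState q l₀ z₀ := by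
  have hmem : (l₀, zetaUp l₀) ∈ {P : ℂ × ℂ | P ∈ upperSheet ∧ coeffA q P.1 P.2 = 0} := by
    rw [hzero]; rfl
  obtain ⟨⟨h1, h2⟩, h3⟩ := hmem
  obtain ⟨u1, u2, u3⟩ := uniformize h1 h2
  refine ⟨l₀ + zetaUp l₀, u1, (hq.wr_eq_zero_iff u1).2 (by rw [u2, u3]; exact h3),
    fun z hz hw => ?_, u2, u3.symm⟩
  have hz0 := (upper_subset_sheet hz).2.1
  have : (lam z, zet z) ∈ {P : ℂ × ℂ | P ∈ upperSheet ∧ coeffA q P.1 P.2 = 0} :=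
    ⟨⟨lam_sq_sub z hz0, zet_im_pos hz⟩, (hq.wr_eq_zero_iff hz).1 hw⟩
  rw [hzero, Set.mem_singleton_iff, Prod.mk.injEq] at this
  rw [← lam_add_zet z, this.1, this.2]

theorem IsBoundState.mul_star (h : IsBoundState q l₀ z₀) (hq : Tame q) :
    z₀ * star z₀ = 1 / 2 := by
  have := hq.normSq_zero h.mem h.zero
  rw [RCLike.star_def, Complex.mul_conj, this]
  norm_num

/-- Since z₀ lies on the circle |z|² = 1/2, it is a fixed point of z ↦ 1/(2z*). All reality
statements about the bound state follow by evaluating that symmetry here. -/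
theorem IsBoundState.inv_star (h : IsBoundState q l₀ z₀) (hq : Tame q) :
    1 / (2 * star z₀) = z₀ := by
  have h0 : star z₀ ≠ 0 := star_ne_zero.2 (upper_subset_sheet h.mem).2.1
  field_simp
  linear_combination -2 * h.mul_star hq

theorem IsBoundState.star_lam (h : IsBoundState q l₀ z₀) (hq : Tame q) : star l₀ = l₀ := by
  have := lam_inv_star (upper_subset_sheet h.mem).2.1
  rwa [h.inv_star hq, h.lam_eq, eq_comm] at this

theorem IsBoundState.star_zet (h : IsBoundState q l₀ z₀) (hq : Tame q) :
    star (zet z₀) = -zet z₀ := by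
  have := zet_inv_star (upper_subset_sheet h.mem).2.1
  rw [h.inv_star hq] at this
  linear_combination this

theorem IsBoundState.I_mul_zet (h : IsBoundState q l₀ z₀) : Complex.I * zet z₀ = -nu l₀ := by
  rw [← h.zet_eq, zetaUp, ← mul_assoc, Complex.I_mul_I, neg_one_mul]

theorem IsBoundState.star_nu (h : IsBoundState q l₀ z₀) (hq : Tame q) : star (nu l₀) = nu l₀ := by
  rw [← neg_neg (nu l₀), ← h.I_mul_zet, star_neg, star_mul, h.star_zet hq, RCLike.star_def,
    Complex.conj_I]
  ring

theorem IsBoundState.nu_ne_zero (h : IsBoundState q l₀ z₀) : nu l₀ ≠ 0 := by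
  rw [← neg_ne_zero, ← h.I_mul_zet]
  exact mul_ne_zero Complex.I_ne_zero (upper_subset_sheet h.mem).2.2

theorem IsBoundState.proportional (h : IsBoundState q l₀ z₀) (hq : Tame q) :
    ∀ x, reflSol (jost (GPMarchenko.refl q) z₀) x = bZero q l₀ • jost q z₀ x := by
  have hs := upper_subset_sheet h.mem
  have hJ := hq.right.isJost hs
  obtain ⟨x₀, hx₀⟩ := hJ.ne_zero (vec_ne_zero _)
  have hex := (hq.isSolution_left hs).proportional hq.continuous hJ.1 hx₀ (by
    have := h.zero
    simp only [wronskian, reflSol, wr, neg_zero, Matrix.cons_val_zero, Matrix.cons_val_one,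
      Matrix.cons_val_fin_one] at this ⊢
    linear_combination this)
  have e : phi1 q l₀ (zetaUp l₀) = reflSol (jost (GPMarchenko.refl q) z₀) := by
    rw [h.zet_eq, ← h.lam_eq, hq.phi1_eq hs]
  have e' : psi2 q l₀ (zetaUp l₀) = jost q z₀ := by rw [h.zet_eq, ← h.lam_eq, jost]
  have := Classical.epsilon_spec
    (p := fun c : ℂ => ∀ x : ℝ, phi1 q l₀ (zetaUp l₀) x = c • psi2 q l₀ (zetaUp l₀) x)
    (by rw [e, e']; exact hex)
  rw [← bZero] at this
  rwa [e, e'] at this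

theorem IsBoundState.left_one (h : IsBoundState q l₀ z₀) (hq : Tame q) (x : ℝ) :
    jost (GPMarchenko.refl q) z₀ (-x) 1 = bZero q l₀ * jost q z₀ x 0 := by
  simpa [reflSol] using congrFun (h.proportional hq x) 0

theorem IsBoundState.left_zero (h : IsBoundState q l₀ z₀) (hq : Tame q) (x : ℝ) :
    -jost (GPMarchenko.refl q) z₀ (-x) 0 = bZero q l₀ * jost q z₀ x 1 := by
  simpa [reflSol] using congrFun (h.proportional hq x) 1

theorem IsBoundState.jost_zero_star (h : IsBoundState q l₀ z₀) (hq : Tame q) {p : ℝ → ℂ}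
    (hp : RightTame p) (x : ℝ) :
    jost p z₀ x 0 = star z₀ / (rt2 / 2) * star (jost p z₀ x 1) ∧
      star (jost p z₀ x 0) = z₀ / (rt2 / 2) * jost p z₀ x 1 := by
  have := (hp.jost_inv_star (upper_subset_sheet h.mem) x).1
  rw [h.inv_star hq] at this
  refine ⟨this, ?_⟩
  rw [this, star_mul, star_star, star_div₀, star_star, star_rt2_half]
  ring

theorem IsBoundState.exists_jost_one_ne_zero (h : IsBoundState q l₀ z₀) (hq : Tame q)
    {p : ℝ → ℂ} (hp : RightTame p) : ∃ x, jost p z₀ x 1 ≠ 0 := by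
  obtain ⟨x, hx⟩ := (hp.isJost (upper_subset_sheet h.mem)).ne_zero (vec_ne_zero _)
  refine ⟨x, fun h1 => hx ?_⟩
  funext i
  fin_cases i
  · have := (h.jost_zero_star hq hp x).1
    rw [h1, star_zero, mul_zero] at this
    exact this
  · exact h1

/-- At the fixed point the symmetry relates the two components of each Jost solution by conjugation.
Comparing the two components of φ₁ = b₀ψ₂ then forces b₀ to be purely imaginary. -/
theorem IsBoundState.star_bZero (h : IsBoundState q l₀ z₀) (hq : Tame q) :
    star (bZero q l₀) = -bZero q l₀ := by
  obtain ⟨x, hx⟩ := h.exists_jost_one_ne_zero hq hq.right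
  have h1 := (h.jost_zero_star hq hq.left (-x)).1
  rw [h.left_one hq, star_mul, (h.jost_zero_star hq hq.right x).2] at h1
  have h2 := h.left_zero hq x
  have h3 : star z₀ / (rt2 / 2) * (z₀ / (rt2 / 2)) = 1 := by
    rw [div_mul_div_comm, rt2_half_sq, mul_comm (star z₀), h.mul_star hq]
    norm_num
  refine mul_right_cancel₀ hx ?_
  linear_combination -h2 - h1 - star (bZero q l₀) * jost q z₀ x 1 * h3

theorem IsBoundState.bZero_ne_zero (h : IsBoundState q l₀ z₀) (hq : Tame q) : bZero q l₀ ≠ 0 := by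
  obtain ⟨x, hx⟩ := h.exists_jost_one_ne_zero hq hq.left
  intro h0
  have := h.left_one hq (-x)
  rw [neg_neg, h0, zero_mul] at this
  exact hx this

/-- The symmetry `wr_inv_star` is differentiated at its fixed point, after conjugating source and
target to make both sides holomorphic; the term with `wr q z₀` drops out. -/
theorem IsBoundState.star_deriv_wr (h : IsBoundState q l₀ z₀) (hq : Tame q) :
    star (deriv (wr q) z₀) = -(4 * z₀ ^ 4 * deriv (wr q) z₀) := by
  have hz0 : z₀ ≠ 0 := (upper_subset_sheet h.mem).2.1
  have hz0' : star z₀ ≠ 0 := star_ne_zero.2 hz0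
  have hd : HasDerivAt (wr q) (deriv (wr q) z₀) z₀ :=
    ((hq.differentiableOn_wr).differentiableAt (isOpen_upper.mem_nhds h.mem)).hasDerivAt
  have hinv : HasDerivAt (fun w : ℂ => 1 / (2 * w)) (-(1 / (2 * star z₀ ^ 2))) (star z₀) := by
    have h1 : HasDerivAt (fun w : ℂ => 2 * w) 2 (star z₀) := by
      simpa using (hasDerivAt_id (star z₀)).const_mul 2
    have h2 := (h1.inv (mul_ne_zero two_ne_zero hz0'))
    simp only [one_div]
    refine h2.congr_deriv ?_
    field_simp
  have hc : HasDerivAt (fun w : ℂ => wr q (1 / (2 * w)))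
      (deriv (wr q) z₀ * -(1 / (2 * star z₀ ^ 2))) (star z₀) :=
    HasDerivAt.comp (h₂ := wr q) (star z₀) (by rw [h.inv_star hq]; exact hd) hinv
  have hl := hc.conj_conj
  have hsq : HasDerivAt (fun z : ℂ => 2 * z ^ 2) (2 * (2 * z₀)) z₀ := by
    simpa using (hasDerivAt_pow 2 z₀).const_mul 2
  have hr := hsq.mul hd
  have heq : (star ∘ (fun w : ℂ => wr q (1 / (2 * w))) ∘ star) =ᶠ[𝓝 z₀]
      ((fun z : ℂ => 2 * z ^ 2) * wr q) := by
    filter_upwards [isOpen_upper.mem_nhds h.mem] with z hz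
    have := hq.wr_inv_star (upper_subset_sheet hz)
    simp only [Function.comp, Pi.mul_apply, this, star_mul, star_star, star_pow]
    rw [show star (2 : ℂ) = 2 from Complex.conj_ofNat 2]
    ring
  have hl' : HasDerivAt (star ∘ (fun w : ℂ => wr q (1 / (2 * w))) ∘ star)
      (star (deriv (wr q) z₀ * -(1 / (2 * star z₀ ^ 2)))) z₀ := by
    rw [show (starRingEnd ℂ) (star z₀) = z₀ from star_star z₀] at hl
    exact hl
  have hfin := (hl'.congr_of_eventuallyEq heq.symm).unique hr
  rw [h.zero, mul_zero, zero_add, star_mul, star_neg, star_div₀, star_one, star_mul, star_pow,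
    star_star, show star (2 : ℂ) = 2 from Complex.conj_ofNat 2] at hfin
  field_simp at hfin
  linear_combination -hfin

/-- The residue weight. -/
def weight (q : ℝ → ℂ) (b z₀ : ℂ) : ℂ :=
  Complex.I * b * (1 - 1 / (2 * z₀ ^ 2)) / (z₀ * deriv (wr q) z₀)

theorem IsBoundState.star_weight (h : IsBoundState q l₀ z₀) (hq : Tame q) {b : ℂ}
    (hb : star b = -b) : star (weight q b z₀) = weight q b z₀ := by
  have hz0 : z₀ ≠ 0 := (upper_subset_sheet h.mem).2.1
  have hz0' : star z₀ = 1 / (2 * z₀) := by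
    rw [eq_div_iff (mul_ne_zero two_ne_zero hz0)]
    linear_combination 2 * h.mul_star hq
  have hw := hq.deriv_wr_ne_zero h.mem h.zero
  rw [weight, star_div₀, star_mul, star_mul, star_mul, star_sub, star_div₀, star_mul, star_pow,
    star_one, hb, h.star_deriv_wr hq, hz0', show star (2 : ℂ) = 2 from Complex.conj_ofNat 2,
    RCLike.star_def, Complex.conj_I]
  field_simp
  ring

/-- Chain rule through z = λ + ζ(λ), for which dz/dλ = z/ζ. The principal root is differentiable at
λ₀ because ν₀ is real and nonzero, so 1/2 − λ₀² is positive; the derivative of the denominator of a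
is irrelevant at a zero. -/
theorem IsBoundState.derivA_eq (h : IsBoundState q l₀ z₀) (hq : Tame q) :
    derivA q l₀ = deriv (wr q) z₀ * (z₀ / zet z₀) / (1 - 1 / (2 * z₀ ^ 2)) := by
  have hs := upper_subset_sheet h.mem
  have hz0 : z₀ ≠ 0 := hs.2.1
  have hζ := hs.2.2
  have hZ₀ : l₀ + zetaUp l₀ = z₀ := by rw [h.zet_eq, ← h.lam_eq, lam_add_zet]
  have hpos : (1 / 2 - l₀ ^ 2) ∈ Complex.slitPlane := by
    rw [← nu_sq]
    refine Complex.mem_slitPlane_iff.2 (Or.inl ?_)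
    have h1 : (nu l₀).im = 0 := Complex.conj_eq_iff_im.1 (h.star_nu hq)
    have h2 : (nu l₀).re ≠ 0 := fun h2 => h.nu_ne_zero (Complex.ext h2 h1)
    rw [sq, Complex.mul_re, h1, mul_zero, sub_zero]
    exact mul_self_pos.2 h2
  have hnu : DifferentiableAt ℂ nu l₀ := by
    unfold nu
    exact DifferentiableAt.cpow_const (by fun_prop) hpos
  have hzu : DifferentiableAt ℂ zetaUp l₀ := hnu.const_mul _
  have hder : deriv zetaUp l₀ = l₀ / zet z₀ := by
    have h1 := (hzu.hasDerivAt.pow 2)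
    have h2 : HasDerivAt (zetaUp ^ 2) (2 * l₀) l₀ := by
      have : zetaUp ^ 2 = fun l => l ^ 2 - 1 / 2 := by
        funext l; exact zetaUp_sq l
      rw [this]
      simpa using (hasDerivAt_pow 2 l₀).sub_const (1 / 2)
    have h3 := h1.unique h2
    rw [h.zet_eq] at h3
    rw [eq_div_iff hζ]
    norm_num at h3
    linear_combination h3 / 2
  have hZ : HasDerivAt (fun l => l + zetaUp l) (z₀ / zet z₀) l₀ := by
    refine ((hasDerivAt_id l₀).add hzu.hasDerivAt).congr_deriv ?_
    rw [hder, eq_div_iff hζ, add_mul, div_mul_cancel₀ _ hζ]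
    rw [h.zet_eq] at hZ₀
    linear_combination hZ₀
  have hd : HasDerivAt (wr q) (deriv (wr q) z₀) z₀ :=
    ((hq.differentiableOn_wr).differentiableAt (isOpen_upper.mem_nhds h.mem)).hasDerivAt
  have hD : DifferentiableAt ℂ (fun z : ℂ => 1 - 1 / (2 * z ^ 2)) z₀ := by
    fun_prop (disch := simp [hz0])
  have hquot := hd.div hD.hasDerivAt (one_sub_ne_zero hs)
  rw [h.zero, zero_mul, sub_zero] at hquot
  have hcomp := HasDerivAt.comp (h₂ := fun z => wr q z / (1 - 1 / (2 * z ^ 2))) l₀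
    (by rw [hZ₀]; exact hquot) hZ
  have him : ∀ᶠ l in 𝓝 l₀, 0 < (zetaUp l).im := by
    have hc := (Complex.continuous_im.continuousAt).comp hzu.continuousAt
    refine hc.eventually (lt_mem_nhds ?_)
    rw [Function.comp, h.zet_eq]
    exact zet_im_pos h.mem
  have heq : (fun l' : ℂ => coeffA q l' (zetaUp l')) =ᶠ[𝓝 l₀]
      ((fun z => wr q z / (1 - 1 / (2 * z ^ 2))) ∘ fun l => l + zetaUp l) := by
    filter_upwards [him] with l hl
    obtain ⟨u1, u2, u3⟩ := uniformize (l := l) (ζ := zetaUp l) (by rw [zetaUp_sq]; ring) hl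
    have := hq.coeffA_eq (upper_subset_sheet u1)
    rwa [u2, u3] at this
  rw [derivA, heq.deriv_eq, hcomp.deriv]
  have := one_sub_ne_zero hs
  field_simp

/-- The residue of the contour integral is thus exactly the norming constant μ₀, by ν₀ = −iζ at z₀.
-/
theorem IsBoundState.muRight_eq (h : IsBoundState q l₀ z₀) (hq : Tame q) :
    muRight q l₀ = weight q (bZero q l₀) z₀ := by
  have hs := upper_subset_sheet h.mem
  have hz0 : z₀ ≠ 0 := hs.2.1
  have hζ := hs.2.2
  have hD := one_sub_ne_zero hs
  have hw := hq.deriv_wr_ne_zero h.mem h.zero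
  have hnu : nu l₀ = -(Complex.I * zet z₀) := by rw [h.I_mul_zet, neg_neg]
  rw [muRight, h.derivA_eq hq, weight, hnu]
  have hI := Complex.I_ne_zero
  generalize 1 - 1 / (2 * z₀ ^ 2) = D at hD ⊢
  field_simp
  linear_combination -(bZero q l₀) * Complex.I_sq

end

/-! ### The right Marchenko system -/

theorem star_invF {A : ℝ → ℂ} (hA : ∀ᵐ ζ : ℝ, A (-ζ) = star (A ζ)) (z : ℝ) :
    star (invF A z) = invF A z := by
  have hint : star (∫ ζ : ℝ, A ζ * Complex.exp (Complex.I * (ζ : ℂ) * (z : ℂ))) =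
      ∫ ζ : ℝ, A ζ * Complex.exp (Complex.I * (ζ : ℂ) * (z : ℂ)) := by
    rw [RCLike.star_def, ← integral_conj,
      ← integral_neg_eq_self (fun ζ : ℝ => A ζ * Complex.exp (Complex.I * (ζ : ℂ) * (z : ℂ)))]
    refine integral_congr_ae (hA.mono fun ζ h => ?_)
    simp only [h]
    rw [map_mul, ← Complex.exp_conj, map_mul, map_mul, Complex.conj_I, Complex.conj_ofReal,
      Complex.conj_ofReal, RCLike.star_def]
    push_cast
    congr 2
    ring
  rw [invF, star_mul, hint, mul_comm]
  congr 1
  rw [star_div₀, star_mul, star_one, RCLike.star_def, Complex.conj_ofReal, Complex.conj_ofNat,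
    mul_comm]

theorem invF_const_mul_add {A B : ℝ → ℂ} (hA : Integrable A) (hB : Integrable B) (a b : ℂ) (z : ℝ) :
    invF (fun ζ => a * A ζ + b * B ζ) z = a * invF A z + b * invF B z := by
  have e : ∀ ζ : ℝ, (a * A ζ + b * B ζ) * Complex.exp (Complex.I * (ζ : ℂ) * (z : ℂ)) =
      a * (A ζ * Complex.exp (Complex.I * (ζ : ℂ) * (z : ℂ))) +
        b * (B ζ * Complex.exp (Complex.I * (ζ : ℂ) * (z : ℂ))) := fun ζ => by ring
  simp only [invF, e]
  rw [integral_add ((integrable_mul_exp hA z).const_mul a) ((integrable_mul_exp hB z).const_mul b),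
    integral_const_mul, integral_const_mul]
  ring

section

variable {q : ℝ → ℂ} {l₀ z₀ : ℂ}

/-- On the real line z ↦ 1/(2z) preserves the branch and reverses ζ. This is therefore Hermitian
symmetry in ζ, and it makes the Fourier integrals real. -/
theorem Tame.reflCoef_inv (hq : Tame q) {z : ℂ} (hz : z ∈ sheet) (hreal : star z = z) :
    reflCoef q (1 / (2 * z)) = star (reflCoef q z) := by
  have h1 := hq.wr_inv_star hz
  rw [hreal] at h1
  rw [reflCoef, reflCoef, h1, hq.wrB_inv_star hz hreal, star_div₀, star_neg, ← mul_neg,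
    mul_div_mul_left]
  simp [hz.2.1]

theorem lamOf_neg (ζ : ℝ) : lamOf (-ζ) = lamOf ζ := by rw [lamOf, lamOf, neg_sq]

theorem star_lamOf (ζ : ℝ) : star (lamOf ζ) = lamOf ζ := Complex.conj_ofReal _

theorem inv_zPos (ζ : ℝ) : 1 / (2 * (zPos ζ : ℂ)) = zPos (-ζ) := by
  have h0 : (zPos ζ : ℂ) ≠ 0 := by exact_mod_cast (zPos_pos ζ).ne'
  rw [div_eq_iff (by simp [h0]), ofReal_zPos, ofReal_zPos, lamOf_neg]
  push_cast
  linear_combination -2 * lamOf_sq ζ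

theorem inv_zNeg (ζ : ℝ) : 1 / (2 * (zNeg ζ : ℂ)) = zNeg (-ζ) := by
  have h0 : (zNeg ζ : ℂ) ≠ 0 := by exact_mod_cast (zNeg_neg ζ).ne
  rw [div_eq_iff (by simp [h0]), ofReal_zNeg, ofReal_zNeg, lamOf_neg]
  push_cast
  linear_combination -2 * lamOf_sq ζ

theorem Tame.cRight_star (hq : Tame q) {ζ : ℝ} (hζ : ζ ≠ 0) :
    cRight1 q (-ζ) = star (cRight1 q ζ) ∧ cRight2 q (-ζ) = star (cRight2 q ζ) := by
  have h1 := hq.reflCoef_inv (zPos_mem hζ) (Complex.conj_ofReal _)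
  have h2 := hq.reflCoef_inv (zNeg_mem hζ) (Complex.conj_ofReal _)
  rw [inv_zPos] at h1
  rw [inv_zNeg] at h2
  have hζ' := neg_ne_zero.2 hζ
  rw [hq.cRight1_eq hζ, hq.cRight1_eq hζ', hq.cRight2_eq hζ, hq.cRight2_eq hζ', h1, h2, star_add,
    star_div₀, star_sub, lamOf_neg, star_lamOf]
  exact ⟨rfl, rfl⟩

theorem IsBoundState.exp_eq (h : IsBoundState q l₀ z₀) (z : ℝ) :
    Complex.exp (Complex.I * zet z₀ * z) = Complex.exp (-(nu l₀ * (z : ℂ))) := by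
  rw [h.I_mul_zet, neg_mul]

theorem IsBoundState.FRight1_eq (h : IsBoundState q l₀ z₀) (hq : Tame q) (z : ℝ) :
    FRight1 q l₀ z = poleF (cRight1 q) (weight q (bZero q l₀) z₀ * l₀) (zet z₀) z := by
  rw [FRight1, h.muRight_eq hq, poleF, h.exp_eq, invF]

theorem IsBoundState.FRight2_eq (h : IsBoundState q l₀ z₀) (hq : Tame q) (z : ℝ) :
    FRight2 q l₀ z = poleF (cRight2 q) (weight q (bZero q l₀) z₀) (zet z₀) z := by
  rw [FRight2, h.muRight_eq hq, poleF, h.exp_eq, invF]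

theorem IsBoundState.star_exp (h : IsBoundState q l₀ z₀) (hq : Tame q) (z : ℝ) :
    star (Complex.exp (Complex.I * zet z₀ * z)) = Complex.exp (Complex.I * zet z₀ * z) := by
  rw [h.exp_eq, RCLike.star_def, ← Complex.exp_conj, map_neg, map_mul, Complex.conj_ofReal,
    ← RCLike.star_def, h.star_nu hq]

theorem IsBoundState.FRight_im (h : IsBoundState q l₀ z₀) (hq : Tame q) (z : ℝ) :
    (FRight1 q l₀ z).im = 0 ∧ (FRight2 q l₀ z).im = 0 := by
  have hw := h.star_weight hq (h.star_bZero hq)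
  constructor
  · refine Complex.conj_eq_iff_im.1 ?_
    change star _ = _
    rw [h.FRight1_eq hq, poleF, star_sub, star_mul, star_mul, hw, h.star_lam hq, h.star_exp hq,
      star_invF (ae_ne_zero.mono fun ζ hζ => (hq.cRight_star hζ).1)]
    ring
  · refine Complex.conj_eq_iff_im.1 ?_
    change star _ = _
    rw [h.FRight2_eq hq, poleF, star_sub, star_mul, hw, h.star_exp hq,
      star_invF (ae_ne_zero.mono fun ζ hζ => (hq.cRight_star hζ).2)]
    ring

theorem IsBoundState.hasDerivAt_FRight2 (h : IsBoundState q l₀ z₀) (hq : Tame q) (z : ℝ) :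
    HasDerivAt (FRight2 q l₀) (Complex.I * invF (fun ζ : ℝ => (ζ : ℂ) * cRight2 q ζ) z -
      weight q (bZero q l₀) z₀ *
        (Complex.I * zet z₀ * Complex.exp (Complex.I * zet z₀ * z))) z := by
  have e : FRight2 q l₀ = poleF (cRight2 q) (weight q (bZero q l₀) z₀) (zet z₀) :=
    funext fun z => h.FRight2_eq hq z
  rw [e]
  have h1 : HasDerivAt (fun z : ℝ => Complex.I * zet z₀ * (z : ℂ)) (Complex.I * zet z₀ * 1) z :=
    (Complex.ofRealCLM.hasDerivAt).const_mul _
  refine ((hasDerivAt_invF hq.integrable_cRight2 hq.integrable_mul_cRight2 z).sub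
    (h1.cexp.const_mul _)).congr_deriv ?_
  ring

/-- Differentiation multiplies the symbol by iζ, so ±iF₂' contributes ∓ζc₂. In the pole terms λ₀ −
ζ(z₀) = 1/(2z₀) and λ₀ + ζ(z₀) = z₀ give the residue weights found in `right_system`. -/
theorem IsBoundState.symb_eq (h : IsBoundState q l₀ z₀) (hq : Tame q) (z : ℝ) :
    rt2 * (FRight1 q l₀ z + Complex.I * deriv (FRight2 q l₀) z) =
      poleF (symbPlus q) (weight q (bZero q l₀) z₀ * (rt2 / 2 / z₀)) (zet z₀) z ∧
    rt2 * (FRight1 q l₀ z - Complex.I * deriv (FRight2 q l₀) z) =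
      poleF (symbMinus q) (weight q (bZero q l₀) z₀ * (rt2 * z₀)) (zet z₀) z := by
  have i1 := hq.integrable_cRight1
  have i2 := hq.integrable_mul_cRight2
  have e1 : symbPlus q = fun ζ => rt2 * cRight1 q ζ + -rt2 * ((ζ : ℂ) * cRight2 q ζ) := by
    funext ζ; rw [symbPlus]; ring
  have e2 : symbMinus q = fun ζ => rt2 * cRight1 q ζ + rt2 * ((ζ : ℂ) * cRight2 q ζ) := by
    funext ζ; rw [symbMinus]; ring
  have hI := Complex.I_sq
  have hz : l₀ + zet z₀ = z₀ := by rw [← h.lam_eq, lam_add_zet]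
  have hz' : rt2 / 2 / z₀ = rt2 * (l₀ - zet z₀) := by
    rw [← rt2_mul_lam_sub_zet, h.lam_eq]
  rw [(h.hasDerivAt_FRight2 hq z).deriv, h.FRight1_eq hq, poleF, poleF, poleF, e1, e2,
    invF_const_mul_add i1 i2, invF_const_mul_add i1 i2, hz', ← hz]
  rw [hz]
  constructor
  · linear_combination rt2 * (invF (fun ζ : ℝ => (ζ : ℂ) * cRight2 q ζ) z -
      weight q (bZero q l₀) z₀ * zet z₀ * Complex.exp (Complex.I * zet z₀ * z)) * hI
  · linear_combination -rt2 * (invF (fun ζ : ℝ => (ζ : ℂ) * cRight2 q ζ) z -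
      weight q (bZero q l₀) z₀ * zet z₀ * Complex.exp (Complex.I * zet z₀ * z)) * hI -
      rt2 * weight q (bZero q l₀) z₀ * Complex.exp (Complex.I * zet z₀ * z) * hz

theorem IsBoundState.rightMarchenko (h : IsBoundState q l₀ z₀) (hq : Tame q)
    {K : ℝ → ℝ → Matrix (Fin 2) (Fin 2) ℂ} (hK : IsRightKernel q K) :
    RightMarchenko K (FRight1 q l₀) (FRight2 q l₀) := by
  intro x y hxy
  obtain ⟨⟨i1, e1⟩, i2, e2⟩ := hq.right_system h.mem h.zero h.uniq hK
    (h.left_one hq) (rfl : weight q (bZero q l₀) z₀ = _) hxy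
  have f1 : integrand11 K (FRight1 q l₀) (FRight2 q l₀) x y = fun s =>
      K x s 0 0 * poleF (cRight2 q) (weight q (bZero q l₀) z₀) (zet z₀) (s + y) +
        K x s 0 1 * poleF (symbMinus q) (weight q (bZero q l₀) z₀ * (rt2 * z₀)) (zet z₀) (s + y) := by
    funext s
    rw [integrand11, (h.symb_eq hq (s + y)).2, h.FRight2_eq hq, add_comm]
  have f2 : integrand12 K (FRight1 q l₀) (FRight2 q l₀) x y = fun s =>
      K x s 0 0 * poleF (symbPlus q) (weight q (bZero q l₀) z₀ * (rt2 / 2 / z₀)) (zet z₀) (s + y) +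
        K x s 0 1 * poleF (cRight2 q) (weight q (bZero q l₀) z₀) (zet z₀) (s + y) := by
    funext s
    rw [integrand12, (h.symb_eq hq (s + y)).1, h.FRight2_eq hq]
  rw [f1, f2, h.FRight2_eq hq, (h.symb_eq hq (x + y)).1]
  exact ⟨i1, i2, e1, e2⟩

end

/-! ### Kink-like potentials -/

theorem rightTame_of_bounds {v : ℝ → ℂ} (hv : ContDiff ℝ 2 v)
    (h0 : ∃ C : ℝ, ∀ s : ℝ, 0 ≤ s → ‖v s‖ * (1 + s ^ 2) ^ 2 ≤ C)
    (h1 : ∃ C : ℝ, ∀ s : ℝ, 0 ≤ s → ‖deriv v s‖ * (1 + s ^ 2) ^ 2 ≤ C)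
    (h2 : ∃ C : ℝ, ∀ s : ℝ, 0 ≤ s → ‖deriv (deriv v) s‖ * (1 + s ^ 2) ^ 2 ≤ C) :
    RightTame fun s => rt2 / 2 * (v s + 1) := by
  obtain ⟨C₀, h0⟩ := h0
  obtain ⟨C₁, h1⟩ := h1
  obtain ⟨C₂, h2⟩ := h2
  have step : ∀ {w : ℂ} {s C : ℝ}, 0 ≤ s → ‖w‖ * (1 + s ^ 2) ^ 2 ≤ C →
      ∀ {D : ℝ}, C ≤ D → ‖rt2 / 2 * w‖ ≤ 4 * D / (1 + s) ^ 4 := by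
    intro w s C hs h D hD
    rw [le_div_iff₀ (by positivity), norm_mul]
    have h3 : (1 + s) ^ 4 ≤ 4 * (1 + s ^ 2) ^ 2 := by
      have : (1 + s) ^ 2 ≤ 2 * (1 + s ^ 2) := by nlinarith [sq_nonneg (1 - s)]
      calc (1 + s) ^ 4 = ((1 + s) ^ 2) ^ 2 := by ring
        _ ≤ (2 * (1 + s ^ 2)) ^ 2 := by gcongr
        _ = _ := by ring
    calc ‖rt2 / 2‖ * ‖w‖ * (1 + s) ^ 4 ≤ 1 * ‖w‖ * (4 * (1 + s ^ 2) ^ 2) := by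
          gcongr
          exact norm_rt2_half_le
      _ = 4 * (‖w‖ * (1 + s ^ 2) ^ 2) := by ring
      _ ≤ 4 * D := by linarith
  have d1 : deriv (fun s => rt2 / 2 * (v s + 1)) = fun s => rt2 / 2 * deriv v s := by
    funext s
    rw [deriv_const_mul_field, deriv_add_const]
  refine ⟨contDiff_const.mul (hv.add contDiff_const), 4 * max (max C₀ C₁) (max C₂ 0),
    by positivity, fun s hs => ⟨?_, ?_, ?_⟩⟩
  · rw [show rt2 / 2 * (v s + 1) - rt2 / 2 = rt2 / 2 * v s by ring]
    exact step hs (h0 s hs) ((le_max_left _ _).trans (le_max_left _ _))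
  · rw [d1]
    exact step hs (h1 s hs) ((le_max_right _ _).trans (le_max_left _ _))
  · rw [d1, deriv_const_mul_field]
    exact step hs (h2 s hs) ((le_max_left _ _).trans (le_max_right _ _))

/-- The reflection −q*(−x) turns the limit −√2/2 at −∞ into √2/2 at +∞, so both ends satisfy the
same decay condition. -/
theorem KinkLike.tame {u : ℝ → ℂ} (hu : KinkLike u) : Tame (pot u) := by
  have hc : ContDiff ℝ 2 u := hu.contDiff.of_le (by norm_num)
  constructor
  · have := rightTame_of_bounds (v := fun t => u t - 1) (hc.sub contDiff_const)
      (by simpa only [iteratedDeriv_zero] using hu.bound_right 0 (by norm_num))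
      (by simpa only [iteratedDeriv_one] using hu.bound_right 1 (by norm_num))
      (by simpa only [iteratedDeriv_succ, iteratedDeriv_zero] using hu.bound_right 2 (by norm_num))
    simp only [sub_add_cancel] at this
    exact this
  · have b := fun (k : ℕ) (hk : k ≤ 3) => hu.bound_left k hk
    have e0 : ∀ {w : ℝ → ℂ}, (∃ C : ℝ, ∀ x ≤ 0, ‖w x‖ * (1 + x ^ 2) ^ 2 ≤ C) →
        ∃ C : ℝ, ∀ s : ℝ, 0 ≤ s → ‖w (-s)‖ * (1 + s ^ 2) ^ 2 ≤ C := fun ⟨C, h⟩ =>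
      ⟨C, fun s hs => by simpa using h (-s) (by linarith)⟩
    have d1 : ∀ w : ℝ → ℂ, deriv (fun s => -star (w (-s))) = fun s => star (deriv w (-s)) := by
      intro w
      funext s
      rw [deriv.fun_neg, deriv.star, deriv_comp_neg, star_neg, neg_neg]
    have d2 : ∀ w : ℝ → ℂ, deriv (fun s => star (w (-s))) = fun s => -star (deriv w (-s)) := by
      intro w
      funext s
      rw [deriv.star, deriv_comp_neg, star_neg]
    have hcs : ContDiff ℝ 2 fun s => -star (u (-s) + 1) :=
      ((Complex.conjCLE.contDiff.comp ((hc.comp contDiff_neg).add contDiff_const))).neg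
    have := rightTame_of_bounds (v := fun s => -star (u (-s) + 1)) hcs
      (by
        have := e0 (b 0 (by norm_num))
        simpa only [iteratedDeriv_zero, norm_neg, norm_star] using this)
      (by
        have := e0 (b 1 (by norm_num))
        rw [d1 fun t => u t + 1]
        simpa only [iteratedDeriv_one, norm_neg, norm_star] using this)
      (by
        have := e0 (b 2 (by norm_num))
        rw [d1 fun t => u t + 1, d2]
        simpa only [iteratedDeriv_succ, iteratedDeriv_zero, norm_neg, norm_star] using this)
    have e : refl (pot u) = fun s => rt2 / 2 * (-star (u (-s) + 1) + 1) := by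
      funext s
      rw [refl, pot, star_mul, star_rt2_half, star_add, star_one]
      ring
    rwa [e]

/-! ### Reflection -/

section

variable {q : ℝ → ℂ} {l₀ z₀ : ℂ}

/-- Reflection exchanges the roles of φ₁ and ψ₂: a is preserved and the numerator of b is
conjugated. The left scattering data of q are then, up to sign, the right data of `refl q`. -/
theorem wr_refl (q : ℝ → ℂ) : wr (refl q) = wr q := by
  funext z
  rw [wr, wr, refl_refl]
  ring

theorem wrB_refl (q : ℝ → ℂ) (z : ℂ) : wrB (refl q) z = star (wrB q z) := by
  rw [wrB, wrB, refl_refl, star_add, star_mul, star_mul, star_star, star_star]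
  ring

theorem IsBoundState.refl (h : IsBoundState q l₀ z₀) : IsBoundState (refl q) l₀ z₀ :=
  ⟨h.mem, by rw [wr_refl]; exact h.zero, by rw [wr_refl]; exact h.uniq, h.lam_eq, h.zet_eq⟩

theorem Tame.cLeft_eq (hq : Tame q) {z : ℂ} (hz : z ∈ sheet) (hreal : star z = z) :
    cLeft q (lam z) (zet z) = -cRight (GPMarchenko.refl q) (lam z) (zet z) := by
  rw [hq.refl.cRight_eq hz hreal, cLeft, hq.coeffA_eq hz, hq.coeffB_eq hz hreal, reflCoef, wr_refl,
    wrB_refl, star_div₀, star_neg, star_sub, star_div₀, star_mul, mul_comm (star (z ^ 2)),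
    star_pow, hreal, star_one,
    show star (2 : ℂ) = 2 from Complex.conj_ofNat 2, ← neg_div, div_div_div_cancel_right₀
      (one_sub_ne_zero hz), neg_div, neg_div]

theorem Tame.cLeft12_eq (hq : Tame q) {ζ : ℝ} (hζ : ζ ≠ 0) :
    cLeft1 q ζ = -cRight1 (GPMarchenko.refl q) ζ ∧ cLeft2 q ζ = -cRight2 (GPMarchenko.refl q) ζ := by
  have h1 := hq.cLeft_eq (zPos_mem hζ) (Complex.conj_ofReal _)
  have h2 := hq.cLeft_eq (zNeg_mem hζ) (Complex.conj_ofReal _)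
  rw [lam_zPos, zet_zPos] at h1
  rw [lam_zNeg, zet_zNeg] at h2
  rw [cLeft1, cLeft2, cRight1, cRight2, h1, h2]
  constructor <;> ring

/-- Reflecting φ₁ = b₀ψ₂ inverts the constant, and the sign comes from `reflSol` squaring to −1.
This turns μ̃₀ into minus the μ₀ of the reflected potential. -/
theorem IsBoundState.bZero_refl (h : IsBoundState q l₀ z₀) (hq : Tame q) :
    bZero q l₀ * bZero (GPMarchenko.refl q) l₀ = -1 := by
  obtain ⟨x, hx⟩ := h.exists_jost_one_ne_zero hq hq.right
  have h1 := h.left_zero hq x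
  have h2 := h.refl.left_one hq.refl (-x)
  rw [refl_refl, neg_neg] at h2
  refine mul_right_cancel₀ hx ?_
  linear_combination -bZero (GPMarchenko.refl q) l₀ * h1 + h2

theorem IsBoundState.muLeft_eq (h : IsBoundState q l₀ z₀) (hq : Tame q) :
    muLeft q l₀ = -muRight (GPMarchenko.refl q) l₀ := by
  have hb := h.bZero_ne_zero hq
  have e : bZero (GPMarchenko.refl q) l₀ = -1 / bZero q l₀ := by
    rw [eq_div_iff hb, mul_comm]
    exact h.bZero_refl hq
  rw [muLeft, muRight, h.refl.derivA_eq hq.refl, h.derivA_eq hq, wr_refl, e, ← neg_div, ← neg_div,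
    neg_neg, mul_assoc, div_div]

theorem IsBoundState.FLeft_eq (h : IsBoundState q l₀ z₀) (hq : Tame q) (z : ℝ) :
    FLeft1 q l₀ z = -FRight1 (GPMarchenko.refl q) l₀ (-z) ∧
      FLeft2 q l₀ z = -FRight2 (GPMarchenko.refl q) l₀ (-z) := by
  have e : ∀ {A B : ℝ → ℂ}, (∀ ζ, ζ ≠ 0 → A ζ = -B ζ) →
      ∫ ζ : ℝ, A ζ * Complex.exp (-(Complex.I * (ζ : ℂ) * (z : ℂ))) =
        -∫ ζ : ℝ, B ζ * Complex.exp (Complex.I * (ζ : ℂ) * ((-z : ℝ) : ℂ)) := fun hAB => by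
    rw [← integral_neg]
    refine integral_congr_ae (ae_ne_zero.mono fun ζ hζ => ?_)
    simp only [hAB ζ hζ]
    push_cast
    rw [mul_neg, neg_mul]
  rw [FLeft1, FLeft2, FRight1, FRight2, e fun ζ hζ => (hq.cLeft12_eq hζ).1,
    e fun ζ hζ => (hq.cLeft12_eq hζ).2, h.muLeft_eq hq]
  push_cast
  rw [mul_neg (nu l₀), neg_neg]
  constructor <;> ring

/-- The reflection of a kernel. -/
def reflKer (K : ℝ → ℝ → Matrix (Fin 2) (Fin 2) ℂ) (x y : ℝ) : Matrix (Fin 2) (Fin 2) ℂ :=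
  fun i j => (if i = j then 1 else -1) * star (K (-x) (-y) i j)

theorem dX_reflKer (K : ℝ → ℝ → Matrix (Fin 2) (Fin 2) ℂ) (i j : Fin 2) (x y : ℝ) :
    dX (reflKer K) i j x y = -((if i = j then 1 else -1) * star (dX K i j (-x) (-y))) := by
  simp only [dX, reflKer]
  rw [deriv_const_mul_field, deriv.star, deriv_comp_neg (fun t => K t (-y) i j), star_neg, mul_neg]

theorem dY_reflKer (K : ℝ → ℝ → Matrix (Fin 2) (Fin 2) ℂ) (i j : Fin 2) (x y : ℝ) :
    dY (reflKer K) i j x y = -((if i = j then 1 else -1) * star (dY K i j (-x) (-y))) := by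
  simp only [dY, reflKer]
  rw [deriv_const_mul_field, deriv.star, deriv_comp_neg (fun t => K (-x) t i j), star_neg, mul_neg]

theorem integral_Ioi_comp_neg {E : Type*} [NormedAddCommGroup E] [NormedSpace ℝ E] (f : ℝ → E)
    (x : ℝ) : ∫ s in Set.Ioi x, f (-s) = ∫ s in Set.Iio (-x), f s := by
  rw [integral_comp_neg_Ioi, integral_Iic_eq_integral_Iio]

theorem integrableOn_Ioi_comp_neg {f : ℝ → ℂ} {x : ℝ} (h : IntegrableOn f (Set.Iio (-x))) :
    IntegrableOn (fun s => f (-s)) (Set.Ioi x) := by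
  have := (Measure.measurePreserving_neg (volume : Measure ℝ)).integrableOn_comp_preimage
    (Homeomorph.neg ℝ).measurableEmbedding |>.2 h
  rwa [show (Neg.neg ⁻¹' Set.Iio (-x) : Set ℝ) = Set.Ioi x by ext; simp] at this

theorem star_I_mul (w : ℂ) : star (Complex.I * w) = -(Complex.I * star w) := by
  rw [star_mul, RCLike.star_def, Complex.conj_I]
  ring

/-- Reversing x and y changes the sign of both derivatives, and conjugation changes that of i. The
sign put on the off-diagonal entries then matches the opposite sign of √2/2 in the left equations
and the replacement of q by −q*. -/
theorem IsLeftKernel.reflKer {K : ℝ → ℝ → Matrix (Fin 2) (Fin 2) ℂ} (hK : IsLeftKernel q K) :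
    IsRightKernel (GPMarchenko.refl q) (reflKer K) where
  smooth i j := by
    have h := (hK.smooth i j).comp (g := fun P : ℝ × ℝ => K P.1 P.2 i j)
      (contDiff_neg (𝕜 := ℝ) (F := ℝ × ℝ) (n := 1)).contDiffOn
      (s := {P : ℝ × ℝ | P.1 ≤ P.2}) fun P (hP : P.1 ≤ P.2) => neg_le_neg hP
    exact contDiffOn_const.mul (Complex.conjCLE.contDiff.comp_contDiffOn h)
  eq_11 x y hxy := by
    have := congrArg star (hK.eq_11 (-x) (-y) (neg_lt_neg hxy))
    rw [star_add, star_I_mul, star_add, star_mul, star_mul, star_star, star_rt2_half] at this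
    rw [dX_reflKer, dY_reflKer, GPMarchenko.refl]
    simp [GPMarchenko.reflKer]
    simp at this
    linear_combination -this
  eq_22 x y hxy := by
    have := congrArg star (hK.eq_22 (-x) (-y) (neg_lt_neg hxy))
    rw [star_add, star_I_mul, star_sub, star_mul, star_mul, star_neg, star_rt2_half] at this
    rw [dX_reflKer, dY_reflKer, GPMarchenko.refl]
    simp [GPMarchenko.reflKer]
    simp at this
    linear_combination -this
  eq_12 x y hxy := by
    have := congrArg star (hK.eq_12 (-x) (-y) (neg_lt_neg hxy))
    rw [star_sub, star_I_mul, star_add, star_mul, star_mul, star_star, star_rt2_half] at this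
    rw [dX_reflKer, dY_reflKer, GPMarchenko.refl]
    simp [GPMarchenko.reflKer]
    simp at this
    linear_combination this
  eq_21 x y hxy := by
    have := congrArg star (hK.eq_21 (-x) (-y) (neg_lt_neg hxy))
    rw [star_sub, star_I_mul, star_sub, star_mul, star_mul, star_neg, star_rt2_half] at this
    rw [dX_reflKer, dY_reflKer, GPMarchenko.refl]
    simp [GPMarchenko.reflKer]
    simp at this
    linear_combination this
  diag_12 x := by
    have := congrArg star (hK.diag_12 (-x))
    rw [star_star, star_mul, star_add, star_rt2_half] at this
    simp [GPMarchenko.reflKer, GPMarchenko.refl]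
    simp at this
    rw [this]
    ring
  diag_21 x := by
    have := congrArg star (hK.diag_21 (-x))
    rw [star_mul, star_add, star_rt2_half] at this
    simp [GPMarchenko.reflKer, GPMarchenko.refl]
    simp at this
    rw [this]
    ring
  integrable i j x := by
    have h := integrableOn_Ioi_comp_neg (hK.integrable i j (-x))
    exact (Complex.conjCLE.toContinuousLinearMap.integrable_comp h).const_mul _
  decay i j := by
    refine ((hK.decay i j).comp tendsto_neg_atTop_atBot).congr fun x => ?_
    rw [Function.comp, ← integral_Ioi_comp_neg]
    refine integral_congr_ae (Eventually.of_forall fun y => ?_)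
    simp only [GPMarchenko.reflKer]
    rw [norm_mul, norm_star]
    split_ifs <;> simp

theorem IsBoundState.star_FRight (h : IsBoundState q l₀ z₀) (hq : Tame q) (z : ℝ) :
    star (FRight1 q l₀ z) = FRight1 q l₀ z ∧ star (FRight2 q l₀ z) = FRight2 q l₀ z ∧
      star (deriv (FRight2 q l₀) z) = deriv (FRight2 q l₀) z := by
  have h2 : ∀ z, star (FRight2 q l₀ z) = FRight2 q l₀ z := fun z =>
    Complex.conj_eq_iff_im.2 (h.FRight_im hq z).2
  refine ⟨Complex.conj_eq_iff_im.2 (h.FRight_im hq z).1, h2 z, ?_⟩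
  rw [← deriv.star]
  simp only [h2]

/-- The right system for the reflected data is conjugated and read at −x, −y, −s; since F₁, F₂ and
F₂' are real, conjugation acts only on the kernel and on i. -/
theorem IsBoundState.leftMarchenko (h : IsBoundState q l₀ z₀) (hq : Tame q)
    {K : ℝ → ℝ → Matrix (Fin 2) (Fin 2) ℂ} (hK : IsLeftKernel q K) :
    LeftMarchenko K (FLeft1 q l₀) (FLeft2 q l₀) := by
  intro x y hxy
  obtain ⟨i1, i2, e1, e2⟩ := h.refl.rightMarchenko hq.refl hK.reflKer (-x) (-y) (neg_le_neg hxy)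
  have hs := h.refl.star_FRight hq.refl
  have hF1 := fun z => (h.FLeft_eq hq z).1
  have hF2 := fun z => (h.FLeft_eq hq z).2
  have hD : ∀ z, deriv (FLeft2 q l₀) z = deriv (FRight2 (GPMarchenko.refl q) l₀) (-z) := fun z => by
    rw [show FLeft2 q l₀ = fun z => -FRight2 (GPMarchenko.refl q) l₀ (-z) from funext hF2,
      deriv.fun_neg, deriv_comp_neg, neg_neg]
  have f1 : ∀ s, integrandLeft11 K (FLeft1 q l₀) (FLeft2 q l₀) x y s =
      star (integrand11 (reflKer K) (FRight1 (GPMarchenko.refl q) l₀)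
        (FRight2 (GPMarchenko.refl q) l₀) (-x) (-y) (-s)) := fun s => by
    rw [integrandLeft11, integrand11, hF1, hF2, hD, ← neg_add, star_add, star_mul, star_mul,
      star_mul, star_sub, star_I_mul, star_rt2, (hs _).1, (hs _).2.1, (hs _).2.2]
    simp [reflKer]
    ring
  have f2 : ∀ s, integrandLeft12 K (FLeft1 q l₀) (FLeft2 q l₀) x y s =
      -star (integrand12 (reflKer K) (FRight1 (GPMarchenko.refl q) l₀)
        (FRight2 (GPMarchenko.refl q) l₀) (-x) (-y) (-s)) := fun s => by
    rw [integrandLeft12, integrand12, hF1, hF2, hD, ← neg_add, star_add, star_mul, star_mul,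
      star_mul, star_add, star_I_mul, star_rt2, (hs _).1, (hs _).2.1, (hs _).2.2]
    simp [reflKer]
    ring
  have tr : ∀ {f : ℝ → ℂ}, IntegrableOn f (Set.Ioi (-x)) →
      IntegrableOn (fun s => star (f (-s))) (Set.Iio x) := fun {f} hf => by
    have := (Measure.measurePreserving_neg (volume : Measure ℝ)).integrableOn_comp_preimage
      (Homeomorph.neg ℝ).measurableEmbedding |>.2 hf
    rw [show (Neg.neg ⁻¹' Set.Ioi (-x) : Set ℝ) = Set.Iio x by ext; simp] at this
    exact Complex.conjCLE.toContinuousLinearMap.integrable_comp this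
  have tv : ∀ f : ℝ → ℂ, ∫ s in Set.Iio x, star (f (-s)) = star (∫ s in Set.Ioi (-x), f s) :=
    fun f => by
      have := integral_Ioi_comp_neg (fun s => star (f (-s))) (-x)
      simp only [neg_neg] at this
      rw [← this]
      exact integral_conj
  refine ⟨(tr i1).congr (Eventually.of_forall fun s => (f1 s).symm),
    (tr i2).neg.congr (Eventually.of_forall fun s => (f2 s).symm), ?_, ?_⟩
  · have := congrArg star e1
    simp only [f1]
    rw [tv, hF2, neg_add, neg_neg]
    rw [star_sub, star_mul, star_mul, star_rt2, (hs _).2.1] at this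
    simp [reflKer] at this
    simp
    linear_combination this
  · have := congrArg star e2
    simp only [f2]
    rw [integral_neg, tv, hF1, hD, neg_add]
    rw [star_sub, star_mul, star_mul, star_mul, star_add, star_I_mul, star_rt2, (hs _).1,
      (hs _).2.2] at this
    simp [reflKer] at this
    simp
    linear_combination -this

theorem IsBoundState.left_properties (h : IsBoundState q l₀ z₀) (hq : Tame q) :
    Integrable (cLeft1 q) ∧ Integrable (cLeft2 q) ∧
      (∀ z : ℝ, (FLeft1 q l₀ z).im = 0 ∧ (FLeft2 q l₀ z).im = 0) ∧
      Differentiable ℝ (FLeft2 q l₀) := by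
  refine ⟨hq.refl.integrable_cRight1.neg.congr (ae_ne_zero.mono fun ζ hζ =>
      (hq.cLeft12_eq hζ).1.symm), hq.refl.integrable_cRight2.neg.congr (ae_ne_zero.mono fun ζ hζ =>
      (hq.cLeft12_eq hζ).2.symm), fun z => ?_, ?_⟩
  · obtain ⟨h1, h2⟩ := h.FLeft_eq hq z
    obtain ⟨h3, h4⟩ := h.refl.FRight_im hq.refl (-z)
    rw [h1, h2, Complex.neg_im, Complex.neg_im, h3, h4, neg_zero]
    exact ⟨rfl, rfl⟩
  · rw [show FLeft2 q l₀ = fun z => -FRight2 (GPMarchenko.refl q) l₀ (-z) from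
      funext fun z => (h.FLeft_eq hq z).2]
    have hd : Differentiable ℝ (FRight2 (GPMarchenko.refl q) l₀) := fun z =>
      (h.refl.hasDerivAt_FRight2 hq.refl z).differentiableAt
    exact (hd.comp differentiable_neg).neg

end

end GPMarchenko

end

/-! ### Assembly of the right and left statements -/

theorem proposition5p1 (u : ℝ → ℂ) (hu : GPMarchenko.KinkLike u) (l₀ : ℂ)
    (hzero : {P : ℂ × ℂ | P ∈ GPMarchenko.upperSheet ∧
        GPMarchenko.coeffA (GPMarchenko.pot u) P.1 P.2 = 0} = {(l₀, GPMarchenko.zetaUp l₀)}) :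
    -- the functions F₁, F₂ are well defined and real valued, and F₂ is differentiable
    (Integrable (GPMarchenko.cRight1 (GPMarchenko.pot u)) ∧
      Integrable (GPMarchenko.cRight2 (GPMarchenko.pot u)) ∧
      (∀ z : ℝ, (GPMarchenko.FRight1 (GPMarchenko.pot u) l₀ z).im = 0 ∧
        (GPMarchenko.FRight2 (GPMarchenko.pot u) l₀ z).im = 0) ∧
      Differentiable ℝ (GPMarchenko.FRight2 (GPMarchenko.pot u) l₀)) ∧
    -- the right system
    (∀ Ψ : ℝ → ℝ → Matrix (Fin 2) (Fin 2) ℂ,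
      GPMarchenko.IsRightKernel (GPMarchenko.pot u) Ψ →
      GPMarchenko.RightMarchenko Ψ (GPMarchenko.FRight1 (GPMarchenko.pot u) l₀)
        (GPMarchenko.FRight2 (GPMarchenko.pot u) l₀)) ∧
    -- the same for the left functions and the left system
    (Integrable (GPMarchenko.cLeft1 (GPMarchenko.pot u)) ∧
      Integrable (GPMarchenko.cLeft2 (GPMarchenko.pot u)) ∧
      (∀ z : ℝ, (GPMarchenko.FLeft1 (GPMarchenko.pot u) l₀ z).im = 0 ∧
        (GPMarchenko.FLeft2 (GPMarchenko.pot u) l₀ z).im = 0) ∧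
      Differentiable ℝ (GPMarchenko.FLeft2 (GPMarchenko.pot u) l₀)) ∧
    (∀ Φ : ℝ → ℝ → Matrix (Fin 2) (Fin 2) ℂ,
      GPMarchenko.IsLeftKernel (GPMarchenko.pot u) Φ →
      GPMarchenko.LeftMarchenko Φ (GPMarchenko.FLeft1 (GPMarchenko.pot u) l₀)
        (GPMarchenko.FLeft2 (GPMarchenko.pot u) l₀)) := by
  have hq := hu.tame
  obtain ⟨z₀, h⟩ := hq.exists_isBoundState hzero
  exact ⟨⟨hq.integrable_cRight1, hq.integrable_cRight2, h.FRight_im hq,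
      fun z => (h.hasDerivAt_FRight2 hq z).differentiableAt⟩,
    fun _ hΨ => h.rightMarchenko hq hΨ, h.left_properties hq, fun _ hΦ => h.leftMarchenko hq hΦ⟩
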